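/- **Setting.** Let $\hbar>0$, $\varepsilon\in\mathbb R$, $\phi,\beta,\gamma,\delta\in\mathbb C$ and $K\in\mathbb N$. A discrete linear Markovian quantum open oscillator consists of operators $x$ and $v_k,w_k$ ($k\ge1$) in a Hilbert space that satisfy (in the Weyl sense) the commutation relations $$[x,x^*]=\hbar,\quad [v_k,v_k^*]=(1-|\phi|^2)\hbar,\quad [w_k,w_k^*]=(\varepsilon-|\gamma|^2)\hbar,\quad [w_k,v_k^*]=-\bar\phi\gamma\hbar,$$ all other commutators of these operators and their adjoints, except those that follow by taking adjoints, being zero, in particular those at different instants; and, for controls $u_k\in\mathbb C$, $$x_k=\phi x_{k-1}+\beta u_{k-1}+v_k,\qquad y_k=\gamma x_{k-1}+\delta u_{k-1}+w_k,\qquad x_0=x .$$ The state of the system is normal; $x$ and the pairs $(v_k,w_k)$ are independent and Gaussian in the following sense. With the adjoint operators to the left, the expectations of the ordered exponentials $e^{-\zeta x^*}e^{\bar\zeta x}$ and $e^{-\zeta v_k^*-\theta w_k^*}e^{\bar\zeta v_k+\bar\theta w_k}$ are those of $e^{\bar\zeta\xi-\zeta\bar\xi}$ and $e^{\bar\zeta\xi-\zeta\bar\xi+\bar\theta\eta-\theta\bar\eta}$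 under circular complex Gaussian distributions: for $x$ the one with mean $z$ and $E|\xi-z|^2=\hbar\Sigma$; for $(v_k,w_k)$ the centred one with $E|\xi|^2=\hbar\sigma$, $E\,\xi\bar\eta=-\hbar\upsilon$, $E|\eta|^2=\hbar\nu$, where $\Sigma,\sigma,\nu\ge0$ and $|\upsilon|^2\le\sigma\nu$. A strategy consists of an initial control $u_0$ and, for every $k\ge1$ and every history $(u_0,\eta_1,u_1,\dots,\eta_{k-1},u_{k-1})$, of a normalized positive operator valued measure on $Y\times\mathbb C$, depending weakly measurably on the history, with values in the von Neumann algebra generated by $y_k$; its result is a datum $\eta_k$ in an arbitrary measurable space $Y$ together with the next control $u_k$. The distribution of the histories and the a posteriori states $\pi_k$ are generated by the recursion $\pi_k(dh\times d\zeta)[c]=\pi_{k-1}(dh)[b_k(h,d\zeta)\,c]$. Strategies are compared by the average cost $$\alpha=\Big\langle \Omega x_K^*x_K\Big\rangle+\sum_{k=0}^{K-1}\Big\langle\omega x_k^*x_k-\vartheta\bar u_kx_k-\bar\vartheta u_kx_k^*+\vartheta^1|u_k|^2\Big\rangle,\qquad \Omega\ge0,\ \omega\ge0,\ \vartheta^1>0,\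 \vartheta\in\mathbb C,$$ among the strategies for which $\langle|u_k|^2\rangle$, $k<K$, and $\langle x_k^*x_k\rangle$, $k\le K$, are finite. Let $\Omega_K=\Omega$ and, for $k<K$, $$\Upsilon_k=|\beta|^2\Omega_{k+1}+\vartheta^1,\qquad \lambda_k=(\phi\bar\beta\Omega_{k+1}-\vartheta)/\Upsilon_k,\qquad \Omega_k=|\phi|^2\Omega_{k+1}+\omega-|\lambda_k|^2\Upsilon_k,$$ and assume that $\Upsilon_k>0$ for all $k<K$ (this holds, for instance, if $|\vartheta|^2\le\omega\vartheta^1$). Let $\mu^o=\max(0,\varepsilon)$, $\Sigma_0=\Sigma$ and $$\Psi_k=|\gamma|^2\Sigma_{k-1}+\nu+\mu^o,\qquad \kappa_k=(\phi\bar\gamma\Sigma_{k-1}-\upsilon)/\Psi_k,\qquad \Sigma_k=|\phi|^2\Sigma_{k-1}+\sigma-|\kappa_k|^2\Psi_k$$ (with $\kappa_k=0$ if $\Psi_k=0$). **Theorem.** The linear strategy $u_k=-\lambda_kz_k$, $0\le k<K$, is optimal, where the $z_k$ are the quantum Kalman estimates $$z_0=z,\qquad z_k=\phi z_{k-1}+\beta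 u_{k-1}+\kappa_k(\eta_k-\gamma z_{k-1}-\delta u_{k-1}),$$ and $\eta_k$ is the result of the coherent measurement of $y_k$, that is, of the measurement with the operator valued measure $b_k$ on $\mathbb C$ determined by $$\int e^{\bar\theta\eta-\theta\bar\eta}\,b_k(d\eta)=e^{-\hbar\mu^o|\theta|^2}\,e^{\hbar\varepsilon|\theta|^2/2}\,e^{\bar\theta y_k-\theta y_k^*}\qquad(\theta\in\mathbb C)$$ (the indirect Gaussian measurement with the minimal noise parameter $\mu^o$). That is: such a strategy exists (with its a posteriori states), its mean energies are finite, its cost is $$\alpha^o=\Omega_0|z|^2+\hbar\Big(\Omega_0\Sigma+\sum_{k=1}^K\big(\Omega_k\sigma+\bar\lambda_{k-1}(\phi\bar\beta\Omega_k-\vartheta)\Sigma_{k-1}\big)\Big),$$ and $\alpha\ge\alpha^o$ for every strategy of finite mean energies. -/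

import Mathlib

open MeasureTheory
open scoped ComplexConjugate InnerProductSpace

noncomputable section

namespace QuantumLQG

/-! ### Parameters of the problem and the classical recursions -/

/-- The numerical data of the problem.
`hbar` is Planck's constant; `phi`, `beta`, `gamma`, `delta` are the coefficients of
`x_{k+1} = phi x_k + beta u_k + v_{k+1}` and `y_{k+1} = gamma x_k + delta u_k + w_{k+1}`;
`eps` fixes the commutator `[y_k, y_k*] = eps hbar`;
`z`, `Sig` are the mean and the variance (in units of `hbar`) of the initial Gaussian state;
`sig`, `ups`, `nu` are the covariances of the noise (in units of `hbar`):
`E|v|² = sig`, `E v w̄ = -ups`, `E|w|² = nu`;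
`Om` is the coefficient of the final loss `Om x* x`, and `om`, `vth`, `vth1` are those of the
running loss `om x* x - vth ū x - conj vth u x* + vth1 |u|²`. -/
structure Params where
  hbar : ℝ
  eps : ℝ
  phi : ℂ
  beta : ℂ
  gamma : ℂ
  delta : ℂ
  z : ℂ
  Sig : ℝ
  sig : ℝ
  ups : ℂ
  nu : ℝ
  Om : ℝ
  om : ℝ
  vth : ℂ
  vth1 : ℝ

namespace Params

variable (p : Params)

/-- `Υ` as a function of the value of `Ω` at the next instant: `Υ = |β|² Ω' + ϑ¹`. -/
def upsOf (Om' : ℝ) : ℝ := ‖p.beta‖ ^ 2 * Om' + p.vth1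

/-- `λ` as a function of the value of `Ω` at the next instant: `λ = (φ β̄ Ω' - ϑ) / Υ`. -/
def lamOf (Om' : ℝ) : ℂ := (p.phi * conj p.beta * Om' - p.vth) / (p.upsOf Om' : ℂ)

/-- The backward Riccati recursion, indexed by the number of steps that remain before the
final instant: `Ω = |φ|² Ω' + ω - |λ|² Υ`, starting from the coefficient of the final loss. -/
def riccati : ℕ → ℝ
  | 0 => p.Om
  | m + 1 => ‖p.phi‖ ^ 2 * riccati m + p.om
      - ‖p.lamOf (riccati m)‖ ^ 2 * p.upsOf (riccati m)

/-- `Ω_k` for the horizon `K` (`k ≤ K`). -/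
def OmAt (K k : ℕ) : ℝ := p.riccati (K - k)

/-- `Υ_k = |β|² Ω_{k+1} + ϑ¹` for the horizon `K` (`k < K`). -/
def UpsAt (K k : ℕ) : ℝ := p.upsOf (p.OmAt K (k + 1))

/-- `λ_k = (φ β̄ Ω_{k+1} - ϑ) / Υ_k` for the horizon `K` (`k < K`). -/
def lamAt (K k : ℕ) : ℂ := p.lamOf (p.OmAt K (k + 1))

/-- `Ψ_{k+1} = |γ|² Σ_k + ν + μ` as a function of `Σ_k`. -/
def psiOf (mu S : ℝ) : ℝ := ‖p.gamma‖ ^ 2 * S + (p.nu + mu)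

/-- The Kalman gain `κ_{k+1} = (φ γ̄ Σ_k - υ) / Ψ_{k+1}` as a function of `Σ_k`. -/
def gainOf (mu S : ℝ) : ℂ := (p.phi * conj p.gamma * S - p.ups) / (p.psiOf mu S : ℂ)

/-- The variances `Σ_k` of the Kalman filter when the measurement noise has parameter `mu`:
`Σ_{k+1} = |φ|² Σ_k + σ - |κ_{k+1}|² Ψ_{k+1}`. -/
def SigAt (mu : ℝ) : ℕ → ℝ
  | 0 => p.Sig
  | k + 1 => ‖p.phi‖ ^ 2 * SigAt mu k + p.sig
      - ‖p.gainOf mu (SigAt mu k)‖ ^ 2 * p.psiOf mu (SigAt mu k)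

/-- The Kalman estimates `z_k`, given the controls `u 0, u 1, …` and the results
`eta 0, eta 1, …` of the measurements of `y_1, y_2, …`. -/
def estimate (mu : ℝ) (u eta : ℕ → ℂ) : ℕ → ℂ
  | 0 => p.z
  | k + 1 => p.phi * estimate mu u eta k + p.beta * u k
      + p.gainOf mu (p.SigAt mu k)
        * (eta k - p.gamma * estimate mu u eta k - p.delta * u k)

/-- The minimal noise parameter of a measurement of `y_k`. -/
def muMin : ℝ := max 0 p.eps

/-- The value
`Ω_0 |z|² + ħ (Ω_0 Σ + ∑_{k=1}^K (Ω_k σ + conj λ_{k-1} (φ β̄ Ω_k - ϑ) Σ_{k-1}))`. -/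
def minLoss (K : ℕ) : ℝ :=
  p.OmAt K 0 * ‖p.z‖ ^ 2
    + p.hbar * (p.OmAt K 0 * p.Sig
      + ∑ k ∈ Finset.range K,
          (p.OmAt K (k + 1) * p.sig
            + (conj (p.lamAt K k)
                * (p.phi * conj p.beta * (p.OmAt K (k + 1) : ℂ) - p.vth)).re
              * p.SigAt p.muMin k))

/-- The commutation form of the noise pair `(v, w)`: the commutator of
`ζ̄ v - ζ v* + θ̄ w - θ w*` and `ζ'̄ v - ζ' v* + θ'̄ w - θ' w*` is
`2 i ħ Im (commForm (ζ, θ) (ζ', θ'))`, which encodes `[v, v*] = (1 - |φ|²) ħ`,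
`[w, w*] = (ε - |γ|²) ħ`, `[w, v*] = - φ̄ γ ħ` and `[v, w] = 0`. -/
def commForm (a b : ℂ × ℂ) : ℂ :=
  ((1 - ‖p.phi‖ ^ 2 : ℝ) : ℂ) * (a.1 * conj b.1)
    + ((p.eps - ‖p.gamma‖ ^ 2 : ℝ) : ℂ) * (a.2 * conj b.2)
    - conj p.phi * p.gamma * (a.1 * conj b.2)
    - p.phi * conj p.gamma * (a.2 * conj b.1)

/-- The quadratic form `E |ζ̄ ξ + θ̄ η|² / ħ` of the centred Gaussian distribution on `ℂ²` with
`E|ξ|² = ħ σ`, `E ξ η̄ = - ħ υ`, `E|η|² = ħ ν`. -/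
def covForm (a : ℂ × ℂ) : ℝ :=
  p.sig * ‖a.1‖ ^ 2 + p.nu * ‖a.2‖ ^ 2 - 2 * (p.ups * conj a.1 * a.2).re

end Params

/-! ### Normal states, positive operator valued measures, amplitude operators -/

/-- The phase `exp (ζ̄ a - ζ ā) = exp (2 i Im (ζ̄ a))`. -/
def phase (ζ a : ℂ) : ℂ := Complex.exp (2 * Complex.I * ((conj ζ * a).im : ℂ))

section Hilbert

variable {H : Type*} [NormedAddCommGroup H] [InnerProductSpace ℂ H]

/-- A normal state on the bounded operators of `H`, that is, a density operator
`∑ i, |ψ i⟩⟨ψ i|`, given through its vectors. -/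
structure NormalState (H : Type*) [NormedAddCommGroup H] [InnerProductSpace ℂ H] where
  vec : ℕ → H
  normalized : HasSum (fun i => ‖vec i‖ ^ 2) 1

/-- The expectation of a bounded operator. -/
def NormalState.ev (ρ : NormalState H) (c : H →L[ℂ] H) : ℂ :=
  ∑' i, ⟪ρ.vec i, c (ρ.vec i)⟫_ℂ

/-- A measurement: a normalized positive operator valued measure on `Z`, countably additive
in the weak sense. -/
structure POVM (Z : Type*) [MeasurableSpace Z] (H : Type*) [NormedAddCommGroup H]
    [InnerProductSpace ℂ H] where
  eff : Set Z → H →L[ℂ] H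
  pos : ∀ S, MeasurableSet S → (eff S).IsPositive
  total : eff Set.univ = 1
  additive : ∀ S : ℕ → Set Z, (∀ n, MeasurableSet (S n)) →
    Pairwise (Function.onFun Disjoint S) →
      ∀ f : H, HasSum (fun n => ⟪f, eff (S n) f⟫_ℂ) ⟪f, eff (⋃ n, S n) f⟫_ℂ

theorem POVM.eff_empty {Z : Type*} [MeasurableSpace Z] (E : POVM Z H) (f : H) :
    ⟪f, E.eff ∅ f⟫_ℂ = 0 := by
  have h := E.additive (fun _ => ∅) (fun _ => MeasurableSet.empty)
    (fun _ _ _ => by simp [Function.onFun]) f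
  simp only [Set.iUnion_empty] at h
  exact (summable_const_iff (β := ℕ) _).1 h.summable

/-- The finite measure `S ↦ ⟨f, E(S) f⟩`. -/
def POVM.measureAt {Z : Type*} [MeasurableSpace Z] (E : POVM Z H) (f : H) : Measure Z :=
  Measure.ofMeasurable (fun S _ => ENNReal.ofReal (⟪f, E.eff S f⟫_ℂ).re)
    (by simp [E.eff_empty f])
    (by
      intro S hS hd
      have h := Complex.hasSum_re (E.additive S hS hd f)
      have h0 : ∀ n, 0 ≤ (⟪f, E.eff (S n) f⟫_ℂ).re := fun n =>
        (E.pos (S n) (hS n)).re_inner_nonneg_right f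
      rw [← h.tsum_eq, ENNReal.ofReal_tsum_of_nonneg h0 h.summable])

/-- Let `W ζ = exp (ζ̄ x - ζ x*)`. `InDom W f` says that `f` belongs to the domain of the
amplitude operator `x`, that is, to the domains of the generators `x - x*` and `-i (x + x*)` of
`t ↦ W t` and `t ↦ W (t i)`. -/
def InDom (W : ℂ → H →L[ℂ] H) (f : H) : Prop :=
  DifferentiableAt ℝ (fun t : ℝ => W (t : ℂ) f) 0 ∧
    DifferentiableAt ℝ (fun t : ℝ => W ((t : ℂ) * Complex.I) f) 0

/-- The value `x f = ((x - x*) f + i (- i (x + x*)) f) / 2` of the amplitude operator `x` with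
Weyl operators `W ζ = exp (ζ̄ x - ζ x*)`, for `f` in its domain. -/
def amp (W : ℂ → H →L[ℂ] H) (f : H) : H :=
  (1 / 2 : ℂ) • (deriv (fun t : ℝ => W (t : ℂ) f) 0
    + Complex.I • deriv (fun t : ℝ => W ((t : ℂ) * Complex.I) f) 0)

/-- The expectation of the amplitude operator `x` (meaningful when that of `x* x` is finite). -/
def NormalState.mean (ρ : NormalState H) (W : ℂ → H →L[ℂ] H) : ℂ :=
  ∑' i, ⟪ρ.vec i, amp W (ρ.vec i)⟫_ℂ

open Classical in
/-- The expectation of `x* x`, possibly infinite. -/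
def NormalState.energy (ρ : NormalState H) (W : ℂ → H →L[ℂ] H) : ENNReal :=
  if ∀ i, InDom W (ρ.vec i) then ∑' i, ENNReal.ofReal (‖amp W (ρ.vec i)‖ ^ 2) else ⊤

/-- The double commutant of a set of operators: for a set that is stable under adjoints, the
von Neumann algebra that it generates. -/
def bicommutant (S : Set (H →L[ℂ] H)) : Set (H →L[ℂ] H) :=
  Set.centralizer (Set.centralizer S)

end Hilbert

/-! ### The quantum open oscillator -/

/-- The discrete linear Markovian quantum open oscillator, in the Weyl form of the canonical
commutation relations: `X ζ = exp (ζ̄ x - ζ x*)` for the initial amplitude `x`, and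
`N k (ζ, θ) = exp (ζ̄ v - ζ v* + θ̄ w - θ w*)` for the noise pair `(v, w) = (v_{k+1}, w_{k+1})`
of the step from `k` to `k + 1`. The initial amplitude and the noises of different steps
commute together with their adjoints; `state` is the state of the whole system. -/
structure OpenOscillator (p : Params) (H : Type*) [NormedAddCommGroup H]
    [InnerProductSpace ℂ H] [CompleteSpace H] where
  X : ℂ → H →L[ℂ] H
  N : ℕ → ℂ × ℂ → H →L[ℂ] H
  X_unitary : ∀ ζ, X ζ ∈ unitary (H →L[ℂ] H)
  N_unitary : ∀ k a, N k a ∈ unitary (H →L[ℂ] H)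
  X_continuous : ∀ f : H, Continuous fun ζ => X ζ f
  N_continuous : ∀ k (f : H), Continuous fun a => N k a f
  X_weyl : ∀ ζ ζ', X ζ * X ζ' =
    Complex.exp (Complex.I * (p.hbar * (ζ * conj ζ').im : ℝ)) • X (ζ + ζ')
  N_weyl : ∀ k a b, N k a * N k b =
    Complex.exp (Complex.I * (p.hbar * (p.commForm a b).im : ℝ)) • N k (a + b)
  X_N_commute : ∀ ζ k a, Commute (X ζ) (N k a)
  N_N_commute : ∀ k l, k ≠ l → ∀ a b, Commute (N k a) (N l b)
  state : NormalState H

namespace OpenOscillator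

variable {p : Params} {H : Type*} [NormedAddCommGroup H] [InnerProductSpace ℂ H]
  [CompleteSpace H] (Q : OpenOscillator p H)

/-- The initial amplitude and all the noise pairs are independent and have Gaussian
distributions. The symbol distribution of an operator pair is the distribution that gives the
expectations of the ordered exponentials with the adjoint operators on the left,
`exp (-ζ x*) exp (ζ̄ x) = exp (ħ |ζ|² / 2) X ζ`, and
`exp (-ζ v* - θ w*) exp (ζ̄ v + θ̄ w) = exp (ħ commForm a a / 2) N k a` with `a = (ζ, θ)`.
Here it is Gaussian with mean `z` and variance `ħ Σ`, with characteristic function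
`exp (2 i Im (ζ̄ z) - ħ Σ |ζ|²)`, and centred Gaussian with characteristic function
`exp (- ħ covForm a)`, respectively. -/
def IsGaussian : Prop :=
  ∀ (n : ℕ) (ζ : ℂ) (a : ℕ → ℂ × ℂ),
    Q.state.ev (X Q ζ * ((List.range n).map fun k => N Q k (a k)).prod) =
      phase ζ p.z * Complex.exp (-(p.hbar * (p.Sig + 1 / 2) * ‖ζ‖ ^ 2 : ℝ))
        * ∏ k ∈ Finset.range n,
            Complex.exp (-(p.hbar * (p.covForm (a k) + (p.commForm (a k) (a k)).re / 2) : ℝ))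

/-- The Weyl operators `exp (ζ̄ x_k - ζ x_k*)` of the amplitude at the instant `k`, under the
controls `u`, where `x_0 = x` and `x_{k+1} = φ x_k + β u_k + v_{k+1}`. -/
def xWeyl (u : ℕ → ℂ) : ℕ → ℂ → H →L[ℂ] H
  | 0, ζ => X Q ζ
  | k + 1, ζ => phase ζ (p.beta * u k) •
      (xWeyl u k (conj p.phi * ζ) * N Q k (ζ, 0))

/-- The Weyl operators `exp (θ̄ y - θ y*)` of the output
`y = y_{k+1} = γ x_k + δ u_k + w_{k+1}`, under the controls `u`. -/
def yWeyl (u : ℕ → ℂ) (k : ℕ) (θ : ℂ) : H →L[ℂ] H :=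
  phase θ (p.delta * u k) • (Q.xWeyl u k (conj p.gamma * θ) * N Q k (0, θ))

/-- The von Neumann algebra generated by the output `y_{k+1}`. It does not depend on the
controls, which only add scalars to the operator. -/
def outputAlgebra (k : ℕ) : Set (H →L[ℂ] H) :=
  bicommutant (Set.range (Q.yWeyl 0 k))

/-- The von Neumann algebra generated by the amplitude `x_n` and all the noises that enter after
the instant `n`; it contains all `x_k`, `k ≥ n`, and `y_k`, `k > n`, and commutes with the
outputs `y_1, …, y_n`. -/
def futureAlgebra (n : ℕ) : Set (H →L[ℂ] H) :=
  bicommutant (Set.range (Q.xWeyl 0 n) ∪ {c | ∃ k a, n ≤ k ∧ c = N Q k a})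

/-- The measurement `#m(η - y)# dη` of the output `y = y_{k+1}`, for the Gaussian distribution
`m` with mean zero and variance `ħ μ`, of density
`exp (-|η|² / (ħ μ)) / μ` with respect to `dη = d Re η d Im η / (π ħ)` (a Dirac measure for
`μ = 0`). In `# · #` the operator `y` acts before its adjoint, so that
`#exp (θ̄ y - θ y*)# = exp (-θ y*) exp (θ̄ y) = exp (ħ ε |θ|² / 2) yWeyl θ`, and the measure is
determined by
`∫ exp (θ̄ η - θ η̄) b(dη) = exp (- ħ μ |θ|²) #exp (θ̄ y - θ y*)#`. -/
def IsIndirectMeasurement (mu : ℝ) (u : ℕ → ℂ) (k : ℕ) (E : POVM ℂ H) : Prop :=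
  ∀ (θ : ℂ) (f : H),
    ∫ η, phase θ η ∂(E.measureAt f) =
      Complex.exp (-(p.hbar * mu * ‖θ‖ ^ 2 : ℝ))
        * (Complex.exp ((p.hbar * p.eps * ‖θ‖ ^ 2 / 2 : ℝ)) * ⟪f, Q.yWeyl u k θ f⟫_ℂ)

end OpenOscillator

/-! ### Strategies, the states they generate, and their cost -/

section Strategy

variable {p : Params} {H : Type*} [NormedAddCommGroup H] [InnerProductSpace ℂ H]
  [CompleteSpace H]

/-- The data `(η_1, u_1), …, (η_n, u_n)` of the first `n` stages, with results `η` in `Y`. -/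
abbrev History (Y : Type*) (n : ℕ) : Type _ := Fin n → Y × ℂ

/-- A strategy of measurement and control: an initial control `u_0`, and for every `n` and every
history of the first `n` stages a measurement of the output `y_{n+1}` (with values in the algebra
that the output generates), whose result is a pair of a datum `η_{n+1}` in `Y` and a
control `u_{n+1}`; it may depend on the history in any weakly measurable way. -/
structure Strategy (Q : OpenOscillator p H) (Y : Type*) [MeasurableSpace Y] where
  u0 : ℂ
  meas : (n : ℕ) → History Y n → POVM (Y × ℂ) H
  mem_output : ∀ n h S, MeasurableSet S → (meas n h).eff S ∈ Q.outputAlgebra n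
  measurable : ∀ n S, MeasurableSet S → ∀ f g : H,
    Measurable fun h => ⟪f, (meas n h).eff S g⟫_ℂ

variable {Q : OpenOscillator p H} {Y : Type*} [MeasurableSpace Y]

/-- The controls `u_0, …, u_n` of a history of `n` stages (and zero afterwards). -/
def Strategy.controls (s : Strategy Q Y) {n : ℕ} (h : History Y n) : ℕ → ℂ
  | 0 => s.u0
  | j + 1 => if hj : j < n then (h ⟨j, hj⟩).2 else 0

/-- The statistics generated by a strategy in the state of the oscillator: the probability
distributions `P n` of the histories, and the a posteriori states `post n h`, given the history,
on the algebra `futureAlgebra n`, which are determined by the recursion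
`π_{n+1}(dh × dζ)[c] = π_n(dh)[b(h, dζ) c]`. -/
structure Evolution (s : Strategy Q Y) where
  P : (n : ℕ) → Measure (History Y n)
  prob : ∀ n, IsProbabilityMeasure (P n)
  post : (n : ℕ) → History Y n → NormalState H
  post_measurable : ∀ n i, StronglyMeasurable fun h => (post n h).vec i
  post_zero : ∀ h, post 0 h = Q.state
  step : ∀ (n : ℕ) (A : Set (History Y n)) (S : Set (Y × ℂ)),
    MeasurableSet A → MeasurableSet S → ∀ c ∈ Q.futureAlgebra (n + 1),
      ∫ h in {h : History Y (n + 1) | (fun i : Fin n => h i.castSucc) ∈ A ∧ h (Fin.last n) ∈ S},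
          (post (n + 1) h).ev c ∂(P (n + 1))
        = ∫ h in A, (post n h).ev ((s.meas n h).eff S * c) ∂(P n)

namespace Evolution

variable {s : Strategy Q Y} (R : Evolution s)

/-- All the terms of the average cost are absolutely convergent: the mean squares of the
controls and of the amplitudes are finite on the interval `[0, K]`. -/
def FiniteEnergy (K : ℕ) : Prop :=
  (∀ k < K, ∫⁻ h, ENNReal.ofReal (‖s.controls h k‖ ^ 2) ∂(R.P k) ≠ ⊤) ∧
    ∀ k ≤ K, ∫⁻ h, (R.post k h).energy (Q.xWeyl (s.controls h) k) ∂(R.P k) ≠ ⊤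

/-- The average of the running loss `ω x* x - ϑ ū x - conj ϑ u x* + ϑ¹ |u|²` at the
instant `k`. -/
def runningCost (k : ℕ) : ℝ :=
  ∫ h, (p.om * ((R.post k h).energy (Q.xWeyl (s.controls h) k)).toReal
      - 2 * (p.vth * conj (s.controls h k)
          * (R.post k h).mean (Q.xWeyl (s.controls h) k)).re
      + p.vth1 * ‖s.controls h k‖ ^ 2) ∂(R.P k)

/-- The average of the final loss `Ω x* x` at the instant `K`. -/
def finalCost (K : ℕ) : ℝ :=
  ∫ h, p.Om * ((R.post K h).energy (Q.xWeyl (s.controls h) K)).toReal ∂(R.P K)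

/-- The average cost on the interval `[0, K]`. It does not depend on the measurements at the
stages `K, K + 1, …`. -/
def cost (K : ℕ) : ℝ :=
  R.finalCost K + ∑ k ∈ Finset.range K, R.runningCost k

end Evolution

/-- The results `η_1, …, η_n` of a history, followed by the new result `η`. -/
def results {n : ℕ} (h : History ℂ n) (η : ℂ) (j : ℕ) : ℂ :=
  if hj : j < n then (h ⟨j, hj⟩).1 else η

/-- The linear strategy with measurement parameter `mu`: `u_k = -λ_k z_k` for all `k < K`, where
the `z_k` are the Kalman estimates based on the results `η_1, …, η_k` of the indirect Gaussian
measurements with parameter `mu`. -/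
def Strategy.IsLinearGaussian (s : Strategy Q ℂ) (K : ℕ) (mu : ℝ) : Prop :=
  (0 < K → s.u0 = -p.lamAt K 0 * p.z) ∧
    ∀ n, n + 1 < K → ∀ h : History ℂ n, ∃ E : POVM ℂ H,
      Q.IsIndirectMeasurement mu (s.controls h) n E ∧
        ∀ S : Set (ℂ × ℂ), MeasurableSet S →
          (s.meas n h).eff S = E.eff {η : ℂ |
            (η, -p.lamAt K (n + 1)
              * p.estimate mu (s.controls h) (results h η) (n + 1)) ∈ S}

end Strategy

end QuantumLQG

end

noncomputable section

set_option linter.unusedSectionVars false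

namespace QuantumLQG

/-! ### Phases -/

/-! The cost is a sum of squares. The Riccati recursion completes the square in the control:
telescoping `Ω_k ⟨x_k* x_k⟩` along `x_{k+1} = φ x_k + β u_k + v_{k+1}` turns the cost of any
strategy of finite energies into `Ω_0 ⟨x* x⟩ + ∑ (ħ σ Ω_{k+1} + Υ_k ⟨|u_k + λ_k x_k|²⟩)`
(`Evolution.cost_eq`). Given the history, `u_k` is a number, so the error `⟨|u_k + λ_k x_k|²⟩` is at
least `|λ_k|²` times the a posteriori variance of `x_k`. As `Υ_k > 0`, the lower bound of the cost
reduces to one claim: whatever has been measured, this variance is almost surely at least `ħ Σ_k`,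
the Kalman variance for the minimal noise.

The claim is proved through a stronger property that survives conditioning, the positivity of
`varianceKernel`: after a Gaussian factor of the required variance is divided out, the expectations
`ρ(W(-ζ) W(ζ'))` still form a positive semidefinite kernel. In one step the kernel of the pair
`(x_{k+1}, y_{k+1})` is the pullback of the previous kernel times exponentials of positive forms.
The identity `Params.filter_square` yields one of them, `Ψ |θ + κ̄ ζ|²`; the other is the covariance
form of the noise, or, for `ε ≤ 0`, the sum of covariance and commutator, positive by the
uncertainty relation (`posKernel_jointKernel`). An effect of a measurement of `y_{k+1}` is `b²` with
`b` self-adjoint in the output algebra. It commutes with `x_{k+1}`, and `b` is approximated by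
combinations of Weyl operators of `y_{k+1}`, so positivity of the joint kernel passes to the a
posteriori states (`Evolution.ae_posKernel`). The second order of the kernel at the origin is the
variance bound (`le_energy_of_posKernel`).

The bound is attained. Under the coherent measurement the conditional characteristic functions are
Gaussian with mean `z_k` and variance `ħ Σ_k` (`Evolution.ae_gaussian`), and `u_k = -λ_k z_k` makes
the error exactly `|λ_k|² ħ Σ_k`.

Existence has two parts. The coherent measurement exists because `exp (-|c| |θ|² / 2) ⟨f, W θ f⟩` is
a characteristic function: with slightly more damping its Fourier transform is a squared norm of a
Gaussian average of `W θ f`, and Lévy's continuity theorem gives the limit (`exists_weyl_measure`).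
The a posteriori states matter only through their expectations on the future algebra, so any normal
states with the right values serve: the unconditional state is narrowed to the variance `ħ Σ_n` by a
Gaussian average of Weyl operators and then displaced to the estimate (`exists_reference`,
`posterior`).

Since `x` is unbounded, energies and means are recovered from difference quotients of characteristic
functions at dyadic times. These quotients involve bounded operators only, and those for the energy
increase, so averages are taken by monotone convergence (`iSup_charQuot`). Passing from Weyl
operators to the algebras that they generate uses the bicommutant theorem on spaces of square
integrable families (`IsProductClosed.ampl_mem_closure`). -/

theorem phase_eq (ζ a : ℂ) : phase ζ a = Complex.exp (((2 * (conj ζ * a).im : ℝ) : ℂ) * Complex.I) := by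
  unfold phase
  push_cast
  congr 1
  ring

@[simp] theorem phase_zero_left (a : ℂ) : phase 0 a = 1 := by simp [phase]

@[simp] theorem phase_zero_right (ζ : ℂ) : phase ζ 0 = 1 := by simp [phase]

theorem phase_add_left (ζ ζ' a : ℂ) : phase (ζ + ζ') a = phase ζ a * phase ζ' a := by
  simp only [phase, ← Complex.exp_add, map_add, add_mul, Complex.add_im, Complex.ofReal_add, mul_add]

theorem phase_add_right (ζ a a' : ℂ) : phase ζ (a + a') = phase ζ a * phase ζ a' := by
  simp only [phase, ← Complex.exp_add, mul_add, Complex.add_im, Complex.ofReal_add]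

@[simp] theorem norm_phase (ζ a : ℂ) : ‖phase ζ a‖ = 1 := by
  rw [phase_eq, Complex.norm_exp_ofReal_mul_I]

theorem conj_phase (ζ a : ℂ) : conj (phase ζ a) = phase (-ζ) a := by
  rw [phase, phase, ← Complex.exp_conj]
  simp only [map_mul, Complex.conj_I, Complex.conj_ofReal, map_neg, map_ofNat, neg_mul,
    Complex.neg_im, Complex.ofReal_neg, mul_neg]

theorem phase_neg_right (ζ a : ℂ) : phase ζ (-a) = phase (-ζ) a := by
  simp [phase]

theorem phase_mul_phase_neg (ζ a : ℂ) : phase ζ a * phase (-ζ) a = 1 := by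
  rw [← phase_add_left]; simp

theorem phase_mul_right (ζ κ a : ℂ) : phase ζ (κ * a) = phase (conj κ * ζ) a := by
  unfold phase
  simp only [map_mul, Complex.conj_conj]
  congr 4
  ring

theorem continuous_phase : Continuous fun x : ℂ × ℂ => phase x.1 x.2 := by
  unfold phase
  fun_prop

@[fun_prop] theorem continuous_phase_comp {X : Type*} [TopologicalSpace X] {f g : X → ℂ}
    (hf : Continuous f) (hg : Continuous g) : Continuous fun x => phase (f x) (g x) :=
  continuous_phase.comp (hf.prodMk hg)

@[fun_prop] theorem measurable_phase_comp {X : Type*} [MeasurableSpace X] {f g : X → ℂ}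
    (hf : Measurable f) (hg : Measurable g) : Measurable fun x => phase (f x) (g x) := by
  unfold phase
  fun_prop

/-! ### Expectations in normal states -/

section States

variable {H : Type*} [NormedAddCommGroup H] [InnerProductSpace ℂ H]

theorem summable_inner_of_sq {f g : ℕ → H} (hf : Summable fun i => ‖f i‖ ^ 2)
    (hg : Summable fun i => ‖g i‖ ^ 2) : Summable fun i => ⟪f i, g i⟫_ℂ := by
  refine Summable.of_norm_bounded (hf.add hg) fun i => ?_
  have h1 := norm_inner_le_norm (𝕜 := ℂ) (f i) (g i)
  nlinarith [sq_nonneg (‖f i‖ - ‖g i‖), sq_nonneg ‖f i‖, sq_nonneg ‖g i‖]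

theorem summable_sq_apply {f : ℕ → H} (hf : Summable fun i => ‖f i‖ ^ 2) (c : H →L[ℂ] H) :
    Summable fun i => ‖c (f i)‖ ^ 2 := by
  refine Summable.of_nonneg_of_le (fun i => by positivity) (fun i => ?_) (hf.mul_left (‖c‖ ^ 2))
  rw [← mul_pow]
  exact pow_le_pow_left₀ (norm_nonneg _) (c.le_opNorm _) 2

theorem summable_sq_add {f g : ℕ → H} (hf : Summable fun i => ‖f i‖ ^ 2)
    (hg : Summable fun i => ‖g i‖ ^ 2) : Summable fun i => ‖f i + g i‖ ^ 2 := by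
  refine Summable.of_nonneg_of_le (fun i => by positivity) (fun i => ?_)
    ((hf.mul_left 2).add (hg.mul_left 2))
  have := norm_add_le (f i) (g i)
  nlinarith [sq_nonneg (‖f i‖ - ‖g i‖), norm_nonneg (f i + g i), norm_nonneg (f i), norm_nonneg (g i)]

namespace NormalState

variable (ρ : NormalState H)

theorem summable_sq : Summable fun i => ‖ρ.vec i‖ ^ 2 := ρ.normalized.summable

theorem summable_ev (c : H →L[ℂ] H) : Summable fun i => ⟪ρ.vec i, c (ρ.vec i)⟫_ℂ :=
  summable_inner_of_sq ρ.summable_sq (summable_sq_apply ρ.summable_sq c)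

theorem norm_inner_vec_le (c : H →L[ℂ] H) {C : ℝ} (hC : ‖c‖ ≤ C) (i : ℕ) :
    ‖⟪ρ.vec i, c (ρ.vec i)⟫_ℂ‖ ≤ C * ‖ρ.vec i‖ ^ 2 := by
  refine (norm_inner_le_norm _ _).trans ?_
  have := c.le_of_opNorm_le hC (ρ.vec i)
  nlinarith [norm_nonneg (ρ.vec i)]

theorem norm_ev_le (c : H →L[ℂ] H) : ‖ρ.ev c‖ ≤ ‖c‖ := by
  have h := tsum_of_norm_bounded (ρ.normalized.mul_left ‖c‖)
    (fun i => ρ.norm_inner_vec_le c le_rfl i)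
  simpa [ev] using h

theorem ev_add (c d : H →L[ℂ] H) : ρ.ev (c + d) = ρ.ev c + ρ.ev d := by
  simp only [ev, add_apply, inner_add_right]
  exact (ρ.summable_ev c).tsum_add (ρ.summable_ev d)

theorem ev_smul (a : ℂ) (c : H →L[ℂ] H) : ρ.ev (a • c) = a * ρ.ev c := by
  simp only [ev, smul_apply, inner_smul_right]
  exact tsum_mul_left

@[simp] theorem ev_zero : ρ.ev 0 = 0 := by simp [ev]

theorem ev_neg (c : H →L[ℂ] H) : ρ.ev (-c) = -ρ.ev c := by
  simpa using ρ.ev_smul (-1) c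

theorem ev_sub (c d : H →L[ℂ] H) : ρ.ev (c - d) = ρ.ev c - ρ.ev d := by
  rw [sub_eq_add_neg, ev_add, ev_neg, sub_eq_add_neg]

theorem ev_sum {ι : Type*} (s : Finset ι) (c : ι → H →L[ℂ] H) :
    ρ.ev (∑ i ∈ s, c i) = ∑ i ∈ s, ρ.ev (c i) := by
  classical
  induction s using Finset.induction_on with
  | empty => simp
  | insert a s ha ih => rw [Finset.sum_insert ha, Finset.sum_insert ha, ev_add, ih]

@[simp] theorem ev_one : ρ.ev 1 = 1 := by
  have h : HasSum (fun i => ((‖ρ.vec i‖ ^ 2 : ℝ) : ℂ)) 1 := by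
    have := Complex.hasSum_ofReal.2 ρ.normalized
    rwa [Complex.ofReal_one] at this
  simp only [ev, one_apply_eq_self, inner_self_eq_norm_sq_to_K]
  simpa using h.tsum_eq

/-- Weyl families are continuous only strongly, not in norm; a uniform bound of the norms makes the
series of expectations converge uniformly. -/
theorem continuous_ev {X : Type*} [TopologicalSpace X] {T : X → H →L[ℂ] H} {C : ℝ}
    (hT : ∀ f, Continuous fun x => T x f) (hC : ∀ x, ‖T x‖ ≤ C) :
    Continuous fun x => ρ.ev (T x) :=
  continuous_tsum (fun _ => continuous_const.inner (hT _)) (ρ.summable_sq.mul_left C)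
    (fun _ x => ρ.norm_inner_vec_le _ (hC x) _)

theorem ev_star [CompleteSpace H] (c : H →L[ℂ] H) : ρ.ev (star c) = conj (ρ.ev c) := by
  simp only [ev, ContinuousLinearMap.star_eq_adjoint, ContinuousLinearMap.adjoint_inner_right]
  rw [Complex.conj_tsum]
  exact tsum_congr fun i => (inner_conj_symm _ _).symm

end NormalState

theorem measurable_ev {X : Type*} [MeasurableSpace X] {ρ : X → NormalState H}
    (hρ : ∀ i, StronglyMeasurable fun x => (ρ x).vec i) (c : H →L[ℂ] H) :
    StronglyMeasurable fun x => (ρ x).ev c := by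
  have h : ∀ i, Measurable fun x => ⟪(ρ x).vec i, c ((ρ x).vec i)⟫_ℂ := fun i =>
    ((hρ i).inner (c.continuous.comp_stronglyMeasurable (hρ i))).measurable
  refine Measurable.stronglyMeasurable ?_
  refine measurable_of_tendsto_metrizable (f := fun n x => ∑ i ∈ Finset.range n,
    ⟪(ρ x).vec i, c ((ρ x).vec i)⟫_ℂ) (fun n => Finset.measurable_fun_sum _ fun i _ => h i) ?_
  rw [tendsto_pi_nhds]
  exact fun x => ((ρ x).summable_ev c).hasSum.tendsto_sum_nat

end States

/-! ### Families of Weyl operators -/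

section Weyl

variable {H : Type*} [NormedAddCommGroup H] [InnerProductSpace ℂ H] [CompleteSpace H]

/-- A strongly continuous family of unitary operators with the Weyl relations
`W a W b = exp (i B a b) W (a + b)`. -/
structure IsWeyl {V : Type*} [AddCommGroup V] [TopologicalSpace V] (B : V → V → ℝ)
    (W : V → H →L[ℂ] H) : Prop where
  unitary : ∀ a, W a ∈ unitary (H →L[ℂ] H)
  cont : ∀ f : H, Continuous fun a => W a f
  mul : ∀ a b, W a * W b = Complex.exp (Complex.I * (B a b : ℝ)) • W (a + b)
  alt : ∀ a, B a (-a) = 0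

namespace IsWeyl

variable {V : Type*} [AddCommGroup V] [TopologicalSpace V] {B : V → V → ℝ} {W : V → H →L[ℂ] H}
  (hW : IsWeyl B W)

include hW

theorem zero : W 0 = 1 := by
  have h := hW.mul 0 0
  have h0 : B 0 0 = 0 := by simpa using hW.alt 0
  rw [h0] at h
  simp only [Complex.ofReal_zero, mul_zero, Complex.exp_zero, one_smul, add_zero] at h
  have h1 := Unitary.star_mul_self_of_mem (hW.unitary 0)
  calc W 0 = star (W 0) * W 0 * W 0 := by rw [h1, one_mul]
    _ = star (W 0) * (W 0 * W 0) := by rw [mul_assoc]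
    _ = 1 := by rw [h, h1]

theorem mul_neg (a : V) : W a * W (-a) = 1 := by
  rw [hW.mul, hW.alt, add_neg_cancel, hW.zero]; simp

theorem star_eq (a : V) : star (W a) = W (-a) := by
  have h1 := Unitary.star_mul_self_of_mem (hW.unitary a)
  calc star (W a) = star (W a) * (W a * W (-a)) := by rw [hW.mul_neg, mul_one]
    _ = W (-a) := by rw [← mul_assoc, h1, one_mul]

theorem norm_apply (a : V) (f : H) : ‖W a f‖ = ‖f‖ :=
  ContinuousLinearMap.norm_map_of_mem_unitary (hW.unitary a) f

theorem norm_le (a : V) : ‖W a‖ ≤ 1 :=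
  ContinuousLinearMap.opNorm_le_bound _ zero_le_one fun f => by rw [hW.norm_apply, one_mul]

theorem inner_apply (a : V) (f g : H) : ⟪W a f, W a g⟫_ℂ = ⟪f, g⟫_ℂ :=
  ContinuousLinearMap.inner_map_map_of_mem_unitary (hW.unitary a) f g

theorem inner_left (a : V) (f g : H) : ⟪W a f, g⟫_ℂ = ⟪f, W (-a) g⟫_ℂ := by
  rw [← hW.star_eq, ContinuousLinearMap.star_eq_adjoint, ContinuousLinearMap.adjoint_inner_right]

/-- Since every `W a` is isometric, strong continuity in the parameter suffices even when the vector
varies with it. -/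
theorem continuous_comp {X : Type*} [TopologicalSpace X] {a : X → V} {F : X → H}
    (ha : Continuous a) (hF : Continuous F) : Continuous fun x => W (a x) (F x) := by
  rw [continuous_iff_continuousAt]
  intro x
  have h1 : Filter.Tendsto (fun y => W (a y) (F x)) (nhds x) (nhds (W (a x) (F x))) :=
    ((hW.cont (F x)).comp ha).tendsto x
  have h2 : Filter.Tendsto (fun y => W (a y) (F y - F x)) (nhds x) (nhds 0) := by
    rw [tendsto_zero_iff_norm_tendsto_zero]
    simp only [hW.norm_apply]
    have := ((hF.sub continuous_const).norm.tendsto x : Filter.Tendsto (fun y => ‖F y - F x‖) _ _)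
    simpa using this
  have := h1.add h2
  simpa [ContinuousAt] using this

end IsWeyl

/-- The symplectic form of an amplitude with commutator `[x, x*] = c`. -/
def symp (c : ℝ) (ζ ζ' : ℂ) : ℝ := c * (ζ * conj ζ').im

theorem symp_neg_self (c : ℝ) (ζ : ℂ) : symp c ζ (-ζ) = 0 := by
  simp [symp, Complex.mul_im]; right; ring

theorem IsWeyl.phase_smul {c : ℝ} {W : ℂ → H →L[ℂ] H} (hW : IsWeyl (symp c) W) (a : ℂ) :
    IsWeyl (symp c) fun ζ => phase ζ a • W ζ where
  unitary ζ := by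
    have h : phase ζ a ∈ _root_.unitary ℂ := by
      rw [Unitary.mem_iff]
      simp only [RCLike.star_def, conj_phase]
      rw [mul_comm, phase_mul_phase_neg]; simp
    rw [Unitary.mem_iff] at h ⊢
    have h1 := Unitary.star_mul_self_of_mem (hW.unitary ζ)
    have h2 := Unitary.mul_star_self_of_mem (hW.unitary ζ)
    simp only [star_smul, smul_mul_smul_comm, h1, h2, h.1, h.2, one_smul, and_self]
  cont f := by
    have := hW.cont f
    simp only [smul_apply]
    fun_prop
  mul ζ ζ' := by
    rw [smul_mul_smul_comm, hW.mul, phase_add_left, smul_smul, smul_smul, mul_comm]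
  alt := hW.alt

end Weyl

/-! ### The Weyl operators of the oscillator -/

namespace OpenOscillator

variable {p : Params} {H : Type*} [NormedAddCommGroup H] [InnerProductSpace ℂ H]
  [CompleteSpace H] (Q : OpenOscillator p H)

theorem isWeyl_X : IsWeyl (symp p.hbar) Q.X where
  unitary := Q.X_unitary
  cont := Q.X_continuous
  mul := Q.X_weyl
  alt := symp_neg_self _

/-- This is the preservation of the commutation relations: the commutators of the noise compensate
those of `φ x` and `γ x`, so that the form of `(x_{k+1}, y_{k+1})` is diagonal. -/
theorem commForm_im_add (a b : ℂ × ℂ) : p.hbar * ((conj p.gamma * a.2 + conj p.phi * a.1) *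
      conj (conj p.gamma * b.2 + conj p.phi * b.1)).im + p.hbar * (p.commForm a b).im
    = p.hbar * (a.1 * conj b.1).im + p.hbar * p.eps * (a.2 * conj b.2).im := by
  simp only [Params.commForm, Complex.add_im, Complex.sub_im, Complex.mul_im, Complex.mul_re,
    Complex.add_re, Complex.conj_re, Complex.conj_im, Complex.ofReal_re, Complex.ofReal_im,
    Complex.sq_norm, Complex.normSq_apply]
  ring

theorem isWeyl_N (k : ℕ) : IsWeyl (fun a b => p.hbar * (p.commForm a b).im) (Q.N k) where
  unitary := Q.N_unitary k
  cont := Q.N_continuous k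
  mul := Q.N_weyl k
  alt a := by
    simp only [Params.commForm, Prod.fst_neg, Prod.snd_neg, map_neg, Complex.add_im,
      Complex.sub_im, Complex.mul_im, Complex.mul_re, Complex.neg_re, Complex.neg_im,
      Complex.conj_re, Complex.conj_im, Complex.ofReal_re, Complex.ofReal_im]
    ring

variable (p) in
/-- The contribution of the controls to the amplitude at the instant `n`. -/
def shift (u : ℕ → ℂ) : ℕ → ℂ
  | 0 => 0
  | n + 1 => p.phi * shift u n + p.beta * u n

theorem xWeyl_eq (u : ℕ → ℂ) (n : ℕ) (ζ : ℂ) :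
    Q.xWeyl u n ζ = phase ζ (shift p u n) • Q.xWeyl 0 n ζ := by
  induction n generalizing ζ with
  | zero => simp [xWeyl, shift]
  | succ n ih =>
    simp only [xWeyl, shift]
    rw [ih, phase_add_right, phase_mul_right ζ p.phi]
    simp only [Pi.zero_apply, mul_zero, phase_zero_right, one_smul, smul_mul_assoc, smul_smul]
    rw [mul_comm]

theorem xWeyl_commute_N (u : ℕ → ℂ) {n k : ℕ} (h : n ≤ k) (ζ : ℂ) (a : ℂ × ℂ) :
    Commute (Q.xWeyl u n ζ) (Q.N k a) := by
  induction n generalizing ζ with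
  | zero => exact Q.X_N_commute ζ k a
  | succ n ih =>
    exact Commute.smul_left ((ih (by omega) _).mul_left (Q.N_N_commute _ _ (by omega) _ _)) _

/-- The joint Weyl operators `exp (ζ̄ x_{k+1} - ζ x_{k+1}* + θ̄ y_{k+1} - θ y_{k+1}*)` with
`a = (ζ, θ)`, for vanishing controls. -/
def jointWeyl (k : ℕ) (a : ℂ × ℂ) : H →L[ℂ] H :=
  Q.xWeyl 0 k (conj p.gamma * a.2 + conj p.phi * a.1) * Q.N k a

variable (p) in
/-- The symplectic form of the pair `(x_{k+1}, y_{k+1})`. -/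
def jointForm (a b : ℂ × ℂ) : ℝ :=
  p.hbar * (a.1 * conj b.1).im + p.hbar * p.eps * (a.2 * conj b.2).im

theorem xWeyl_zero_succ (k : ℕ) (ζ : ℂ) : Q.xWeyl 0 (k + 1) ζ = Q.jointWeyl k (ζ, 0) := by
  simp [xWeyl, jointWeyl]

theorem yWeyl_zero (k : ℕ) (θ : ℂ) : Q.yWeyl 0 k θ = Q.jointWeyl k (0, θ) := by
  simp [yWeyl, jointWeyl]

/-- Stated conditionally because the induction for `xWeyl` passes through the joint operators of the
preceding step. -/
theorem isWeyl_jointWeyl_of {k : ℕ} (h : IsWeyl (symp p.hbar) (Q.xWeyl 0 k)) :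
    IsWeyl (jointForm p) (Q.jointWeyl k) where
  unitary a := mul_mem (h.unitary _) (Q.N_unitary _ _)
  cont f := by
    exact h.continuous_comp (by fun_prop) (Q.N_continuous k f)
  mul a b := by
    have hc := (Q.xWeyl_commute_N 0 (le_refl k) (conj p.gamma * b.2 + conj p.phi * b.1) a).symm
    have hx := h.mul (conj p.gamma * a.2 + conj p.phi * a.1) (conj p.gamma * b.2 + conj p.phi * b.1)
    have hn := (Q.isWeyl_N k).mul a b
    calc Q.jointWeyl k a * Q.jointWeyl k b
        = (Q.xWeyl 0 k (conj p.gamma * a.2 + conj p.phi * a.1) *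
            Q.xWeyl 0 k (conj p.gamma * b.2 + conj p.phi * b.1)) * (Q.N k a * Q.N k b) := by
          simp only [jointWeyl, mul_assoc]
          rw [← mul_assoc (Q.N k a), hc.eq, mul_assoc]
      _ = _ := by
          rw [hx, hn, smul_mul_smul_comm, ← Complex.exp_add, ← mul_add, ← Complex.ofReal_add]
          simp only [symp]
          rw [commForm_im_add]
          simp only [jointForm, jointWeyl, Prod.fst_add, Prod.snd_add, mul_add]
          congr 3
          ring
  alt a := by
    simp only [jointForm, Prod.fst_neg, Prod.snd_neg, map_neg, mul_neg, Complex.neg_im,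
      Complex.mul_im, Complex.conj_re, Complex.conj_im]
    ring

theorem isWeyl_xWeyl_zero (n : ℕ) : IsWeyl (symp p.hbar) (Q.xWeyl 0 n) := by
  induction n with
  | zero => exact Q.isWeyl_X
  | succ n ih =>
    have h := Q.isWeyl_jointWeyl_of ih
    have he : Q.xWeyl 0 (n + 1) = fun ζ => Q.jointWeyl n (ζ, 0) :=
      funext fun ζ => Q.xWeyl_zero_succ n ζ
    rw [he]
    exact
    { unitary := fun ζ => h.unitary _
      cont := fun f => (h.cont f).comp (by fun_prop)
      mul := fun ζ ζ' => by
        rw [h.mul]; simp [jointForm, symp]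
      alt := symp_neg_self _ }

theorem isWeyl_jointWeyl (k : ℕ) : IsWeyl (jointForm p) (Q.jointWeyl k) :=
  Q.isWeyl_jointWeyl_of (Q.isWeyl_xWeyl_zero k)

theorem isWeyl_xWeyl (u : ℕ → ℂ) (n : ℕ) : IsWeyl (symp p.hbar) (Q.xWeyl u n) := by
  have he : Q.xWeyl u n = fun ζ => phase ζ (shift p u n) • Q.xWeyl 0 n ζ :=
    funext fun ζ => Q.xWeyl_eq u n ζ
  rw [he]
  exact (Q.isWeyl_xWeyl_zero n).phase_smul _

theorem isWeyl_yWeyl_zero (k : ℕ) : IsWeyl (symp (p.hbar * p.eps)) (Q.yWeyl 0 k) := by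
  have h := Q.isWeyl_jointWeyl k
  have he : Q.yWeyl 0 k = fun θ => Q.jointWeyl k (0, θ) := funext fun ζ => Q.yWeyl_zero k ζ
  rw [he]
  exact
  { unitary := fun ζ => h.unitary _
    cont := fun f => (h.cont f).comp (by fun_prop)
    mul := fun ζ ζ' => by
      rw [h.mul]; simp [jointForm, symp]
    alt := symp_neg_self _ }

theorem yWeyl_eq (u : ℕ → ℂ) (k : ℕ) (θ : ℂ) : Q.yWeyl u k θ =
    phase θ (p.gamma * shift p u k + p.delta * u k) • Q.yWeyl 0 k θ := by
  simp only [yWeyl]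
  rw [xWeyl_eq, phase_add_right, phase_mul_right θ p.gamma]
  simp only [Pi.zero_apply, mul_zero, phase_zero_right, one_smul, smul_mul_assoc, smul_smul]
  rw [mul_comm]

theorem yWeyl_mul_xWeyl (k : ℕ) (θ ζ : ℂ) :
    Q.yWeyl 0 k θ * Q.xWeyl 0 (k + 1) ζ = Q.jointWeyl k (ζ, θ) := by
  rw [xWeyl_zero_succ, yWeyl_zero, (Q.isWeyl_jointWeyl k).mul]
  simp [jointForm]

theorem xWeyl_mul_yWeyl (k : ℕ) (θ ζ : ℂ) :
    Q.xWeyl 0 (k + 1) ζ * Q.yWeyl 0 k θ = Q.jointWeyl k (ζ, θ) := by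
  rw [xWeyl_zero_succ, yWeyl_zero, (Q.isWeyl_jointWeyl k).mul]
  simp [jointForm]

/-- The nondemolition property: the joint form has no cross term, so a measurement of the output
does not disturb the next amplitude. -/
theorem yWeyl_commute_xWeyl (k : ℕ) (θ ζ : ℂ) :
    Commute (Q.yWeyl 0 k θ) (Q.xWeyl 0 (k + 1) ζ) := by
  rw [commute_iff_eq, yWeyl_mul_xWeyl, xWeyl_mul_yWeyl]

theorem yWeyl_commute_N {k l : ℕ} (h : k < l) (θ : ℂ) (a : ℂ × ℂ) :
    Commute (Q.yWeyl 0 k θ) (Q.N l a) := by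
  rw [yWeyl_zero]
  exact (Q.xWeyl_commute_N 0 h.le _ _).mul_left (Q.N_N_commute _ _ h.ne _ _)

/-! ### The algebras of the outputs and of the future -/

theorem subset_bicommutant (S : Set (H →L[ℂ] H)) : S ⊆ bicommutant S :=
  fun _ hc _ hd => (hd _ hc).symm

theorem xWeyl_mem_futureAlgebra (u : ℕ → ℂ) (n : ℕ) (ζ : ℂ) :
    Q.xWeyl u n ζ ∈ Q.futureAlgebra n := by
  rw [xWeyl_eq]
  intro c hc
  rw [mul_smul_comm, smul_mul_assoc, hc _ (Or.inl ⟨ζ, rfl⟩)]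

theorem N_mem_futureAlgebra {n k : ℕ} (h : n ≤ k) (a : ℂ × ℂ) : Q.N k a ∈ Q.futureAlgebra n :=
  subset_bicommutant _ (Or.inr ⟨k, a, h, rfl⟩)

theorem mul_mem_futureAlgebra {n : ℕ} {c d : H →L[ℂ] H} (hc : c ∈ Q.futureAlgebra n)
    (hd : d ∈ Q.futureAlgebra n) : c * d ∈ Q.futureAlgebra n :=
  Set.mul_mem_centralizer hc hd

theorem one_mem_futureAlgebra (n : ℕ) : (1 : H →L[ℂ] H) ∈ Q.futureAlgebra n :=
  Set.one_mem_centralizer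

theorem smul_mem_futureAlgebra {n : ℕ} {c : H →L[ℂ] H} (a : ℂ) (hc : c ∈ Q.futureAlgebra n) :
    a • c ∈ Q.futureAlgebra n := fun d hd => by
  rw [mul_smul_comm, smul_mul_assoc, hc d hd]

theorem sum_mem_futureAlgebra {n : ℕ} {ι : Type*} (s : Finset ι) {c : ι → H →L[ℂ] H}
    (hc : ∀ i ∈ s, c i ∈ Q.futureAlgebra n) : ∑ i ∈ s, c i ∈ Q.futureAlgebra n := fun d hd => by
  rw [Finset.mul_sum, Finset.sum_mul]
  exact Finset.sum_congr rfl fun i hi => hc i hi d hd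

/-- A generator of the future algebra commutes with all Weyl operators of the output, hence with
their bicommutant; so `e` lies in the commutant of the future generators, and `c` commutes with that
commutant. -/
theorem outputAlgebra_commute_futureAlgebra {n : ℕ} {e c : H →L[ℂ] H}
    (he : e ∈ Q.outputAlgebra n) (hc : c ∈ Q.futureAlgebra (n + 1)) : Commute e c := by
  refine hc e fun d hd => ?_
  refine he d ?_
  rintro _ ⟨θ, rfl⟩
  rcases hd with ⟨ζ, rfl⟩ | ⟨k, a, hk, rfl⟩
  · exact Q.yWeyl_commute_xWeyl n θ ζ
  · exact Q.yWeyl_commute_N hk θ a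

/-- A product of noise operators of successive steps. -/
def noise (n M : ℕ) (a : ℕ → ℂ × ℂ) : H →L[ℂ] H :=
  ((List.range M).map fun k => Q.N (n + k) (a k)).prod

theorem noise_zero (n : ℕ) (a : ℕ → ℂ × ℂ) : Q.noise n 0 a = 1 := rfl

theorem noise_succ' (n M : ℕ) (a : ℕ → ℂ × ℂ) :
    Q.noise n (M + 1) a = Q.noise n M a * Q.N (n + M) (a M) := by
  simp [noise, List.range_succ]

theorem noise_succ (n M : ℕ) (a : ℕ → ℂ × ℂ) :
    Q.noise n (M + 1) a = Q.N n (a 0) * Q.noise (n + 1) M fun k => a (k + 1) := by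
  simp only [noise, List.range_succ_eq_map, List.map_cons, List.prod_cons, List.map_map]
  congr 3
  funext k
  simp [Nat.add_assoc, Nat.add_comm 1]

theorem noise_mem_futureAlgebra {m n : ℕ} (h : m ≤ n) (M : ℕ) (a : ℕ → ℂ × ℂ) :
    Q.noise n M a ∈ Q.futureAlgebra m := by
  induction M with
  | zero => exact Q.one_mem_futureAlgebra m
  | succ M ih =>
    rw [noise_succ']
    exact Q.mul_mem_futureAlgebra ih (Q.N_mem_futureAlgebra (by omega) _)

end OpenOscillator


/-! ### The density theorem for bicommutants -/

section Density

variable {H : Type*} [NormedAddCommGroup H] [InnerProductSpace ℂ H] [CompleteSpace H]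
  {α : Type*} [MeasurableSpace α] {μ : Measure α}

/-- The amplification of an operator to square integrable functions. -/
abbrev ampl (μ : Measure α) (c : H →L[ℂ] H) : Lp H 2 μ →L[ℂ] Lp H 2 μ := c.compLpL 2 μ

theorem coeFn_ampl (c : H →L[ℂ] H) (F : Lp H 2 μ) : ampl μ c F =ᵐ[μ] fun x => c (F x) :=
  c.coeFn_compLpL F

theorem inner_ampl (c : H →L[ℂ] H) (F G : Lp H 2 μ) :
    ⟪F, ampl μ c G⟫_ℂ = ∫ x, ⟪F x, c (G x)⟫_ℂ ∂μ := by
  rw [L2.inner_def]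
  exact integral_congr_ae ((coeFn_ampl c G).mono fun x hx => by simp only [hx])

theorem inner_ampl_left (c : H →L[ℂ] H) (F G : Lp H 2 μ) :
    ⟪ampl μ c F, G⟫_ℂ = ⟪F, ampl μ (star c) G⟫_ℂ := by
  rw [inner_ampl, L2.inner_def]
  refine integral_congr_ae ((coeFn_ampl c F).mono fun x hx => ?_)
  simp only [hx, ContinuousLinearMap.star_eq_adjoint, ContinuousLinearMap.adjoint_inner_right]

theorem ampl_mul (c d : H →L[ℂ] H) (F : Lp H 2 μ) :
    ampl μ (c * d) F = ampl μ c (ampl μ d F) := by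
  ext1
  filter_upwards [coeFn_ampl (c * d) F, coeFn_ampl c (ampl μ d F), coeFn_ampl d F] with x h1 h2 h3
  rw [h1, h2, h3]; rfl

theorem ampl_one (F : Lp H 2 μ) : ampl μ (1 : H →L[ℂ] H) F = F := by
  ext1
  filter_upwards [coeFn_ampl 1 F] with x h1
  rw [h1]; rfl

theorem ampl_add (c d : H →L[ℂ] H) (F : Lp H 2 μ) :
    ampl μ (c + d) F = ampl μ c F + ampl μ d F := by
  simp only [ampl, ContinuousLinearMap.add_compLpL]; rfl

theorem ampl_smul (a : ℂ) (c : H →L[ℂ] H) (F : Lp H 2 μ) :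
    ampl μ (a • c) F = a • ampl μ c F := by
  simp only [ampl, ContinuousLinearMap.smul_compLpL]; rfl

/-- The embedding of vectors as constants on a set of finite measure. -/
def constOn (μ : Measure α) {s : Set α} (hs : MeasurableSet s) (hμs : μ s ≠ ⊤) :
    H →L[ℂ] Lp H 2 μ :=
  LinearMap.mkContinuous
    { toFun := fun x => indicatorConstLp 2 hs hμs x
      map_add' := fun _ _ => (indicatorConstLp_add).symm
      map_smul' := fun a x => by
        ext1
        filter_upwards [indicatorConstLp_coeFn (p := 2) (hs := hs) (hμs := hμs) (c := a • x),
          Lp.coeFn_smul a (indicatorConstLp 2 hs hμs x),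
          indicatorConstLp_coeFn (p := 2) (hs := hs) (hμs := hμs) (c := x)] with y h1 h2 h3
        simp only [RingHom.id_apply]
        rw [h1, h2, Pi.smul_apply, h3]
        by_cases hy : y ∈ s <;> simp [hy] } (μ.real s ^ (1 / (2 : ENNReal).toReal))
    fun x => by
      have := norm_indicatorConstLp_le (p := 2) (hs := hs) (hμs := hμs) (c := x)
      rw [mul_comm]; exact this

theorem constOn_apply {s : Set α} (hs : MeasurableSet s) (hμs : μ s ≠ ⊤) (x : H) :
    constOn μ hs hμs x = indicatorConstLp 2 hs hμs x := rfl

theorem ampl_constOn (c : H →L[ℂ] H) {s : Set α} (hs : MeasurableSet s) (hμs : μ s ≠ ⊤) (x : H) :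
    ampl μ c (constOn μ hs hμs x) = constOn μ hs hμs (c x) := by
  simp only [constOn_apply]
  ext1
  filter_upwards [coeFn_ampl c (indicatorConstLp 2 hs hμs x),
    indicatorConstLp_coeFn (p := 2) (hs := hs) (hμs := hμs) (c := x),
    indicatorConstLp_coeFn (p := 2) (hs := hs) (hμs := hμs) (c := c x)] with y h1 h2 h3
  rw [h1, h2, h3]
  by_cases hy : y ∈ s <;> simp [hy]

theorem clm_ext_constOn {E : Type*} [NormedAddCommGroup E] [NormedSpace ℂ E]
    {S T : Lp H 2 μ →L[ℂ] E}
    (h : ∀ (s : Set α) (hs : MeasurableSet s) (hμs : μ s ≠ ⊤) (x : H),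
      S (constOn μ hs hμs x) = T (constOn μ hs hμs x)) : S = T := by
  ext F
  refine Lp.induction (p := 2) (by simp) (fun F => S F = T F) ?_ ?_ ?_ F
  · intro c s hs hμs
    rw [Lp.simpleFunc.coe_indicatorConst]
    exact h _ hs hμs.ne c
  · intro f g hf hg _ h1 h2
    rw [map_add, map_add, h1, h2]
  · exact isClosed_eq S.continuous T.continuous

theorem adjoint_constOn_ampl (c : H →L[ℂ] H) {s : Set α} (hs : MeasurableSet s) (hμs : μ s ≠ ⊤)
    (F : Lp H 2 μ) :
    (ContinuousLinearMap.adjoint (constOn μ hs hμs)) (ampl μ c F)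
      = c ((ContinuousLinearMap.adjoint (constOn (H := H) μ hs hμs)) F) := by
  refine ext_inner_left ℂ fun y => ?_
  rw [ContinuousLinearMap.adjoint_inner_right, ← star_star c, ← inner_ampl_left, ampl_constOn,
    ContinuousLinearMap.star_eq_adjoint (star c), ContinuousLinearMap.adjoint_inner_right,
    ContinuousLinearMap.adjoint_inner_right]

theorem eq_of_adjoint_constOn {F G : Lp H 2 μ}
    (h : ∀ (s : Set α) (hs : MeasurableSet s) (hμs : μ s ≠ ⊤),
      (ContinuousLinearMap.adjoint (constOn (H := H) μ hs hμs)) F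
        = (ContinuousLinearMap.adjoint (constOn (H := H) μ hs hμs)) G) : F = G := by
  have : innerSL ℂ F = innerSL ℂ G := by
    refine clm_ext_constOn fun s hs hμs x => ?_
    simp only [innerSL_apply_apply]
    rw [← ContinuousLinearMap.adjoint_inner_left, ← ContinuousLinearMap.adjoint_inner_left, h]
  refine ext_inner_right ℂ fun v => ?_
  simpa using congrArg (fun L => L v) this

/-- An operator that commutes with the amplifications of a set of operators commutes with the
amplification of its bicommutant. -/
theorem ampl_commute_of_bicommutant {A : Set (H →L[ℂ] H)} {T : Lp H 2 μ →L[ℂ] Lp H 2 μ}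
    (hT : ∀ a ∈ A, ∀ F, T (ampl μ a F) = ampl μ a (T F))
    {c : H →L[ℂ] H} (hc : c ∈ bicommutant A) (F : Lp H 2 μ) :
    T (ampl μ c F) = ampl μ c (T F) := by
  have key : T ∘L ampl μ c = ampl μ c ∘L T := by
    refine clm_ext_constOn fun t ht hμt x => ?_
    simp only [ContinuousLinearMap.comp_apply]
    refine eq_of_adjoint_constOn fun s hs hμs => ?_
    -- A matrix element of `T` between the constants on `s` and on `t`. Amplifications act
    -- diagonally, so these compressions lie in the commutant of `A`, and they determine `T`.
    let M : H →L[ℂ] H := (ContinuousLinearMap.adjoint (constOn (H := H) μ hs hμs)) ∘L T ∘L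
      constOn μ ht hμt
    have hM : M ∈ Set.centralizer A := by
      intro a ha
      ext y
      change a (M y) = M (a y)
      simp only [M, ContinuousLinearMap.comp_apply]
      rw [← ampl_constOn, hT a ha, adjoint_constOn_ampl]
    have h := congrArg (fun L : H →L[ℂ] H => L x) (hc M hM)
    change M (c x) = c (M x) at h
    simp only [M, ContinuousLinearMap.comp_apply] at h
    rw [ampl_constOn, adjoint_constOn_ampl, h]
  exact congrArg (fun L => L F) key

/-- Von Neumann's argument, carried out for square integrable families: the projection onto the
closure of `{a F}` commutes with the amplified algebra, hence with the amplification of `c`; it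
fixes `F` because `1 ∈ A`, and therefore fixes `c F`. -/
theorem ampl_mem_closure {A : Submodule ℂ (H →L[ℂ] H)} (hone : 1 ∈ A)
    (hmul : ∀ a ∈ A, ∀ b ∈ A, a * b ∈ A) (hstar : ∀ a ∈ A, star a ∈ A)
    {c : H →L[ℂ] H} (hc : c ∈ bicommutant (A : Set (H →L[ℂ] H))) (F : Lp H 2 μ) :
    ampl μ c F ∈ closure ((fun a => ampl μ a F) '' (A : Set (H →L[ℂ] H))) := by
  let L : (H →L[ℂ] H) →ₗ[ℂ] Lp H 2 μ :=
    { toFun := fun a => ampl μ a F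
      map_add' := fun a b => ampl_add a b F
      map_smul' := fun a b => ampl_smul a b F }
  let V₀ : Submodule ℂ (Lp H 2 μ) := A.map L
  let V : Submodule ℂ (Lp H 2 μ) := V₀.topologicalClosure
  have : CompleteSpace V := V₀.isClosed_topologicalClosure.completeSpace_coe
  have hinv : ∀ a ∈ A, ∀ G ∈ V, ampl μ a G ∈ V := by
    intro a ha G hG
    refine map_mem_closure (ampl μ a).continuous hG ?_
    rintro _ ⟨b, hb, rfl⟩
    exact ⟨a * b, hmul a ha b hb, ampl_mul a b F⟩
  have hinv' : ∀ a ∈ A, ∀ G ∈ Vᗮ, ampl μ a G ∈ Vᗮ := by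
    intro a ha G hG
    rw [Submodule.mem_orthogonal] at hG ⊢
    intro u hu
    rw [← star_star a, ← inner_ampl_left]
    exact hG _ (hinv _ (hstar a ha) u hu)
  have hcomm : ∀ a ∈ (A : Set (H →L[ℂ] H)), ∀ G,
      V.starProjection (ampl μ a G) = ampl μ a (V.starProjection G) := by
    intro a ha G
    refine Submodule.eq_starProjection_of_mem_orthogonal
      (hinv a ha _ (V.starProjection_apply_mem G)) ?_
    rw [← map_sub]
    exact hinv' a ha _ (V.sub_starProjection_mem_orthogonal G)
  have hF : F ∈ V := V₀.le_topologicalClosure ⟨1, hone, ampl_one F⟩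
  have h := ampl_commute_of_bicommutant hcomm hc F
  rw [V.starProjection_eq_self_iff.2 hF] at h
  exact V.starProjection_eq_self_iff.1 h

theorem bicommutant_mono {A B : Set (H →L[ℂ] H)} (h : A ⊆ B) : bicommutant A ⊆ bicommutant B :=
  Set.centralizer_subset (Set.centralizer_subset h)

/-- A set of operators which is closed, up to scalars, under products and adjoints. -/
structure IsProductClosed (S : Set (H →L[ℂ] H)) : Prop where
  one : 1 ∈ S
  mul : ∀ a ∈ S, ∀ b ∈ S, ∃ z : ℂ, ∃ d ∈ S, a * b = z • d
  adj : ∀ a ∈ S, ∃ z : ℂ, ∃ d ∈ S, star a = z • d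

theorem IsProductClosed.mul_mem_span {S : Set (H →L[ℂ] H)} (hS : IsProductClosed S)
    {a b : H →L[ℂ] H} (ha : a ∈ Submodule.span ℂ S) (hb : b ∈ Submodule.span ℂ S) :
    a * b ∈ Submodule.span ℂ S := by
  induction ha using Submodule.span_induction with
  | mem a ha =>
    induction hb using Submodule.span_induction with
    | mem b hb =>
      obtain ⟨z, d, hd, h⟩ := hS.mul a ha b hb
      rw [h]; exact Submodule.smul_mem _ _ (Submodule.subset_span hd)
    | zero => simp
    | add x y _ _ hx hy => rw [mul_add]; exact add_mem hx hy
    | smul z x _ hx => rw [mul_smul_comm]; exact Submodule.smul_mem _ _ hx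
  | zero => simp
  | add x y _ _ hx hy => rw [add_mul]; exact add_mem hx hy
  | smul z x _ hx => rw [smul_mul_assoc]; exact Submodule.smul_mem _ _ hx

theorem IsProductClosed.star_mem_span {S : Set (H →L[ℂ] H)} (hS : IsProductClosed S)
    {a : H →L[ℂ] H} (ha : a ∈ Submodule.span ℂ S) : star a ∈ Submodule.span ℂ S := by
  induction ha using Submodule.span_induction with
  | mem a ha =>
    obtain ⟨z, d, hd, h⟩ := hS.adj a ha
    rw [h]; exact Submodule.smul_mem _ _ (Submodule.subset_span hd)
  | zero => simp
  | add x y _ _ hx hy => rw [star_add]; exact add_mem hx hy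
  | smul z x _ hx => rw [star_smul]; exact Submodule.smul_mem _ _ hx

/-- Square integrable families of vectors are transformed by the operators of the bicommutant
into limits of transforms by linear combinations of the generators. -/
theorem IsProductClosed.ampl_mem_closure {S : Set (H →L[ℂ] H)} (hS : IsProductClosed S)
    {c : H →L[ℂ] H} (hc : c ∈ bicommutant S) (F : Lp H 2 μ) :
    ampl μ c F ∈ closure ((fun a => ampl μ a F) '' (Submodule.span ℂ S : Set (H →L[ℂ] H))) :=
  QuantumLQG.ampl_mem_closure (Submodule.subset_span hS.one) (fun _ ha _ hb => hS.mul_mem_span ha hb)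
    (fun _ ha => hS.star_mem_span ha) (bicommutant_mono Submodule.subset_span hc) F

/-- A normal functional that vanishes on the generators vanishes on the bicommutant. -/
theorem IsProductClosed.inner_ampl_eq_zero {S : Set (H →L[ℂ] H)} (hS : IsProductClosed S)
    {F G : Lp H 2 μ} (h : ∀ a ∈ S, ⟪G, ampl μ a F⟫_ℂ = 0)
    {c : H →L[ℂ] H} (hc : c ∈ bicommutant S) : ⟪G, ampl μ c F⟫_ℂ = 0 := by
  have hspan : ∀ a ∈ Submodule.span ℂ S, ⟪G, ampl μ a F⟫_ℂ = 0 := by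
    intro a ha
    induction ha using Submodule.span_induction with
    | mem a ha => exact h a ha
    | zero => have := ampl_smul (μ := μ) 0 (0 : H →L[ℂ] H) F; rw [zero_smul, zero_smul] at this; simp [this]
    | add x y _ _ hx hy => rw [ampl_add, inner_add_right, hx, hy, add_zero]
    | smul z x _ hx => rw [ampl_smul, inner_smul_right, hx, mul_zero]
  have hcl : IsClosed {v : Lp H 2 μ | ⟪G, v⟫_ℂ = 0} :=
    isClosed_eq (by fun_prop) continuous_const
  refine closure_minimal ?_ hcl (hS.ampl_mem_closure hc F)
  rintro _ ⟨a, ha, rfl⟩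
  exact hspan a ha

theorem IsProductClosed.integral_inner_eq_zero {S : Set (H →L[ℂ] H)} (hS : IsProductClosed S)
    {f g : α → H} (hf : MemLp f 2 μ) (hg : MemLp g 2 μ)
    (h : ∀ a ∈ S, ∫ x, ⟪g x, a (f x)⟫_ℂ ∂μ = 0)
    {c : H →L[ℂ] H} (hc : c ∈ bicommutant S) : ∫ x, ⟪g x, c (f x)⟫_ℂ ∂μ = 0 := by
  have key : ∀ a : H →L[ℂ] H, ⟪hg.toLp g, ampl μ a (hf.toLp f)⟫_ℂ = ∫ x, ⟪g x, a (f x)⟫_ℂ ∂μ := by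
    intro a
    rw [inner_ampl]
    refine integral_congr_ae ?_
    filter_upwards [hf.coeFn_toLp, hg.coeFn_toLp] with x h1 h2
    rw [h1, h2]
  rw [← key]
  exact hS.inner_ampl_eq_zero (fun a ha => by rw [key]; exact h a ha) hc

/-! #### Sequences of vectors -/

theorem memLp_count {f : ℕ → H} (hf : Summable fun i => ‖f i‖ ^ 2) :
    MemLp f 2 (Measure.count : Measure ℕ) := by
  have hm : StronglyMeasurable f :=
    -- The truncations of the sequence are simple functions, so `H` need not be separable.
    ⟨fun n => ⟨fun i => if i ≤ n then f i else 0, fun _ => MeasurableSet.of_discrete,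
      ((Set.finite_Iic n).image f |>.insert 0).subset (by
        rintro _ ⟨i, rfl⟩
        by_cases h : i ≤ n
        · right; exact ⟨i, h, by simp [h]⟩
        · left; simp [h])⟩,
      fun i => tendsto_atTop_of_eventually_const (i₀ := i) fun n hn => by
        have : i ≤ n := hn
        simp [this]⟩
  rw [memLp_two_iff_integrable_sq_norm hm.aestronglyMeasurable, integrable_count_iff]
  simpa using hf

theorem integral_inner_count {f g : ℕ → H} (hf : Summable fun i => ‖f i‖ ^ 2)
    (hg : Summable fun i => ‖g i‖ ^ 2) :
    ∫ i, ⟪g i, f i⟫_ℂ ∂(Measure.count : Measure ℕ) = ∑' i, ⟪g i, f i⟫_ℂ := by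
  have h : Integrable (fun i => ⟪g i, f i⟫_ℂ) (Measure.count : Measure ℕ) := by
    rw [integrable_count_iff]
    exact (summable_inner_of_sq hg hf).norm
  rw [integral_countable h]
  simp

theorem IsProductClosed.tsum_inner_eq_zero {S : Set (H →L[ℂ] H)} (hS : IsProductClosed S)
    {f g : ℕ → H} (hf : Summable fun i => ‖f i‖ ^ 2) (hg : Summable fun i => ‖g i‖ ^ 2)
    (h : ∀ a ∈ S, ∑' i, ⟪g i, a (f i)⟫_ℂ = 0)
    {c : H →L[ℂ] H} (hc : c ∈ bicommutant S) : ∑' i, ⟪g i, c (f i)⟫_ℂ = 0 := by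
  rw [← integral_inner_count (summable_sq_apply hf c) hg]
  refine hS.integral_inner_eq_zero (memLp_count hf) (memLp_count hg) (fun a ha => ?_) hc
  rw [integral_inner_count (summable_sq_apply hf a) hg, h a ha]

/-- If the expectations of `star b * d * b` have non-negative real parts for the linear
combinations `b` of the generators, then also for the elements `b` of the bicommutant. -/
theorem IsProductClosed.re_ev_nonneg {S : Set (H →L[ℂ] H)} (hS : IsProductClosed S)
    (ρ : NormalState H) {d : H →L[ℂ] H}
    (h : ∀ b ∈ Submodule.span ℂ S, 0 ≤ (ρ.ev (star b * d * b)).re)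
    {c : H →L[ℂ] H} (hc : c ∈ bicommutant S) : 0 ≤ (ρ.ev (star c * d * c)).re := by
  let ν : Measure ℕ := Measure.count
  let F : Lp H 2 ν := (memLp_count ρ.summable_sq).toLp ρ.vec
  have key : ∀ b : H →L[ℂ] H, ρ.ev (star b * d * b) = ⟪ampl ν b F, ampl ν d (ampl ν b F)⟫_ℂ := by
    intro b
    rw [← ampl_mul, inner_ampl_left, ← ampl_mul, mul_assoc, inner_ampl]
    rw [integral_congr_ae (g := fun i => ⟪ρ.vec i, (star b * (d * b)) (ρ.vec i)⟫_ℂ)]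
    · rw [integral_inner_count (summable_sq_apply ρ.summable_sq _) ρ.summable_sq]
      rfl
    · filter_upwards [(memLp_count ρ.summable_sq).coeFn_toLp] with i hi
      rw [hi]
  -- The quadratic form of `d` is norm continuous, so its sign passes from the vectors `b F`, with
  -- `b` a combination of generators, to their limit `c F`.
  have hcl : IsClosed {v : Lp H 2 ν | 0 ≤ (⟪v, ampl ν d v⟫_ℂ).re} :=
    isClosed_le continuous_const (Complex.continuous_re.comp (by fun_prop))
  rw [key]
  refine closure_minimal ?_ hcl (hS.ampl_mem_closure hc F)
  rintro _ ⟨b, hb, rfl⟩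
  have := h b hb
  rw [key] at this
  exact this

end Density


/-! ### Complex linear combinations of finite measures -/

section Combinations

variable {Z : Type*} [MeasurableSpace Z] {ι : Type*} [Fintype ι]

/-- A real combination of measures is compared through its positive and its negative part, so that
the uniqueness theorems for positive measures apply. -/
theorem sum_integral_eq_zero_of_real {m : ι → Measure Z} {b : ι → ℝ}
    (h : ∑ i, (b i).toNNReal • m i = ∑ i, (-b i).toNNReal • m i) {f : Z → ℂ}
    (hf : ∀ i, Integrable f (m i)) : ∑ i, (b i : ℂ) * ∫ x, f x ∂(m i) = 0 := by
  have h1 : ∫ x, f x ∂(∑ i, (b i).toNNReal • m i) = ∫ x, f x ∂(∑ i, (-b i).toNNReal • m i) := by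
    rw [h]
  rw [integral_finsetSum_measure (fun i _ => (hf i).smul_measure_nnreal),
    integral_finsetSum_measure (fun i _ => (hf i).smul_measure_nnreal)] at h1
  simp only [integral_smul_nnreal_measure] at h1
  rw [← sub_eq_zero, ← Finset.sum_sub_distrib] at h1
  rw [← h1]
  refine Finset.sum_congr rfl fun i _ => ?_
  simp only [NNReal.smul_def, Complex.real_smul]
  rw [← sub_mul, ← Complex.ofReal_sub]
  congr 2
  simp only [Real.coe_toNNReal']
  rcases le_total 0 (b i) with h0 | h0
  · rw [max_eq_left h0, max_eq_right (by linarith)]; ring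
  · rw [max_eq_right h0, max_eq_left (by linarith)]; ring

theorem sum_integral_eq_zero_of_parts {m : ι → Measure Z} {a : ι → ℂ}
    (hre : ∑ i, ((a i).re).toNNReal • m i = ∑ i, (-(a i).re).toNNReal • m i)
    (him : ∑ i, ((a i).im).toNNReal • m i = ∑ i, (-(a i).im).toNNReal • m i)
    {f : Z → ℂ} (hf : ∀ i, Integrable f (m i)) : ∑ i, a i * ∫ x, f x ∂(m i) = 0 := by
  have h1 := sum_integral_eq_zero_of_real hre hf
  have h2 := sum_integral_eq_zero_of_real him hf
  have : ∀ i, a i * ∫ x, f x ∂(m i) = ((a i).re : ℂ) * ∫ x, f x ∂(m i)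
      + Complex.I * (((a i).im : ℂ) * ∫ x, f x ∂(m i)) := by
    intro i
    conv_lhs => rw [← Complex.re_add_im (a i)]
    ring
  simp only [this, Finset.sum_add_distrib, ← Finset.mul_sum, h1, h2, mul_zero, add_zero]

theorem sum_smul_apply_eq {m : ι → Measure Z} [∀ i, IsFiniteMeasure (m i)] {b : ι → ℝ} {R : Set Z}
    (h : ∑ i, b i * (m i).real R = 0) :
    (∑ i, (b i).toNNReal • m i) R = (∑ i, (-b i).toNNReal • m i) R := by
  have h0 : ∀ c : ι → NNReal, (∑ i, c i • m i) R = ENNReal.ofReal (∑ i, c i * (m i).real R) := by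
    intro c
    rw [Measure.finsetSum_apply, ENNReal.ofReal_sum_of_nonneg fun i _ => by positivity]
    refine Finset.sum_congr rfl fun i _ => ?_
    rw [ENNReal.ofReal_mul (by positivity), Measure.real, ENNReal.ofReal_toReal (by simp)]
    rw [Measure.smul_apply, ENNReal.smul_def, smul_eq_mul, ENNReal.ofReal_coe_nnreal]
  rw [h0, h0]
  congr 1
  rw [← sub_eq_zero, ← Finset.sum_sub_distrib, ← h]
  refine Finset.sum_congr rfl fun i _ => ?_
  rw [← sub_mul]
  congr 1
  simp only [Real.coe_toNNReal']
  rcases le_total 0 (b i) with h0 | h0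
  · rw [max_eq_left h0, max_eq_right (by linarith)]; ring
  · rw [max_eq_right h0, max_eq_left (by linarith)]; ring

/-- Two complex combinations of finite measures that agree on a generating π-system agree. -/
theorem sum_integral_eq_zero_of_piSystem {m : ι → Measure Z} [∀ i, IsFiniteMeasure (m i)]
    {a : ι → ℂ} {C : Set (Set Z)} (hgen : ‹MeasurableSpace Z› = MeasurableSpace.generateFrom C)
    (hpi : IsPiSystem C) (huniv : Set.univ ∈ C)
    (h : ∀ R ∈ C, ∑ i, a i * ((m i).real R : ℂ) = 0) {f : Z → ℂ}
    (hf : ∀ i, Integrable f (m i)) : ∑ i, a i * ∫ x, f x ∂(m i) = 0 := by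
  have hre : ∀ R ∈ C, ∑ i, (a i).re * (m i).real R = 0 := fun R hR => by
    simpa using congrArg Complex.re (h R hR)
  have him : ∀ R ∈ C, ∑ i, (a i).im * (m i).real R = 0 := fun R hR => by
    simpa using congrArg Complex.im (h R hR)
  exact sum_integral_eq_zero_of_parts
    (ext_of_generate_finite C hgen hpi (fun R hR => sum_smul_apply_eq (hre R hR))
      (sum_smul_apply_eq (hre _ huniv)))
    (ext_of_generate_finite C hgen hpi (fun R hR => sum_smul_apply_eq (him R hR))
      (sum_smul_apply_eq (him _ huniv))) hf

theorem charFun_eq_integral_phase (μ : Measure ℂ) (t : ℂ) :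
    charFun μ t = ∫ η, phase (-Complex.I * t / 2) η ∂μ := by
  rw [charFun_apply]
  refine integral_congr_ae (.of_forall fun η => ?_)
  simp only [phase_eq]
  congr 2
  rw [Complex.inner]
  push_cast
  rw [← Complex.ofReal_ofNat, ← Complex.ofReal_mul]
  congr 1
  simp [Complex.mul_im, Complex.mul_re, Complex.div_re, Complex.div_im, Complex.normSq_apply]
  ring

theorem integrable_phase (μ : Measure ℂ) [IsFiniteMeasure μ] (θ : ℂ) :
    Integrable (fun η => phase θ η) μ :=
  Integrable.of_bound (C := 1) (by fun_prop : Continuous fun η => phase θ η).aestronglyMeasurable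
    (.of_forall fun η => by simp)

theorem sum_smul_eq_of_char {m : ι → Measure ℂ} [∀ i, IsFiniteMeasure (m i)] {b : ι → ℝ}
    (h : ∀ θ, ∑ i, (b i : ℂ) * ∫ η, phase θ η ∂(m i) = 0) :
    ∑ i, (b i).toNNReal • m i = ∑ i, (-b i).toNNReal • m i := by
  refine Measure.ext_of_charFun ?_
  funext t
  rw [charFun_eq_integral_phase, charFun_eq_integral_phase]
  rw [integral_finsetSum_measure (fun i _ => (integrable_phase _ _).smul_measure_nnreal),
    integral_finsetSum_measure (fun i _ => (integrable_phase _ _).smul_measure_nnreal)]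
  simp only [integral_smul_nnreal_measure]
  rw [← sub_eq_zero, ← Finset.sum_sub_distrib, ← h (-Complex.I * t / 2)]
  refine Finset.sum_congr rfl fun i _ => ?_
  simp only [NNReal.smul_def, Complex.real_smul]
  rw [← sub_mul, ← Complex.ofReal_sub]
  congr 2
  simp only [Real.coe_toNNReal']
  rcases le_total 0 (b i) with h0 | h0
  · rw [max_eq_left h0, max_eq_right (by linarith)]; ring
  · rw [max_eq_right h0, max_eq_left (by linarith)]; ring

/-- A complex combination of finite measures on `ℂ` is determined by its characteristic
function. -/
theorem sum_integral_eq_zero_of_char {m : ι → Measure ℂ} [∀ i, IsFiniteMeasure (m i)] {a : ι → ℂ}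
    (h : ∀ θ, ∑ i, a i * ∫ η, phase θ η ∂(m i) = 0) {f : ℂ → ℂ}
    (hf : ∀ i, Integrable f (m i)) : ∑ i, a i * ∫ x, f x ∂(m i) = 0 := by
  -- Conjugation replaces `θ` by `-θ`, so the conjugate coefficients satisfy the same relations;
  -- hence so do the real and imaginary parts of the coefficients.
  have hconj : ∀ θ, ∑ i, conj (a i) * ∫ η, phase θ η ∂(m i) = 0 := by
    intro θ
    have h1 := congrArg conj (h (-θ))
    rw [map_sum, map_zero] at h1
    rw [← h1]
    refine Finset.sum_congr rfl fun i _ => ?_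
    rw [map_mul, ← integral_conj]
    simp only [conj_phase, neg_neg]
  refine sum_integral_eq_zero_of_parts (sum_smul_eq_of_char fun θ => ?_)
    (sum_smul_eq_of_char fun θ => ?_) hf
  · have : ∀ i, (((a i).re : ℝ) : ℂ) * ∫ η, phase θ η ∂(m i) = (1 / 2) * (a i * ∫ η, phase θ η ∂(m i))
        + (1 / 2) * (conj (a i) * ∫ η, phase θ η ∂(m i)) := fun i => by
      rw [Complex.re_eq_add_conj]; ring
    simp only [this, Finset.sum_add_distrib, ← Finset.mul_sum, h, hconj, mul_zero, add_zero]
  · have : ∀ i, (((a i).im : ℝ) : ℂ) * ∫ η, phase θ η ∂(m i)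
        = (1 / (2 * Complex.I)) * (a i * ∫ η, phase θ η ∂(m i))
        - (1 / (2 * Complex.I)) * (conj (a i) * ∫ η, phase θ η ∂(m i)) := fun i => by
      rw [Complex.im_eq_sub_conj]; ring
    simp only [this, Finset.sum_sub_distrib, ← Finset.mul_sum, h, hconj, mul_zero, sub_zero]

/-- The measures whose combination with the coefficients `1, i, -1, -i` is the image of the
complex measure with density `g`. -/
def partMeasure {α : Type*} [MeasurableSpace α] (μ : Measure α) (X : α → Z) (g : α → ℂ)
    (k : Fin 4) : Measure Z :=
  (μ.withDensity fun x => ((((-Complex.I) ^ (k : ℕ) * g x).re.toNNReal : NNReal) : ENNReal)).map X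

theorem sum_pow_I_part (z : ℂ) :
    ∑ k : Fin 4, Complex.I ^ (k : ℕ) * (((((-Complex.I) ^ (k : ℕ) * z).re.toNNReal : NNReal) : ℝ) : ℂ)
      = z := by
  have h2 : (-Complex.I) ^ 2 = -1 := by rw [neg_sq, Complex.I_sq]
  have h3 : (-Complex.I) ^ 3 = Complex.I := by rw [pow_succ, h2]; ring
  have h3' : Complex.I ^ 3 = -Complex.I := by rw [pow_succ, Complex.I_sq]; ring
  simp only [Fin.sum_univ_four, Real.coe_toNNReal']
  norm_num [h2, h3, h3', Complex.I_sq]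
  rcases le_total 0 z.re with h | h <;> rcases le_total 0 z.im with h' | h' <;>
    simp [h, h', Complex.ext_iff]

theorem isFiniteMeasure_partMeasure {α : Type*} [MeasurableSpace α] {μ : Measure α} {X : α → Z}
    {g : α → ℂ} (hg : Integrable g μ) (k : Fin 4) : IsFiniteMeasure (partMeasure μ X g k) := by
  have : IsFiniteMeasure (μ.withDensity fun x =>
      ((((-Complex.I) ^ (k : ℕ) * g x).re.toNNReal : NNReal) : ENNReal)) :=
    isFiniteMeasure_withDensity_ofReal (hg.const_mul ((-Complex.I) ^ (k : ℕ))).re.2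
  unfold partMeasure
  infer_instance

theorem integral_eq_sum_partMeasure {α : Type*} [MeasurableSpace α] {μ : Measure α} {X : α → Z}
    (hX : Measurable X) {g : α → ℂ} (hgm : Measurable g) (hg : Integrable g μ) {F : Z → ℂ}
    (hF : Measurable F) {C : ℝ} (hC : ∀ z, ‖F z‖ ≤ C) :
    ∫ x, F (X x) * g x ∂μ = ∑ k : Fin 4, Complex.I ^ (k : ℕ) * ∫ z, F z ∂(partMeasure μ X g k) := by
  have hpart : ∀ k : Fin 4, ∫ z, F z ∂(partMeasure μ X g k) = ∫ x,
      F (X x) * (((((-Complex.I) ^ (k : ℕ) * g x).re.toNNReal : NNReal) : ℝ) : ℂ) ∂μ := by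
    intro k
    rw [partMeasure, integral_map hX.aemeasurable hF.aestronglyMeasurable,
      integral_withDensity_eq_integral_smul (by fun_prop)]
    refine integral_congr_ae (.of_forall fun x => ?_)
    simp only [NNReal.smul_def, Complex.real_smul]
    ring
  have hint : ∀ k : Fin 4, Integrable (fun x =>
      F (X x) * (((((-Complex.I) ^ (k : ℕ) * g x).re.toNNReal : NNReal) : ℝ) : ℂ)) μ := by
    intro k
    refine Integrable.bdd_mul (c := C) ?_ (hF.comp hX).aestronglyMeasurable (.of_forall fun x => hC _)
    exact (hg.const_mul ((-Complex.I) ^ (k : ℕ))).re.real_toNNReal.ofReal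
  simp only [hpart]
  simp_rw [← integral_const_mul]
  rw [← integral_finsetSum _ fun k _ => (hint k).const_mul _]
  refine integral_congr_ae (.of_forall fun x => ?_)
  simp only
  conv_lhs => rw [← sum_pow_I_part (g x), Finset.mul_sum]
  refine Finset.sum_congr rfl fun k _ => by ring

end Combinations

/-! ### Measures of the results of a measurement -/

section Results

variable {H : Type*} [NormedAddCommGroup H] [InnerProductSpace ℂ H]
  {Z : Type*} [MeasurableSpace Z]

namespace POVM

variable (E : POVM Z H)

theorem measureAt_apply (f : H) {S : Set Z} (hS : MeasurableSet S) :
    E.measureAt f S = ENNReal.ofReal (⟪f, E.eff S f⟫_ℂ).re :=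
  Measure.ofMeasurable_apply S hS

theorem inner_eff_re_nonneg (f : H) {S : Set Z} (hS : MeasurableSet S) :
    0 ≤ (⟪f, E.eff S f⟫_ℂ).re := (E.pos S hS).re_inner_nonneg_right f

theorem inner_eff_eq_re (f : H) {S : Set Z} (hS : MeasurableSet S) :
    ⟪f, E.eff S f⟫_ℂ = ((⟪f, E.eff S f⟫_ℂ).re : ℂ) := by
  have h := (E.pos S hS).isSymmetric f f
  have h2 : conj ⟪f, E.eff S f⟫_ℂ = ⟪f, E.eff S f⟫_ℂ := by
    rw [inner_conj_symm]; exact h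
  exact (Complex.conj_eq_iff_re.1 h2).symm

theorem measureAt_univ (f : H) : E.measureAt f Set.univ = ENNReal.ofReal (‖f‖ ^ 2) := by
  rw [measureAt_apply E f MeasurableSet.univ, E.total]
  congr 1
  simp only [one_apply_eq_self]
  exact inner_self_eq_norm_sq (𝕜 := ℂ) f

instance (f : H) : IsFiniteMeasure (E.measureAt f) :=
  ⟨by rw [measureAt_univ]; exact ENNReal.ofReal_lt_top⟩

theorem measureAt_real (f : H) {S : Set Z} (hS : MeasurableSet S) :
    ((E.measureAt f).real S : ℂ) = ⟪f, E.eff S f⟫_ℂ := by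
  rw [Measure.real, measureAt_apply E f hS, ENNReal.toReal_ofReal (E.inner_eff_re_nonneg f hS),
    ← inner_eff_eq_re E f hS]

/-- The sum of the measures of a sequence of vectors. -/
def seqMeasure (f : ℕ → H) : Measure Z := Measure.sum fun i => E.measureAt (f i)

theorem isFiniteMeasure_seqMeasure {f : ℕ → H} (hf : Summable fun i => ‖f i‖ ^ 2) :
    IsFiniteMeasure (E.seqMeasure f) := by
  refine ⟨?_⟩
  rw [seqMeasure, Measure.sum_apply _ MeasurableSet.univ]
  simp only [measureAt_univ]
  rw [← ENNReal.ofReal_tsum_of_nonneg (fun i => by positivity) hf]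
  exact ENNReal.ofReal_lt_top

theorem hasSum_integral_seqMeasure {f : ℕ → H} (hf : Summable fun i => ‖f i‖ ^ 2) {F : Z → ℂ}
    (hF : Measurable F) {C : ℝ} (hC : ∀ z, ‖F z‖ ≤ C) :
    HasSum (fun i => ∫ z, F z ∂(E.measureAt (f i))) (∫ z, F z ∂(E.seqMeasure f)) := by
  have := E.isFiniteMeasure_seqMeasure hf
  exact hasSum_integral_measure
    (Integrable.of_bound (μ := E.seqMeasure f) hF.aestronglyMeasurable (C := C) (.of_forall hC))

/-- The integral of a bounded function with respect to the complex measure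
`S ↦ ∑ i, ⟨f i, E S (g i)⟩`. -/
def cint (f g : ℕ → H) (F : Z → ℂ) : ℂ :=
  (1 / 4) * ∑ k : Fin 4, Complex.I ^ (k : ℕ) *
    ∫ z, F z ∂(E.seqMeasure fun i => f i + ((-Complex.I) ^ (k : ℕ)) • g i)

theorem polarization (T : H →L[ℂ] H) (f g : H) :
    ∑ k : Fin 4, Complex.I ^ (k : ℕ) * ⟪f + ((-Complex.I) ^ (k : ℕ)) • g,
      T (f + ((-Complex.I) ^ (k : ℕ)) • g)⟫_ℂ = 4 * ⟪f, T g⟫_ℂ := by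
  have h2 : (-Complex.I) ^ 2 = -1 := by rw [neg_sq, Complex.I_sq]
  have h3 : (-Complex.I) ^ 3 = Complex.I := by rw [pow_succ, h2]; ring
  have h3' : Complex.I ^ 3 = -Complex.I := by rw [pow_succ, Complex.I_sq]; ring
  simp only [Fin.sum_univ_four, Fin.coe_ofNat_eq_mod,
    pow_zero, pow_one, h2, h3, h3', Complex.I_sq, map_add, map_smul, inner_add_left,
    inner_add_right, inner_smul_left, inner_smul_right, Nat.reduceMod, map_one, map_neg,
    Complex.conj_I]
  have := Complex.I_mul_I
  linear_combination (-⟪f, T g⟫_ℂ - ⟪f, T g⟫_ℂ + ⟪g, T f⟫_ℂ + ⟪g, T f⟫_ℂ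
    + (-Complex.I + Complex.I) * ⟪g, T g⟫_ℂ) * this

theorem summable_sq_polar {f g : ℕ → H} (hf : Summable fun i => ‖f i‖ ^ 2)
    (hg : Summable fun i => ‖g i‖ ^ 2) (a : ℂ) : Summable fun i => ‖f i + a • g i‖ ^ 2 := by
  refine summable_sq_add hf ?_
  simp only [norm_smul, mul_pow]
  exact hg.mul_left _

/-- If the integrals of `F` are given by the quadratic form of an operator, then the complex
integral is given by its sesquilinear form. -/
theorem cint_eq_of_quadratic {F : Z → ℂ} {T : H →L[ℂ] H} (hF : Measurable F) {C : ℝ}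
    (hC : ∀ z, ‖F z‖ ≤ C) (hT : ∀ f, ∫ z, F z ∂(E.measureAt f) = ⟪f, T f⟫_ℂ) {f g : ℕ → H}
    (hf : Summable fun i => ‖f i‖ ^ 2) (hg : Summable fun i => ‖g i‖ ^ 2) :
    E.cint f g F = ∑' i, ⟪f i, T (g i)⟫_ℂ := by
  have h : ∀ k : Fin 4, HasSum (fun i => Complex.I ^ (k : ℕ) *
      ⟪f i + ((-Complex.I) ^ (k : ℕ)) • g i, T (f i + ((-Complex.I) ^ (k : ℕ)) • g i)⟫_ℂ)
      (Complex.I ^ (k : ℕ) * ∫ z, F z ∂(E.seqMeasure fun i => f i + ((-Complex.I) ^ (k : ℕ)) • g i)) := by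
    intro k
    have := E.hasSum_integral_seqMeasure (summable_sq_polar hf hg ((-Complex.I) ^ (k : ℕ))) hF hC
    simp only [hT] at this
    exact this.mul_left _
  have h2 := (hasSum_sum (s := Finset.univ) fun k _ => h k).mul_left (1 / 4 : ℂ)
  simp only [polarization] at h2
  rw [cint, ← h2.tsum_eq]
  exact tsum_congr fun i => by ring

theorem cint_indicator {S : Set Z} (hS : MeasurableSet S) {f g : ℕ → H}
    (hf : Summable fun i => ‖f i‖ ^ 2) (hg : Summable fun i => ‖g i‖ ^ 2) :
    E.cint f g (S.indicator 1) = ∑' i, ⟪f i, E.eff S (g i)⟫_ℂ := by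
  refine E.cint_eq_of_quadratic (C := 1) (measurable_one.indicator hS) (fun z => ?_) (fun h => ?_) hf hg
  · by_cases hz : z ∈ S <;> simp [hz]
  · rw [integral_indicator hS, ← E.measureAt_real h hS]
    simp

theorem cint_const (a : ℂ) {f g : ℕ → H}
    (hf : Summable fun i => ‖f i‖ ^ 2) (hg : Summable fun i => ‖g i‖ ^ 2) :
    E.cint f g (fun _ => a) = a * ∑' i, ⟪f i, g i⟫_ℂ := by
  rw [E.cint_eq_of_quadratic (C := ‖a‖) (T := a • 1) measurable_const (fun z => le_rfl)
    (fun h => ?_) hf hg]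
  · simp only [smul_apply, one_apply_eq_self, inner_smul_right]
    exact tsum_mul_left
  · rw [integral_const, Measure.real, measureAt_univ, ENNReal.toReal_ofReal (by positivity)]
    simp only [smul_apply, one_apply_eq_self, inner_smul_right, Complex.real_smul,
      inner_self_eq_norm_sq_to_K]
    push_cast
    rw [mul_comm]; rfl

theorem cint_smul (a : ℂ) (f g : ℕ → H) (F : Z → ℂ) :
    E.cint f g (fun z => a * F z) = a * E.cint f g F := by
  simp only [cint, integral_const_mul, Finset.mul_sum]
  exact Finset.sum_congr rfl fun k _ => by ring

theorem cint_zero (f g : ℕ → H) : E.cint f g (fun _ => 0) = 0 := by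
  simp [cint]

end POVM

/-! ### Measurements that depend on a parameter -/

variable {X : Type*} [MeasurableSpace X]

/-- Weak measurability concerns fixed vectors only; the simple approximations of `f` take finitely
many values, and each `T x` is continuous. -/
theorem measurable_inner_of_weak {T : X → H →L[ℂ] H} (hT : ∀ f g : H, Measurable fun x => ⟪f, T x g⟫_ℂ)
    {f : X → H} (hf : StronglyMeasurable f) : Measurable fun x => ⟪f x, T x (f x)⟫_ℂ := by
  refine measurable_of_tendsto_metrizable
    (f := fun n x => ⟪hf.approx n x, T x (hf.approx n x)⟫_ℂ) (fun n => ?_) ?_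
  · exact (hf.approx n).measurable_bind (fun v x => ⟪v, T x v⟫_ℂ) fun v => hT v v
  · rw [tendsto_pi_nhds]
    intro x
    have h := hf.tendsto_approx x
    exact Filter.Tendsto.inner h (((T x).continuous.tendsto (f x)).comp h)

end Results


/-! ### The kernels of the results, and the recursion for bounded functions -/

theorem norm_indicator_one_le {Z : Type*} (S : Set Z) (z : Z) : ‖S.indicator (1 : Z → ℂ) z‖ ≤ 1 := by
  by_cases hz : z ∈ S <;> simp [hz]

section Kernels

open ProbabilityTheory

variable {H : Type*} [NormedAddCommGroup H] [InnerProductSpace ℂ H]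
  {X Z : Type*} [MeasurableSpace X] [MeasurableSpace Z]

/-- The weak measurability of a family of measurements. -/
def WeaklyMeasurable (E : X → POVM Z H) : Prop :=
  ∀ S, MeasurableSet S → ∀ f g : H, Measurable fun x => ⟪f, (E x).eff S g⟫_ℂ

/-- The kernel formed by the measures of a measurable sequence of vectors. -/
def seqKernel {E : X → POVM Z H} (hE : WeaklyMeasurable E) {f : X → ℕ → H}
    (hf : ∀ i, StronglyMeasurable fun x => f x i) : Kernel X Z where
  toFun x := (E x).seqMeasure (f x)
  measurable' := by
    refine Measure.measurable_of_measurable_coe _ fun S hS => ?_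
    have h : ∀ x, (E x).seqMeasure (f x) S
        = ∑' i, ENNReal.ofReal (⟪f x i, (E x).eff S (f x i)⟫_ℂ).re := fun x => by
      rw [POVM.seqMeasure, Measure.sum_apply _ hS]
      exact tsum_congr fun i => POVM.measureAt_apply _ _ hS
    simp only [h]
    refine Measurable.tsum fun i => ENNReal.measurable_ofReal.comp
      (Complex.measurable_re.comp (measurable_inner_of_weak (hE S hS) (hf i)))

theorem seqKernel_apply {E : X → POVM Z H} (hE : WeaklyMeasurable E) {f : X → ℕ → H}
    (hf : ∀ i, StronglyMeasurable fun x => f x i) (x : X) :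
    seqKernel hE hf x = (E x).seqMeasure (f x) := rfl

theorem isFiniteKernel_seqKernel {E : X → POVM Z H} (hE : WeaklyMeasurable E) {f : X → ℕ → H}
    (hf : ∀ i, StronglyMeasurable fun x => f x i) (hs : ∀ x, Summable fun i => ‖f x i‖ ^ 2)
    {B : ℝ} (hB : ∀ x, ∑' i, ‖f x i‖ ^ 2 ≤ B) : IsFiniteKernel (seqKernel hE hf) := by
  refine ⟨⟨ENNReal.ofReal B, ENNReal.ofReal_lt_top, fun x => ?_⟩⟩
  rw [seqKernel_apply, POVM.seqMeasure, Measure.sum_apply _ MeasurableSet.univ]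
  simp only [POVM.measureAt_univ]
  rw [← ENNReal.ofReal_tsum_of_nonneg (fun i => by positivity) (hs x)]
  exact ENNReal.ofReal_le_ofReal (hB x)

/-- The kernels of the polarization identity for a state vector sequence and its transform. -/
theorem stronglyMeasurable_polar {f : X → ℕ → H} (hf : ∀ i, StronglyMeasurable fun x => f x i)
    (c : H →L[ℂ] H) (a : ℂ) (i : ℕ) : StronglyMeasurable fun x => f x i + a • c (f x i) :=
  (hf i).add ((c.continuous.comp_stronglyMeasurable (hf i)).const_smul a)

theorem tsum_polar_le {ρ : NormalState H} (c : H →L[ℂ] H) (a : ℂ) :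
    ∑' i, ‖ρ.vec i + a • c (ρ.vec i)‖ ^ 2 ≤ (1 + ‖a‖ * ‖c‖) ^ 2 := by
  have h : ∀ i, ‖ρ.vec i + a • c (ρ.vec i)‖ ^ 2 ≤ (1 + ‖a‖ * ‖c‖) ^ 2 * ‖ρ.vec i‖ ^ 2 := by
    intro i
    rw [← mul_pow]
    refine pow_le_pow_left₀ (norm_nonneg _) ((norm_add_le _ _).trans ?_) 2
    rw [norm_smul]
    nlinarith [c.le_opNorm (ρ.vec i), norm_nonneg a]
  have hs := POVM.summable_sq_polar ρ.summable_sq (summable_sq_apply ρ.summable_sq c) a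
  refine (hs.tsum_le_tsum h (ρ.summable_sq.mul_left _)).trans ?_
  rw [tsum_mul_left, ρ.normalized.tsum_eq, mul_one]

/-- The integral of the complex integrals is an integral over the product space. -/
theorem integral_cint_eq {E : X → POVM Z H} (hE : WeaklyMeasurable E) {ρ : X → NormalState H}
    (hρ : ∀ i, StronglyMeasurable fun x => (ρ x).vec i) (c : H →L[ℂ] H)
    (P : Measure X) [IsFiniteMeasure P] {F : X × Z → ℂ} (hF : Measurable F) {C : ℝ}
    (hC : ∀ z, ‖F z‖ ≤ C) :
    ∫ x, (E x).cint (ρ x).vec (fun i => c ((ρ x).vec i)) (fun z => F (x, z)) ∂P =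
      ∑ k : Fin 4, (1 / 4 * Complex.I ^ (k : ℕ)) * ∫ y, F y ∂(P.compProd (seqKernel hE
        (stronglyMeasurable_polar hρ c ((-Complex.I) ^ (k : ℕ))))) := by
  have hfin : ∀ k : Fin 4, IsFiniteKernel (seqKernel hE
        (stronglyMeasurable_polar hρ c ((-Complex.I) ^ (k : ℕ)))) := fun k =>
    isFiniteKernel_seqKernel hE _
      (fun x => POVM.summable_sq_polar (ρ x).summable_sq (summable_sq_apply (ρ x).summable_sq c) _)
      (fun x => tsum_polar_le c _)
  have hint : ∀ k : Fin 4, Integrable F (P.compProd (seqKernel hE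
        (stronglyMeasurable_polar hρ c ((-Complex.I) ^ (k : ℕ))))) := fun k =>
    Integrable.of_bound hF.aestronglyMeasurable C (.of_forall hC)
  simp only [POVM.cint]
  rw [integral_const_mul, integral_finsetSum, Finset.mul_sum]
  · refine Finset.sum_congr rfl fun k _ => ?_
    rw [integral_const_mul, Measure.integral_compProd (hint k), mul_assoc]
    rfl
  · intro k _
    exact (Integrable.integral_compProd (κ := Kernel.const Unit P) (η := Kernel.prodMkLeft Unit _)
      (a := ()) (hint k)).const_mul _

end Kernels

/-! ### The recursion of the a posteriori states, tested with bounded functions. -/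

section Evolution

variable {p : Params} {H : Type*} [NormedAddCommGroup H] [InnerProductSpace ℂ H]
  [CompleteSpace H] {Q : OpenOscillator p H} {Y : Type*} [MeasurableSpace Y]

theorem Strategy.weaklyMeasurable (s : Strategy Q Y) (n : ℕ) : WeaklyMeasurable (s.meas n) :=
  fun S hS f g => s.measurable n S hS f g

/-- The separation of the last stage of a history. -/
def splitLast {n : ℕ} (h : History Y (n + 1)) : History Y n × (Y × ℂ) :=
  (fun i => h i.castSucc, h (Fin.last n))

@[fun_prop] theorem measurable_splitLast {n : ℕ} :
    Measurable (splitLast : History Y (n + 1) → History Y n × (Y × ℂ)) := by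
  unfold splitLast
  fun_prop

/-- The addition of a last stage to a history. -/
def joinLast {n : ℕ} (y : History Y n × (Y × ℂ)) : History Y (n + 1) :=
  Fin.snoc (α := fun _ => Y × ℂ) y.1 y.2

@[fun_prop] theorem measurable_joinLast {n : ℕ} :
    Measurable (joinLast : History Y n × (Y × ℂ) → History Y (n + 1)) := by
  refine measurable_pi_iff.2 fun i => ?_
  refine Fin.lastCases ?_ (fun j => ?_) i
  · simp only [joinLast, Fin.snoc_last]; fun_prop
  · simp only [joinLast, Fin.snoc_castSucc]; fun_prop

@[simp] theorem joinLast_splitLast {n : ℕ} (x : History Y (n + 1)) : joinLast (splitLast x) = x := by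
  funext i
  refine Fin.lastCases ?_ (fun j => ?_) i
  · simp [joinLast, splitLast]
  · simp [joinLast, splitLast]

@[simp] theorem splitLast_joinLast {n : ℕ} (y : History Y n × (Y × ℂ)) :
    splitLast (joinLast y) = y := by
  simp [joinLast, splitLast]

namespace Evolution

variable {s : Strategy Q Y} (R : Evolution s)

instance (n : ℕ) : IsProbabilityMeasure (R.P n) := R.prob n

theorem measurable_ev (n : ℕ) (c : H →L[ℂ] H) :
    StronglyMeasurable fun h => (R.post n h).ev c :=
  QuantumLQG.measurable_ev (R.post_measurable n) c

theorem integrable_ev (n : ℕ) (c : H →L[ℂ] H) : Integrable (fun h => (R.post n h).ev c) (R.P n) :=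
  Integrable.of_bound (R.measurable_ev n c).aestronglyMeasurable (‖c‖)
    (.of_forall fun h => (R.post n h).norm_ev_le c)

/-- The recursion `π_{n+1}(dh × dζ)[c] = π_n(dh)[b(h, dζ) c]`, integrated with a bounded
function. -/
theorem integral_step (n : ℕ) {c : H →L[ℂ] H} (hc : c ∈ Q.futureAlgebra (n + 1))
    {F : History Y n × (Y × ℂ) → ℂ} (hF : Measurable F) {C : ℝ} (hC : ∀ z, ‖F z‖ ≤ C) :
    ∫ h, F (splitLast h) * (R.post (n + 1) h).ev c ∂(R.P (n + 1)) =
      ∫ h, (s.meas n h).cint (R.post n h).vec (fun i => c ((R.post n h).vec i))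
        (fun z => F (h, z)) ∂(R.P n) := by
  -- Both sides become combinations of finite measures on the product of history and result: four
  -- with the density of the a posteriori expectation, and four polarized distributions of the
  -- results. The defining recursion says that the combinations agree on rectangles, which generate
  -- the σ-algebra.
  let m : Fin 4 ⊕ Fin 4 → Measure (History Y n × (Y × ℂ)) := Sum.elim
    (partMeasure (R.P (n + 1)) splitLast fun h => (R.post (n + 1) h).ev c)
    (fun k => (R.P n).compProd (seqKernel (s.weaklyMeasurable n)
      (stronglyMeasurable_polar (R.post_measurable n) c ((-Complex.I) ^ (k : ℕ)))))
  let a : Fin 4 ⊕ Fin 4 → ℂ := Sum.elim (fun k => Complex.I ^ (k : ℕ))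
    (fun k => -(1 / 4 * Complex.I ^ (k : ℕ)))
  have hfin : ∀ k : Fin 4, ProbabilityTheory.IsFiniteKernel (seqKernel (s.weaklyMeasurable n)
      (stronglyMeasurable_polar (R.post_measurable n) c ((-Complex.I) ^ (k : ℕ)))) := fun k =>
    isFiniteKernel_seqKernel _ _
      (fun x => POVM.summable_sq_polar (R.post n x).summable_sq
        (summable_sq_apply (R.post n x).summable_sq c) _)
      (fun x => tsum_polar_le c _)
  have hm : ∀ i, IsFiniteMeasure (m i) := by
    rintro (k | k)
    · exact isFiniteMeasure_partMeasure (R.integrable_ev (n + 1) c) k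
    · exact inferInstanceAs (IsFiniteMeasure ((R.P n).compProd (seqKernel (s.weaklyMeasurable n)
        (stronglyMeasurable_polar (R.post_measurable n) c ((-Complex.I) ^ (k : ℕ))))))
  have hsum : ∀ {G : History Y n × (Y × ℂ) → ℂ}, Measurable G → ∀ {D : ℝ}, (∀ z, ‖G z‖ ≤ D) →
      ∑ i, a i * ∫ y, G y ∂(m i) =
      ∫ h, G (splitLast h) * (R.post (n + 1) h).ev c ∂(R.P (n + 1)) -
      ∫ h, (s.meas n h).cint (R.post n h).vec (fun i => c ((R.post n h).vec i))
        (fun z => G (h, z)) ∂(R.P n) := by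
    intro G hG D hD
    rw [integral_eq_sum_partMeasure measurable_splitLast (R.measurable_ev _ c).measurable
      (R.integrable_ev _ c) hG hD, integral_cint_eq (s.weaklyMeasurable n) (R.post_measurable n) c
      (R.P n) hG hD, Fintype.sum_sum_type, sub_eq_add_neg, ← Finset.sum_neg_distrib]
    simp only [m, a, Sum.elim_inl, Sum.elim_inr, neg_mul]
  rw [← sub_eq_zero, ← hsum hF hC]
  refine sum_integral_eq_zero_of_piSystem generateFrom_prod.symm isPiSystem_prod
    ⟨Set.univ, MeasurableSet.univ, Set.univ, MeasurableSet.univ, Set.univ_prod_univ⟩ ?_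
    fun i => Integrable.of_bound hF.aestronglyMeasurable C (.of_forall hC)
  rintro _ ⟨A, (hA : MeasurableSet A), S, (hS : MeasurableSet S), rfl⟩
  have hind : ∀ i, ((m i).real (A ×ˢ S) : ℂ) = ∫ y, (A ×ˢ S).indicator 1 y ∂(m i) := fun i => by
    rw [integral_indicator (hA.prod hS)]; simp
  simp only [hind]
  rw [hsum (D := 1) (measurable_one.indicator (hA.prod hS)) (norm_indicator_one_le _), sub_eq_zero]
  have hst := R.step n A S hA hS c hc
  have hmeas : MeasurableSet {h : History Y (n + 1) |
      (fun i : Fin n => h i.castSucc) ∈ A ∧ h (Fin.last n) ∈ S} :=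
    measurable_splitLast (hA.prod hS)
  rw [← integral_indicator hmeas, ← integral_indicator hA] at hst
  convert hst using 2
  · funext h
    by_cases hh : splitLast h ∈ A ×ˢ S
    · rw [Set.indicator_of_mem hh, Set.indicator_of_mem (show h ∈ _ from hh)]; simp
    · rw [Set.indicator_of_notMem hh, Set.indicator_of_notMem (show h ∉ _ from hh)]; simp
  · funext h
    by_cases hh : h ∈ A
    · rw [Set.indicator_of_mem hh]
      have : (fun z => (A ×ˢ S).indicator (1 : History Y n × (Y × ℂ) → ℂ) (h, z)) = S.indicator 1 := by
        funext z
        by_cases hz : z ∈ S <;> simp [hz, hh, Set.indicator]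
      rw [this, POVM.cint_indicator _ hS (R.post n h).summable_sq
        (summable_sq_apply (R.post n h).summable_sq c)]
      rfl
    · rw [Set.indicator_of_notMem hh]
      have : (fun z => (A ×ˢ S).indicator (1 : History Y n × (Y × ℂ) → ℂ) (h, z)) = fun _ => 0 := by
        funext z
        simp [hh, Set.indicator]
      rw [this, POVM.cint_zero]

/-- The average over the last result does not change the expectations in the future. -/
theorem integral_step_const (n : ℕ) {c : H →L[ℂ] H} (hc : c ∈ Q.futureAlgebra (n + 1))
    {F : History Y n → ℂ} (hF : Measurable F) {C : ℝ} (hC : ∀ z, ‖F z‖ ≤ C) :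
    ∫ h, F (splitLast h).1 * (R.post (n + 1) h).ev c ∂(R.P (n + 1)) =
      ∫ h, F h * (R.post n h).ev c ∂(R.P n) := by
  rw [R.integral_step n hc (F := fun z => F z.1) (by fun_prop) (C := C) fun z => hC _]
  refine integral_congr_ae (.of_forall fun h => ?_)
  simp only
  rw [POVM.cint_const _ _ (R.post n h).summable_sq
    (summable_sq_apply (R.post n h).summable_sq c)]
  rfl

/-- A complex function of the next history is determined by its integrals with the
characteristic functions of rectangles. -/
theorem ae_eq_zero_of_rect (n : ℕ) {G : History Y (n + 1) → ℂ} (hG : Integrable G (R.P (n + 1)))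
    (hGm : Measurable G)
    (h : ∀ A S, MeasurableSet A → MeasurableSet S →
      ∫ x, (A ×ˢ S).indicator 1 (splitLast x) * G x ∂(R.P (n + 1)) = 0) :
    ∀ᵐ x ∂(R.P (n + 1)), G x = 0 := by
  have hfin := isFiniteMeasure_partMeasure (X := (splitLast : History Y (n + 1) → _)) hG
  have key : ∀ {F : History Y n × (Y × ℂ) → ℂ}, Measurable F → ∀ {C : ℝ}, (∀ z, ‖F z‖ ≤ C) →
      ∫ x, F (splitLast x) * G x ∂(R.P (n + 1)) = 0 := by
    intro F hF C hC
    rw [integral_eq_sum_partMeasure measurable_splitLast hGm hG hF hC]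
    refine sum_integral_eq_zero_of_piSystem generateFrom_prod.symm isPiSystem_prod
      ⟨Set.univ, MeasurableSet.univ, Set.univ, MeasurableSet.univ, Set.univ_prod_univ⟩ ?_
      fun i => Integrable.of_bound hF.aestronglyMeasurable C (.of_forall hC)
    rintro _ ⟨A, (hA : MeasurableSet A), S, (hS : MeasurableSet S), rfl⟩
    rw [← h A S hA hS, integral_eq_sum_partMeasure measurable_splitLast hGm hG
      (measurable_one.indicator (hA.prod hS)) (C := 1) (norm_indicator_one_le _)]
    refine Finset.sum_congr rfl fun k _ => ?_
    rw [integral_indicator (hA.prod hS)]; simp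
  refine hG.ae_eq_zero_of_forall_setIntegral_eq_zero fun T hT _ => ?_
  have := key (F := fun y => T.indicator 1 (joinLast y)) (C := 1)
    ((measurable_one.indicator hT).comp measurable_joinLast) (fun z => norm_indicator_one_le _ _)
  simp only [joinLast_splitLast] at this
  rw [← integral_indicator hT, ← this]
  refine integral_congr_ae (.of_forall fun x => ?_)
  by_cases hx : x ∈ T <;> simp [hx]

/-- An inequality for the expectations after a measurement follows from the corresponding
inequalities for all results of the measurement. -/
theorem ae_re_ev_nonneg (n : ℕ) {c : H →L[ℂ] H} (hc : c ∈ Q.futureAlgebra (n + 1))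
    (h : ∀ᵐ x ∂(R.P n), ∀ S, MeasurableSet S →
      0 ≤ ((R.post n x).ev ((s.meas n x).eff S * c)).re) :
    ∀ᵐ x ∂(R.P (n + 1)), 0 ≤ ((R.post (n + 1) x).ev c).re := by
  have hre : Integrable (fun x => ((R.post (n + 1) x).ev c).re) (R.P (n + 1)) :=
    (R.integrable_ev (n + 1) c).re
  -- The event `T` is arbitrary, not a rectangle; its section over each history is a set of results,
  -- to whose effect the hypothesis applies.
  refine ae_nonneg_of_forall_setIntegral_nonneg hre fun T hT _ => ?_
  have hst := R.integral_step n hc (F := fun y => T.indicator 1 (joinLast y)) (C := 1)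
    ((measurable_one.indicator hT).comp measurable_joinLast) (fun z => norm_indicator_one_le _ _)
  simp only [joinLast_splitLast] at hst
  have hlhs : ∫ x, T.indicator (1 : History Y (n + 1) → ℂ) x * (R.post (n + 1) x).ev c ∂(R.P (n + 1))
      = ∫ x in T, (R.post (n + 1) x).ev c ∂(R.P (n + 1)) := by
    rw [← integral_indicator hT]
    refine integral_congr_ae (.of_forall fun x => ?_)
    by_cases hx : x ∈ T <;> simp [hx]
  rw [hlhs] at hst
  have h1 : ∫ x in T, ((R.post (n + 1) x).ev c).re ∂(R.P (n + 1))
      = (∫ x in T, (R.post (n + 1) x).ev c ∂(R.P (n + 1))).re :=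
    integral_re (R.integrable_ev (n + 1) c).integrableOn
  rw [h1, hst]
  have hcint : ∀ x, (s.meas n x).cint (R.post n x).vec (fun i => c ((R.post n x).vec i))
      (fun z => T.indicator 1 (joinLast (x, z)))
      = (R.post n x).ev ((s.meas n x).eff {z | joinLast (x, z) ∈ T} * c) := by
    intro x
    have hm : MeasurableSet {z | joinLast (x, z) ∈ T} := (measurable_joinLast.comp measurable_prodMk_left) hT
    have : (fun z => T.indicator (1 : History Y (n + 1) → ℂ) (joinLast (x, z))) = {z | joinLast (x, z) ∈ T}.indicator 1 := by
      funext z; simp [Set.indicator]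
    rw [this, POVM.cint_indicator _ hm (R.post n x).summable_sq
      (summable_sq_apply (R.post n x).summable_sq c)]
    rfl
  simp only [hcint]
  -- Integrability need not be verified: the integral of a non-integrable function is `0`, which
  -- also satisfies the inequality.
  by_cases hi : Integrable (fun x => (R.post n x).ev ((s.meas n x).eff {z | joinLast (x, z) ∈ T} * c)) (R.P n)
  · have h2 : ∫ x, ((R.post n x).ev ((s.meas n x).eff {z | joinLast (x, z) ∈ T} * c)).re ∂(R.P n)
        = (∫ x, (R.post n x).ev ((s.meas n x).eff {z | joinLast (x, z) ∈ T} * c) ∂(R.P n)).re :=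
      integral_re hi
    rw [← h2]
    refine integral_nonneg_of_ae (h.mono fun x hx => hx _ ?_)
    exact (measurable_joinLast.comp measurable_prodMk_left) hT
  · rw [integral_undef hi]; simp

end Evolution

end Evolution


/-! ### Positive semidefinite kernels -/

section Kernels

open scoped ComplexOrder

variable {ι κ : Type*}

/-- Positive semidefinite kernels on an arbitrary set. -/
def PosKernel (M : ι → ι → ℂ) : Prop := Matrix.PosSemidef (M : Matrix ι ι ℂ)

theorem sum_re_nonneg_of_posKernel {M : ι → ι → ℂ} (hM : PosKernel M) {J : Type*} [Fintype J]
    (x : J → ι) (a : J → ℂ) : 0 ≤ (∑ i, ∑ j, conj (a i) * M (x i) (x j) * a j).re := by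
  have h := (Matrix.posSemidef_iff_dotProduct_mulVec.1 (Matrix.PosSemidef.submatrix hM x)).2 a
  have h2 : star a ⬝ᵥ Matrix.mulVec (Matrix.submatrix M x x) a
      = ∑ i, ∑ j, conj (a i) * M (x i) (x j) * a j := by
    simp only [dotProduct, Matrix.mulVec, Finset.mul_sum, Pi.star_apply,
      mul_assoc]
    rfl
  rw [h2] at h
  exact (Complex.le_def.1 h).1

theorem posKernel_of_sum_re_nonneg {M : ι → ι → ℂ} (hH : ∀ i j, conj (M i j) = M j i)
    (h : ∀ (N : ℕ) (x : Fin N → ι) (a : Fin N → ℂ),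
      0 ≤ (∑ i, ∑ j, conj (a i) * M (x i) (x j) * a j).re) : PosKernel M := by
  refine ⟨Matrix.IsHermitian.ext fun i j => hH j i, fun x => ?_⟩
  let e := x.support.equivFin.symm
  have h1 : (x.sum fun i xi => x.sum fun j xj => star xi * M i j * xj)
      = ∑ i, ∑ j, conj (x (e i)) * M (e i) (e j) * x (e j) := by
    rw [Finsupp.sum, ← Finset.sum_coe_sort, ← e.sum_comp]
    refine Finset.sum_congr rfl fun i _ => ?_
    rw [Finsupp.sum, ← Finset.sum_coe_sort, ← e.sum_comp]
    rfl
  rw [h1, Complex.le_def]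
  refine ⟨h _ (fun i => e i) fun i => x (e i), ?_⟩
  have h2 : conj (∑ i, ∑ j, conj (x (e i)) * M (e i) (e j) * x (e j))
      = ∑ i, ∑ j, conj (x (e i)) * M (e i) (e j) * x (e j) := by
    rw [map_sum]
    simp only [map_sum, map_mul, Complex.conj_conj, hH]
    rw [Finset.sum_comm]
    exact Finset.sum_congr rfl fun i _ => Finset.sum_congr rfl fun j _ => by ring
  rw [Complex.conj_eq_iff_im] at h2
  rw [h2]; rfl

theorem posKernel_conj {M : ι → ι → ℂ} (hM : PosKernel M) (i j : ι) : conj (M i j) = M j i :=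
  Matrix.IsHermitian.apply hM.1 j i

theorem posKernel_mul {M N : ι → ι → ℂ} (hM : PosKernel M) (hN : PosKernel N) :
    PosKernel fun i j : ι => M i j * N i j :=
  Matrix.PosSemidef.hadamard hM hN

theorem posKernel_rankOne (f : ι → ℂ) :
    PosKernel fun i j : ι => conj (f i) * f j := by
  refine posKernel_of_sum_re_nonneg (fun i j => by simp [mul_comm]) fun N x a => ?_
  have : ∑ i, ∑ j, conj (a i) * (conj (f (x i)) * f (x j)) * a j
      = conj (∑ i, a i * f (x i)) * ∑ j, a j * f (x j) := by
    rw [map_sum, Finset.sum_mul_sum]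
    refine Finset.sum_congr rfl fun i _ => Finset.sum_congr rfl fun j _ => ?_
    rw [map_mul]; ring
  rw [this, ← Complex.normSq_eq_conj_mul_self, Complex.ofReal_re]
  exact Complex.normSq_nonneg _

theorem posKernel_smul {M : ι → ι → ℂ} (hM : PosKernel M) {c : ℝ} (hc : 0 ≤ c) :
    PosKernel fun i j : ι => (c : ℂ) * M i j := by
  refine posKernel_of_sum_re_nonneg (fun i j => by simp [posKernel_conj hM]) fun N x a => ?_
  have : ∑ i, ∑ j, conj (a i) * ((c : ℂ) * M (x i) (x j)) * a j
      = (c : ℂ) * ∑ i, ∑ j, conj (a i) * M (x i) (x j) * a j := by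
    simp only [Finset.mul_sum]
    exact Finset.sum_congr rfl fun i _ => Finset.sum_congr rfl fun j _ => by ring
  rw [this, Complex.re_ofReal_mul]
  exact mul_nonneg hc (sum_re_nonneg_of_posKernel hM x a)

theorem posKernel_pow {M : ι → ι → ℂ} (hM : PosKernel M) (k : ℕ) :
    PosKernel fun i j : ι => M i j ^ k := by
  induction k with
  | zero => simpa using posKernel_rankOne fun _ : ι => (1 : ℂ)
  | succ k ih => simpa only [pow_succ] using posKernel_mul ih hM

/-- The entrywise exponential of a positive semidefinite kernel. -/
theorem posKernel_exp {M : ι → ι → ℂ} (hM : PosKernel M) :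
    PosKernel fun i j : ι => Complex.exp (M i j) := by
  refine posKernel_of_sum_re_nonneg (fun i j => by
    rw [← Complex.exp_conj, posKernel_conj hM]) fun N x a => ?_
  have h : HasSum (fun k : ℕ => (∑ i, ∑ j, conj (a i) * (((k.factorial : ℝ)⁻¹ : ℝ) * M (x i) (x j) ^ k)
      * a j).re) (∑ i, ∑ j, conj (a i) * Complex.exp (M (x i) (x j)) * a j).re := by
    refine Complex.hasSum_re ?_
    refine hasSum_sum fun i _ => hasSum_sum fun j _ => ?_
    refine HasSum.mul_right _ (HasSum.mul_left _ ?_)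
    have := NormedSpace.expSeries_div_hasSum_exp (M (x i) (x j))
    rw [← Complex.exp_eq_exp_ℂ] at this
    have e : (fun k : ℕ => (((k.factorial : ℝ)⁻¹ : ℝ) : ℂ) * M (x i) (x j) ^ k)
        = fun k => M (x i) (x j) ^ k / k.factorial := funext fun k => by
      push_cast
      rw [div_eq_mul_inv, mul_comm]
    rw [e]
    exact this
  exact h.nonneg fun k => sum_re_nonneg_of_posKernel
    (posKernel_smul (posKernel_pow hM k) (by positivity)) x a

/-- The kernel of a Hermitian form on `ℂ²`. -/
def formKernel (A B : ℝ) (D : ℂ) (a b : ℂ × ℂ) : ℂ :=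
  A * (a.1 * conj b.1) + B * (a.2 * conj b.2) + D * (a.1 * conj b.2) + conj D * (a.2 * conj b.1)

theorem formKernel_self_re (A B : ℝ) (D : ℂ) (a : ℂ × ℂ) :
    (formKernel A B D a a).re = A * ‖a.1‖ ^ 2 + B * ‖a.2‖ ^ 2 + 2 * (D * (a.1 * conj a.2)).re := by
  simp only [formKernel, Complex.add_re, Complex.mul_re, Complex.mul_im, Complex.conj_re,
    Complex.conj_im, Complex.ofReal_re, Complex.ofReal_im, Complex.sq_norm, Complex.normSq_apply]
  ring

/-- By sesquilinearity a quadratic sum of the kernel is the value of the form at the single vector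
`∑ i, conj (c i) • x i`. -/
theorem posKernel_formKernel {A B : ℝ} {D : ℂ} (h : ∀ a, 0 ≤ (formKernel A B D a a).re) :
    PosKernel (formKernel A B D) := by
  refine posKernel_of_sum_re_nonneg (fun a b => by simp [formKernel]; ring) fun N x c => ?_
  have : ∑ i, ∑ j, conj (c i) * formKernel A B D (x i) (x j) * c j
      = formKernel A B D (∑ i, conj (c i) * (x i).1, ∑ i, conj (c i) * (x i).2)
        (∑ i, conj (c i) * (x i).1, ∑ i, conj (c i) * (x i).2) := by
    have h1 : ∀ f g : Fin N → ℂ, (∑ i, conj (c i) * f i) * conj (∑ i, conj (c i) * g i)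
        = ∑ i, ∑ j, conj (c i) * (f i * conj (g j)) * c j := fun f g => by
      rw [map_sum, Finset.sum_mul_sum]
      refine Finset.sum_congr rfl fun i _ => Finset.sum_congr rfl fun j _ => ?_
      simp only [map_mul, Complex.conj_conj]
      ring
    simp only [formKernel, h1, Finset.mul_sum, ← Finset.sum_add_distrib]
    refine Finset.sum_congr rfl fun i _ => Finset.sum_congr rfl fun j _ => ?_
    ring
  rw [this]
  exact h _

end Kernels

/-! ### The covariance and commutation forms -/

namespace Params

variable (p : Params)

/-- The sesquilinear form of `covForm`. -/
def covKernel (a b : ℂ × ℂ) : ℂ := formKernel p.sig p.nu (-conj p.ups) a b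

theorem covKernel_self (a : ℂ × ℂ) : p.covKernel a a = (p.covForm a : ℂ) := by
  apply Complex.ext
  · simp only [covKernel, formKernel_self_re, covForm, Complex.ofReal_re, Complex.mul_re, Complex.mul_im,
      Complex.neg_re, Complex.neg_im, Complex.conj_re, Complex.conj_im]
    ring
  · simp only [covKernel, formKernel, Complex.add_im, Complex.mul_re, Complex.mul_im, Complex.ofReal_im,
      Complex.neg_re, Complex.neg_im, Complex.conj_re, Complex.conj_im, Complex.ofReal_re]
    ring

theorem commForm_eq (a b : ℂ × ℂ) : p.commForm a b =
    formKernel (1 - ‖p.phi‖ ^ 2) (p.eps - ‖p.gamma‖ ^ 2) (-(conj p.phi * p.gamma)) a b := by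
  simp only [commForm, formKernel, map_neg, map_mul, Complex.conj_conj]
  ring

theorem covForm_nonneg (hsig : 0 ≤ p.sig) (hnu : 0 ≤ p.nu) (hups : ‖p.ups‖ ^ 2 ≤ p.sig * p.nu)
    (a : ℂ × ℂ) : 0 ≤ p.covForm a := by
  have h1 : (p.ups * conj a.1 * a.2).re ≤ ‖p.ups‖ * ‖a.1‖ * ‖a.2‖ := by
    refine (Complex.re_le_norm _).trans ?_
    simp
  have h2 : ‖p.ups‖ ≤ √p.sig * √p.nu := by
    rw [← Real.sqrt_mul hsig]
    exact Real.le_sqrt_of_sq_le hups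
  have h3 := Real.sq_sqrt hsig
  have h4 := Real.sq_sqrt hnu
  have h5 : ‖p.ups‖ * ‖a.1‖ * ‖a.2‖ ≤ √p.sig * √p.nu * ‖a.1‖ * ‖a.2‖ := by gcongr
  unfold covForm
  nlinarith [sq_nonneg (√p.sig * ‖a.1‖ - √p.nu * ‖a.2‖)]

/-- The argument of the Weyl operator of `x_k` in the joint Weyl operator of
`(x_{k+1}, y_{k+1})`. -/
def pull (a : ℂ × ℂ) : ℂ := conj p.gamma * a.2 + conj p.phi * a.1

/-- The Hermitian version of `commForm_im_add`. The term with `ε` on the right takes the place of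
the measurement noise in the case `ε > 0` of the variance bound. -/
theorem pull_commForm (a b : ℂ × ℂ) :
    p.pull a * conj (p.pull b) + p.commForm a b = a.1 * conj b.1 + p.eps * (a.2 * conj b.2) := by
  have h1 : (‖p.phi‖ ^ 2 : ℂ) = p.phi * conj p.phi := by rw [← Complex.mul_conj']
  have h2 : (‖p.gamma‖ ^ 2 : ℂ) = p.gamma * conj p.gamma := by rw [← Complex.mul_conj']
  simp only [pull, commForm, map_add, map_mul, Complex.conj_conj]
  push_cast
  rw [h1, h2]
  ring

theorem psiOf_nonneg {mu S : ℝ} (hS : 0 ≤ S) (h : 0 ≤ p.nu + mu) : 0 ≤ p.psiOf mu S := by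
  unfold psiOf; positivity

/-- The degenerate case needs an argument: if `Ψ = 0`, then `γ̄ S = 0` and `ν = 0`, and `|υ|² ≤ σ ν`
forces `υ = 0`; so the numerator of the gain vanishes as well. -/
theorem gain_mul_psi {mu S : ℝ} (hS : 0 ≤ S) (hnu : 0 ≤ p.nu) (hmu : 0 ≤ mu)
    (hups : ‖p.ups‖ ^ 2 ≤ p.sig * p.nu) :
    p.gainOf mu S * p.psiOf mu S = p.phi * conj p.gamma * S - p.ups := by
  by_cases h : p.psiOf mu S = 0
  · unfold psiOf at h
    have h1 : ‖p.gamma‖ ^ 2 * S = 0 := by nlinarith [mul_nonneg (sq_nonneg ‖p.gamma‖) hS]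
    have h2 : p.nu = 0 := by nlinarith [mul_nonneg (sq_nonneg ‖p.gamma‖) hS]
    have h3 : p.ups = 0 := by
      rw [h2, mul_zero] at hups
      exact norm_eq_zero.1 (pow_eq_zero_iff two_ne_zero |>.1 (le_antisymm hups (sq_nonneg _)))
    have h4 : conj p.gamma * (S : ℂ) = 0 := by
      rcases mul_eq_zero.1 h1 with h | h
      · rw [norm_eq_zero.1 (pow_eq_zero_iff two_ne_zero |>.1 h)]; simp
      · rw [h]; simp
    rw [h3, mul_assoc, h4, show p.psiOf mu S = 0 from by unfold psiOf; exact h]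
    simp
  · unfold gainOf
    rw [div_mul_cancel₀ _ (by exact_mod_cast h)]

/-- The completion of the square of the Kalman filter. -/
theorem filter_square {mu S : ℝ} (hS : 0 ≤ S) (hnu : 0 ≤ p.nu) (hmu : 0 ≤ mu)
    (hups : ‖p.ups‖ ^ 2 ≤ p.sig * p.nu) (a b : ℂ × ℂ) :
    S * (p.pull a * conj (p.pull b)) + p.covKernel a b + mu * (a.2 * conj b.2)
      = ((‖p.phi‖ ^ 2 * S + p.sig - ‖p.gainOf mu S‖ ^ 2 * p.psiOf mu S : ℝ) : ℂ) * (a.1 * conj b.1)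
        + p.psiOf mu S * ((a.2 + conj (p.gainOf mu S) * a.1)
          * conj (b.2 + conj (p.gainOf mu S) * b.1)) := by
  have h1 : (‖p.phi‖ ^ 2 : ℂ) = p.phi * conj p.phi := by rw [← Complex.mul_conj']
  have h2 : (‖p.gamma‖ ^ 2 : ℂ) = p.gamma * conj p.gamma := by rw [← Complex.mul_conj']
  have h3 : (‖p.gainOf mu S‖ ^ 2 : ℂ) = p.gainOf mu S * conj (p.gainOf mu S) := by
    rw [← Complex.mul_conj']
  have hg := p.gain_mul_psi hS hnu hmu hups
  have hg' := congrArg conj hg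
  simp only [map_mul, map_sub, Complex.conj_ofReal, Complex.conj_conj] at hg'
  have hp : (p.psiOf mu S : ℂ) = p.gamma * conj p.gamma * S + (p.nu + mu) := by
    unfold psiOf; push_cast; rw [h2]
  simp only [pull, covKernel, formKernel, map_add, map_mul, Complex.conj_conj, map_neg]
  push_cast
  rw [h1, h3]
  have e : ∀ x y : ℂ, (p.psiOf mu S : ℂ) * ((a.2 + conj (p.gainOf mu S) * a.1) * (x + p.gainOf mu S * y))
    = p.psiOf mu S * (a.2 * x) + (p.gainOf mu S * p.psiOf mu S) * (a.2 * y)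
      + (conj (p.gainOf mu S) * p.psiOf mu S) * (a.1 * x)
      + p.gainOf mu S * conj (p.gainOf mu S) * p.psiOf mu S * (a.1 * y) := fun x y => by ring
  rw [e, hg, hg', hp]
  ring

theorem muMin_nonneg : 0 ≤ p.muMin := le_max_left _ _

/-- At `(ζ, θ) = (1, -κ̄)` the square in `filter_square` vanishes, which exhibits `Σ_{k+1}` as a sum
of nonnegative quantities. -/
theorem SigAt_nonneg (hSig : 0 ≤ p.Sig) (hsig : 0 ≤ p.sig) (hnu : 0 ≤ p.nu) {mu : ℝ} (hmu : 0 ≤ mu)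
    (hups : ‖p.ups‖ ^ 2 ≤ p.sig * p.nu) (n : ℕ) : 0 ≤ p.SigAt mu n := by
  induction n with
  | zero => exact hSig
  | succ n ih =>
    set κ := p.gainOf mu (p.SigAt mu n)
    have h := p.filter_square ih hnu hmu hups (1, -conj κ) (1, -conj κ)
    rw [covKernel_self] at h
    have h2 := congrArg Complex.re h
    have hz : (-conj κ + conj (p.gainOf mu (p.SigAt mu n)) : ℂ) = 0 := by
      exact neg_add_cancel _
    simp only [map_one, mul_one, Complex.ofReal_re,
      Complex.mul_conj, Complex.add_re, Complex.re_ofReal_mul, hz, map_zero, mul_zero, add_zero] at h2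
    change 0 ≤ ‖p.phi‖ ^ 2 * p.SigAt mu n + p.sig - ‖κ‖ ^ 2 * p.psiOf mu (p.SigAt mu n)
    rw [show κ = p.gainOf mu (p.SigAt mu n) from rfl, ← h2]
    have := p.covForm_nonneg hsig hnu hups (1, -conj κ)
    have := Complex.normSq_nonneg (p.pull (1, -conj κ))
    have := Complex.normSq_nonneg (-conj κ)
    positivity

end Params


/-! ### Square roots of effects -/

theorem IsWeyl.isProductClosed {V : Type*} [AddCommGroup V] [TopologicalSpace V] {B : V → V → ℝ}
    {H : Type*} [NormedAddCommGroup H] [InnerProductSpace ℂ H] [CompleteSpace H]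
    {W : V → H →L[ℂ] H} (hW : IsWeyl B W) : IsProductClosed (Set.range W) where
  one := ⟨0, hW.zero⟩
  mul := by
    rintro _ ⟨a, rfl⟩ _ ⟨b, rfl⟩
    exact ⟨_, _, ⟨a + b, rfl⟩, hW.mul a b⟩
  adj := by
    rintro _ ⟨a, rfl⟩
    exact ⟨1, _, ⟨-a, rfl⟩, by rw [one_smul, hW.star_eq]⟩

/-- The functional calculus stays in the bicommutant: whatever commutes with `e` commutes with its
square root. -/
theorem exists_sqrt_mem_bicommutant {H : Type*} [NormedAddCommGroup H] [InnerProductSpace ℂ H]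
    [CompleteSpace H] {S : Set (H →L[ℂ] H)} {e : H →L[ℂ] H} (he : e.IsPositive)
    (hS : e ∈ bicommutant S) : ∃ b ∈ bicommutant S, star b = b ∧ b * b = e := by
  have h0 : 0 ≤ e := (ContinuousLinearMap.nonneg_iff_isPositive e).2 he
  refine ⟨CFC.sqrt e, fun c hc => ?_, (IsSelfAdjoint.of_nonneg (CFC.sqrt_nonneg e)).star_eq,
    CFC.sqrt_mul_sqrt_self e h0⟩
  have h1 : Commute e c := (hS c hc).symm
  exact (h1.cfcₙ_nnreal NNReal.sqrt).symm

/-- A condition that holds almost everywhere for every value of a parameter in a separable space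
holds almost everywhere for all values together, when the dependence is continuous. -/
theorem ae_forall_of_continuous {X α E : Type*} [TopologicalSpace X]
    [TopologicalSpace.SeparableSpace X] [Nonempty X] [MeasurableSpace α] [TopologicalSpace E]
    {μ : Measure α} {f : X → α → E} {C : Set E} (hC : IsClosed C)
    (hf : ∀ h, Continuous fun x => f x h) (h : ∀ x, ∀ᵐ y ∂μ, f x y ∈ C) :
    ∀ᵐ y ∂μ, ∀ x, f x y ∈ C := by
  have h1 : ∀ᵐ y ∂μ, ∀ n, f (TopologicalSpace.denseSeq X n) y ∈ C := ae_all_iff.2 fun n => h _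
  filter_upwards [h1] with y hy x
  exact DenseRange.induction_on (p := fun x => f x y ∈ C)
    (TopologicalSpace.denseRange_denseSeq X) x (hC.preimage (hf y)) hy

variable {p : Params} {H : Type*} [NormedAddCommGroup H] [InnerProductSpace ℂ H]
  [CompleteSpace H]

/-- The inequality `ae_re_ev_nonneg`, applied to the multiples of `c` by `1`, `-1`, `i` and `-i`. -/
theorem Evolution.ae_ev_eq_zero {Q : OpenOscillator p H} {Y : Type*} [MeasurableSpace Y]
    {s : Strategy Q Y} (R : Evolution s) (n : ℕ) {c : H →L[ℂ] H} (hc : c ∈ Q.futureAlgebra (n + 1))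
    (h : ∀ᵐ x ∂(R.P n), ∀ S, MeasurableSet S → (R.post n x).ev ((s.meas n x).eff S * c) = 0) :
    ∀ᵐ x ∂(R.P (n + 1)), (R.post (n + 1) x).ev c = 0 := by
  have key : ∀ a : ℂ, ∀ᵐ x ∂(R.P (n + 1)), 0 ≤ (a * (R.post (n + 1) x).ev c).re := by
    intro a
    have := R.ae_re_ev_nonneg n (Q.smul_mem_futureAlgebra a hc) (h.mono fun x hx S hS => by
      rw [mul_smul_comm, NormalState.ev_smul, hx S hS]; simp)
    simpa only [NormalState.ev_smul] using this
  filter_upwards [key 1, key (-1), key Complex.I, key (-Complex.I)] with x h1 h2 h3 h4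
  simp only [one_mul, neg_mul, Complex.neg_re, Complex.I_mul_re] at h1 h2 h3 h4
  exact Complex.ext (by simp; linarith) (by simp; linarith)

namespace Params

variable (p) in
/-- The expectation of a noise Weyl operator. -/
def noiseWeight (a : ℂ × ℂ) : ℂ :=
  Complex.exp (-(p.hbar * (p.covForm a + (p.commForm a a).re / 2) : ℝ))

theorem continuous_noiseWeight : Continuous p.noiseWeight := by
  unfold noiseWeight covForm commForm
  fun_prop

end Params

namespace OpenOscillator

variable (Q : OpenOscillator p H)

theorem norm_noise_le (n M : ℕ) (a : ℕ → ℂ × ℂ) : ‖Q.noise n M a‖ ≤ 1 := by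
  induction M with
  | zero => rw [noise_zero]; exact ContinuousLinearMap.norm_id_le
  | succ M ih =>
    rw [noise_succ']
    exact (norm_mul_le _ _).trans (mul_le_one₀ ih (norm_nonneg _) ((Q.isWeyl_N _).norm_le _))

theorem continuous_noise (n M : ℕ) (f : H) : Continuous fun a => Q.noise n M a f := by
  induction M generalizing n with
  | zero => simp only [noise_zero]; exact continuous_const
  | succ M ih =>
    simp only [noise_succ]
    refine (Q.isWeyl_N n).continuous_comp (continuous_apply 0) ?_
    exact (ih (n + 1)).comp (continuous_pi fun k => continuous_apply (k + 1))

/-! ### Independence of the future noises -/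

/-- In the state `ρ`, the noises that enter after the instant `n` are Gaussian and independent of
the amplitude at the instant `n`. -/
def NoiseIndependent (n : ℕ) (ρ : NormalState H) : Prop :=
  ∀ ζ M a, ρ.ev (Q.xWeyl 0 n ζ * Q.noise n M a)
    = ρ.ev (Q.xWeyl 0 n ζ) * ∏ k ∈ Finset.range M, p.noiseWeight (a k)

variable {Q}

theorem IsGaussian.noiseIndependent (hQ : Q.IsGaussian) : Q.NoiseIndependent 0 Q.state := by
  intro ζ M a
  have h1 := hQ M ζ a
  have h2 := hQ 0 ζ a
  simp only [List.range_zero, List.map_nil, List.prod_nil, mul_one, Finset.range_zero,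
    Finset.prod_empty] at h2
  simp only [noise, zero_add, xWeyl]
  rw [h1, h2]
  rfl

namespace NoiseIndependent

variable {n : ℕ} {ρ : NormalState H}

theorem ev_jointWeyl_mul_noise (h : Q.NoiseIndependent n ρ) (b : ℂ × ℂ) (M : ℕ) (a : ℕ → ℂ × ℂ) :
    ρ.ev (Q.jointWeyl n b * Q.noise (n + 1) M a)
      = ρ.ev (Q.xWeyl 0 n (p.pull b)) * p.noiseWeight b * ∏ k ∈ Finset.range M, p.noiseWeight (a k) := by
  have h1 := h (p.pull b) (M + 1) (fun k => Nat.casesOn k b a)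
  rw [noise_succ, Finset.prod_range_succ'] at h1
  rw [jointWeyl, mul_assoc]
  refine Eq.trans h1 ?_
  change _ * (_ * p.noiseWeight b) = _
  ring

theorem ev_jointWeyl (h : Q.NoiseIndependent n ρ) (b : ℂ × ℂ) :
    ρ.ev (Q.jointWeyl n b) = ρ.ev (Q.xWeyl 0 n (p.pull b)) * p.noiseWeight b := by
  simpa [noise_zero] using h.ev_jointWeyl_mul_noise b 0 0

/-- For `e` a Weyl operator of the output, the product with `xWeyl` is a joint Weyl operator, which
contains the noise of step `n` only and is thus independent of the later noises. The defect is a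
normal functional of `e`, so its vanishing extends to the output algebra. -/
theorem ev_output_mul (h : Q.NoiseIndependent n ρ) {e : H →L[ℂ] H} (he : e ∈ Q.outputAlgebra n)
    (ζ : ℂ) (M : ℕ) (a : ℕ → ℂ × ℂ) :
    ρ.ev (e * (Q.xWeyl 0 (n + 1) ζ * Q.noise (n + 1) M a
      - (∏ k ∈ Finset.range M, p.noiseWeight (a k)) • Q.xWeyl 0 (n + 1) ζ)) = 0 := by
  refine (Q.isWeyl_yWeyl_zero n).isProductClosed.tsum_inner_eq_zero
    (summable_sq_apply ρ.summable_sq _) ρ.summable_sq ?_ he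
  rintro _ ⟨θ, rfl⟩
  change ρ.ev (Q.yWeyl 0 n θ * (Q.xWeyl 0 (n + 1) ζ * Q.noise (n + 1) M a
      - (∏ k ∈ Finset.range M, p.noiseWeight (a k)) • Q.xWeyl 0 (n + 1) ζ)) = 0
  rw [mul_sub, ← mul_assoc, mul_smul_comm, yWeyl_mul_xWeyl, NormalState.ev_sub, NormalState.ev_smul,
    h.ev_jointWeyl_mul_noise, h.ev_jointWeyl]
  ring

end NoiseIndependent

end OpenOscillator

section Evolution

variable {Q : OpenOscillator p H} {Y : Type*} [MeasurableSpace Y] {s : Strategy Q Y}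
  (R : Evolution s)

/-- The a posteriori states inherit the independence of the future noises. -/
theorem Evolution.ae_noiseIndependent (hQ : Q.IsGaussian) (n : ℕ) :
    ∀ᵐ h ∂(R.P n), Q.NoiseIndependent n (R.post n h) := by
  induction n with
  | zero => exact .of_forall fun h => by rw [R.post_zero]; exact hQ.noiseIndependent
  | succ n ih =>
    let f : ℕ → (ℂ × (ℕ → ℂ × ℂ)) → History Y (n + 1) → ℂ := fun M x h => (R.post (n + 1) h).ev
      (Q.xWeyl 0 (n + 1) x.1 * Q.noise (n + 1) M x.2
        - (∏ k ∈ Finset.range M, p.noiseWeight (x.2 k)) • Q.xWeyl 0 (n + 1) x.1)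
    -- One null set must serve all the parameters `ζ`, `a`: continuity reduces them to a countable
    -- dense set.
    have hf : ∀ᵐ h ∂(R.P (n + 1)), ∀ M x, f M x h ∈ ({0} : Set ℂ) := by
      refine ae_all_iff.2 fun M => ae_forall_of_continuous isClosed_singleton (fun h => ?_)
        fun x => ?_
      · simp only [f, NormalState.ev_sub, NormalState.ev_smul]
        have h1 : Continuous fun x : ℂ × (ℕ → ℂ × ℂ) => (R.post (n + 1) h).ev (Q.xWeyl 0 (n + 1) x.1) :=
          NormalState.continuous_ev (C := 1) _
            (fun g => ((Q.isWeyl_xWeyl 0 (n + 1)).cont g).comp continuous_fst)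
            (fun x => (Q.isWeyl_xWeyl 0 (n + 1)).norm_le _)
        refine Continuous.sub ?_ (Continuous.mul ?_ h1)
        · refine NormalState.continuous_ev (C := 1) _ (fun g => ?_) fun x => ?_
          · exact (Q.isWeyl_xWeyl 0 (n + 1)).continuous_comp continuous_fst
              ((Q.continuous_noise (n + 1) M g).comp continuous_snd)
          · exact (norm_mul_le _ _).trans (mul_le_one₀ ((Q.isWeyl_xWeyl 0 (n + 1)).norm_le _)
              (norm_nonneg _) (Q.norm_noise_le _ _ _))
        · exact continuous_finsetProd _ fun k _ => p.continuous_noiseWeight.comp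
            ((continuous_apply k).comp continuous_snd)
      · refine R.ae_ev_eq_zero n ?_ (ih.mono fun h hh S hS => ?_)
        · rw [sub_eq_add_neg, ← neg_one_smul ℂ, smul_smul]
          have h1 := Q.xWeyl_mem_futureAlgebra 0 (n + 1) x.1
          have := Q.sum_mem_futureAlgebra (n := n + 1) (Finset.univ : Finset (Fin 2))
            (c := ![_, _]) fun i _ => by
              fin_cases i
              · exact Q.mul_mem_futureAlgebra h1 (Q.noise_mem_futureAlgebra le_rfl M x.2)
              · exact Q.smul_mem_futureAlgebra (-1 * ∏ k ∈ Finset.range M, p.noiseWeight (x.2 k)) h1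
          simpa using this
        · exact hh.ev_output_mul (s.mem_output n h S hS) _ _ _
    filter_upwards [hf] with h hh ζ M a
    have := hh M (ζ, a)
    simp only [f, Set.mem_singleton_iff, NormalState.ev_sub, NormalState.ev_smul] at this
    rw [sub_eq_zero.1 this, mul_comm]

end Evolution

/-! ### The variance kernel -/

/-- The kernel whose positivity expresses that the state contains at least the antinormally
ordered variance `s` and the normally ordered variance `t` (in units of `c`) of Gaussian noise. -/
def varianceKernel (c s t : ℝ) (ρ : NormalState H) (W : ℂ → H →L[ℂ] H) (ζ ζ' : ℂ) : ℂ :=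
  Complex.exp (-(c * (s * (ζ * conj ζ') + t * (conj ζ * ζ')))) * ρ.ev (W (-ζ) * W ζ')

theorem conj_varianceKernel {c s t c' : ℝ} {ρ : NormalState H} {W : ℂ → H →L[ℂ] H}
    (hW : IsWeyl (symp c') W) (ζ ζ' : ℂ) :
    conj (varianceKernel c s t ρ W ζ ζ') = varianceKernel c s t ρ W ζ' ζ := by
  rw [varianceKernel, map_mul, ← NormalState.ev_star, star_mul, hW.star_eq, hW.star_eq, neg_neg,
    ← Complex.exp_conj, varianceKernel]
  congr 2
  simp only [map_neg, map_mul, map_add, Complex.conj_ofReal, Complex.conj_conj]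
  ring

/-- The operator whose expectation is a quadratic form of the variance kernel. -/
def varianceOp (c s t : ℝ) (W : ℂ → H →L[ℂ] H) {N : ℕ} (x a : Fin N → ℂ) : H →L[ℂ] H :=
  ∑ i, ∑ j, (conj (a i) * Complex.exp (-(c * (s * (x i * conj (x j)) + t * (conj (x i) * x j)))) * a j)
    • (W (-x i) * W (x j))

theorem ev_varianceOp (c s t : ℝ) (ρ : NormalState H) (W : ℂ → H →L[ℂ] H) {N : ℕ}
    (x a : Fin N → ℂ) : ρ.ev (varianceOp c s t W x a)
      = ∑ i, ∑ j, conj (a i) * varianceKernel c s t ρ W (x i) (x j) * a j := by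
  simp only [varianceOp, NormalState.ev_sum, NormalState.ev_smul, varianceKernel]
  exact Finset.sum_congr rfl fun i _ => Finset.sum_congr rfl fun j _ => by ring

/-- Positivity becomes a family of inequalities for expectations of operators that do not depend on
the state; this is the form in which it can be conditioned on results. -/
theorem posKernel_varianceKernel_iff {c s t c' : ℝ} {ρ : NormalState H} {W : ℂ → H →L[ℂ] H}
    (hW : IsWeyl (symp c') W) : PosKernel (varianceKernel c s t ρ W) ↔
      ∀ (N : ℕ) (x : (Fin N → ℂ) × (Fin N → ℂ)), 0 ≤ (ρ.ev (varianceOp c s t W x.1 x.2)).re := by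
  constructor
  · intro h N x
    rw [ev_varianceOp]
    exact sum_re_nonneg_of_posKernel h _ _
  · intro h
    refine posKernel_of_sum_re_nonneg (fun i j => conj_varianceKernel hW i j) fun N x a => ?_
    have := h N (x, a)
    rwa [ev_varianceOp] at this

namespace OpenOscillator

variable {Q : OpenOscillator p H}

theorem commute_of_mem {n : ℕ} {b : H →L[ℂ] H} (hb : b ∈ Q.outputAlgebra n) {c : H →L[ℂ] H}
    (hc : c ∈ Q.futureAlgebra (n + 1)) : b * c = c * b :=
  Q.outputAlgebra_commute_futureAlgebra hb hc

theorem varianceOp_mem_futureAlgebra (c s t : ℝ) (n : ℕ) {N : ℕ} (x a : Fin N → ℂ) :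
    varianceOp c s t (Q.xWeyl 0 n) x a ∈ Q.futureAlgebra n := by
  refine Q.sum_mem_futureAlgebra _ fun i _ => Q.sum_mem_futureAlgebra _ fun j _ => ?_
  exact Q.smul_mem_futureAlgebra _ (Q.mul_mem_futureAlgebra (Q.xWeyl_mem_futureAlgebra 0 n _)
    (Q.xWeyl_mem_futureAlgebra 0 n _))

/-- The kernel of the pair of the next amplitude and the output. -/
def jointKernel (Q : OpenOscillator p H) (n : ℕ) (s t : ℝ) (ρ : NormalState H) (a b : ℂ × ℂ) : ℂ :=
  Complex.exp (-(p.hbar * (s * (a.1 * conj b.1) + t * (conj a.1 * b.1))))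
    * ρ.ev (Q.jointWeyl n (-a) * Q.jointWeyl n b)

/-- Because the output commutes with the next amplitude, the Weyl operators of `y` merge with those
of `x_{k+1}` into joint ones. The result is a quadratic sum of the joint kernel with product
coefficients, indexed by pairs. -/
theorem star_mul_varianceOp_mul (n : ℕ) (s t : ℝ) (ρ : NormalState H) {N M : ℕ} (x a : Fin N → ℂ)
    (θ b : Fin M → ℂ) :
    ρ.ev (star (∑ k, b k • Q.yWeyl 0 n (θ k)) * varianceOp p.hbar s t (Q.xWeyl 0 (n + 1)) x a
        * ∑ k, b k • Q.yWeyl 0 n (θ k))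
      = ∑ i : Fin N × Fin M, ∑ j : Fin N × Fin M, conj (a i.1 * b i.2)
          * Q.jointKernel n s t ρ (x i.1, θ i.2) (x j.1, θ j.2) * (a j.1 * b j.2) := by
  have h1 : ∀ i j k l, Q.yWeyl 0 n (-θ k) * (Q.xWeyl 0 (n + 1) (-x i) * Q.xWeyl 0 (n + 1) (x j))
      * Q.yWeyl 0 n (θ l) = Q.jointWeyl n (-(x i, θ k)) * Q.jointWeyl n (x j, θ l) := by
    intro i j k l
    rw [show -(x i, θ k) = (-x i, -θ k) from rfl, ← yWeyl_mul_xWeyl, ← xWeyl_mul_yWeyl]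
    simp only [mul_assoc]
  simp only [star_sum, star_smul, (Q.isWeyl_yWeyl_zero n).star_eq, varianceOp, Finset.sum_mul, Finset.mul_sum, smul_mul_assoc, mul_smul_comm, h1, NormalState.ev_sum,
    NormalState.ev_smul, Fintype.sum_prod_type, jointKernel]
  rw [Finset.sum_comm]
  refine Finset.sum_congr rfl fun i _ => ?_
  rw [Finset.sum_comm, Finset.sum_congr rfl fun j _ => Finset.sum_comm, Finset.sum_comm]
  refine Finset.sum_congr rfl fun k _ => Finset.sum_congr rfl fun j _ =>
    Finset.sum_congr rfl fun l _ => ?_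
  rw [map_mul, ← starRingEnd_apply]
  ring

end OpenOscillator

/-! ### Gaussian factors -/

open scoped ComplexOrder in
theorem posKernel_swap {ι : Type*} {M : ι → ι → ℂ} (hM : PosKernel M) :
    PosKernel fun i j => M j i :=
  Matrix.PosSemidef.transpose hM

open scoped ComplexOrder in
theorem posKernel_comp {ι κ : Type*} {M : ι → ι → ℂ} (hM : PosKernel M) (f : κ → ι) :
    PosKernel fun i j => M (f i) (f j) :=
  Matrix.PosSemidef.submatrix hM f

theorem NormalState.re_ev_star_mul_self_nonneg (ρ : NormalState H) (c : H →L[ℂ] H) :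
    0 ≤ (ρ.ev (star c * c)).re := by
  rw [NormalState.ev, Complex.re_tsum (ρ.summable_ev _)]
  refine tsum_nonneg fun i => ?_
  change 0 ≤ (⟪ρ.vec i, star c (c (ρ.vec i))⟫_ℂ).re
  rw [ContinuousLinearMap.star_eq_adjoint, ContinuousLinearMap.adjoint_inner_right]
  exact inner_self_nonneg (𝕜 := ℂ)

theorem IsWeyl.posKernel_ev {V : Type*} [AddCommGroup V] [TopologicalSpace V] {B : V → V → ℝ}
    {W : V → H →L[ℂ] H} (hW : IsWeyl B W) (ρ : NormalState H) :
    PosKernel fun a b => ρ.ev (W (-a) * W b) := by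
  refine posKernel_of_sum_re_nonneg (fun a b => ?_) fun N x a => ?_
  · rw [← NormalState.ev_star, star_mul, hW.star_eq, hW.star_eq, neg_neg]
  · have := ρ.re_ev_star_mul_self_nonneg (∑ i, a i • W (x i))
    convert this using 2
    simp only [star_sum, star_smul, hW.star_eq, Finset.sum_mul_sum, NormalState.ev_sum,
      smul_mul_assoc, mul_smul_comm, NormalState.ev_smul]
    refine Finset.sum_congr rfl fun i _ => Finset.sum_congr rfl fun j _ => ?_
    rw [← starRingEnd_apply]
    ring

/-- The kernel is tested at `√τ` times the fourth roots of unity `z m`, with the weights `conj (z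
m)`. As the `z m` and their squares sum to zero, the constant term and the term of `A` cancel; the
derivative at `τ = 0` is `16 B`. -/
theorem nonneg_of_posKernel_exp {A B : ℝ}
    (h : PosKernel fun z w : ℂ => Complex.exp (A * (z * conj w) + B * (conj z * w))) : 0 ≤ B := by
  let z : Fin 4 → ℂ := ![1, Complex.I, -1, -Complex.I]
  let e : Fin 4 → Fin 4 → ℂ := fun m l => A * (z m * conj (z l)) + B * (conj (z m) * z l)
  let G : ℝ → ℝ := fun τ => (∑ m, ∑ l, z m * Complex.exp (τ * e m l) * conj (z l)).re
  have h0 : G 0 = 0 := by simp [G, z, Fin.sum_univ_four]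
  have hG : ∀ τ, 0 < τ → 0 ≤ G τ := by
    intro τ hτ
    have := sum_re_nonneg_of_posKernel h (fun m => (√τ : ℂ) * z m) fun m => conj (z m)
    convert this using 2
    refine Finset.sum_congr rfl fun m _ => Finset.sum_congr rfl fun l _ => ?_
    have hs : (√τ : ℂ) * √τ = τ := by rw [← Complex.ofReal_mul, Real.mul_self_sqrt hτ.le]
    simp only [Complex.conj_conj, map_mul, Complex.conj_ofReal, e]
    congr 3
    rw [← hs]
    ring
  have hd : HasDerivAt G (16 * B) 0 := by
    have h1 : ∀ m l, HasDerivAt (fun τ : ℝ => z m * Complex.exp (τ * e m l) * conj (z l))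
        (z m * e m l * conj (z l)) 0 := by
      intro m l
      have := (((Complex.ofRealCLM.hasDerivAt (x := (0 : ℝ))).mul_const (e m l)).cexp.const_mul
        (z m)).mul_const (conj (z l))
      simpa using this
    have h2 : HasDerivAt (fun τ : ℝ => ∑ m, ∑ l, z m * Complex.exp (τ * e m l) * conj (z l))
        (∑ m, ∑ l, z m * e m l * conj (z l)) 0 :=
      HasDerivAt.fun_sum fun m _ => HasDerivAt.fun_sum fun l _ => h1 m l
    have h3 : HasDerivAt G (∑ m, ∑ l, z m * e m l * conj (z l)).re 0 :=
      Complex.reCLM.hasFDerivAt.comp_hasDerivAt (0 : ℝ) h2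
    have h4 : (∑ m, ∑ l, z m * e m l * conj (z l)).re = 16 * B := by
      simp [e, z, Fin.sum_univ_four]
      ring
    rwa [h4] at h3
  have h4 := hd.tendsto_slope_zero_right
  simp only [zero_add, h0, sub_zero, smul_eq_mul] at h4
  have h5 : 0 ≤ 16 * B := ge_of_tendsto h4 (by
    filter_upwards [self_mem_nhdsWithin] with τ hτ
    exact mul_nonneg (inv_nonneg.2 (le_of_lt hτ)) (hG τ hτ))
  linarith

namespace Params

theorem commForm_conj (a b : ℂ × ℂ) : conj (p.commForm a b) = p.commForm b a := by
  simp only [commForm_eq, formKernel, map_add, map_mul, Complex.conj_conj, Complex.conj_ofReal]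
  ring

theorem noiseWeight_eq (a : ℂ × ℂ) :
    p.noiseWeight a = Complex.exp (-(p.hbar * (p.covKernel a a + p.commForm a a / 2))) := by
  have h : p.commForm a a = ((p.commForm a a).re : ℂ) :=
    (Complex.conj_eq_iff_re.1 (p.commForm_conj a a)).symm
  rw [noiseWeight, covKernel_self, h, Complex.ofReal_re]
  push_cast
  rfl

theorem conj_noiseWeight (a : ℂ × ℂ) : conj (p.noiseWeight a) = p.noiseWeight a := by
  rw [noiseWeight, ← Complex.exp_conj, map_neg, Complex.conj_ofReal]

theorem noiseWeight_ne_zero (a : ℂ × ℂ) : p.noiseWeight a ≠ 0 := Complex.exp_ne_zero _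

/-- The expectations of products of noise operators are a rank-one kernel times an exponential. Its
exponent separates into a form in `a` and the conjugate of `b`, and one with the roles exchanged;
only the latter receives the commutator. -/
theorem noiseWeight_sub (a b : ℂ × ℂ) :
    Complex.exp (Complex.I * (p.hbar * (p.commForm (-a) b).im : ℝ)) * p.noiseWeight (b - a)
      = conj (p.noiseWeight a) * p.noiseWeight b
        * Complex.exp (p.hbar * (p.covKernel a b + (p.covKernel b a + p.commForm b a))) := by
  rw [conj_noiseWeight]
  simp only [noiseWeight_eq, ← Complex.exp_add]
  congr 1
  have h : Complex.I * (((p.commForm (-a) b).im : ℝ) : ℂ)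
      = (p.commForm b a - p.commForm a b) / 2 := by
    have h1 : p.commForm (-a) b = -p.commForm a b := by
      simp only [commForm, Prod.fst_neg, Prod.snd_neg]; ring
    rw [Complex.im_eq_sub_conj, h1, map_neg, commForm_conj]
    field_simp
    ring
  rw [Complex.ofReal_mul, mul_left_comm, h]
  simp only [covKernel, commForm_eq, formKernel, Prod.fst_sub, Prod.snd_sub, map_sub]
  ring

end Params

namespace OpenOscillator

variable {Q : OpenOscillator p H}

theorem NoiseIndependent.ev_N {n : ℕ} {ρ : NormalState H} (h : Q.NoiseIndependent n ρ) (a : ℂ × ℂ) :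
    ρ.ev (Q.N n a) = p.noiseWeight a := by
  have := h 0 1 fun _ => a
  rw [(Q.isWeyl_xWeyl 0 n).zero, NormalState.ev_one] at this
  simpa [noise] using this

/-- The uncertainty relation for the noise. -/
theorem IsGaussian.covForm_add_commForm_nonneg (hQ : Q.IsGaussian) (hh : 0 < p.hbar) (a : ℂ × ℂ) :
    0 ≤ p.covForm a + (p.commForm a a).re := by
  have h1 := (Q.isWeyl_N 0).posKernel_ev Q.state
  have h2 : ∀ a b, Q.state.ev (Q.N 0 (-a) * Q.N 0 b) = conj (p.noiseWeight a) * p.noiseWeight b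
        * Complex.exp (p.hbar * (p.covKernel a b + (p.covKernel b a + p.commForm b a))) := by
    intro a b
    rw [Q.N_weyl, NormalState.ev_smul, hQ.noiseIndependent.ev_N, ← p.noiseWeight_sub, neg_add_eq_sub]
  simp only [h2] at h1
  have h3 := posKernel_mul (posKernel_rankOne fun a => (p.noiseWeight a)⁻¹) h1
  -- The rank-one factor never vanishes and has been divided out. On the complex line through `a`
  -- there remains an exponential in `z w̄` and `z̄ w`, and the coefficient of the second is the
  -- asserted form.
  have h4 := posKernel_comp h3 fun z : ℂ => (z * a.1, z * a.2)
  have h5 := nonneg_of_posKernel_exp (A := p.hbar * p.covForm a)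
    (B := p.hbar * (p.covForm a + (p.commForm a a).re)) (by
      convert h4 using 3 with z w
      have hx := (map_ne_zero (starRingEnd ℂ)).2 (p.noiseWeight_ne_zero (z * a.1, z * a.2))
      have hy := p.noiseWeight_ne_zero (w * a.1, w * a.2)
      have hc : p.commForm a a = ((p.commForm a a).re : ℂ) :=
        (Complex.conj_eq_iff_re.1 (p.commForm_conj a a)).symm
      rw [map_inv₀, mul_mul_mul_comm, ← mul_assoc, ← mul_assoc]
      field_simp
      congr 1
      push_cast
      rw [← hc, ← p.covKernel_self]
      simp only [Params.covKernel, Params.commForm_eq, formKernel, map_mul]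
      ring)
  exact nonneg_of_mul_nonneg_right h5 hh

end OpenOscillator


/-! ### Propagation of the variance kernel -/

variable {p : Params} {H : Type*} [NormedAddCommGroup H] [InnerProductSpace ℂ H]
  [CompleteSpace H]

/-- The characteristic function of a Gaussian state with mean `a` and variance `c S`. -/
def gaussianChar (c S : ℝ) (a ζ : ℂ) : ℂ :=
  phase ζ a * Complex.exp (-(c * (S + 1 / 2) * ‖ζ‖ ^ 2 : ℝ))

/-- The coefficients `S` and `S + 1` are the variances in the two operator orders and differ by the
commutator. They are the thresholds for `s` and `t` in `posKernel_varianceKernel_of_gaussian`. -/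
theorem gaussianChar_sub (c S : ℝ) (a ζ ζ' : ℂ) :
    Complex.exp (Complex.I * (symp c (-ζ) ζ' : ℝ)) * gaussianChar c S a (-ζ + ζ')
      = conj (gaussianChar c S a ζ) * gaussianChar c S a ζ'
        * Complex.exp (c * (S * (ζ * conj ζ') + (S + 1) * (conj ζ * ζ'))) := by
  have h1 : Complex.I * (symp c (-ζ) ζ' : ℝ) = c * (conj ζ * ζ' - ζ * conj ζ') / 2 := by
    rw [symp, Complex.ofReal_mul, Complex.im_eq_sub_conj]
    simp only [map_mul, map_neg, Complex.conj_conj]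
    field_simp
    ring
  have h2 : ∀ z : ℂ, ((‖z‖ : ℝ) : ℂ) ^ 2 = z * conj z := fun z => (Complex.mul_conj' z).symm
  simp only [gaussianChar, map_mul, conj_phase, phase_add_left, ← Complex.exp_conj, map_neg,
    Complex.conj_ofReal]
  rw [h1]
  have h3 : Complex.exp (c * (conj ζ * ζ' - ζ * conj ζ') / 2)
      * Complex.exp (-((c * (S + 1 / 2) * ‖-ζ + ζ'‖ ^ 2 : ℝ) : ℂ))
      = Complex.exp (-((c * (S + 1 / 2) * ‖ζ‖ ^ 2 : ℝ) : ℂ))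
        * Complex.exp (-((c * (S + 1 / 2) * ‖ζ'‖ ^ 2 : ℝ) : ℂ))
        * Complex.exp (c * (S * (ζ * conj ζ') + (S + 1) * (conj ζ * ζ'))) := by
    simp only [← Complex.exp_add]
    congr 1
    push_cast
    simp only [h2, map_add, map_neg]
    ring
  linear_combination phase (-ζ) a * phase ζ' a * h3

theorem posKernel_varianceKernel_of_gaussian {c S s t : ℝ} {a : ℂ} {ρ : NormalState H}
    {W : ℂ → H →L[ℂ] H} (hW : IsWeyl (symp c) W) (hρ : ∀ ζ, ρ.ev (W ζ) = gaussianChar c S a ζ)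
    (hc : 0 ≤ c) (hs : s ≤ S) (ht : t ≤ S + 1) : PosKernel (varianceKernel c s t ρ W) := by
  have h1 : PosKernel fun ζ ζ' : ℂ => Complex.exp (((c * (S - s) : ℝ) : ℂ) * (conj (conj ζ) * conj ζ')) :=
    posKernel_exp (posKernel_smul (posKernel_rankOne fun ζ : ℂ => conj ζ)
      (mul_nonneg hc (by linarith)))
  have h2 : PosKernel fun ζ ζ' : ℂ => Complex.exp (((c * (S + 1 - t) : ℝ) : ℂ) * (conj ζ * ζ')) :=
    posKernel_exp (posKernel_smul (posKernel_rankOne fun ζ : ℂ => ζ)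
      (mul_nonneg hc (by linarith)))
  have h3 := posKernel_mul (posKernel_rankOne (gaussianChar c S a)) (posKernel_mul h1 h2)
  convert h3 using 3 with ζ ζ'
  rw [varianceKernel, hW.mul, NormalState.ev_smul, hρ, gaussianChar_sub, ← Complex.exp_add,
    mul_left_comm, ← Complex.exp_add]
  congr 2
  simp only [Complex.conj_conj]
  push_cast
  ring

namespace Params

variable (p)

/-- The antinormally ordered variance that is present for `ε ≤ 0`. -/
def lowerS (n : ℕ) : ℝ := if p.eps ≤ 0 then p.SigAt p.muMin n else 0

/-- The normally ordered variance that is present for `ε > 0`. -/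
def lowerT (n : ℕ) : ℝ := if p.eps ≤ 0 then 0 else p.SigAt p.muMin n + 1

end Params

namespace OpenOscillator

variable {Q : OpenOscillator p H}

/-- The joint Weyl operator is a Weyl operator of `x_n` at the argument `pull` times an independent
noise operator. The joint kernel is thus the pullback of the previous one, times a rank-one kernel,
times an exponential that collects all the quadratic terms. -/
theorem jointKernel_eq {n : ℕ} {ρ : NormalState H} (hρ : Q.NoiseIndependent n ρ) (s t s' t' : ℝ)
    (a b : ℂ × ℂ) : Q.jointKernel n s' t' ρ a b
      = varianceKernel p.hbar s t ρ (Q.xWeyl 0 n) (p.pull a) (p.pull b)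
        * (conj (p.noiseWeight a) * p.noiseWeight b)
        * Complex.exp (p.hbar * (s * (p.pull a * conj (p.pull b)) + t * (conj (p.pull a) * p.pull b)
          + p.covKernel a b + (p.covKernel b a + p.commForm b a)
          - s' * (a.1 * conj b.1) - t' * (conj a.1 * b.1))) := by
  have h1 := (Q.isWeyl_jointWeyl n).mul (-a) b
  have h2 := (Q.isWeyl_xWeyl 0 n).mul (-p.pull a) (p.pull b)
  have hp : p.pull (-a + b) = -p.pull a + p.pull b := by
    simp only [Params.pull, Prod.fst_add, Prod.snd_add, Prod.fst_neg, Prod.snd_neg]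
    ring
  have h3 : jointForm p (-a) b = symp p.hbar (-p.pull a) (p.pull b)
      + p.hbar * (p.commForm (-a) b).im := by
    have := commForm_im_add (p := p) (-a) b
    have hq : p.pull (-a) = -p.pull a := by
      simp only [Params.pull, Prod.fst_neg, Prod.snd_neg]
      ring
    rw [jointForm, ← this, symp, ← hq]
    rfl
  have h4 := p.noiseWeight_sub a b
  rw [← neg_add_eq_sub] at h4
  rw [jointKernel, varianceKernel, h1, h2, NormalState.ev_smul, NormalState.ev_smul,
    hρ.ev_jointWeyl, hp, h3, Complex.ofReal_add, mul_add Complex.I, Complex.exp_add]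
  have e1 : Complex.exp (-(p.hbar * (s' * (a.1 * conj b.1) + t' * (conj a.1 * b.1))))
      * Complex.exp (p.hbar * (p.covKernel a b + (p.covKernel b a + p.commForm b a)))
      = Complex.exp (-(p.hbar * (s * (p.pull a * conj (p.pull b)) + t * (conj (p.pull a) * p.pull b))))
        * Complex.exp (p.hbar * (s * (p.pull a * conj (p.pull b)) + t * (conj (p.pull a) * p.pull b)
          + p.covKernel a b + (p.covKernel b a + p.commForm b a)
          - s' * (a.1 * conj b.1) - t' * (conj a.1 * b.1))) := by
    rw [← Complex.exp_add, ← Complex.exp_add]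
    congr 1
    ring
  set x := Complex.exp (Complex.I * ↑(symp p.hbar (-p.pull a) (p.pull b)))
  set y := ρ.ev (Q.xWeyl 0 n (-p.pull a + p.pull b))
  linear_combination Complex.exp (-(p.hbar * (s' * (a.1 * conj b.1) + t' * (conj a.1 * b.1)))) * x * y * h4
    + x * y * conj (p.noiseWeight a) * p.noiseWeight b * e1

/-- The joint kernel of the next amplitude and the output is positive for the variances of the
Kalman filter with the minimal noise. -/
theorem posKernel_jointKernel (hh : 0 < p.hbar) (hSig : 0 ≤ p.Sig) (hsig : 0 ≤ p.sig)
    (hnu : 0 ≤ p.nu) (hups : ‖p.ups‖ ^ 2 ≤ p.sig * p.nu) (hQ : Q.IsGaussian) {n : ℕ}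
    {ρ : NormalState H} (hρ : Q.NoiseIndependent n ρ)
    (hK : PosKernel (varianceKernel p.hbar (p.lowerS n) (p.lowerT n) ρ (Q.xWeyl 0 n))) :
    PosKernel (Q.jointKernel n (p.lowerS (n + 1)) (p.lowerT (n + 1)) ρ) := by
  have hmu := p.muMin_nonneg
  have hS := p.SigAt_nonneg hSig hsig hnu hmu hups n
  have hpsi := p.psiOf_nonneg hS (add_nonneg hnu hmu)
  have hK' := posKernel_comp hK p.pull
  have hw := posKernel_mul hK' (posKernel_rankOne p.noiseWeight)
  set κ := p.gainOf p.muMin (p.SigAt p.muMin n)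
  have hsq := p.filter_square hS hnu hmu hups
  -- For `ε ≤ 0` the minimal noise is zero, and the square is completed in the terms `a b̄` of the
  -- exponent; the remaining terms `ā b` are positive by the uncertainty relation. For `ε > 0` the
  -- square is completed in the terms `ā b`, where `pull_commForm` yields the summand `ε` that plays
  -- the part of the noise parameter; the covariance form remains.
  by_cases he : p.eps ≤ 0
  · have hform : PosKernel fun a b => p.covKernel b a + p.commForm b a := by
      have h0 := posKernel_formKernel (A := p.sig + (1 - ‖p.phi‖ ^ 2))
        (B := p.nu + (p.eps - ‖p.gamma‖ ^ 2)) (D := -conj p.ups - conj p.phi * p.gamma) fun a => by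
          have := hQ.covForm_add_commForm_nonneg hh a
          convert this using 1
          rw [← Complex.ofReal_re (p.covForm a), ← p.covKernel_self, p.commForm_eq,
            ← Complex.add_re]
          congr 1
          simp only [Params.covKernel, formKernel, map_sub, map_neg, map_mul, Complex.conj_conj]
          push_cast
          ring
      convert posKernel_swap h0 using 3 with a b
      simp only [Params.covKernel, Params.commForm_eq, formKernel, map_sub, map_neg, map_mul,
        Complex.conj_conj]
      push_cast
      ring
    have h1 := posKernel_exp (posKernel_smul hform hh.le)
    have h2 := posKernel_exp (posKernel_smul (posKernel_rankOne fun a : ℂ × ℂ =>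
      conj (a.2 + conj κ * a.1)) (mul_nonneg hh.le hpsi))
    have h3 := posKernel_mul hw (posKernel_mul h1 h2)
    convert h3 using 3 with a b
    rw [jointKernel_eq hρ (p.lowerS n) (p.lowerT n), ← Complex.exp_add]
    congr 2
    have := hsq a b
    have hmz : (p.muMin : ℂ) = 0 := by exact_mod_cast max_eq_left he
    simp only [Params.lowerS, Params.lowerT, if_pos he, Params.SigAt, Complex.conj_conj]
    push_cast at this ⊢
    simp only [κ] at *
    linear_combination (p.hbar : ℂ) * this - (p.hbar : ℂ) * (a.2 * conj b.2) * hmz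
  · have hform : PosKernel p.covKernel := posKernel_formKernel fun a => by
      have := p.covForm_nonneg hsig hnu hups a
      convert this using 1
      rw [← Complex.ofReal_re (p.covForm a), ← p.covKernel_self]
      rfl
    have h1 := posKernel_exp (posKernel_smul hform hh.le)
    have h2 := posKernel_exp (posKernel_smul (posKernel_rankOne fun a : ℂ × ℂ =>
      a.2 + conj κ * a.1) (mul_nonneg hh.le hpsi))
    have h3 := posKernel_mul hw (posKernel_mul h1 h2)
    convert h3 using 3 with a b
    rw [jointKernel_eq hρ (p.lowerS n) (p.lowerT n), ← Complex.exp_add]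
    congr 2
    have h4 := hsq b a
    have h5 := p.pull_commForm b a
    have hmz : p.muMin = p.eps := max_eq_right (not_le.1 he).le
    simp only [Params.lowerS, Params.lowerT, if_neg he, Params.SigAt]
    push_cast at h4 ⊢
    simp only [κ, hmz] at *
    linear_combination (p.hbar : ℂ) * h4 + (p.hbar : ℂ) * h5

theorem IsGaussian.posKernel_zero (hQ : Q.IsGaussian) (hh : 0 < p.hbar) (hSig : 0 ≤ p.Sig) :
    PosKernel (varianceKernel p.hbar (p.lowerS 0) (p.lowerT 0) Q.state (Q.xWeyl 0 0)) := by
  have hρ : ∀ ζ, Q.state.ev (Q.xWeyl 0 0 ζ) = gaussianChar p.hbar p.Sig p.z ζ := fun ζ => by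
    simpa [gaussianChar, xWeyl] using hQ 0 ζ 0
  by_cases he : p.eps ≤ 0
  · simp only [Params.lowerS, Params.lowerT, if_pos he]
    exact posKernel_varianceKernel_of_gaussian (Q.isWeyl_xWeyl 0 0) hρ hh.le le_rfl
      (by linarith)
  · simp only [Params.lowerS, Params.lowerT, if_neg he]
    exact posKernel_varianceKernel_of_gaussian (Q.isWeyl_xWeyl 0 0) hρ hh.le hSig le_rfl

/-- With `e = b²` and `b` self-adjoint in the output algebra, `b` moves past the operator of the
future, which gives an expectation of the form `b* D b`. It suffices to treat finite combinations
`b` of Weyl operators of the output, for which this is a quadratic sum of the joint kernel. -/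
theorem NoiseIndependent.re_ev_eff_mul_varianceOp_nonneg {n : ℕ} {ρ : NormalState H} {s t : ℝ}
    (hK : PosKernel (Q.jointKernel n s t ρ)) {e : H →L[ℂ] H} (he : e ∈ Q.outputAlgebra n)
    (hpos : e.IsPositive) {N : ℕ} (x a : Fin N → ℂ) :
    0 ≤ (ρ.ev (e * varianceOp p.hbar s t (Q.xWeyl 0 (n + 1)) x a)).re := by
  obtain ⟨b, hb, hsb, rfl⟩ := exists_sqrt_mem_bicommutant hpos he
  have hc := varianceOp_mem_futureAlgebra (Q := Q) p.hbar s t (n + 1) x a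
  rw [mul_assoc, commute_of_mem hb hc, ← mul_assoc]
  nth_rw 1 [← hsb]
  refine (Q.isWeyl_yWeyl_zero n).isProductClosed.re_ev_nonneg ρ (fun d hd => ?_) hb
  obtain ⟨f, rfl⟩ := Finsupp.mem_span_range_iff_exists_finsupp.1 hd
  have h1 : (f.sum fun i a => a • Q.yWeyl 0 n i)
      = ∑ k : Fin f.support.card, f (f.support.equivFin.symm k)
        • Q.yWeyl 0 n (f.support.equivFin.symm k) := by
    rw [Finsupp.sum, ← Finset.sum_coe_sort, ← f.support.equivFin.symm.sum_comp]
  rw [h1, Q.star_mul_varianceOp_mul]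
  exact sum_re_nonneg_of_posKernel hK (fun i : Fin N × Fin f.support.card =>
    (x i.1, (f.support.equivFin.symm i.2 : ℂ))) fun i => a i.1 * f (f.support.equivFin.symm i.2)

end OpenOscillator

theorem continuous_ev_varianceOp (c s t : ℝ) (ρ : NormalState H) {c' : ℝ} {W : ℂ → H →L[ℂ] H}
    (hW : IsWeyl (symp c') W) (N : ℕ) :
    Continuous fun x : (Fin N → ℂ) × (Fin N → ℂ) => ρ.ev (varianceOp c s t W x.1 x.2) := by
  simp only [ev_varianceOp, varianceKernel]
  refine continuous_finsetSum _ fun i _ => continuous_finsetSum _ fun j _ => ?_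
  have h : Continuous fun x : (Fin N → ℂ) × (Fin N → ℂ) => ρ.ev (W (-x.1 i) * W (x.1 j)) := by
    refine NormalState.continuous_ev (C := 1) _ (fun f => ?_) fun x => ?_
    · exact hW.continuous_comp (by fun_prop) ((hW.cont f).comp (by fun_prop))
    · exact (norm_mul_le _ _).trans (mul_le_one₀ (hW.norm_le _) (norm_nonneg _) (hW.norm_le _))
  fun_prop

/-- The variance of the amplitude in the a posteriori states of an arbitrary strategy is bounded
from below by that of the Kalman filter with the minimal noise. -/
theorem Evolution.ae_posKernel {Q : OpenOscillator p H} {Y : Type*} [MeasurableSpace Y]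
    {s : Strategy Q Y} (R : Evolution s) (hh : 0 < p.hbar) (hSig : 0 ≤ p.Sig) (hsig : 0 ≤ p.sig)
    (hnu : 0 ≤ p.nu) (hups : ‖p.ups‖ ^ 2 ≤ p.sig * p.nu) (hQ : Q.IsGaussian) (n : ℕ) :
    ∀ᵐ h ∂(R.P n), PosKernel (varianceKernel p.hbar (p.lowerS n) (p.lowerT n) (R.post n h)
      (Q.xWeyl 0 n)) := by
  induction n with
  | zero => exact .of_forall fun h => by rw [R.post_zero]; exact hQ.posKernel_zero hh hSig
  | succ n ih =>
    simp only [posKernel_varianceKernel_iff (Q.isWeyl_xWeyl 0 (n + 1))]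
    refine ae_all_iff.2 fun N => ?_
    have key : ∀ x : (Fin N → ℂ) × (Fin N → ℂ), ∀ᵐ h ∂(R.P (n + 1)),
        ((R.post (n + 1) h).ev (varianceOp p.hbar (p.lowerS (n + 1)) (p.lowerT (n + 1))
          (Q.xWeyl 0 (n + 1)) x.1 x.2)).re ∈ Set.Ici (0 : ℝ) := fun x => by
      refine R.ae_re_ev_nonneg n (OpenOscillator.varianceOp_mem_futureAlgebra _ _ _ _ x.1 x.2) ?_
      filter_upwards [ih, R.ae_noiseIndependent hQ n] with h hK hind S hS
      exact OpenOscillator.NoiseIndependent.re_ev_eff_mul_varianceOp_nonneg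
        (OpenOscillator.posKernel_jointKernel hh hSig hsig hnu hups hQ hind hK)
        (s.mem_output n h S hS) ((s.meas n h).pos S hS) x.1 x.2
    exact ae_forall_of_continuous isClosed_Ici (fun h => Complex.continuous_re.comp
      (continuous_ev_varianceOp _ _ _ _ (Q.isWeyl_xWeyl 0 (n + 1)) N)) key


/-! ### Strongly continuous unitary groups -/

section Groups

variable {H : Type*} [NormedAddCommGroup H] [InnerProductSpace ℂ H] [CompleteSpace H]

/-- A bounded sequence has a weak limit along an ultrafilter. -/
theorem exists_weak_limit {d : ℕ → H} {C : ℝ} (hd : ∀ n, ‖d n‖ ≤ C) :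
    ∃ g, ∀ y, Filter.Tendsto (fun n => ⟪y, d n⟫_ℂ) (Filter.hyperfilter ℕ) (nhds ⟪y, g⟫_ℂ) := by
  let x : ℕ → WeakDual ℂ H := fun n => StrongDual.toWeakDual (InnerProductSpace.toDual ℂ H (d n))
  have hx : ∀ n, x n ∈ WeakDual.toStrongDual ⁻¹' Metric.closedBall (0 : StrongDual ℂ H) C := by
    intro n
    simp only [Set.mem_preimage, mem_closedBall_zero_iff]
    exact ((InnerProductSpace.toDual ℂ H).norm_map (d n)).le.trans (hd n)
  obtain ⟨y₀, -, h⟩ := (WeakDual.isCompact_closedBall (0 : StrongDual ℂ H) C).ultrafilter_le_nhds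
    ((Filter.hyperfilter ℕ).map x) (by
      rw [Filter.le_principal_iff, Ultrafilter.mem_coe, Ultrafilter.mem_map]
      exact Filter.univ_mem' hx)
  refine ⟨(InnerProductSpace.toDual ℂ H).symm (WeakDual.toStrongDual y₀), fun y => ?_⟩
  have h1 : Filter.Tendsto (fun n => x n y) (Filter.hyperfilter ℕ) (nhds (y₀ y)) :=
    ((WeakDual.eval_continuous y).tendsto y₀).comp h
  have h2 := (Complex.continuous_conj.tendsto _).comp h1
  have h3 : conj (y₀ y) = ⟪y, (InnerProductSpace.toDual ℂ H).symm (WeakDual.toStrongDual y₀)⟫_ℂ := by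
    rw [← inner_conj_symm, InnerProductSpace.toDual_symm_apply]
    rfl
  rw [h3] at h2
  refine h2.congr fun n => ?_
  change conj (⟪d n, y⟫_ℂ) = _
  rw [inner_conj_symm]

/-- A strongly continuous group of unitary operators. -/
structure IsUnitaryGroup (U : ℝ → H →L[ℂ] H) : Prop where
  add : ∀ s t f, U (s + t) f = U s (U t f)
  zero : ∀ f, U 0 f = f
  norm_apply : ∀ t f, ‖U t f‖ = ‖f‖
  cont : ∀ f, Continuous fun t => U t f

/-- The dyadic sequence of times. -/
def dyadic (n : ℕ) : ℝ := (2 ^ n)⁻¹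

theorem dyadic_pos (n : ℕ) : 0 < dyadic n := by unfold dyadic; positivity

theorem dyadic_succ (n : ℕ) : dyadic n = 2 * dyadic (n + 1) := by
  unfold dyadic
  rw [pow_succ]
  field_simp

theorem tendsto_dyadic : Filter.Tendsto dyadic Filter.atTop (nhdsWithin 0 (Set.Ioi 0)) := by
  refine tendsto_nhdsWithin_iff.2 ⟨?_, .of_forall dyadic_pos⟩
  have := tendsto_pow_atTop_nhds_zero_of_lt_one (r := (1 / 2 : ℝ)) (by norm_num) (by norm_num)
  refine this.congr fun n => ?_
  rw [dyadic, one_div, inv_pow]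

namespace IsUnitaryGroup

variable {U : ℝ → H →L[ℂ] H} (hU : IsUnitaryGroup U)

include hU

theorem hasDerivAt {f g : H} (h : HasDerivAt (fun t => U t f) g 0) (t : ℝ) :
    HasDerivAt (fun s => U s f) (U t g) t := by
  have h1 : HasDerivAt (fun s => U (s - t) f) g t :=
    HasDerivAt.comp_sub_const t t (by rwa [sub_self])
  have h2 := ((U t).restrictScalars ℝ).hasFDerivAt.comp_hasDerivAt t h1
  refine h2.congr_of_eventuallyEq (.of_forall fun s => ?_)
  change U s f = U t (U (s - t) f)
  rw [← hU.add, add_sub_cancel]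

theorem norm_sub_le {f g : H} (h : HasDerivAt (fun t => U t f) g 0) (t : ℝ) :
    ‖U t f - f‖ ≤ ‖g‖ * |t| := by
  have := Convex.norm_image_sub_le_of_norm_hasDerivWithin_le (s := Set.univ) (C := ‖g‖)
    (f := fun t => U t f) (x := 0) (y := t) (fun s _ => (hU.hasDerivAt h s).hasDerivWithinAt)
    (fun s _ => (hU.norm_apply s g).le) convex_univ (Set.mem_univ _) (Set.mem_univ _)
  simpa [hU.zero] using this

/-- This comparison of the times `t` and `2 t` is the reason for dyadic times: it makes the
difference quotients monotone. -/
theorem norm_two_mul_sub_le (t : ℝ) (f : H) : ‖U (2 * t) f - f‖ ≤ 2 * ‖U t f - f‖ := by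
  have : U (2 * t) f - f = U t (U t f - f) + (U t f - f) := by
    rw [map_sub, ← hU.add, two_mul]; abel
  rw [this, two_mul]
  exact (norm_add_le _ _).trans (by rw [hU.norm_apply])

/-- The squared difference quotient at a dyadic time. -/
theorem quot_mono (f : H) :
    Monotone fun n => ‖U (dyadic n) f - f‖ ^ 2 / dyadic n ^ 2 := by
  refine monotone_nat_of_le_succ fun n => ?_
  have h0 := dyadic_pos (n + 1)
  rw [dyadic_succ n]
  generalize dyadic (n + 1) = x at *
  have h := pow_le_pow_left₀ (norm_nonneg _) (hU.norm_two_mul_sub_le x f) 2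
  rw [div_le_div_iff₀ (by positivity) (by positivity)]
  nlinarith [mul_le_mul_of_nonneg_right h (sq_nonneg x)]

theorem tendsto_quot {f g : H} (h : HasDerivAt (fun t => U t f) g 0) :
    Filter.Tendsto (fun n => ‖U (dyadic n) f - f‖ ^ 2 / dyadic n ^ 2) Filter.atTop
      (nhds (‖g‖ ^ 2)) := by
  have h1 := (h.tendsto_slope_zero_right.comp tendsto_dyadic).norm.pow 2
  refine h1.congr fun n => ?_
  simp only [Function.comp, zero_add, hU.zero, norm_smul, norm_inv, Real.norm_eq_abs,
    abs_of_pos (dyadic_pos n), mul_pow]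
  field_simp

/-- The integral of the group over an interval. -/
def primitive (t : ℝ) : H →L[ℂ] H :=
  LinearMap.mkContinuous
    { toFun := fun x => ∫ s in (0 : ℝ)..t, U s x
      map_add' := fun x y => by
        simp only [map_add]
        exact intervalIntegral.integral_add ((hU.cont x).intervalIntegrable _ _)
          ((hU.cont y).intervalIntegrable _ _)
      map_smul' := fun a x => by
        simp only [map_smul, RingHom.id_apply]
        exact intervalIntegral.integral_smul _ _ } |t| fun x => by
      have := intervalIntegral.norm_integral_le_of_norm_le_const (a := 0) (b := t) (C := ‖x‖)
        (f := fun s => U s x) fun s _ => (hU.norm_apply s x).le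
      rw [sub_zero] at this
      rw [mul_comm]
      exact this

theorem primitive_apply (t : ℝ) (x : H) : hU.primitive t x = ∫ s in (0 : ℝ)..t, U s x := rfl

/-- The integrals of the shifted and of the original orbit overlap up to two short intervals, so the
integrated quotient converges for every vector, in the domain or not. -/
theorem primitive_quot (t : ℝ) (f : H) : Filter.Tendsto
    (fun n => hU.primitive t ((dyadic n)⁻¹ • (U (dyadic n) f - f))) Filter.atTop
      (nhds (U t f - f)) := by
  let G : ℝ → H := fun τ => ∫ s in (0 : ℝ)..τ, U s f
  have hG : ∀ τ, HasDerivAt G (U τ f) τ := fun τ => ((hU.cont f).integral_hasStrictDerivAt 0 τ).hasDerivAt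
  have h1 := ((hG t).tendsto_slope_zero_right.comp tendsto_dyadic).sub
    ((hG 0).tendsto_slope_zero_right.comp tendsto_dyadic)
  rw [hU.zero] at h1
  refine h1.congr fun n => ?_
  have hi : ∀ a b : ℝ, IntervalIntegrable (fun s => U s f) volume a b := fun a b =>
    (hU.cont f).intervalIntegrable _ _
  have h2 : hU.primitive t (U (dyadic n) f) = G (t + dyadic n) - G (dyadic n) := by
    simp only [primitive_apply, ← hU.add]
    rw [intervalIntegral.integral_comp_add_right (fun s => U s f), zero_add]
    exact (intervalIntegral.integral_interval_sub_left (hi _ _) (hi _ _)).symm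
  have hG0 : G 0 = 0 := intervalIntegral.integral_same
  have h3 : hU.primitive t f = G t := rfl
  simp only [Function.comp, zero_add, hG0, sub_zero]
  rw [← smul_sub, ← Complex.coe_smul, ← Complex.coe_smul, map_smul, map_sub, h2, h3]
  congr 1
  abel

/-- A vector with bounded difference quotients belongs to the domain of the generator. -/
theorem differentiableAt_of_bounded {f : H} {C : ℝ}
    (hC : ∀ n, ‖U (dyadic n) f - f‖ ^ 2 / dyadic n ^ 2 ≤ C) :
    DifferentiableAt ℝ (fun t => U t f) 0 := by
  obtain ⟨g, hg⟩ := exists_weak_limit (d := fun n => (dyadic n)⁻¹ • (U (dyadic n) f - f))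
    (C := √C) fun n => by
      rw [norm_smul, norm_inv, Real.norm_eq_abs, abs_of_pos (dyadic_pos n)]
      refine Real.le_sqrt_of_sq_le ?_
      convert hC n using 1
      have := (dyadic_pos n).ne'
      field_simp
  -- A weak limit `g` of the quotients suffices: the bounded operator `primitive t` preserves weak
  -- limits, and the integral equation thus obtained yields differentiability in norm.
  have key : ∀ t, U t f - f = hU.primitive t g := by
    intro t
    refine ext_inner_left ℂ fun y => ?_
    have h1 := (Filter.Tendsto.inner (𝕜 := ℂ) (tendsto_const_nhds (x := y))
      (hU.primitive_quot t f)).mono_left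
        Nat.hyperfilter_le_atTop
    have h2 := hg (ContinuousLinearMap.adjoint (hU.primitive t) y)
    simp only [ContinuousLinearMap.adjoint_inner_left] at h2
    exact tendsto_nhds_unique h1 h2
  have h3 : (fun t => U t f) = fun t => f + ∫ s in (0 : ℝ)..t, U s g := by
    funext t
    rw [← primitive_apply hU, ← key t, add_sub_cancel]
  rw [h3]
  exact (((hU.cont g).integral_hasStrictDerivAt 0 0).hasDerivAt.const_add f).differentiableAt

end IsUnitaryGroup

end Groups


/-! ### Amplitude operators -/

section Amplitude

open Filter

theorem hasSum_of_eq {f g : ℕ → ℝ} {a b : ℝ} (h : HasSum f a) (e : ∀ i, g i = f i) (e' : b = a) :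
    HasSum g b := by
  rwa [funext e, e']

variable {H : Type*} [NormedAddCommGroup H] [InnerProductSpace ℂ H] [CompleteSpace H]
  {c : ℝ} {W : ℂ → H →L[ℂ] H}

namespace IsWeyl

variable (hW : IsWeyl (symp c) W)

include hW

theorem isUnitaryGroup (e : ℂ) : IsUnitaryGroup fun t : ℝ => W (t * e) where
  add s t f := by
    have h := congrArg (fun T => T f) (hW.mul (s * e) (t * e))
    have h0 : symp c (s * e) (t * e) = 0 := by
      simp only [symp, map_mul, Complex.conj_ofReal, Complex.mul_im, Complex.mul_re,
        Complex.ofReal_re, Complex.ofReal_im, Complex.conj_re, Complex.conj_im]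
      ring
    rw [h0] at h
    simp only [Complex.ofReal_zero, mul_zero, Complex.exp_zero, one_smul] at h
    rw [show ((s + t : ℝ) : ℂ) * e = s * e + t * e by push_cast; ring, ← h]
    rfl
  zero f := by simp [hW.zero]
  norm_apply t f := hW.norm_apply _ f
  cont f := (hW.cont f).comp (by fun_prop)

theorem isUnitaryGroup_one : IsUnitaryGroup fun t : ℝ => W (t : ℂ) := by
  simpa using hW.isUnitaryGroup 1

/-- The commutation relation on vectors that are only in the domains of the two generators. Forward
quotients are paired with each other and compared with the backward ones: the Weyl relation
exchanges the factors at the cost of `exp (2 i c t²)`, all other terms cancel, and no second-order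
domain is needed. -/
theorem inner_generators {f a b : H} (ha : HasDerivAt (fun t : ℝ => W (t : ℂ) f) a 0)
    (hb : HasDerivAt (fun t : ℝ => W ((t : ℂ) * Complex.I) f) b 0) :
    ⟪a, b⟫_ℂ - ⟪b, a⟫_ℂ = 2 * Complex.I * c * (‖f‖ ^ 2 : ℝ) := by
  have hqa : Tendsto (fun n => (dyadic n)⁻¹ • (W (dyadic n : ℂ) f - f)) atTop (nhds a) := by
    refine (ha.tendsto_slope_zero_right.comp tendsto_dyadic).congr fun n => ?_
    simp [hW.zero]
  have hqb : Tendsto (fun n => (dyadic n)⁻¹ • (W ((dyadic n : ℂ) * Complex.I) f - f)) atTop (nhds b) := by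
    refine (hb.tendsto_slope_zero_right.comp tendsto_dyadic).congr fun n => ?_
    simp [hW.zero]
  have hneg : Tendsto (fun n => -dyadic n) atTop (nhdsWithin 0 (Set.Iio 0)) := by
    refine tendsto_nhdsWithin_iff.2 ⟨?_, .of_forall fun n => by simpa using dyadic_pos n⟩
    simpa using (tendsto_nhdsWithin_iff.1 tendsto_dyadic).1.neg
  have hqa' : Tendsto (fun n => (-dyadic n)⁻¹ • (W (-(dyadic n : ℂ)) f - f)) atTop (nhds a) := by
    refine (ha.tendsto_slope_zero_left.comp hneg).congr fun n => ?_
    simp [hW.zero]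
  have hqb' : Tendsto (fun n => (-dyadic n)⁻¹ • (W (-((dyadic n : ℂ) * Complex.I)) f - f)) atTop
      (nhds b) := by
    refine (hb.tendsto_slope_zero_left.comp hneg).congr fun n => ?_
    simp [hW.zero]
  have h1 := (hqa.inner (𝕜 := ℂ) hqb).sub (hqb'.inner (𝕜 := ℂ) hqa')
  have h2 : ∀ n, ⟪(dyadic n)⁻¹ • (W (dyadic n : ℂ) f - f),
        (dyadic n)⁻¹ • (W ((dyadic n : ℂ) * Complex.I) f - f)⟫_ℂ
      - ⟪(-dyadic n)⁻¹ • (W (-((dyadic n : ℂ) * Complex.I)) f - f),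
        (-dyadic n)⁻¹ • (W (-(dyadic n : ℂ)) f - f)⟫_ℂ
      = (((dyadic n ^ 2)⁻¹ : ℝ) : ℂ) * (Complex.exp (2 * Complex.I * c * ((dyadic n ^ 2 : ℝ) : ℂ)) - 1)
        * ⟪W (-((dyadic n : ℂ) * Complex.I)) f, W (-(dyadic n : ℂ)) f⟫_ℂ := by
    intro n
    set t := dyadic n
    have e1 := hW.mul (-(t : ℂ)) (t * Complex.I)
    have e2 := hW.mul (t * Complex.I) (-(t : ℂ))
    have s1 : symp c (-(t : ℂ)) (t * Complex.I) = c * t ^ 2 := by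
      simp [symp, sq]
    have s2 : symp c (t * Complex.I) (-(t : ℂ)) = -(c * t ^ 2) := by
      simp [symp, sq]
    rw [s1] at e1
    rw [s2, add_comm] at e2
    have e3 : ⟪W (t : ℂ) f, W (t * Complex.I) f⟫_ℂ
        = Complex.exp (2 * Complex.I * c * ((t ^ 2 : ℝ) : ℂ))
          * ⟪W (-(t * Complex.I)) f, W (-(t : ℂ)) f⟫_ℂ := by
      rw [hW.inner_left, hW.inner_left, neg_neg]
      have f1 : W (-(t : ℂ)) (W (t * Complex.I) f) = (W (-(t : ℂ)) * W (t * Complex.I)) f := rfl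
      have f2 : W (t * Complex.I) (W (-(t : ℂ)) f) = (W (t * Complex.I) * W (-(t : ℂ))) f := rfl
      rw [f1, f2, e1, e2, smul_apply, smul_apply, inner_smul_right, inner_smul_right, ← mul_assoc,
        ← Complex.exp_add]
      congr 2
      push_cast
      ring
    have e4 : ⟪f, W (t * Complex.I) f⟫_ℂ = ⟪W (-(t * Complex.I)) f, f⟫_ℂ := by
      rw [hW.inner_left, neg_neg]
    have e5 : ⟪f, W (-(t : ℂ)) f⟫_ℂ = ⟪W (t : ℂ) f, f⟫_ℂ := by rw [hW.inner_left]
    simp only [← Complex.coe_smul, inner_smul_left, inner_smul_right, inner_sub_left,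
      inner_sub_right, e3, e4, e5, Complex.conj_ofReal]
    push_cast
    rw [inv_neg]
    ring
  have h3 : Tendsto (fun n => (((dyadic n ^ 2)⁻¹ : ℝ) : ℂ)
        * (Complex.exp (2 * Complex.I * c * ((dyadic n ^ 2 : ℝ) : ℂ)) - 1)
        * ⟪W (-((dyadic n : ℂ) * Complex.I)) f, W (-(dyadic n : ℂ)) f⟫_ℂ) atTop
      (nhds (2 * Complex.I * c * ⟪f, f⟫_ℂ)) := by
    have hz : Tendsto (fun n => (dyadic n : ℂ)) atTop (nhds 0) :=
      (Complex.continuous_ofReal.tendsto' 0 0 rfl).comp (tendsto_nhdsWithin_iff.1 tendsto_dyadic).1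
    refine Tendsto.mul ?_ (Tendsto.inner ?_ ?_)
    · have hd : HasDerivAt (fun τ : ℝ => Complex.exp (2 * Complex.I * c * (τ : ℂ)))
          (2 * Complex.I * c) 0 := by
        have := ((Complex.ofRealCLM.hasDerivAt (x := (0 : ℝ))).const_mul (2 * Complex.I * c)).cexp
        simpa using this
      have hsq : Tendsto (fun n => dyadic n ^ 2) atTop (nhdsWithin 0 (Set.Ioi 0)) := by
        refine tendsto_nhdsWithin_iff.2 ⟨?_, .of_forall fun n => pow_pos (dyadic_pos n) 2⟩
        simpa using (tendsto_nhdsWithin_iff.1 tendsto_dyadic).1.pow 2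
      refine (hd.tendsto_slope_zero_right.comp hsq).congr fun n => ?_
      simp
    · have := ((hW.cont f).comp (g := fun a => W a f) (f := fun z : ℂ => -(z * Complex.I))
        (by fun_prop)).tendsto 0
      simp only [Function.comp, zero_mul, neg_zero, hW.zero, one_apply_eq_self] at this
      exact this.comp hz
    · have := ((hW.cont f).comp (g := fun a => W a f) (f := fun z : ℂ => -z)
        (by fun_prop)).tendsto 0
      simp only [Function.comp, neg_zero, hW.zero, one_apply_eq_self] at this
      exact this.comp hz
  have h4 := tendsto_nhds_unique (h1.congr h2) h3
  rw [h4, inner_self_eq_norm_sq_to_K]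
  push_cast
  rfl

/-- The commutator converts the symmetric sum of the squared generators, which difference quotients
control, into the normally ordered energy. -/
theorem norm_amp_sq {f a b : H} (ha : HasDerivAt (fun t : ℝ => W (t : ℂ) f) a 0)
    (hb : HasDerivAt (fun t : ℝ => W ((t : ℂ) * Complex.I) f) b 0) :
    ‖amp W f‖ ^ 2 = (‖a‖ ^ 2 + ‖b‖ ^ 2) / 4 - c / 2 * ‖f‖ ^ 2 := by
  have h := hW.inner_generators ha hb
  rw [amp, ha.deriv, hb.deriv]
  have h1 : ⟪b, a⟫_ℂ = conj ⟪a, b⟫_ℂ := (inner_conj_symm _ _).symm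
  rw [h1] at h
  have h2 : (⟪a, b⟫_ℂ).im = c * ‖f‖ ^ 2 := by
    have := congrArg Complex.im h
    have e : 2 * Complex.I * (c : ℂ) * ((‖f‖ ^ 2 : ℝ) : ℂ) = ((2 * c * ‖f‖ ^ 2 : ℝ) : ℂ) * Complex.I := by
      push_cast; ring
    rw [e] at this
    simp only [Complex.sub_im, Complex.conj_im, Complex.mul_im, Complex.ofReal_re, Complex.ofReal_im,
      Complex.I_im, Complex.I_re] at this
    linarith
  have h3 := norm_add_sq (𝕜 := ℂ) a (Complex.I • b)
  rw [norm_smul, mul_pow, h3, norm_smul, inner_smul_right]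
  have h4 : RCLike.re (Complex.I * ⟪a, b⟫_ℂ) = -(c * ‖f‖ ^ 2) := by
    rw [← h2]
    simp
  rw [h4]
  simp only [norm_div, norm_one, Complex.norm_ofNat, Complex.norm_I, one_mul]
  ring

end IsWeyl

/-! ### Energies -/

/-- The mean square of the difference quotients of the Weyl operators in two directions, in terms
of the characteristic function. -/
def charQuot (ρ : NormalState H) (W : ℂ → H →L[ℂ] H) (n : ℕ) : ℝ :=
  (2 - (ρ.ev (W (dyadic n : ℂ))).re - (ρ.ev (W ((dyadic n : ℂ) * Complex.I))).re) / (2 * dyadic n ^ 2)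

/-- The mean square of the difference quotients for a single vector. -/
def vecQuot (W : ℂ → H →L[ℂ] H) (n : ℕ) (f : H) : ℝ :=
  (‖W (dyadic n : ℂ) f - f‖ ^ 2 / dyadic n ^ 2
    + ‖W ((dyadic n : ℂ) * Complex.I) f - f‖ ^ 2 / dyadic n ^ 2) / 4

theorem vecQuot_nonneg (n : ℕ) (f : H) : 0 ≤ vecQuot W n f := by
  unfold vecQuot; positivity

section

variable (hW : IsWeyl (symp c) W)

include hW

theorem vecQuot_mono (f : H) : Monotone fun n => vecQuot W n f := by
  intro m n h
  have h1 := hW.isUnitaryGroup_one.quot_mono f h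
  have h2 := (hW.isUnitaryGroup Complex.I).quot_mono f h
  simp only at h1 h2
  simp only [vecQuot]
  linarith

theorem hasSum_vecQuot (ρ : NormalState H) (n : ℕ) :
    HasSum (fun i => vecQuot W n (ρ.vec i)) (charQuot ρ W n) := by
  have h1 : ∀ ζ, HasSum (fun i => ‖W ζ (ρ.vec i) - ρ.vec i‖ ^ 2) (2 - 2 * (ρ.ev (W ζ)).re) := by
    intro ζ
    have h2 := (ρ.normalized.mul_left 2).sub
      ((Complex.hasSum_re (ρ.summable_ev (W ζ)).hasSum).mul_left 2)
    rw [mul_one] at h2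
    refine hasSum_of_eq h2 (fun i => ?_) rfl
    have h4 := norm_sub_sq (𝕜 := ℂ) (W ζ (ρ.vec i)) (ρ.vec i)
    rw [hW.norm_apply, ← inner_conj_symm, RCLike.conj_re] at h4
    rw [h4]
    change _ - 2 * (⟪ρ.vec i, W ζ (ρ.vec i)⟫_ℂ).re + _ = _
    ring
  have h3 := ((h1 (dyadic n : ℂ)).add (h1 ((dyadic n : ℂ) * Complex.I))).mul_left
    (1 / (4 * dyadic n ^ 2))
  have := (dyadic_pos n).ne'
  refine hasSum_of_eq h3 (fun i => ?_) ?_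
  · simp only [vecQuot]
    field_simp
  · simp only [charQuot]
    field_simp
    ring

theorem inDom_of_bounded {f : H} {C : ℝ} (h : ∀ n, vecQuot W n f ≤ C) : InDom W f := by
  refine ⟨hW.isUnitaryGroup_one.differentiableAt_of_bounded (C := 4 * C) fun n => ?_,
    (hW.isUnitaryGroup Complex.I).differentiableAt_of_bounded (C := 4 * C) fun n => ?_⟩ <;>
  · have h1 := h n
    simp only [vecQuot] at h1
    have h2 : 0 ≤ ‖W (dyadic n : ℂ) f - f‖ ^ 2 / dyadic n ^ 2 := by positivity
    have h3 : 0 ≤ ‖W ((dyadic n : ℂ) * Complex.I) f - f‖ ^ 2 / dyadic n ^ 2 := by positivity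
    linarith

theorem tendsto_vecQuot {f : H} (hf : InDom W f) :
    Tendsto (fun n => vecQuot W n f) atTop (nhds (‖amp W f‖ ^ 2 + c / 2 * ‖f‖ ^ 2)) := by
  have h1 := hW.isUnitaryGroup_one.tendsto_quot hf.1.hasDerivAt
  have h2 := (hW.isUnitaryGroup Complex.I).tendsto_quot hf.2.hasDerivAt
  have h3 := (h1.add h2).div_const 4
  rw [hW.norm_amp_sq hf.1.hasDerivAt hf.2.hasDerivAt, sub_add_cancel]
  exact h3

theorem iSup_vecQuot {f : H} (hf : InDom W f) (hc : 0 ≤ c) :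
    ⨆ n, ENNReal.ofReal (vecQuot W n f)
      = ENNReal.ofReal (‖amp W f‖ ^ 2) + ENNReal.ofReal (c / 2 * ‖f‖ ^ 2) := by
  rw [← ENNReal.ofReal_add (by positivity) (by positivity)]
  exact iSup_eq_of_tendsto (fun m n h => ENNReal.ofReal_le_ofReal (vecQuot_mono hW f h))
    ((ENNReal.continuous_ofReal.tendsto _).comp (tendsto_vecQuot hW hf))

theorem charQuot_nonneg (ρ : NormalState H) (n : ℕ) : 0 ≤ charQuot ρ W n :=
  (hasSum_vecQuot hW ρ n).nonneg fun _ => vecQuot_nonneg n _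

theorem ofReal_charQuot (ρ : NormalState H) (n : ℕ) :
    ENNReal.ofReal (charQuot ρ W n) = ∑' i, ENNReal.ofReal (vecQuot W n (ρ.vec i)) := by
  rw [← (hasSum_vecQuot hW ρ n).tsum_eq,
    ENNReal.ofReal_tsum_of_nonneg (fun i => vecQuot_nonneg n _) (hasSum_vecQuot hW ρ n).summable]

theorem charQuot_mono (ρ : NormalState H) : Monotone fun n => ENNReal.ofReal (charQuot ρ W n) := by
  intro m n h
  simp only [ofReal_charQuot hW]
  exact ENNReal.tsum_le_tsum fun i => ENNReal.ofReal_le_ofReal (vecQuot_mono hW _ h)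

/-- Monotone convergence in the index of the vectors. It holds for infinite energy too: a finite
supremum for a vector puts it into the domain, so a vector outside makes both sides infinite. -/
theorem iSup_charQuot (ρ : NormalState H) (hc : 0 ≤ c) :
    ⨆ n, ENNReal.ofReal (charQuot ρ W n) = ρ.energy W + ENNReal.ofReal (c / 2) := by
  have h1 : ⨆ n, ENNReal.ofReal (charQuot ρ W n)
      = ∑' i, ⨆ n, ENNReal.ofReal (vecQuot W n (ρ.vec i)) := by
    simp only [ofReal_charQuot hW, ← lintegral_count]
    exact (lintegral_iSup (f := fun n i => ENNReal.ofReal (vecQuot W n (ρ.vec i)))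
      (fun n => measurable_from_nat)
      fun m n h i => ENNReal.ofReal_le_ofReal (vecQuot_mono hW _ h)).symm
  rw [h1]
  by_cases hd : ∀ i, InDom W (ρ.vec i)
  · rw [NormalState.energy, if_pos hd, tsum_congr fun i => iSup_vecQuot hW (hd i) hc,
      ENNReal.tsum_add]
    congr 1
    rw [← ENNReal.ofReal_tsum_of_nonneg (fun i => by positivity) (ρ.summable_sq.mul_left _),
      (ρ.normalized.mul_left (c / 2)).tsum_eq, mul_one]
  · rw [NormalState.energy, if_neg hd, top_add, ENNReal.tsum_eq_top_of_eq_top]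
    push Not at hd
    obtain ⟨i, hi⟩ := hd
    refine ⟨i, by_contra fun hne => hi (inDom_of_bounded hW (C := (⨆ n,
      ENNReal.ofReal (vecQuot W n (ρ.vec i))).toReal) fun n => ?_)⟩
    rw [← ENNReal.ofReal_le_iff_le_toReal hne]
    exact le_iSup (fun n => ENNReal.ofReal (vecQuot W n (ρ.vec i))) n

theorem tendsto_charQuot (ρ : NormalState H) (hc : 0 ≤ c) :
    Tendsto (fun n => ENNReal.ofReal (charQuot ρ W n)) atTop
      (nhds (ρ.energy W + ENNReal.ofReal (c / 2))) := by
  rw [← iSup_charQuot hW ρ hc]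
  exact tendsto_atTop_iSup (charQuot_mono hW ρ)

/-- The energy, when the difference quotients of the characteristic function converge. -/
theorem energy_eq_of_tendsto {ρ : NormalState H} (hc : 0 ≤ c) {E : ℝ} (hE : 0 ≤ E)
    (h : Tendsto (charQuot ρ W) atTop (nhds (E + c / 2))) : ρ.energy W = ENNReal.ofReal E := by
  have h1 := tendsto_nhds_unique (tendsto_charQuot hW ρ hc)
    ((ENNReal.continuous_ofReal.tendsto _).comp h)
  rw [ENNReal.ofReal_add hE (by positivity)] at h1
  exact (ENNReal.add_left_inj ENNReal.ofReal_ne_top).1 h1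

theorem tendsto_charQuot_real {ρ : NormalState H} (hc : 0 ≤ c) (h : ρ.energy W ≠ ⊤) :
    Tendsto (charQuot ρ W) atTop (nhds ((ρ.energy W).toReal + c / 2)) := by
  have h1 := (ENNReal.tendsto_toReal (ENNReal.add_ne_top.2 ⟨h, ENNReal.ofReal_ne_top⟩)).comp
    (tendsto_charQuot hW ρ hc)
  rw [ENNReal.toReal_add h ENNReal.ofReal_ne_top, ENNReal.toReal_ofReal (by positivity)] at h1
  refine h1.congr fun n => ?_
  simp only [Function.comp]
  exact ENNReal.toReal_ofReal (charQuot_nonneg hW ρ n)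

end

/-! ### States of finite energy -/

theorem NormalState.inDom_of_energy {ρ : NormalState H} (h : ρ.energy W ≠ ⊤) (i : ℕ) :
    InDom W (ρ.vec i) := by
  by_contra hi
  exact h (if_neg fun h' => hi (h' i))

theorem NormalState.hasSum_energy {ρ : NormalState H} (h : ρ.energy W ≠ ⊤) :
    HasSum (fun i => ‖amp W (ρ.vec i)‖ ^ 2) (ρ.energy W).toReal := by
  have h1 : ρ.energy W = ∑' i, ENNReal.ofReal (‖amp W (ρ.vec i)‖ ^ 2) :=
    if_pos (NormalState.inDom_of_energy h)
  rw [h1] at h ⊢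
  refine hasSum_of_eq (ENNReal.hasSum_toReal h)
    (fun i => (ENNReal.toReal_ofReal (by positivity)).symm) ?_
  exact ENNReal.tsum_toReal_eq fun i => ENNReal.ofReal_ne_top

/-- The difference quotients that approximate the mean amplitude. -/
def meanQuot (ρ : NormalState H) (W : ℂ → H →L[ℂ] H) (n : ℕ) : ℂ :=
  (ρ.ev (W (dyadic n : ℂ)) - 1 + Complex.I * (ρ.ev (W ((dyadic n : ℂ) * Complex.I)) - 1))
    / (2 * dyadic n)

theorem summable_sq_generators (hW : IsWeyl (symp c) W) {ρ : NormalState H} (h : ρ.energy W ≠ ⊤) :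
    (Summable fun i => ‖deriv (fun t : ℝ => W (t : ℂ) (ρ.vec i)) 0‖ ^ 2) ∧
      Summable fun i => ‖deriv (fun t : ℝ => W ((t : ℂ) * Complex.I) (ρ.vec i)) 0‖ ^ 2 := by
  have h1 := ((NormalState.hasSum_energy h).summable.mul_left 4).add (ρ.summable_sq.mul_left (2 * c))
  have h2 : ∀ i, 4 * ‖amp W (ρ.vec i)‖ ^ 2 + 2 * c * ‖ρ.vec i‖ ^ 2
      = ‖deriv (fun t : ℝ => W (t : ℂ) (ρ.vec i)) 0‖ ^ 2
        + ‖deriv (fun t : ℝ => W ((t : ℂ) * Complex.I) (ρ.vec i)) 0‖ ^ 2 := fun i => by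
    have hd := NormalState.inDom_of_energy h i
    rw [hW.norm_amp_sq hd.1.hasDerivAt hd.2.hasDerivAt]
    ring
  constructor
  · refine Summable.of_nonneg_of_le (fun i => by positivity) (fun i => ?_) h1
    rw [h2]
    exact le_add_of_nonneg_right (by positivity)
  · refine Summable.of_nonneg_of_le (fun i => by positivity) (fun i => ?_) h1
    rw [h2]
    exact le_add_of_nonneg_left (by positivity)

/-- The difference quotients of a vector in the domain are bounded by the norm of the generator,
which provides the summable majorant `‖ρ.vec i‖ * ‖g i‖`. -/
theorem tendsto_ev_quot {U : ℝ → H →L[ℂ] H} (hU : IsUnitaryGroup U) {ρ : NormalState H} {g : ℕ → H}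
    (hg : ∀ i, HasDerivAt (fun t => U t (ρ.vec i)) (g i) 0) (hs : Summable fun i => ‖g i‖ ^ 2) :
    Tendsto (fun n => (ρ.ev (U (dyadic n)) - 1) / dyadic n) atTop (nhds (∑' i, ⟪ρ.vec i, g i⟫_ℂ)) := by
  have h1 : ∀ n, (ρ.ev (U (dyadic n)) - 1) / dyadic n
      = ∑' i, ⟪ρ.vec i, (dyadic n)⁻¹ • (U (dyadic n) (ρ.vec i) - ρ.vec i)⟫_ℂ := by
    intro n
    rw [← ρ.ev_one, ← NormalState.ev_sub, NormalState.ev, div_eq_inv_mul, ← tsum_mul_left]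
    refine tsum_congr fun i => ?_
    rw [← Complex.coe_smul, inner_smul_right, Complex.ofReal_inv]
    rfl
  simp only [h1]
  have hb : Summable fun i => ‖ρ.vec i‖ * ‖g i‖ := by
    refine Summable.of_nonneg_of_le (fun i => by positivity) (fun i => ?_) (ρ.summable_sq.add hs)
    nlinarith [sq_nonneg (‖ρ.vec i‖ - ‖g i‖), sq_nonneg ‖ρ.vec i‖, sq_nonneg ‖g i‖]
  refine tendsto_tsum_of_dominated_convergence hb (fun i => ?_) (.of_forall fun n i => ?_)
  · refine Tendsto.inner tendsto_const_nhds ?_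
    refine ((hg i).tendsto_slope_zero_right.comp tendsto_dyadic).congr fun n => ?_
    simp [hU.zero]
  · refine (norm_inner_le_norm _ _).trans (mul_le_mul_of_nonneg_left ?_ (norm_nonneg _))
    have h2 := hU.norm_sub_le (hg i) (dyadic n)
    have h3 := dyadic_pos n
    rw [norm_smul, norm_inv, Real.norm_eq_abs, inv_mul_le_iff₀ (abs_pos.2 h3.ne'), mul_comm]
    exact h2

theorem tendsto_meanQuot (hW : IsWeyl (symp c) W) {ρ : NormalState H} (h : ρ.energy W ≠ ⊤) :
    Tendsto (meanQuot ρ W) atTop (nhds (ρ.mean W)) := by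
  have hs := summable_sq_generators hW h
  have hd := NormalState.inDom_of_energy h
  have h1 := tendsto_ev_quot hW.isUnitaryGroup_one (fun i => (hd i).1.hasDerivAt) hs.1
  have h2 := tendsto_ev_quot (hW.isUnitaryGroup Complex.I) (fun i => (hd i).2.hasDerivAt) hs.2
  have h3 := (h1.add (h2.const_mul Complex.I)).const_mul (1 / 2)
  have h4 : ρ.mean W = 1 / 2 * (∑' i, ⟪ρ.vec i, deriv (fun t : ℝ => W (t : ℂ) (ρ.vec i)) 0⟫_ℂ
      + Complex.I * ∑' i, ⟪ρ.vec i, deriv (fun t : ℝ => W ((t : ℂ) * Complex.I) (ρ.vec i)) 0⟫_ℂ) := by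
    rw [← tsum_mul_left, ← (summable_inner_of_sq ρ.summable_sq hs.1).tsum_add
      ((summable_inner_of_sq ρ.summable_sq hs.2).mul_left _), ← tsum_mul_left]
    refine tsum_congr fun i => ?_
    rw [amp, inner_smul_right, inner_add_right, inner_smul_right]
  rw [h4]
  refine h3.congr fun n => ?_
  rw [meanQuot]
  have := dyadic_pos n
  field_simp

theorem NormalState.summable_sq_amp {ρ : NormalState H} (h : ρ.energy W ≠ ⊤) :
    Summable fun i => ‖amp W (ρ.vec i)‖ ^ 2 := (NormalState.hasSum_energy h).summable

theorem NormalState.hasSum_mean {ρ : NormalState H} (h : ρ.energy W ≠ ⊤) :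
    HasSum (fun i => ⟪ρ.vec i, amp W (ρ.vec i)⟫_ℂ) (ρ.mean W) :=
  (summable_inner_of_sq ρ.summable_sq (NormalState.summable_sq_amp h)).hasSum

/-- The second moment of the amplitude about an arbitrary point. -/
theorem NormalState.hasSum_sq_sub {ρ : NormalState H} (h : ρ.energy W ≠ ⊤) (a b : ℂ) :
    HasSum (fun i => ‖a • amp W (ρ.vec i) + b • ρ.vec i‖ ^ 2)
      (‖a‖ ^ 2 * (ρ.energy W).toReal + 2 * (conj b * a * ρ.mean W).re + ‖b‖ ^ 2) := by
  have h1 := ((NormalState.hasSum_energy h).mul_left (‖a‖ ^ 2)).add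
    ((Complex.hasSum_re ((NormalState.hasSum_mean h).mul_left (conj b * a))).mul_left 2)
  have h2 := h1.add (ρ.normalized.mul_left (‖b‖ ^ 2))
  rw [mul_one] at h2
  refine hasSum_of_eq h2 (fun i => ?_) rfl
  have h3 := norm_add_sq (𝕜 := ℂ) (a • amp W (ρ.vec i)) (b • ρ.vec i)
  rw [norm_smul, norm_smul, mul_pow, mul_pow, ← inner_conj_symm, RCLike.conj_re, inner_smul_left,
    inner_smul_right, ← mul_assoc] at h3
  exact h3

theorem NormalState.sq_mean_le {ρ : NormalState H} (h : ρ.energy W ≠ ⊤) :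
    ‖ρ.mean W‖ ^ 2 ≤ (ρ.energy W).toReal := by
  have h1 := (NormalState.hasSum_sq_sub h 1 (-ρ.mean W)).nonneg fun i => by positivity
  have h2 : (conj (ρ.mean W) * ρ.mean W).re = ‖ρ.mean W‖ ^ 2 := by
    rw [Complex.conj_mul']; norm_cast
  simp only [norm_one, one_pow, one_mul, map_neg, mul_one, neg_mul, Complex.neg_re, h2, norm_neg] at h1
  linarith

end Amplitude


/-! ### The lower bound of the variance -/

section Variance

open Filter

variable {H : Type*} [NormedAddCommGroup H] [InnerProductSpace ℂ H] [CompleteSpace H]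
  {c c' s t : ℝ} {W : ℂ → H →L[ℂ] H} {ρ : NormalState H}

/-- The fourth roots of unity. -/
def unitRoot : Fin 4 → ℂ := ![1, Complex.I, -1, -Complex.I]

theorem sum_unitRoot : ∑ m, unitRoot m = 0 := by simp [unitRoot, Fin.sum_univ_four]

theorem tendsto_dyadic_zero : Tendsto dyadic atTop (nhds 0) :=
  (tendsto_nhdsWithin_iff.1 tendsto_dyadic).1

theorem tendsto_dyadic_ofReal : Tendsto (fun n => (dyadic n : ℂ)) atTop (nhds 0) :=
  (Complex.continuous_ofReal.tendsto' 0 0 rfl).comp tendsto_dyadic_zero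

/-- The operators that approximate `x + b`. -/
def approxAmp (W : ℂ → H →L[ℂ] H) (b : ℂ) (n : ℕ) : H →L[ℂ] H :=
  b • W 0 + ∑ m, (unitRoot m / (4 * dyadic n)) • W (dyadic n * unitRoot m)

theorem approxAmp_apply (hW : IsWeyl (symp c') W) (b : ℂ) (n : ℕ) (f : H) :
    approxAmp W b n f = b • f + ∑ m, (unitRoot m / 4) •
      ((dyadic n)⁻¹ • (W (dyadic n * unitRoot m) f - f)) := by
  have h0 := (dyadic_pos n).ne'
  simp only [approxAmp, add_apply, smul_apply, hW.zero, one_apply_eq_self, sum_apply]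
  congr 1
  have h1 : ∑ m, (unitRoot m / (4 * dyadic n)) • f = 0 := by
    rw [← Finset.sum_smul, ← Finset.sum_div, sum_unitRoot, zero_div, zero_smul]
  rw [← sub_zero (∑ m, (unitRoot m / (4 * (dyadic n : ℂ))) • _), ← h1, ← Finset.sum_sub_distrib]
  refine Finset.sum_congr rfl fun m _ => ?_
  rw [← smul_sub, ← Complex.coe_smul, smul_smul]
  congr 1
  push_cast
  field_simp

theorem hasDerivAt_root {f : H} (hf : InDom W f) (m : Fin 4) :
    HasDerivAt (fun τ : ℝ => W (τ * unitRoot m) f)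
      (![deriv (fun t : ℝ => W (t : ℂ) f) 0, deriv (fun t : ℝ => W ((t : ℂ) * Complex.I) f) 0,
        -deriv (fun t : ℝ => W (t : ℂ) f) 0, -deriv (fun t : ℝ => W ((t : ℂ) * Complex.I) f) 0] m) 0 := by
  have hA := hf.1.hasDerivAt
  have hB := hf.2.hasDerivAt
  have hn : HasDerivAt (fun τ : ℝ => -τ) (-1) 0 := hasDerivAt_neg 0
  fin_cases m
  · simpa [unitRoot] using hA
  · simpa [unitRoot] using hB
  · have hA' : HasDerivAt (fun t : ℝ => W (t : ℂ) f) (deriv (fun t : ℝ => W (t : ℂ) f) 0) (-0) := by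
      rwa [neg_zero]
    have := hA'.scomp (0 : ℝ) hn
    simpa [unitRoot, Function.comp_def] using this
  · have hB' : HasDerivAt (fun t : ℝ => W ((t : ℂ) * Complex.I) f)
        (deriv (fun t : ℝ => W ((t : ℂ) * Complex.I) f) 0) (-0) := by
      rwa [neg_zero]
    have := hB'.scomp (0 : ℝ) hn
    simpa [unitRoot, Function.comp_def] using this

theorem tendsto_approxAmp (hW : IsWeyl (symp c') W) (b : ℂ) {f : H} (hf : InDom W f) :
    Tendsto (fun n => approxAmp W b n f) atTop (nhds (amp W f + b • f)) := by
  simp only [approxAmp_apply hW]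
  have h1 : ∀ m, Tendsto (fun n => (unitRoot m / 4) • ((dyadic n)⁻¹ • (W (dyadic n * unitRoot m) f - f)))
      atTop (nhds ((unitRoot m / 4) • (![deriv (fun t : ℝ => W (t : ℂ) f) 0,
        deriv (fun t : ℝ => W ((t : ℂ) * Complex.I) f) 0, -deriv (fun t : ℝ => W (t : ℂ) f) 0,
        -deriv (fun t : ℝ => W ((t : ℂ) * Complex.I) f) 0] m))) := fun m => by
    refine Tendsto.const_smul ?_ _
    refine ((hasDerivAt_root hf m).tendsto_slope_zero_right.comp tendsto_dyadic).congr fun n => ?_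
    simp [hW.zero]
  have h2 := (tendsto_finsetSum Finset.univ fun m _ => h1 m).const_add (b • f)
  convert h2 using 2
  rw [add_comm, amp]
  congr 1
  simp only [unitRoot, Fin.sum_univ_four]
  simp only [Matrix.cons_val_zero, Matrix.cons_val_one, Matrix.cons_val]
  module

theorem norm_approxAmp_le (hW : IsWeyl (symp c') W) (b : ℂ) (n : ℕ) {f : H} (hf : InDom W f) :
    ‖approxAmp W b n f‖ ≤ ‖b‖ * ‖f‖ + ‖deriv (fun t : ℝ => W (t : ℂ) f) 0‖
      + ‖deriv (fun t : ℝ => W ((t : ℂ) * Complex.I) f) 0‖ := by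
  have h0 := dyadic_pos n
  have h1 : ∀ m, ‖(unitRoot m / 4) • ((dyadic n)⁻¹ • (W (dyadic n * unitRoot m) f - f))‖
      ≤ 1 / 4 * ‖(![deriv (fun t : ℝ => W (t : ℂ) f) 0,
        deriv (fun t : ℝ => W ((t : ℂ) * Complex.I) f) 0, -deriv (fun t : ℝ => W (t : ℂ) f) 0,
        -deriv (fun t : ℝ => W ((t : ℂ) * Complex.I) f) 0] m)‖ := fun m => by
    have h2 := (hW.isUnitaryGroup (unitRoot m)).norm_sub_le (hasDerivAt_root hf m) (dyadic n)
    have h3 : ‖unitRoot m‖ = 1 := by fin_cases m <;> simp [unitRoot]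
    rw [norm_smul, norm_div, h3, norm_smul, norm_inv, Real.norm_eq_abs, Complex.norm_ofNat]
    refine mul_le_mul_of_nonneg_left ?_ (by norm_num)
    rw [inv_mul_le_iff₀ (abs_pos.2 h0.ne')]
    exact h2.trans_eq (mul_comm _ _)
  rw [approxAmp_apply hW]
  refine (norm_add_le _ _).trans ?_
  rw [norm_smul, add_assoc]
  refine add_le_add_right ((norm_sum_le _ _).trans ((Finset.sum_le_sum fun m _ => h1 m).trans ?_)) _
  simp only [Fin.sum_univ_four]
  simp only [Matrix.cons_val_zero, Matrix.cons_val_one, Matrix.cons_val, norm_neg]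
  linarith [norm_nonneg (deriv (fun t : ℝ => W (t : ℂ) f) 0),
    norm_nonneg (deriv (fun t : ℝ => W ((t : ℂ) * Complex.I) f) 0)]

theorem ev_approxAmp (ρ : NormalState H) (W : ℂ → H →L[ℂ] H) (b : ℂ) (n : ℕ) :
    (ρ.ev (star (approxAmp W b n) * approxAmp W b n)).re = ∑' i, ‖approxAmp W b n (ρ.vec i)‖ ^ 2 := by
  rw [NormalState.ev, Complex.re_tsum (ρ.summable_ev _)]
  refine tsum_congr fun i => ?_
  change (⟪ρ.vec i, star (approxAmp W b n) (approxAmp W b n (ρ.vec i))⟫_ℂ).re = _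
  rw [ContinuousLinearMap.star_eq_adjoint, ContinuousLinearMap.adjoint_inner_right]
  exact inner_self_eq_norm_sq (𝕜 := ℂ) _

theorem tendsto_ev_approxAmp (hW : IsWeyl (symp c') W) (h : ρ.energy W ≠ ⊤) (b : ℂ) :
    Tendsto (fun n => (ρ.ev (star (approxAmp W b n) * approxAmp W b n)).re) atTop
      (nhds ((ρ.energy W).toReal + 2 * (conj b * ρ.mean W).re + ‖b‖ ^ 2)) := by
  have h1 := NormalState.hasSum_sq_sub h 1 b
  have hd := NormalState.inDom_of_energy h
  have hs := summable_sq_generators hW h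
  simp only [norm_one, one_pow, one_mul, mul_one, one_smul] at h1
  rw [← h1.tsum_eq]
  simp only [ev_approxAmp]
  refine tendsto_tsum_of_dominated_convergence (((ρ.summable_sq.mul_left (3 * ‖b‖ ^ 2)).add
    (hs.1.mul_left 3)).add (hs.2.mul_left 3)) (fun i => ?_) (.of_forall fun n i => ?_)
  · exact (tendsto_approxAmp hW b (hd i)).norm.pow 2
  · have h2 := norm_approxAmp_le hW b n (hd i)
    rw [norm_pow, norm_norm]
    refine (pow_le_pow_left₀ (norm_nonneg _) h2 2).trans ?_
    set x := ‖b‖ * ‖ρ.vec i‖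
    have e : 3 * ‖b‖ ^ 2 * ‖ρ.vec i‖ ^ 2 = 3 * x ^ 2 := by simp only [x]; ring
    rw [e]
    set y := ‖deriv (fun t : ℝ => W (t : ℂ) (ρ.vec i)) 0‖
    set z := ‖deriv (fun t : ℝ => W ((t : ℂ) * Complex.I) (ρ.vec i)) 0‖
    nlinarith [sq_nonneg (x - y), sq_nonneg (y - z), sq_nonneg (x - z)]

/-- The kernel is tested with the points and weights of `approxAmp`. If its Gaussian factor were
`1`, this would give the second moment of `x + b`; the deviation of the factor from `1` is of second
order in the step and contributes `-c s` in the limit. The term with `t` drops out because the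
squares of the fourth roots of unity sum to zero. -/
theorem le_energy_of_posKernel (hW : IsWeyl (symp c') W) (h : ρ.energy W ≠ ⊤)
    (hK : PosKernel (varianceKernel c s t ρ W)) (b : ℂ) :
    c * s ≤ (ρ.energy W).toReal + 2 * (conj b * ρ.mean W).re + ‖b‖ ^ 2 := by
  let w : Fin 4 → Fin 4 → ℂ := fun m l =>
    -(c * (s * (unitRoot m * conj (unitRoot l)) + t * (conj (unitRoot m) * unitRoot l)))
  let T : ℕ → ℂ := fun n => ∑ m, ∑ l, conj (unitRoot m) * unitRoot l / 16
    * ((((dyadic n ^ 2)⁻¹ : ℝ) : ℂ) * (Complex.exp ((dyadic n ^ 2 : ℝ) * w m l) - 1))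
    * ρ.ev (W (-(dyadic n * unitRoot m)) * W (dyadic n * unitRoot l))
  have hT : Tendsto T atTop (nhds (∑ m, ∑ l, conj (unitRoot m) * unitRoot l / 16 * w m l * 1)) := by
    refine tendsto_finsetSum _ fun m _ => tendsto_finsetSum _ fun l _ => ?_
    refine Tendsto.mul (Tendsto.const_mul _ ?_) ?_
    · have hd : HasDerivAt (fun τ : ℝ => Complex.exp ((τ : ℂ) * w m l)) (w m l) 0 := by
        have := ((Complex.ofRealCLM.hasDerivAt (x := (0 : ℝ))).mul_const (w m l)).cexp
        simpa using this
      have hsq : Tendsto (fun n => dyadic n ^ 2) atTop (nhdsWithin 0 (Set.Ioi 0)) := by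
        refine tendsto_nhdsWithin_iff.2 ⟨?_, .of_forall fun n => pow_pos (dyadic_pos n) 2⟩
        simpa using tendsto_dyadic_zero.pow 2
      refine (hd.tendsto_slope_zero_right.comp hsq).congr fun n => ?_
      simp
    · have hc : Continuous fun z : ℂ => ρ.ev (W (-(z * unitRoot m)) * W (z * unitRoot l)) := by
        refine NormalState.continuous_ev (C := 1) _ (fun f => ?_) fun x => ?_
        · exact hW.continuous_comp (by fun_prop) ((hW.cont f).comp (by fun_prop))
        · exact (norm_mul_le _ _).trans (mul_le_one₀ (hW.norm_le _) (norm_nonneg _) (hW.norm_le _))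
      have := (hc.tendsto 0).comp tendsto_dyadic_ofReal
      simpa [hW.zero, Function.comp_def] using this
  have hlim : (∑ m, ∑ l, conj (unitRoot m) * unitRoot l / 16 * w m l * 1).re = -(c * s) := by
    simp only [w, unitRoot, Fin.sum_univ_four]
    simp
    ring
  have hpos : ∀ n, 0 ≤ (ρ.ev (star (approxAmp W b n) * approxAmp W b n)).re + (T n).re := by
    intro n
    have h0 : (dyadic n : ℂ) ≠ 0 := by exact_mod_cast (dyadic_pos n).ne'
    -- The additional point `0` carries the weight `b`; there the Gaussian factor is exactly `1`, so
    -- only the four other points enter the correction `T`.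
    let x : Fin 5 → ℂ := Fin.cons 0 fun m => (dyadic n : ℂ) * unitRoot m
    let a : Fin 5 → ℂ := Fin.cons b fun m => unitRoot m / (4 * dyadic n)
    have x0 : x 0 = 0 := rfl
    have xs : ∀ m : Fin 4, x m.succ = (dyadic n : ℂ) * unitRoot m := fun m => rfl
    have as : ∀ m : Fin 4, a m.succ = unitRoot m / (4 * dyadic n) := fun m => rfl
    have h1 := sum_re_nonneg_of_posKernel hK x a
    rw [← Complex.add_re]
    convert h1 using 2
    have hN : ρ.ev (star (approxAmp W b n) * approxAmp W b n)
        = ∑ i, ∑ j, conj (a i) * ρ.ev (W (-x i) * W (x j)) * a j := by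
      have : approxAmp W b n = ∑ i, a i • W (x i) := by
        rw [Fin.sum_univ_succ]; rfl
      rw [this]
      simp only [star_sum, star_smul, hW.star_eq, Finset.sum_mul_sum, NormalState.ev_sum,
        smul_mul_assoc, mul_smul_comm, NormalState.ev_smul]
      refine Finset.sum_congr rfl fun i _ => Finset.sum_congr rfl fun j _ => ?_
      rw [← starRingEnd_apply]
      ring
    rw [hN]
    simp only [Fin.sum_univ_succ (n := 4), x0, xs, as, varianceKernel, neg_zero,
      map_zero, mul_zero, zero_mul, add_zero, Complex.exp_zero, one_mul, T]
    rw [add_assoc]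
    congr 1
    rw [← Finset.sum_add_distrib]
    refine Finset.sum_congr rfl fun m _ => ?_
    rw [add_assoc]
    congr 1
    rw [← Finset.sum_add_distrib]
    refine Finset.sum_congr rfl fun l _ => ?_
    have hw : ((dyadic n ^ 2 : ℝ) : ℂ) * w m l = -(c * (s * (dyadic n * unitRoot m * conj (dyadic n * unitRoot l))
        + t * (conj (dyadic n * unitRoot m) * (dyadic n * unitRoot l)))) := by
      simp only [w, map_mul, Complex.conj_ofReal]
      push_cast
      ring
    rw [hw]
    simp only [map_div₀, map_mul, Complex.conj_ofReal]
    push_cast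
    rw [Complex.conj_ofNat]
    field_simp
    ring
  have h2 := (tendsto_ev_approxAmp hW h b).add ((Complex.continuous_re.tendsto _).comp hT)
  have h3 := ge_of_tendsto' h2 hpos
  rw [hlim] at h3
  linarith

end Variance


/-! ### Affine transformations of amplitudes, and energies of states -/

section Amplitude

open Filter

variable {H : Type*} [NormedAddCommGroup H] [InnerProductSpace ℂ H] [CompleteSpace H]
  {c s t : ℝ} {W : ℂ → H →L[ℂ] H} {ρ : NormalState H}

namespace IsWeyl

/-- These are the Weyl operators of `-x*`. The passage reverses the sign of the commutator and
exchanges the two variances of `varianceKernel`. -/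
theorem conj_arg (hW : IsWeyl (symp c) W) : IsWeyl (symp (-c)) fun ζ => W (conj ζ) where
  unitary ζ := hW.unitary _
  cont f := (hW.cont f).comp Complex.continuous_conj
  mul a b := by
    rw [hW.mul, map_add]
    congr 3
    simp only [symp, Complex.mul_im, Complex.conj_re, Complex.conj_im]
    push_cast
    ring
  alt := symp_neg_self _

theorem comp_mul (hW : IsWeyl (symp c) W) (κ : ℂ) :
    IsWeyl (symp (c * ‖κ‖ ^ 2)) fun ζ => W (κ * ζ) where
  unitary ζ := hW.unitary _
  cont f := (hW.cont f).comp (by fun_prop)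
  mul a b := by
    rw [hW.mul, mul_add]
    congr 3
    have : (κ * a) * conj (κ * b) = ((‖κ‖ ^ 2 : ℝ) : ℂ) * (a * conj b) := by
      push_cast
      rw [← Complex.mul_conj', map_mul]
      ring
    rw [symp, this, Complex.im_ofReal_mul, symp]
    push_cast
    ring
  alt := symp_neg_self _

/-- Splitting `W (t ζ)` into its real and imaginary directions costs a phase of order `t²`, which
does not affect the derivative at `0`. -/
theorem hasDerivAt_line (hW : IsWeyl (symp c) W) {f A B : H}
    (hA : HasDerivAt (fun t : ℝ => W (t : ℂ) f) A 0)
    (hB : HasDerivAt (fun t : ℝ => W ((t : ℂ) * Complex.I) f) B 0) (ζ : ℂ) :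
    HasDerivAt (fun t : ℝ => W (t * ζ) f) ((ζ.re : ℂ) • A + (ζ.im : ℂ) • B) 0 := by
  have hA0 : HasDerivAt (fun t : ℝ => W (t : ℂ) f) A (ζ.re * 0) := by rwa [mul_zero]
  have hB0 : HasDerivAt (fun t : ℝ => W ((t : ℂ) * Complex.I) f) B (ζ.im * 0) := by rwa [mul_zero]
  have hA' := hA0.scomp (0 : ℝ) ((hasDerivAt_id (0 : ℝ)).const_mul ζ.re)
  have hB' := hB0.scomp (0 : ℝ) ((hasDerivAt_id (0 : ℝ)).const_mul ζ.im)
  simp only [mul_one, Function.comp_def] at hA' hB'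
  have hg : HasDerivAt (fun t : ℝ => W ((ζ.re * t : ℝ) : ℂ) (W (((ζ.im * t : ℝ) : ℂ) * Complex.I) f))
      (ζ.re • A + ζ.im • B) 0 := by
    rw [hasDerivAt_iff_tendsto_slope_zero] at hA' hB' ⊢
    simp only [zero_add, mul_zero, Complex.ofReal_zero, zero_mul, hW.zero, one_apply_eq_self]
      at hA' hB' ⊢
    have h1 : Tendsto (fun t : ℝ => W ((ζ.re * t : ℝ) : ℂ)
        (t⁻¹ • (W (((ζ.im * t : ℝ) : ℂ) * Complex.I) f - f))) (nhdsWithin 0 {0}ᶜ)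
        (nhds (ζ.im • B)) := by
      rw [tendsto_iff_norm_sub_tendsto_zero] at hB' ⊢
      have h2 : Tendsto (fun t : ℝ => ‖W ((ζ.re * t : ℝ) : ℂ) (ζ.im • B) - ζ.im • B‖)
          (nhdsWithin 0 {0}ᶜ) (nhds 0) := by
        have hc : Continuous fun t : ℝ => ‖W ((ζ.re * t : ℝ) : ℂ) (ζ.im • B) - ζ.im • B‖ :=
          (((hW.cont _).comp (by fun_prop)).sub continuous_const).norm
        have := (hc.tendsto 0).mono_left (nhdsWithin_le_nhds (s := {0}ᶜ))
        simpa [hW.zero] using this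
      refine squeeze_zero (fun _ => norm_nonneg _) (fun t => ?_) (by simpa only [add_zero] using hB'.add h2)
      refine (norm_sub_le_norm_sub_add_norm_sub _ (W ((ζ.re * t : ℝ) : ℂ) (ζ.im • B)) _).trans ?_
      rw [← map_sub, hW.norm_apply]
    refine (by simpa [add_comm] using h1.add hA' : Tendsto _ _ (nhds (ζ.re • A + ζ.im • B))).congr
      fun t => ?_
    push_cast
    rw [← smul_add]
    congr 1
    abel
  have hs : HasDerivAt (fun t : ℝ => Complex.exp (Complex.I *
      ((c * (ζ.re * ζ.im) : ℝ) : ℂ) * ((t : ℂ) * (t : ℂ)))) 0 0 := by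
    have h0 := (hasDerivAt_id (0 : ℝ)).ofReal_comp
    have := ((h0.mul h0).const_mul (Complex.I * ((c * (ζ.re * ζ.im) : ℝ) : ℂ))).cexp
    simpa using this
  have h := hs.smul hg
  simp only [Complex.ofReal_zero, mul_zero, Complex.exp_zero, one_smul, zero_smul, add_zero] at h
  rw [Complex.coe_smul, Complex.coe_smul]
  refine h.congr_of_eventuallyEq (.of_forall fun t => ?_)
  have h1 := congrArg (fun T : H →L[ℂ] H => T f)
    (hW.mul ((ζ.re * t : ℝ) : ℂ) (((ζ.im * t : ℝ) : ℂ) * Complex.I))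
  simp only [mul_apply_eq_comp, smul_apply] at h1
  simp only [Pi.smul_apply', h1, smul_smul, ← Complex.exp_add]
  have e1 : Complex.I * ((c * (ζ.re * ζ.im) : ℝ) : ℂ) * ((t : ℂ) * (t : ℂ)) + Complex.I *
      (symp c ((ζ.re * t : ℝ) : ℂ) (((ζ.im * t : ℝ) : ℂ) * Complex.I) : ℝ) = 0 := by
    simp [symp]
    ring
  have e2 : ((ζ.re * t : ℝ) : ℂ) + ((ζ.im * t : ℝ) : ℂ) * Complex.I = t * ζ := by
    conv_rhs => rw [← Complex.re_add_im ζ]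
    push_cast
    ring
  rw [e1, e2, Complex.exp_zero, one_smul]

end IsWeyl

theorem hasDerivAt_phase_line (ζ w : ℂ) : HasDerivAt (fun t : ℝ => phase (t * ζ) w)
    (conj ζ * w - ζ * conj w) 0 := by
  have h0 := ((hasDerivAt_id (0 : ℝ)).ofReal_comp.mul_const (conj ζ * w - ζ * conj w)).cexp
  simp only [id, Complex.ofReal_zero, zero_mul, Complex.exp_zero, one_mul, Complex.ofReal_one] at h0
  refine h0.congr_of_eventuallyEq (.of_forall fun t => ?_)
  simp only [phase]
  congr 1
  have : conj ζ * w - ζ * conj w = 2 * Complex.I * ((conj ζ * w).im : ℂ) := by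
    have := Complex.sub_conj (conj ζ * w)
    rw [map_mul, Complex.conj_conj] at this
    rw [this]
    push_cast
    ring
  rw [this, map_mul, Complex.conj_ofReal, mul_assoc (t : ℂ), Complex.im_ofReal_mul]
  push_cast
  ring

/-- The amplitude `φ x + w`. -/
theorem amp_affine (hW : IsWeyl (symp c) W) (κ w : ℂ) {f : H} (hf : InDom W f) :
    InDom (fun ζ => phase ζ w • W (conj κ * ζ)) f ∧
      amp (fun ζ => phase ζ w • W (conj κ * ζ)) f = κ • amp W f + w • f := by
  have hA := hf.1.hasDerivAt
  have hB := hf.2.hasDerivAt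
  set A := deriv (fun t : ℝ => W (t : ℂ) f) 0 with hAdef
  set B := deriv (fun t : ℝ => W ((t : ℂ) * Complex.I) f) 0 with hBdef
  have key : ∀ e : ℂ, HasDerivAt
      (fun t : ℝ => (phase (t * e) w • W (conj κ * (t * e)) : H →L[ℂ] H) f)
      ((((conj κ * e).re : ℂ) • A + ((conj κ * e).im : ℂ) • B)
        + (conj e * w - e * conj w) • f) 0 := fun e => by
    have h1 := (hasDerivAt_phase_line e w).smul (hW.hasDerivAt_line hA hB (conj κ * e))
    simp only [Complex.ofReal_zero, zero_mul, hW.zero, one_apply_eq_self, phase_zero_left,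
      one_smul] at h1
    refine h1.congr_of_eventuallyEq (.of_forall fun t => ?_)
    simp only [smul_apply, Pi.smul_apply']
    rw [mul_left_comm]
  have k1 := key 1
  have k2 := key Complex.I
  simp only [mul_one] at k1
  refine ⟨⟨k1.differentiableAt, k2.differentiableAt⟩, ?_⟩
  rw [amp, k1.deriv, k2.deriv, amp, ← hAdef, ← hBdef]
  have hκ : (κ.re : ℂ) + κ.im * Complex.I = κ := Complex.re_add_im κ
  simp only [Complex.mul_re, Complex.mul_im, Complex.conj_re, Complex.conj_im, Complex.I_re,
    Complex.I_im, map_one, Complex.conj_I, one_mul, mul_zero, mul_one, zero_sub, neg_neg, add_zero]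
  push_cast
  have hI : Complex.I * Complex.I = -1 := Complex.I_mul_I
  match_scalars
  · linear_combination (1 / 2) * hκ
  · linear_combination (Complex.I / 2) * hκ - (κ.im : ℂ) / 2 * hI
  · linear_combination (-(w + conj w) / 2) * hI

theorem energy_eq_of_hasSum (hd : ∀ i, InDom W (ρ.vec i)) {E : ℝ}
    (h : HasSum (fun i => ‖amp W (ρ.vec i)‖ ^ 2) E) : ρ.energy W = ENNReal.ofReal E := by
  rw [NormalState.energy, if_pos hd, ← ENNReal.ofReal_tsum_of_nonneg (fun _ => by positivity)
    h.summable, h.tsum_eq]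

/-- The energy of the amplitude `φ x + w`. -/
theorem energy_affine (hW : IsWeyl (symp c) W) (h : ρ.energy W ≠ ⊤) (κ w : ℂ) :
    ρ.energy (fun ζ => phase ζ w • W (conj κ * ζ)) = ENNReal.ofReal
      (‖κ‖ ^ 2 * (ρ.energy W).toReal + 2 * (conj w * κ * ρ.mean W).re + ‖w‖ ^ 2) := by
  have hd := NormalState.inDom_of_energy h
  refine energy_eq_of_hasSum (fun i => (amp_affine hW κ w (hd i)).1) ?_
  refine hasSum_of_eq (NormalState.hasSum_sq_sub h κ w) (fun i => ?_) rfl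
  rw [(amp_affine hW κ w (hd i)).2]

theorem affine_nonneg (h : ρ.energy W ≠ ⊤)
    (κ w : ℂ) : 0 ≤ ‖κ‖ ^ 2 * (ρ.energy W).toReal + 2 * (conj w * κ * ρ.mean W).re + ‖w‖ ^ 2 :=
  (NormalState.hasSum_sq_sub h κ w).nonneg fun _ => by positivity

/-- Differentiation of the constant `‖W (t e) f‖²` shows that the generator is antisymmetric. -/
theorem re_inner_generator (hW : IsWeyl (symp c) W) {f A : H} (e : ℂ)
    (hA : HasDerivAt (fun t : ℝ => W (t * e) f) A 0) : conj ⟪f, A⟫_ℂ = -⟪f, A⟫_ℂ := by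
  have h1 := hA.inner ℂ hA
  have h2 : (fun t : ℝ => ⟪W (t * e) f, W (t * e) f⟫_ℂ) = fun _ => ⟪f, f⟫_ℂ := by
    funext t
    rw [hW.inner_apply]
  rw [h2] at h1
  have h3 := h1.unique (hasDerivAt_const (0 : ℝ) _)
  simp only [Complex.ofReal_zero, zero_mul, hW.zero, one_apply_eq_self] at h3
  rw [inner_conj_symm]
  linear_combination h3

/-- The energy and the mean of the amplitude `-x*`. -/
theorem energy_conj_arg (hW : IsWeyl (symp c) W) (h : ρ.energy W ≠ ⊤) :
    ρ.energy (fun ζ => W (conj ζ)) = ENNReal.ofReal ((ρ.energy W).toReal + c) ∧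
      ρ.mean (fun ζ => W (conj ζ)) = -conj (ρ.mean W) := by
  have hd := NormalState.inDom_of_energy h
  have key : ∀ i, HasDerivAt (fun t : ℝ => W (conj (t : ℂ)) (ρ.vec i))
      (deriv (fun t : ℝ => W (t : ℂ) (ρ.vec i)) 0) 0 ∧
      HasDerivAt (fun t : ℝ => W (conj ((t : ℂ) * Complex.I)) (ρ.vec i))
      (-deriv (fun t : ℝ => W ((t : ℂ) * Complex.I) (ρ.vec i)) 0) 0 := fun i => by
    refine ⟨by simpa using (hd i).1.hasDerivAt, ?_⟩
    have := hasDerivAt_root (hd i) 3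
    simpa [unitRoot] using this
  refine ⟨energy_eq_of_hasSum (fun i => ⟨(key i).1.differentiableAt, (key i).2.differentiableAt⟩) ?_,
    ?_⟩
  · refine hasSum_of_eq ((NormalState.hasSum_energy h).add (ρ.normalized.mul_left c)) (fun i => ?_)
      (by ring)
    rw [hW.conj_arg.norm_amp_sq (key i).1 (key i).2,
      hW.norm_amp_sq (hd i).1.hasDerivAt (hd i).2.hasDerivAt, norm_neg]
    ring
  · rw [NormalState.mean, NormalState.mean, Complex.conj_tsum, ← tsum_neg]
    refine tsum_congr fun i => ?_
    have hA := re_inner_generator hW (f := ρ.vec i) 1 (by simpa only [mul_one] using (hd i).1.hasDerivAt)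
    have hB := re_inner_generator hW Complex.I (hd i).2.hasDerivAt
    rw [amp, amp, (key i).1.deriv, (key i).2.deriv]
    simp only [inner_smul_right, inner_add_right, inner_neg_right, map_mul, map_add, hA, hB,
      Complex.conj_I, map_div₀, map_one, Complex.conj_ofNat]
    ring

/-- The variance bound for `-x*`, in which `t` takes the place of `s`. The energy of `-x*` exceeds
that of `x` by the commutator, whence the subtracted `c`. -/
theorem le_energy_of_posKernel_conj (hW : IsWeyl (symp c) W) (h : ρ.energy W ≠ ⊤) (hc : 0 ≤ c)
    (hK : PosKernel (varianceKernel c s t ρ W)) (b : ℂ) :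
    c * t - c ≤ (ρ.energy W).toReal + 2 * (conj b * ρ.mean W).re + ‖b‖ ^ 2 := by
  have h0 : 0 ≤ (ρ.energy W).toReal + c := add_nonneg ENNReal.toReal_nonneg hc
  obtain ⟨he, hm⟩ := energy_conj_arg hW h
  have hK' : PosKernel (varianceKernel c t s ρ fun ζ => W (conj ζ)) := by
    convert posKernel_comp hK conj using 3 with ζ ζ'
    simp only [varianceKernel, map_neg, Complex.conj_conj]
    ring_nf
  have h1 := le_energy_of_posKernel hW.conj_arg (by rw [he]; exact ENNReal.ofReal_ne_top) hK'
    (-conj b)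
  rw [he, hm, ENNReal.toReal_ofReal h0, norm_neg, RCLike.norm_conj] at h1
  have : (conj (-conj b) * -conj (ρ.mean W)).re = (conj b * ρ.mean W).re := by
    simp
  rw [this] at h1
  linarith

theorem PosKernel.varianceKernel_phase (hK : PosKernel (varianceKernel c s t ρ W)) (w : ℂ) :
    PosKernel (varianceKernel c s t ρ fun ζ => phase ζ w • W ζ) := by
  convert posKernel_mul (posKernel_rankOne fun ζ => phase ζ w) hK using 3 with ζ ζ'
  simp only [varianceKernel, conj_phase, smul_mul_assoc, mul_smul_comm, NormalState.ev_smul]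
  ring

theorem mean_affine (hW : IsWeyl (symp c) W) (h : ρ.energy W ≠ ⊤) (κ w : ℂ) :
    ρ.mean (fun ζ => phase ζ w • W (conj κ * ζ)) = κ * ρ.mean W + w := by
  have hd := NormalState.inDom_of_energy h
  have h1 := ((NormalState.hasSum_mean h).mul_left κ).add
    ((Complex.hasSum_ofReal.2 ρ.normalized).mul_left w)
  rw [Complex.ofReal_one, mul_one] at h1
  rw [NormalState.mean, ← h1.tsum_eq]
  refine tsum_congr fun i => ?_
  rw [(amp_affine hW κ w (hd i)).2, inner_add_right, inner_smul_right, inner_smul_right,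
    inner_self_eq_norm_sq_to_K]
  push_cast
  rfl

theorem tendsto_exp_quot (q : ℝ) :
    Tendsto (fun n => (1 - Real.exp (-(q * dyadic n ^ 2))) / dyadic n ^ 2) atTop (nhds q) := by
  have hd : HasDerivAt (fun τ : ℝ => Real.exp (-(q * τ))) (-q) 0 := by
    simpa using (((hasDerivAt_id (0 : ℝ)).const_mul q).neg).exp
  have hsq : Tendsto (fun n => dyadic n ^ 2) atTop (nhdsWithin 0 (Set.Ioi 0)) := by
    refine tendsto_nhdsWithin_iff.2 ⟨?_, .of_forall fun n => pow_pos (dyadic_pos n) 2⟩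
    simpa using tendsto_dyadic_zero.pow 2
  have := (hd.tendsto_slope_zero_right.comp hsq).neg
  rw [neg_neg] at this
  refine this.congr fun n => ?_
  simp
  ring

/-- A state with a Gaussian characteristic function. -/
theorem energy_mean_of_gaussian (hW : IsWeyl (symp c) W) (hc : 0 ≤ c) {S : ℝ} (hS : 0 ≤ S) {a : ℂ}
    (h : ∀ ζ, ρ.ev (W ζ) = gaussianChar c S a ζ) :
    ρ.energy W = ENNReal.ofReal (‖a‖ ^ 2 + c * S) ∧ ρ.mean W = a := by
  have hU := hW.phase_smul (-a)
  -- The mean is first removed by a phase, so that the characteristic function is a real Gaussian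
  -- and depends on `‖ζ‖` only; it is restored at the end by the affine formulas.
  set U : ℂ → H →L[ℂ] H := fun ζ => phase ζ (-a) • W ζ with hUdef
  have hev : ∀ ζ, ρ.ev (U ζ) = (Real.exp (-(c * (S + 1 / 2) * ‖ζ‖ ^ 2)) : ℂ) := fun ζ => by
    rw [hUdef, NormalState.ev_smul, h, gaussianChar, ← mul_assoc, ← phase_add_right,
      neg_add_cancel, phase_zero_right, one_mul]
    push_cast
    rfl
  have hn : ∀ n, ‖(dyadic n : ℂ)‖ = dyadic n ∧ ‖(dyadic n : ℂ) * Complex.I‖ = dyadic n := fun n => by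
    have : ‖(dyadic n : ℂ)‖ = dyadic n := Complex.norm_of_nonneg (dyadic_pos n).le
    exact ⟨this, by rw [norm_mul, this, Complex.norm_I, mul_one]⟩
  have hq := tendsto_exp_quot (c * (S + 1 / 2))
  have hE : ρ.energy U = ENNReal.ofReal (c * S) := by
    refine energy_eq_of_tendsto hU hc (mul_nonneg hc hS) ?_
    have e : c * S + c / 2 = c * (S + 1 / 2) := by ring
    rw [e]
    refine hq.congr fun n => ?_
    have h0 := (dyadic_pos n).ne'
    rw [charQuot, hev, hev, Complex.ofReal_re, Complex.ofReal_re, (hn n).1, (hn n).2]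
    field_simp
    ring
  have hE' : ρ.energy U ≠ ⊤ := by rw [hE]; exact ENNReal.ofReal_ne_top
  have hM : ρ.mean U = 0 := by
    refine tendsto_nhds_unique (tendsto_meanQuot hU hE') ?_
    have h1 := (Complex.continuous_ofReal.tendsto _).comp (hq.mul tendsto_dyadic_zero)
    have h2 := h1.const_mul (-(1 + Complex.I) / 2)
    rw [mul_zero, Complex.ofReal_zero, mul_zero] at h2
    refine h2.congr fun n => ?_
    have h0 : (dyadic n : ℂ) ≠ 0 := by exact_mod_cast (dyadic_pos n).ne'
    simp only [meanQuot, hev, (hn n).1, (hn n).2, Function.comp_apply]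
    push_cast
    field_simp
    ring
  have hWU : W = fun ζ => phase ζ a • U (conj 1 * ζ) := by
    funext ζ
    rw [map_one, one_mul, hUdef, smul_smul, ← phase_add_right, add_neg_cancel, phase_zero_right,
      one_smul]
  rw [hWU, energy_affine hU hE', mean_affine hU hE', hM, hE,
    ENNReal.toReal_ofReal (mul_nonneg hc hS)]
  refine ⟨?_, by simp⟩
  congr 1
  simp
  ring

/-- An independent Gaussian summand multiplies the characteristic function. The terms `c / 2` and
`c' / 2` appear because normally ordered energies are compared for amplitudes with different
commutators. -/
theorem energy_mul_exp {U : ℂ → H →L[ℂ] H} {c' q : ℝ} (hW : IsWeyl (symp c) W) (hc : 0 ≤ c)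
    (hU : IsWeyl (symp c') U) (hc' : 0 ≤ c') (he : ρ.energy U ≠ ⊤)
    (h : ∀ ζ, ρ.ev (W ζ) = ρ.ev (U ζ) * (Real.exp (-(q * ‖ζ‖ ^ 2)) : ℂ))
    (hE : 0 ≤ (ρ.energy U).toReal + c' / 2 + q - c / 2) :
    ρ.energy W = ENNReal.ofReal ((ρ.energy U).toReal + c' / 2 + q - c / 2) := by
  refine energy_eq_of_tendsto hW hc hE ?_
  have hq := tendsto_exp_quot q
  have h1 : Tendsto (fun n => Real.exp (-(q * dyadic n ^ 2))) atTop (nhds 1) := by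
    have : Continuous fun t : ℝ => Real.exp (-(q * t ^ 2)) := by fun_prop
    simpa [Function.comp_def] using (this.tendsto 0).comp tendsto_dyadic_zero
  have h2 := ((tendsto_charQuot_real hU hc' he).mul h1).add hq
  rw [mul_one] at h2
  rw [sub_add_cancel]
  refine h2.congr fun n => ?_
  have h0 := (dyadic_pos n).ne'
  have hn : ‖(dyadic n : ℂ)‖ = dyadic n := Complex.norm_of_nonneg (dyadic_pos n).le
  have hn' : ‖(dyadic n : ℂ) * Complex.I‖ = dyadic n := by rw [norm_mul, hn, Complex.norm_I, mul_one]
  rw [charQuot, charQuot, h, h, Complex.re_mul_ofReal, Complex.re_mul_ofReal, hn, hn']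
  field_simp
  ring

end Amplitude

/-! ### One step of the oscillator: its energy, and the a posteriori variance bound. -/

section Step

variable {p : Params} {H : Type*} [NormedAddCommGroup H] [InnerProductSpace ℂ H]
  [CompleteSpace H] {Q : OpenOscillator p H} {n : ℕ} {ρ : NormalState H}

/-- The amplitude `φ x_n + β u_n` has the commutator `ħ |φ|²`, and the noise supplies the remaining
`ħ (1 - |φ|²)`. The contributions of the operator order cancel, and only `ħ σ` is added. -/
theorem OpenOscillator.NoiseIndependent.energy_succ (hρ : Q.NoiseIndependent n ρ) (hh : 0 < p.hbar)
    (hsig : 0 ≤ p.sig) (u : ℕ → ℂ) (h : ρ.energy (Q.xWeyl u n) ≠ ⊤) :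
    ρ.energy (Q.xWeyl u (n + 1)) = ENNReal.ofReal
      (‖p.phi‖ ^ 2 * (ρ.energy (Q.xWeyl u n)).toReal
        + 2 * (conj (p.beta * u n) * p.phi * ρ.mean (Q.xWeyl u n)).re + ‖p.beta * u n‖ ^ 2
        + p.hbar * p.sig) := by
  have hW := Q.isWeyl_xWeyl u n
  have hA := energy_affine hW h p.phi (p.beta * u n)
  have h0 := affine_nonneg h p.phi (p.beta * u n)
  have hs := mul_nonneg hh.le hsig
  set E := ‖p.phi‖ ^ 2 * (ρ.energy (Q.xWeyl u n)).toReal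
        + 2 * (conj (p.beta * u n) * p.phi * ρ.mean (Q.xWeyl u n)).re + ‖p.beta * u n‖ ^ 2 with hE
  have hU := (hW.comp_mul (conj p.phi)).phase_smul (p.beta * u n)
  have key := energy_mul_exp (ρ := ρ) (q := p.hbar * (p.sig + (1 - ‖p.phi‖ ^ 2) / 2))
    (Q.isWeyl_xWeyl u (n + 1)) hh.le hU (by positivity) (by rw [hA]; exact ENNReal.ofReal_ne_top)
    (fun ζ => by
      rw [Q.xWeyl_eq, NormalState.ev_smul, Q.xWeyl_zero_succ, hρ.ev_jointWeyl, NormalState.ev_smul,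
        Q.xWeyl_eq u n, NormalState.ev_smul]
      simp only [Params.pull, mul_zero, zero_add, OpenOscillator.shift, phase_add_right,
        phase_mul_right]
      have : p.noiseWeight (ζ, 0)
          = (Real.exp (-(p.hbar * (p.sig + (1 - ‖p.phi‖ ^ 2) / 2) * ‖ζ‖ ^ 2)) : ℂ) := by
        rw [Params.noiseWeight, Complex.ofReal_exp]
        congr 2
        simp [Params.covForm, Params.commForm, Complex.mul_conj', ← Complex.ofReal_pow]
        ring
      rw [this]
      ring)
  rw [hA, ENNReal.toReal_ofReal h0, RCLike.norm_conj] at key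
  have e : E + p.hbar * ‖p.phi‖ ^ 2 / 2 + p.hbar * (p.sig + (1 - ‖p.phi‖ ^ 2) / 2) - p.hbar / 2
      = E + p.hbar * p.sig := by ring
  rw [e] at key
  exact key (add_nonneg h0 hs)

variable {Y : Type*} [MeasurableSpace Y] {s : Strategy Q Y} (R : Evolution s)

/-- The a posteriori variances are bounded from below by those of the Kalman filter. -/
theorem Evolution.ae_variance_le (hh : 0 < p.hbar) (hSig : 0 ≤ p.Sig) (hsig : 0 ≤ p.sig)
    (hnu : 0 ≤ p.nu) (hups : ‖p.ups‖ ^ 2 ≤ p.sig * p.nu) (hQ : Q.IsGaussian) (n : ℕ) :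
    ∀ᵐ h ∂(R.P n), ∀ u : ℕ → ℂ, (R.post n h).energy (Q.xWeyl u n) ≠ ⊤ → ∀ b : ℂ,
      p.hbar * p.SigAt p.muMin n ≤ ((R.post n h).energy (Q.xWeyl u n)).toReal
        + 2 * (conj b * (R.post n h).mean (Q.xWeyl u n)).re + ‖b‖ ^ 2 := by
  filter_upwards [R.ae_posKernel hh hSig hsig hnu hups hQ n] with h hK u hE b
  have hW := Q.isWeyl_xWeyl u n
  have hK' : PosKernel (varianceKernel p.hbar (p.lowerS n) (p.lowerT n) (R.post n h)
      (Q.xWeyl u n)) := by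
    have := hK.varianceKernel_phase (OpenOscillator.shift p u n)
    rwa [← show Q.xWeyl u n = _ from funext fun ζ => Q.xWeyl_eq u n ζ] at this
  by_cases he : p.eps ≤ 0
  · have := le_energy_of_posKernel hW hE hK' b
    rwa [Params.lowerS, if_pos he] at this
  · have := le_energy_of_posKernel_conj hW hE hh.le hK' b
    rw [Params.lowerT, if_neg he] at this
    linarith

end Step


/-! ### Energies along the evolution, and the lower bound of the cost -/

section Evolution

open Filter OpenOscillator

variable {p : Params} {H : Type*} [NormedAddCommGroup H] [InnerProductSpace ℂ H]
  [CompleteSpace H] {Q : OpenOscillator p H} {Y : Type*} [MeasurableSpace Y]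

@[fun_prop] theorem Strategy.measurable_controls (s : Strategy Q Y) (n j : ℕ) :
    Measurable fun h : History Y n => s.controls h j := by
  rcases j with _ | j
  · exact measurable_const
  · by_cases hj : j < n
    · simp only [Strategy.controls, hj, dif_pos]
      fun_prop
    · simp only [Strategy.controls, hj, dif_neg, not_false_iff]
      fun_prop

theorem Strategy.controls_splitLast (s : Strategy Q Y) {n j : ℕ} (hj : j ≤ n)
    (x : History Y (n + 1)) : s.controls (splitLast x).1 j = s.controls x j := by
  rcases j with _ | j
  · rfl
  · simp only [Strategy.controls, dif_pos (Nat.lt_of_succ_le hj),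
      dif_pos (Nat.lt_succ_of_lt (Nat.lt_of_succ_le hj))]
    rfl

theorem shift_congr {u u' : ℕ → ℂ} {k : ℕ} (h : ∀ j < k, u j = u' j) : shift p u k = shift p u' k := by
  induction k with
  | zero => rfl
  | succ k ih => rw [shift, shift, ih fun j hj => h j (by omega), h k (by omega)]

theorem measurable_shift {X : Type*} [MeasurableSpace X] {u : X → ℕ → ℂ}
    (hu : ∀ j, Measurable fun x => u x j) (k : ℕ) : Measurable fun x => shift p (u x) k := by
  induction k with
  | zero => exact measurable_const
  | succ k ih => exact (ih.const_mul _).add ((hu k).const_mul _)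

variable {s : Strategy Q Y} (R : Evolution s)

instance (n : ℕ) : IsProbabilityMeasure (R.P n) := R.prob n

namespace Evolution

theorem measurable_ev_xWeyl (n k : ℕ) (ζ : ℂ) :
    Measurable fun h => (R.post n h).ev (Q.xWeyl (s.controls h) k ζ) := by
  have h1 := measurable_shift (p := p) (s.measurable_controls n) k
  have h2 := (R.measurable_ev n (Q.xWeyl 0 k ζ)).measurable
  have e : (fun h => (R.post n h).ev (Q.xWeyl (s.controls h) k ζ)) = fun h =>
      phase ζ (shift p (s.controls h) k) * (R.post n h).ev (Q.xWeyl 0 k ζ) := by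
    funext h
    rw [Q.xWeyl_eq, NormalState.ev_smul]
  rw [e]
  exact (measurable_phase_comp measurable_const h1).mul h2

theorem norm_ev_xWeyl_le (n k : ℕ) (ζ : ℂ) (h : History Y n) :
    ‖(R.post n h).ev (Q.xWeyl (s.controls h) k ζ)‖ ≤ 1 :=
  (NormalState.norm_ev_le _ _).trans ((Q.isWeyl_xWeyl _ k).norm_le ζ)

theorem integrable_ev_xWeyl (n k : ℕ) (ζ : ℂ) :
    Integrable (fun h => (R.post n h).ev (Q.xWeyl (s.controls h) k ζ)) (R.P n) :=
  .of_bound (R.measurable_ev_xWeyl n k ζ).aestronglyMeasurable (C := 1)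
    (.of_forall (R.norm_ev_xWeyl_le n k ζ))

/-- The amplitude `x_{n+1}` involves the controls up to `u_n` only; they are fixed by the first `n`
stages, so the average over the last result leaves its expectations unchanged. -/
theorem integral_ev_xWeyl_succ (n : ℕ) (ζ : ℂ) :
    ∫ x, (R.post (n + 1) x).ev (Q.xWeyl (s.controls x) (n + 1) ζ) ∂(R.P (n + 1))
      = ∫ h, (R.post n h).ev (Q.xWeyl (s.controls h) (n + 1) ζ) ∂(R.P n) := by
  have h1 := R.integral_step_const n (Q.xWeyl_mem_futureAlgebra 0 (n + 1) ζ)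
    (F := fun h => phase ζ (shift p (s.controls h) (n + 1)))
    (measurable_phase_comp measurable_const (measurable_shift (s.measurable_controls n) _)) (C := 1)
    fun h => (norm_phase _ _).le
  convert h1 using 2
  · funext x
    rw [Q.xWeyl_eq, NormalState.ev_smul]
    congr 2
    exact shift_congr fun j hj => (s.controls_splitLast (by omega) x).symm
  · funext h
    rw [Q.xWeyl_eq, NormalState.ev_smul]

theorem measurable_charQuot (n k m : ℕ) :
    Measurable fun h => charQuot (R.post n h) (Q.xWeyl (s.controls h) k) m :=
  (((R.measurable_ev_xWeyl n k _).re.const_sub 2).sub (R.measurable_ev_xWeyl n k _).re).div_const _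

theorem integral_charQuot (n k m : ℕ) :
    Integrable (fun h => charQuot (R.post n h) (Q.xWeyl (s.controls h) k) m) (R.P n) ∧
    ∫ h, charQuot (R.post n h) (Q.xWeyl (s.controls h) k) m ∂(R.P n) =
      (2 - (∫ h, (R.post n h).ev (Q.xWeyl (s.controls h) k (dyadic m)) ∂(R.P n)).re
        - (∫ h, (R.post n h).ev (Q.xWeyl (s.controls h) k (dyadic m * Complex.I)) ∂(R.P n)).re)
        / (2 * dyadic m ^ 2) := by
  have h1 := R.integrable_ev_xWeyl n k (dyadic m)
  have h2 := R.integrable_ev_xWeyl n k (dyadic m * Complex.I)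
  have h3 : Integrable (fun h => 2 - ((R.post n h).ev (Q.xWeyl (s.controls h) k (dyadic m))).re)
    (R.P n) := (integrable_const 2).sub h1.re
  have h4 : Integrable (fun h => ((R.post n h).ev
    (Q.xWeyl (s.controls h) k (dyadic m * Complex.I))).re) (R.P n) := h2.re
  have h5 : Integrable (fun h => ((R.post n h).ev
    (Q.xWeyl (s.controls h) k (dyadic m))).re) (R.P n) := h1.re
  refine ⟨(h3.sub h4).div_const _, ?_⟩
  have e1 : ∫ h, ((R.post n h).ev (Q.xWeyl (s.controls h) k (dyadic m))).re ∂(R.P n) = _ :=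
    integral_re h1
  have e2 : ∫ h, ((R.post n h).ev (Q.xWeyl (s.controls h) k (dyadic m * Complex.I))).re ∂(R.P n) = _ :=
    integral_re h2
  simp only [charQuot]
  rw [integral_div, integral_sub h3 h4, integral_sub (integrable_const 2) h5, e1, e2]
  simp

theorem measurable_energy (hh : 0 < p.hbar) (n k : ℕ) :
    Measurable fun h => (R.post n h).energy (Q.xWeyl (s.controls h) k) := by
  have h1 : Measurable fun h => (⨆ m, ENNReal.ofReal (charQuot (R.post n h)
      (Q.xWeyl (s.controls h) k) m)) - ENNReal.ofReal (p.hbar / 2) :=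
    (Measurable.iSup fun m => (R.measurable_charQuot n k m).ennreal_ofReal).sub_const _
  convert h1 using 2 with h
  rw [iSup_charQuot (Q.isWeyl_xWeyl _ k) _ hh.le, ENNReal.add_sub_cancel_right ENNReal.ofReal_ne_top]

/-- The energy is not an expectation of a bounded operator, so the recursion does not apply to it
directly; it is averaged as an increasing limit of bounded quotients, to which the recursion
applies. -/
theorem lintegral_energy_add (hh : 0 < p.hbar) (n k : ℕ) :
    ∫⁻ h, (R.post n h).energy (Q.xWeyl (s.controls h) k) ∂(R.P n) + ENNReal.ofReal (p.hbar / 2)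
      = ⨆ m, ENNReal.ofReal (∫ h, charQuot (R.post n h) (Q.xWeyl (s.controls h) k) m ∂(R.P n)) := by
  have h1 : ∀ m, ENNReal.ofReal (∫ h, charQuot (R.post n h) (Q.xWeyl (s.controls h) k) m ∂(R.P n))
      = ∫⁻ h, ENNReal.ofReal (charQuot (R.post n h) (Q.xWeyl (s.controls h) k) m) ∂(R.P n) := fun m =>
    ofReal_integral_eq_lintegral_ofReal (R.integral_charQuot n k m).1
      (.of_forall fun h => charQuot_nonneg (Q.isWeyl_xWeyl _ k) _ m)
  simp only [h1]
  rw [← lintegral_iSup (fun m => (R.measurable_charQuot n k m).ennreal_ofReal)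
    fun m l hml h => charQuot_mono (Q.isWeyl_xWeyl _ k) _ hml]
  simp only [iSup_charQuot (Q.isWeyl_xWeyl _ k) _ hh.le]
  rw [lintegral_add_right _ measurable_const, lintegral_const, measure_univ, mul_one]

theorem lintegral_energy_succ (hh : 0 < p.hbar) (n : ℕ) :
    ∫⁻ x, (R.post (n + 1) x).energy (Q.xWeyl (s.controls x) (n + 1)) ∂(R.P (n + 1))
      = ∫⁻ h, (R.post n h).energy (Q.xWeyl (s.controls h) (n + 1)) ∂(R.P n) := by
  rw [← ENNReal.add_left_inj (ENNReal.ofReal_ne_top (r := p.hbar / 2)), R.lintegral_energy_add hh,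
    R.lintegral_energy_add hh]
  simp only [(R.integral_charQuot _ _ _).2, R.integral_ev_xWeyl_succ]

theorem aestronglyMeasurable_mean {n : ℕ}
    (h : ∀ᵐ x ∂(R.P n), (R.post n x).energy (Q.xWeyl (s.controls x) n) ≠ ⊤) :
    AEStronglyMeasurable (fun x => (R.post n x).mean (Q.xWeyl (s.controls x) n)) (R.P n) := by
  refine aestronglyMeasurable_of_tendsto_ae atTop
    (f := fun m x => meanQuot (R.post n x) (Q.xWeyl (s.controls x) n) m) (fun m => ?_) ?_
  · exact ((((R.measurable_ev_xWeyl n n _).sub_const 1).add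
      (((R.measurable_ev_xWeyl n n _).sub_const 1).const_mul Complex.I)).div_const _).aestronglyMeasurable
  · filter_upwards [h] with x hx
    exact tendsto_meanQuot (Q.isWeyl_xWeyl _ n) hx

/-- The mean energies of the amplitude and of the control at the instant `n` are finite. -/
structure FiniteAt (n : ℕ) : Prop where
  control : ∫⁻ h, ENNReal.ofReal (‖s.controls h n‖ ^ 2) ∂(R.P n) ≠ ⊤
  energy : ∫⁻ h, (R.post n h).energy (Q.xWeyl (s.controls h) n) ∂(R.P n) ≠ ⊤

/-- The mean energy of the amplitude. -/
def meanEnergy (n : ℕ) : ℝ :=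
  ∫ h, ((R.post n h).energy (Q.xWeyl (s.controls h) n)).toReal ∂(R.P n)

/-- The correlation of the control and of the amplitude. -/
def correlation (n : ℕ) : ℂ :=
  ∫ h, conj (s.controls h n) * (R.post n h).mean (Q.xWeyl (s.controls h) n) ∂(R.P n)

/-- The mean energy of the control. -/
def controlEnergy (n : ℕ) : ℝ := ∫ h, ‖s.controls h n‖ ^ 2 ∂(R.P n)

theorem ae_energy_ne_top (hh : 0 < p.hbar) {n : ℕ}
    (hE : ∫⁻ h, (R.post n h).energy (Q.xWeyl (s.controls h) n) ∂(R.P n) ≠ ⊤) :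
    ∀ᵐ h ∂(R.P n), (R.post n h).energy (Q.xWeyl (s.controls h) n) ≠ ⊤ := by
  filter_upwards [ae_lt_top (R.measurable_energy hh n n) hE] with h hh using hh.ne

variable {R}

namespace FiniteAt

variable {n : ℕ} (hF : R.FiniteAt n) (hh : 0 < p.hbar)

include hF

theorem integrable_control : Integrable (fun h => ‖s.controls h n‖ ^ 2) (R.P n) := by
  refine ⟨((s.measurable_controls n n).norm.pow_const 2).aestronglyMeasurable, ?_⟩
  rw [hasFiniteIntegral_iff_ofReal (.of_forall fun h => by positivity)]
  exact hF.control.lt_top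

include hh

theorem integrable_energy :
    Integrable (fun h => ((R.post n h).energy (Q.xWeyl (s.controls h) n)).toReal) (R.P n) :=
  integrable_toReal_of_lintegral_ne_top (R.measurable_energy hh n n).aemeasurable hF.energy

theorem integrable_correlation : Integrable
    (fun h => conj (s.controls h n) * (R.post n h).mean (Q.xWeyl (s.controls h) n)) (R.P n) := by
  have hE := R.ae_energy_ne_top hh hF.energy
  refine (hF.integrable_control.add (hF.integrable_energy hh)).mono'
    ((Complex.continuous_conj.measurable.comp
      (s.measurable_controls n n)).aestronglyMeasurable.mul (R.aestronglyMeasurable_mean hE)) ?_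
  filter_upwards [hE] with h hE
  have h1 := NormalState.sq_mean_le hE
  rw [norm_mul, RCLike.norm_conj, Pi.add_apply]
  nlinarith [sq_nonneg (‖s.controls h n‖ - ‖(R.post n h).mean (Q.xWeyl (s.controls h) n)‖),
    sq_nonneg ‖s.controls h n‖]

/-- The integral of a quadratic function of the control and the amplitude. -/
theorem integral_quadratic (a c : ℝ) (b : ℂ) :
    Integrable (fun h => a * ((R.post n h).energy (Q.xWeyl (s.controls h) n)).toReal
        + 2 * (b * (conj (s.controls h n) * (R.post n h).mean (Q.xWeyl (s.controls h) n))).re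
        + c * ‖s.controls h n‖ ^ 2) (R.P n) ∧
      ∫ h, (a * ((R.post n h).energy (Q.xWeyl (s.controls h) n)).toReal
        + 2 * (b * (conj (s.controls h n) * (R.post n h).mean (Q.xWeyl (s.controls h) n))).re
        + c * ‖s.controls h n‖ ^ 2) ∂(R.P n)
      = a * R.meanEnergy n + 2 * (b * R.correlation n).re + c * R.controlEnergy n := by
  have h1 := (hF.integrable_energy hh).const_mul a
  have h2 := ((hF.integrable_correlation hh).const_mul b)
  have h2' : Integrable (fun h => 2 * (b * (conj (s.controls h n)
    * (R.post n h).mean (Q.xWeyl (s.controls h) n))).re) (R.P n) := h2.re.const_mul 2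
  have h3 := hF.integrable_control.const_mul c
  have h12 : Integrable (fun h => a * ((R.post n h).energy (Q.xWeyl (s.controls h) n)).toReal
    + 2 * (b * (conj (s.controls h n) * (R.post n h).mean (Q.xWeyl (s.controls h) n))).re) (R.P n) :=
    h1.add h2'
  refine ⟨h12.add h3, ?_⟩
  have e : ∫ h, (b * (conj (s.controls h n)
    * (R.post n h).mean (Q.xWeyl (s.controls h) n))).re ∂(R.P n) = _ := integral_re h2
  rw [integral_add h12 h3, integral_add h1 h2', integral_const_mul, integral_const_mul,
    integral_const_mul, e, integral_const_mul]
  rfl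

/-- The mean energy at `n + 1` is computed in the a posteriori states of the instant `n`, where the
noise of the step is still independent. -/
theorem energy_succ (hsig : 0 ≤ p.sig) (hQ : Q.IsGaussian) :
    ∫⁻ x, (R.post (n + 1) x).energy (Q.xWeyl (s.controls x) (n + 1)) ∂(R.P (n + 1)) ≠ ⊤ ∧
      R.meanEnergy (n + 1) = ‖p.phi‖ ^ 2 * R.meanEnergy n
        + 2 * (conj p.beta * p.phi * R.correlation n).re + ‖p.beta‖ ^ 2 * R.controlEnergy n
        + p.hbar * p.sig := by
  have hq := hF.integral_quadratic hh (‖p.phi‖ ^ 2) (‖p.beta‖ ^ 2) (conj p.beta * p.phi)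
  set F : History Y n → ℝ := fun h =>
    ‖p.phi‖ ^ 2 * ((R.post n h).energy (Q.xWeyl (s.controls h) n)).toReal
        + 2 * (conj p.beta * p.phi * (conj (s.controls h n)
          * (R.post n h).mean (Q.xWeyl (s.controls h) n))).re
        + ‖p.beta‖ ^ 2 * ‖s.controls h n‖ ^ 2 with hFdef
  have hFi : Integrable (fun h => F h + p.hbar * p.sig) (R.P n) := hq.1.add (integrable_const _)
  have hE := R.ae_energy_ne_top hh hF.energy
  have hae : ∀ᵐ h ∂(R.P n), (R.post n h).energy (Q.xWeyl (s.controls h) (n + 1))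
      = ENNReal.ofReal (F h + p.hbar * p.sig) ∧ 0 ≤ F h + p.hbar * p.sig := by
    filter_upwards [R.ae_noiseIndependent hQ n, hE] with h h1 h2
    have e : F h = ‖p.phi‖ ^ 2 * ((R.post n h).energy (Q.xWeyl (s.controls h) n)).toReal
        + 2 * (conj (p.beta * s.controls h n) * p.phi
          * (R.post n h).mean (Q.xWeyl (s.controls h) n)).re + ‖p.beta * s.controls h n‖ ^ 2 := by
      simp only [hFdef]
      rw [norm_mul, mul_pow, map_mul]
      congr 4
      ring
    refine ⟨by rw [h1.energy_succ hh hsig _ h2, e], ?_⟩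
    rw [e]
    exact add_nonneg (affine_nonneg h2 _ _) (mul_nonneg hh.le hsig)
  have h0 : 0 ≤ᵐ[R.P n] fun h => F h + p.hbar * p.sig := hae.mono fun h hx => hx.2
  have hL : ∫⁻ x, (R.post (n + 1) x).energy (Q.xWeyl (s.controls x) (n + 1)) ∂(R.P (n + 1))
      = ENNReal.ofReal (∫ h, (F h + p.hbar * p.sig) ∂(R.P n)) := by
    rw [R.lintegral_energy_succ hh, ofReal_integral_eq_lintegral_ofReal hFi h0]
    exact lintegral_congr_ae (hae.mono fun h hx => hx.1)
  have hne := hL.trans_ne ENNReal.ofReal_ne_top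
  refine ⟨hne, ?_⟩
  rw [meanEnergy, integral_toReal (R.measurable_energy hh _ _).aemeasurable
    ((R.ae_energy_ne_top hh hne).mono fun h hx => hx.lt_top), hL,
    ENNReal.toReal_ofReal (integral_nonneg_of_ae h0), integral_add hq.1 (integrable_const _), hq.2]
  simp

theorem runningCost_eq : R.runningCost n = p.om * R.meanEnergy n
    - 2 * (p.vth * R.correlation n).re + p.vth1 * R.controlEnergy n := by
  have h1 := (hF.integral_quadratic hh p.om p.vth1 (-p.vth)).2
  rw [runningCost]
  rw [neg_mul, Complex.neg_re, mul_neg, ← sub_eq_add_neg] at h1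
  rw [← h1]
  refine integral_congr_ae (.of_forall fun h => ?_)
  simp only [neg_mul, Complex.neg_re, mul_neg, mul_assoc]
  ring

/-- For given history the integrand is `|l|²` times the second moment of `x + u / l`, to which the
variance bound applies with the centre `b = u / l`; for `l = 0` the bound is trivial. -/
theorem le_error (hSig : 0 ≤ p.Sig) (hsig : 0 ≤ p.sig)
    (hnu : 0 ≤ p.nu) (hups : ‖p.ups‖ ^ 2 ≤ p.sig * p.nu) (hQ : Q.IsGaussian) (l : ℂ) :
    ‖l‖ ^ 2 * (p.hbar * p.SigAt p.muMin n)
      ≤ ‖l‖ ^ 2 * R.meanEnergy n + 2 * (l * R.correlation n).re + R.controlEnergy n := by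
  have h1 := hF.integral_quadratic hh (‖l‖ ^ 2) 1 l
  rw [one_mul] at h1
  rw [← h1.2]
  refine le_trans (by simp) (integral_mono_ae (integrable_const (‖l‖ ^ 2 * (p.hbar * p.SigAt p.muMin n)))
    h1.1 ?_)
  filter_upwards [R.ae_variance_le hh hSig hsig hnu hups hQ n, R.ae_energy_ne_top hh hF.energy]
    with h h2 hE
  rw [one_mul]
  by_cases hl : l = 0
  · simp [hl]
  have h3 := mul_le_mul_of_nonneg_left (h2 _ hE (s.controls h n / l)) (sq_nonneg ‖l‖)
  have hl' : ‖l‖ ≠ 0 := norm_ne_zero_iff.2 hl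
  have e1 : ‖l‖ ^ 2 * (conj (s.controls h n / l) * (R.post n h).mean (Q.xWeyl (s.controls h) n)).re
      = (l * (conj (s.controls h n) * (R.post n h).mean (Q.xWeyl (s.controls h) n))).re := by
    rw [← Complex.re_ofReal_mul]
    congr 1
    have : conj l ≠ 0 := by simpa using hl
    rw [map_div₀]
    push_cast
    rw [← Complex.mul_conj']
    field_simp
  have e2 : ‖l‖ ^ 2 * ‖s.controls h n / l‖ ^ 2 = ‖s.controls h n‖ ^ 2 := by
    rw [norm_div]
    field_simp
  rw [mul_add, mul_add, e2, mul_left_comm (‖l‖ ^ 2) 2, e1] at h3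
  exact h3

end FiniteAt

theorem FiniteEnergy.finiteAt {K : ℕ} (hF : R.FiniteEnergy K) {n : ℕ} (hn : n < K) : R.FiniteAt n :=
  ⟨hF.1 n hn, hF.2 n hn.le⟩

theorem _root_.QuantumLQG.Params.OmAt_of_lt (p : Params) {K k : ℕ} (hk : k < K) :
    p.OmAt K k = ‖p.phi‖ ^ 2 * p.OmAt K (k + 1) + p.om
      - ‖p.lamAt K k‖ ^ 2 * p.UpsAt K k := by
  have : K - k = K - (k + 1) + 1 := by omega
  rw [Params.OmAt, this]
  rfl

theorem _root_.QuantumLQG.Params.lamAt_mul (p : Params) {K k : ℕ} (h : 0 < p.UpsAt K k) :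
    p.phi * conj p.beta * (p.OmAt K (k + 1) : ℂ) - p.vth = p.lamAt K k * p.UpsAt K k := by
  have : (p.UpsAt K k : ℂ) ≠ 0 := by exact_mod_cast h.ne'
  rw [Params.lamAt, Params.lamOf]
  exact (div_mul_cancel₀ _ this).symm

/-- The cost through the errors of the controls. -/
theorem cost_eq (hh : 0 < p.hbar) (hsig : 0 ≤ p.sig) (hQ : Q.IsGaussian) {K : ℕ}
    (hUps : ∀ k < K, 0 < p.UpsAt K k) (hF : R.FiniteEnergy K) :
    R.cost K = p.OmAt K 0 * R.meanEnergy 0 + ∑ k ∈ Finset.range K,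
      (p.hbar * p.sig * p.OmAt K (k + 1) + p.UpsAt K k * (‖p.lamAt K k‖ ^ 2 * R.meanEnergy k
        + 2 * (p.lamAt K k * R.correlation k).re + R.controlEnergy k)) := by
  have h1 : R.finalCost K = p.OmAt K K * R.meanEnergy K := by
    rw [finalCost, integral_const_mul, Params.OmAt, Nat.sub_self]
    rfl
  -- The final loss is replaced by the initial value of `Ω_k ⟨x_k* x_k⟩` plus its increments; each
  -- increment and the running loss of the same step form the completed square.
  have h2 := Finset.sum_range_sub (fun k => p.OmAt K k * R.meanEnergy k) K
  rw [cost, h1, ← sub_add_cancel (p.OmAt K K * R.meanEnergy K) (p.OmAt K 0 * R.meanEnergy 0), ← h2,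
    add_right_comm, ← Finset.sum_add_distrib, add_comm]
  congr 1
  refine Finset.sum_congr rfl fun k hk => ?_
  have hk := Finset.mem_range.1 hk
  have hf := hF.finiteAt hk
  rw [hf.runningCost_eq hh, (hf.energy_succ hh hsig hQ).2, p.OmAt_of_lt hk]
  have h3 := congrArg (fun z : ℂ => (z * R.correlation k).re) (p.lamAt_mul (hUps k hk))
  simp only [mul_right_comm _ (p.UpsAt K k : ℂ), Complex.re_mul_ofReal] at h3
  have h4 : ((p.phi * conj p.beta * (p.OmAt K (k + 1) : ℂ) - p.vth) * R.correlation k).re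
      = p.OmAt K (k + 1) * (conj p.beta * p.phi * R.correlation k).re
        - (p.vth * R.correlation k).re := by
    rw [sub_mul, Complex.sub_re, ← Complex.re_ofReal_mul]
    congr 2
    ring
  have h5 : p.UpsAt K k = ‖p.beta‖ ^ 2 * p.OmAt K (k + 1) + p.vth1 := rfl
  have h6 : R.controlEnergy k * p.UpsAt K k
      = R.controlEnergy k * (‖p.beta‖ ^ 2 * p.OmAt K (k + 1) + p.vth1) := by rw [h5]
  linear_combination 2 * h4.symm.trans h3 - h6

theorem energy_zero (hh : 0 < p.hbar) (hSig : 0 ≤ p.Sig) (hQ : Q.IsGaussian) (h : History Y 0) :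
    (R.post 0 h).energy (Q.xWeyl (s.controls h) 0) = ENNReal.ofReal (‖p.z‖ ^ 2 + p.hbar * p.Sig) ∧
      (R.post 0 h).mean (Q.xWeyl (s.controls h) 0) = p.z := by
  rw [R.post_zero]
  refine energy_mean_of_gaussian (Q.isWeyl_xWeyl _ 0) hh.le hSig fun ζ => ?_
  have := hQ 0 ζ 0
  simpa [gaussianChar, OpenOscillator.xWeyl] using this

theorem meanEnergy_zero (hh : 0 < p.hbar) (hSig : 0 ≤ p.Sig) (hQ : Q.IsGaussian) :
    R.meanEnergy 0 = ‖p.z‖ ^ 2 + p.hbar * p.Sig := by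
  have h0 : 0 ≤ ‖p.z‖ ^ 2 + p.hbar * p.Sig := by positivity
  simp [meanEnergy, (energy_zero hh hSig hQ _).1, ENNReal.toReal_ofReal h0]

theorem _root_.QuantumLQG.Params.minLoss_eq (p : Params) {K : ℕ} (hUps : ∀ k < K, 0 < p.UpsAt K k) :
    p.minLoss K = p.OmAt K 0 * (‖p.z‖ ^ 2 + p.hbar * p.Sig) + ∑ k ∈ Finset.range K,
      (p.hbar * p.sig * p.OmAt K (k + 1)
        + p.UpsAt K k * (‖p.lamAt K k‖ ^ 2 * (p.hbar * p.SigAt p.muMin k))) := by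
  rw [Params.minLoss, mul_add, Finset.mul_sum, ← add_assoc, mul_add (p.OmAt K 0)]
  congr 1
  · ring
  refine Finset.sum_congr rfl fun k hk => ?_
  rw [p.lamAt_mul (hUps k (Finset.mem_range.1 hk)), ← mul_assoc, ← Complex.normSq_eq_conj_mul_self,
    ← Complex.ofReal_mul, Complex.ofReal_re, Complex.normSq_eq_norm_sq]
  ring

/-- The cost of any strategy of finite mean energies is at least that of the linear one. -/
theorem minLoss_le_cost (hh : 0 < p.hbar) (hSig : 0 ≤ p.Sig) (hsig : 0 ≤ p.sig)
    (hnu : 0 ≤ p.nu) (hups : ‖p.ups‖ ^ 2 ≤ p.sig * p.nu) (hQ : Q.IsGaussian) {K : ℕ}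
    (hUps : ∀ k < K, 0 < p.UpsAt K k) (hF : R.FiniteEnergy K) : p.minLoss K ≤ R.cost K := by
  rw [p.minLoss_eq hUps, cost_eq hh hsig hQ hUps hF, meanEnergy_zero hh hSig hQ]
  refine add_le_add_right (Finset.sum_le_sum fun k hk => add_le_add_right
    (mul_le_mul_of_nonneg_left ?_ (hUps k (Finset.mem_range.1 hk)).le) _) _
  exact (hF.finiteAt (Finset.mem_range.1 hk)).le_error hh hSig hsig hnu hups hQ _

end Evolution

end Evolution


/-! ### Gaussian conditional states -/

namespace POVM

variable {H : Type*} [NormedAddCommGroup H] [InnerProductSpace ℂ H] [CompleteSpace H]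
  {Z : Type*} [MeasurableSpace Z]

theorem cint_map {Z' : Type*} [MeasurableSpace Z'] {E : POVM Z H} {E' : POVM Z' H} {g : Z → Z'}
    (hg : Measurable g) (h : ∀ S, MeasurableSet S → E'.eff S = E.eff (g ⁻¹' S)) (f k : ℕ → H)
    {F : Z' → ℂ} (hF : Measurable F) : E'.cint f k F = E.cint f k fun z => F (g z) := by
  have h1 : ∀ f, E'.measureAt f = (E.measureAt f).map g := fun f => by
    ext S hS
    rw [measureAt_apply _ _ hS, Measure.map_apply hg hS, measureAt_apply _ _ (hg hS), h S hS]
  have h2 : ∀ f, E'.seqMeasure f = (E.seqMeasure f).map g := fun f => by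
    ext S hS
    rw [Measure.map_apply hg hS, seqMeasure, seqMeasure, Measure.sum_apply _ hS,
      Measure.sum_apply _ (hg hS)]
    exact tsum_congr fun i => by rw [h1, Measure.map_apply hg hS]
  simp only [cint, h2]
  congr 1
  refine Finset.sum_congr rfl fun k _ => ?_
  rw [integral_map hg.aemeasurable hF.aestronglyMeasurable]

/-- The complex measure `⟨f, E g⟩` has the density `w` with respect to `⟨f', E g'⟩` as soon as the
characteristic functions agree. Polarization and the parts of `w` reduce the comparison to four plus
sixteen finite positive measures. -/
theorem cint_eq_of_char {E : POVM ℂ H} {f g f' g' : ℕ → H} (hf : Summable fun i => ‖f i‖ ^ 2)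
    (hg : Summable fun i => ‖g i‖ ^ 2) (hf' : Summable fun i => ‖f' i‖ ^ 2)
    (hg' : Summable fun i => ‖g' i‖ ^ 2) {w : ℂ → ℂ} (hw : Measurable w) {C : ℝ}
    (hC : ∀ η, ‖w η‖ ≤ C)
    (h : ∀ θ, E.cint f g (phase θ) = E.cint f' g' fun η => phase θ η * w η) {F : ℂ → ℂ}
    (hF : Measurable F) {C' : ℝ} (hC' : ∀ η, ‖F η‖ ≤ C') :
    E.cint f g F = E.cint f' g' fun η => F η * w η := by
  let m : Fin 4 → Measure ℂ := fun k => E.seqMeasure fun i => f i + ((-Complex.I) ^ (k : ℕ)) • g i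
  let m' : Fin 4 → Measure ℂ := fun k => E.seqMeasure fun i => f' i + ((-Complex.I) ^ (k : ℕ)) • g' i
  have fm : ∀ k, IsFiniteMeasure (m k) := fun k =>
    E.isFiniteMeasure_seqMeasure (summable_sq_polar hf hg _)
  have fm' : ∀ k, IsFiniteMeasure (m' k) := fun k =>
    E.isFiniteMeasure_seqMeasure (summable_sq_polar hf' hg' _)
  have hwi : ∀ k, Integrable w (m' k) := fun k =>
    .of_bound hw.aestronglyMeasurable (C := C) (.of_forall hC)
  have fp : ∀ k l, IsFiniteMeasure (partMeasure (m' k) id w l) := fun k l =>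
    isFiniteMeasure_partMeasure (hwi k) l
  let μ : Fin 4 ⊕ (Fin 4 × Fin 4) → Measure ℂ :=
    Sum.elim m fun k => partMeasure (m' k.1) id w k.2
  let a : Fin 4 ⊕ (Fin 4 × Fin 4) → ℂ :=
    Sum.elim (fun k => Complex.I ^ (k : ℕ)) fun k => -(Complex.I ^ (k.1 : ℕ) * Complex.I ^ (k.2 : ℕ))
  have fμ : ∀ i, IsFiniteMeasure (μ i) := by
    rintro (k | k)
    · exact fm k
    · exact fp k.1 k.2
  have key : ∀ (G : ℂ → ℂ), Measurable G → ∀ D : ℝ, (∀ η, ‖G η‖ ≤ D) →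
      ∑ i, a i * ∫ η, G η ∂(μ i)
        = 4 * (E.cint f g G - E.cint f' g' fun η => G η * w η) := fun G hG D hD => by
    have h1 : ∀ k, ∫ η, G η * w η ∂(m' k)
        = ∑ l : Fin 4, Complex.I ^ (l : ℕ) * ∫ η, G η ∂(partMeasure (m' k) id w l) := fun k =>
      integral_eq_sum_partMeasure measurable_id hw (hwi k) hG hD
    have h2 : ∀ x : ℂ, 4 * (1 / 4 * x) = x := fun x => by ring
    rw [Fintype.sum_sum_type, Fintype.sum_prod_type, mul_sub, cint, cint, h2, h2]
    change ∑ k : Fin 4, Complex.I ^ (k : ℕ) * ∫ η, G η ∂(m k) + _ = ∑ k : Fin 4,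
      Complex.I ^ (k : ℕ) * ∫ η, G η ∂(m k)
        - ∑ k : Fin 4, Complex.I ^ (k : ℕ) * ∫ η, G η * w η ∂(m' k)
    simp only [h1, Finset.mul_sum, sub_eq_add_neg, ← Finset.sum_neg_distrib]
    congr 1
    refine Finset.sum_congr rfl fun k _ => Finset.sum_congr rfl fun l _ => ?_
    simp only [a, μ, Sum.elim_inr]
    ring
  have h0 := sum_integral_eq_zero_of_char (m := μ) (a := a) (fun θ => by
    rw [key (phase θ) (by fun_prop) 1 fun η => (norm_phase θ η).le, h θ, sub_self, mul_zero])
    (f := F) fun i => .of_bound hF.aestronglyMeasurable (C := C') (.of_forall hC')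
  rw [key F hF C' hC'] at h0
  exact sub_eq_zero.1 ((mul_eq_zero.1 h0).resolve_left (by norm_num))

end POVM

/-! ### Conditional Gaussian states and the cost of the linear strategy. -/

section Conditional

open OpenOscillator

variable {p : Params} {H : Type*} [NormedAddCommGroup H] [InnerProductSpace ℂ H]
  [CompleteSpace H] {Q : OpenOscillator p H}

@[simp] theorem gaussianChar_zero (c S : ℝ) (a : ℂ) : gaussianChar c S a 0 = 1 := by
  simp [gaussianChar]

theorem norm_gaussianChar (c S : ℝ) (a ζ : ℂ) :
    ‖gaussianChar c S a ζ‖ = Real.exp (-(c * (S + 1 / 2) * ‖ζ‖ ^ 2)) := by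
  rw [gaussianChar, norm_mul, norm_phase, one_mul, ← Complex.ofReal_neg, ← Complex.ofReal_exp, Complex.norm_real,
    Real.norm_eq_abs, abs_of_pos (Real.exp_pos _)]

theorem gaussianChar_add (c S : ℝ) (a b ζ : ℂ) :
    gaussianChar c S (a + b) ζ = phase ζ b * gaussianChar c S a ζ := by
  rw [gaussianChar, gaussianChar, phase_add_right]
  ring

@[fun_prop] theorem measurable_gaussianChar {X : Type*} [MeasurableSpace X] {c S : ℝ} {f : X → ℂ}
    (hf : Measurable f) (ζ : ℂ) : Measurable fun x => gaussianChar c S (f x) ζ := by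
  unfold gaussianChar
  fun_prop

/-- The joint characteristic function of the next amplitude and of the measured output, in a state
in which the amplitude has a Gaussian distribution. -/
theorem OpenOscillator.NoiseIndependent.ev_yWeyl_mul_xWeyl {n : ℕ} {ρ : NormalState H}
    (hρ : Q.NoiseIndependent n ρ) {mu S : ℝ} {a : ℂ}
    (hG : ∀ ζ, ρ.ev (Q.xWeyl 0 n ζ) = gaussianChar p.hbar S a ζ) (hS : 0 ≤ S) (hnu : 0 ≤ p.nu)
    (hmu : 0 ≤ mu) (hups : ‖p.ups‖ ^ 2 ≤ p.sig * p.nu) (u : ℕ → ℂ) (θ ζ : ℂ) :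
    Complex.exp (-(p.hbar * mu * ‖θ‖ ^ 2 : ℝ)) * (Complex.exp ((p.hbar * p.eps * ‖θ‖ ^ 2 / 2 : ℝ))
        * ρ.ev (Q.yWeyl u n θ * Q.xWeyl 0 (n + 1) ζ))
      = gaussianChar p.hbar (‖p.phi‖ ^ 2 * S + p.sig - ‖p.gainOf mu S‖ ^ 2 * p.psiOf mu S)
          (p.phi * a) ζ * (phase θ (p.gamma * (a + shift p u n) + p.delta * u n)
          * Complex.exp (-(p.hbar * p.psiOf mu S * ‖θ + conj (p.gainOf mu S) * ζ‖ ^ 2 : ℝ))) := by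
  have h1 := p.filter_square hS hnu hmu hups (ζ, θ) (ζ, θ)
  have h2 := p.pull_commForm (ζ, θ) (ζ, θ)
  rw [Q.yWeyl_eq, smul_mul_assoc, NormalState.ev_smul, Q.yWeyl_mul_xWeyl, hρ.ev_jointWeyl, hG,
    gaussianChar, gaussianChar, Params.noiseWeight_eq]
  have hph : phase (p.pull (ζ, θ)) a = phase ζ (p.phi * a) * phase θ (p.gamma * a) := by
    rw [Params.pull, phase_add_left, phase_mul_right, phase_mul_right, mul_comm]
  have hph' : phase θ (p.gamma * (a + shift p u n) + p.delta * u n)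
      = phase θ (p.gamma * a) * phase θ (p.gamma * shift p u n + p.delta * u n) := by
    rw [← phase_add_right]
    congr 1
    ring
  rw [hph, hph']
  -- The exponents match by the Kalman square; the commutation identity, with the factor `1 / 2`,
  -- accounts for the symmetric order of the Weyl operators.
  have hexp : Complex.exp (-(p.hbar * mu * ‖θ‖ ^ 2 : ℝ))
      * Complex.exp ((p.hbar * p.eps * ‖θ‖ ^ 2 / 2 : ℝ))
      * Complex.exp (-(p.hbar * (S + 1 / 2) * ‖p.pull (ζ, θ)‖ ^ 2 : ℝ))
      * Complex.exp (-(p.hbar * (p.covKernel (ζ, θ) (ζ, θ) + p.commForm (ζ, θ) (ζ, θ) / 2)))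
      = Complex.exp (-(p.hbar * ((‖p.phi‖ ^ 2 * S + p.sig
          - ‖p.gainOf mu S‖ ^ 2 * p.psiOf mu S) + 1 / 2) * ‖ζ‖ ^ 2 : ℝ))
        * Complex.exp (-(p.hbar * p.psiOf mu S * ‖θ + conj (p.gainOf mu S) * ζ‖ ^ 2 : ℝ)) := by
    rw [← Complex.exp_add, ← Complex.exp_add, ← Complex.exp_add, ← Complex.exp_add]
    congr 1
    push_cast at h1 ⊢
    simp only [← Complex.mul_conj'] at h1 ⊢
    linear_combination (-(p.hbar : ℂ)) * h1 - (p.hbar : ℂ) / 2 * h2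
  linear_combination (phase θ (p.gamma * shift p u n + p.delta * u n) * phase ζ (p.phi * a)
    * phase θ (p.gamma * a)) * hexp

/-- The density of the conditional characteristic function of the next amplitude. -/
theorem OpenOscillator.NoiseIndependent.cint_eq {n : ℕ} {ρ : NormalState H}
    (hρ : Q.NoiseIndependent n ρ) {mu S : ℝ} {a : ℂ}
    (hG : ∀ ζ, ρ.ev (Q.xWeyl 0 n ζ) = gaussianChar p.hbar S a ζ) (hS : 0 ≤ S) (hnu : 0 ≤ p.nu)
    (hmu : 0 ≤ mu) (hups : ‖p.ups‖ ^ 2 ≤ p.sig * p.nu) {u : ℕ → ℂ} {E : POVM ℂ H}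
    (hE : Q.IsIndirectMeasurement mu u n E) (ζ : ℂ) {F : ℂ → ℂ} (hF : Measurable F) {C : ℝ}
    (hC : ∀ η, ‖F η‖ ≤ C) :
    E.cint ρ.vec (fun i => Q.xWeyl 0 (n + 1) ζ (ρ.vec i)) F = E.cint ρ.vec ρ.vec fun η => F η
      * gaussianChar p.hbar (‖p.phi‖ ^ 2 * S + p.sig - ‖p.gainOf mu S‖ ^ 2 * p.psiOf mu S)
        (p.phi * a + p.gainOf mu S * (η - (p.gamma * (a + shift p u n) + p.delta * u n))) ζ := by
  set S' := ‖p.phi‖ ^ 2 * S + p.sig - ‖p.gainOf mu S‖ ^ 2 * p.psiOf mu S with hS'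
  set b := p.gamma * (a + shift p u n) + p.delta * u n with hb
  set κ := p.gainOf mu S with hκ
  have hs := ρ.summable_sq
  have key : ∀ θ ζ, E.cint ρ.vec (fun i => Q.xWeyl 0 (n + 1) ζ (ρ.vec i)) (phase θ)
      = gaussianChar p.hbar S' (p.phi * a) ζ * (phase θ b
        * Complex.exp (-(p.hbar * p.psiOf mu S * ‖θ + conj κ * ζ‖ ^ 2 : ℝ))) := fun θ ζ => by
    rw [E.cint_eq_of_quadratic (F := phase θ) (T := (Complex.exp (-(p.hbar * mu * ‖θ‖ ^ 2 : ℝ))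
      * Complex.exp ((p.hbar * p.eps * ‖θ‖ ^ 2 / 2 : ℝ))) • Q.yWeyl u n θ) (by fun_prop) (C := 1)
      (fun η => (norm_phase θ η).le) (fun f => ?_) hs (summable_sq_apply hs _),
      ← hρ.ev_yWeyl_mul_xWeyl hG hS hnu hmu hups, NormalState.ev, ← tsum_mul_left, ← tsum_mul_left]
    · refine tsum_congr fun i => ?_
      rw [smul_apply, inner_smul_right, mul_apply_eq_comp, mul_assoc]
    · rw [hE θ f, smul_apply, inner_smul_right]
      ring
  have key0 : ∀ θ, E.cint ρ.vec ρ.vec (phase θ) = phase θ b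
      * Complex.exp (-(p.hbar * p.psiOf mu S * ‖θ‖ ^ 2 : ℝ)) := fun θ => by
    have := key θ 0
    rw [(Q.isWeyl_xWeyl_zero (n + 1)).zero] at this
    simpa only [one_apply_eq_self, gaussianChar_zero, one_mul, mul_zero, add_zero] using this
  -- As a function of the result, the conditional characteristic function is a constant times a
  -- phase; multiplication by it shifts `θ` by `κ̄ ζ`, which is exactly the shift in the joint
  -- characteristic function.
  have hw : ∀ η, gaussianChar p.hbar S' (p.phi * a + κ * (η - b)) ζ
      = gaussianChar p.hbar S' (p.phi * a + -(κ * b)) ζ * phase (conj κ * ζ) η := fun η => by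
    rw [← phase_mul_right, mul_comm _ (phase _ _), ← gaussianChar_add]
    congr 1
    ring
  refine POVM.cint_eq_of_char hs (summable_sq_apply hs _) hs hs (by fun_prop)
    (fun η => (norm_gaussianChar _ _ _ _).le) (fun θ => ?_) hF hC
  have e : (fun η => phase θ η * gaussianChar p.hbar S' (p.phi * a + κ * (η - b)) ζ)
      = fun η => gaussianChar p.hbar S' (p.phi * a + -(κ * b)) ζ * phase (θ + conj κ * ζ) η := by
    funext η
    rw [hw, phase_add_left]
    ring
  rw [e, POVM.cint_smul, key0, key, gaussianChar_add, phase_add_left, phase_neg_right,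
    phase_mul_right]
  have h1 : phase (conj κ * -ζ) b * phase (conj κ * ζ) b = 1 := by
    rw [← phase_add_left, ← mul_add, neg_add_cancel, mul_zero, phase_zero_left]
  linear_combination (-(gaussianChar p.hbar S' (p.phi * a) ζ * phase θ b
    * Complex.exp (-(p.hbar * p.psiOf mu S * ‖θ + conj κ * ζ‖ ^ 2 : ℝ)))) * h1

theorem _root_.QuantumLQG.Params.estimate_congr (p : Params) {mu : ℝ} {u u' eta eta' : ℕ → ℂ} {k : ℕ}
    (hu : ∀ j < k, u j = u' j) (he : ∀ j < k, eta j = eta' j) :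
    p.estimate mu u eta k = p.estimate mu u' eta' k := by
  induction k with
  | zero => rfl
  | succ k ih =>
    rw [Params.estimate, Params.estimate, ih (fun j hj => hu j (by omega)) fun j hj => he j (by omega),
      hu k (by omega), he k (by omega)]

theorem _root_.QuantumLQG.Params.measurable_estimate (p : Params) {X : Type*} [MeasurableSpace X]
    {mu : ℝ} {u eta : X → ℕ → ℂ}
    (hu : ∀ j, Measurable fun x => u x j) (he : ∀ j, Measurable fun x => eta x j) (k : ℕ) :
    Measurable fun x => p.estimate mu (u x) (eta x) k := by
  induction k with
  | zero => exact measurable_const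
  | succ k ih =>
    simp only [Params.estimate]
    have := hu k
    have := he k
    fun_prop

@[fun_prop] theorem measurable_results (n j : ℕ) :
    Measurable fun y : History ℂ n × ℂ => results y.1 y.2 j := by
  by_cases hj : j < n
  · simp only [results, hj, dif_pos]
    fun_prop
  · simp only [results, hj, dif_neg, not_false_iff]
    fun_prop

theorem results_splitLast {n j : ℕ} (hj : j ≤ n) (x : History ℂ (n + 1)) (η : ℂ) :
    results (splitLast x).1 (splitLast x).2.1 j = results x η j := by
  rcases hj.lt_or_eq with hj | rfl
  · simp only [results, dif_pos hj, dif_pos (Nat.lt_succ_of_lt hj)]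
    rfl
  · simp only [results, lt_irrefl, dif_neg, not_false_iff, dif_pos (Nat.lt_succ_self j)]
    rfl

/-- The control prescribed by the linear strategy. -/
def linearControl (s : Strategy Q ℂ) (K : ℕ) (mu : ℝ) (n : ℕ) (y : History ℂ n × ℂ) : ℂ :=
  -p.lamAt K (n + 1) * p.estimate mu (s.controls y.1) (results y.1 y.2) (n + 1)

theorem measurable_linearControl (s : Strategy Q ℂ) (K : ℕ) (mu : ℝ) (n : ℕ) :
    Measurable (linearControl s K mu n) :=
  (p.measurable_estimate (fun j => (s.measurable_controls n j).comp measurable_fst)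
    (fun j => measurable_results n j) _).const_mul _

/-- The Kalman estimate of a history. -/
def estimateAt (s : Strategy Q ℂ) (mu : ℝ) (n : ℕ) (h : History ℂ n) : ℂ :=
  p.estimate mu (s.controls h) (results h 0) n

theorem estimateAt_succ (s : Strategy Q ℂ) (mu : ℝ) (n : ℕ) (x : History ℂ (n + 1)) :
    estimateAt s mu (n + 1) x = p.phi * estimateAt s mu n (splitLast x).1
      + p.beta * s.controls (splitLast x).1 n + p.gainOf mu (p.SigAt mu n)
        * ((splitLast x).2.1 - p.gamma * estimateAt s mu n (splitLast x).1
          - p.delta * s.controls (splitLast x).1 n) := by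
  have h1 : p.estimate mu (s.controls x) (results x 0) n = estimateAt s mu n (splitLast x).1 := by
    refine p.estimate_congr (fun j hj => (s.controls_splitLast hj.le x).symm) fun j hj => ?_
    rw [← results_splitLast hj.le x 0]
    simp only [results, dif_pos hj]
  rw [estimateAt, Params.estimate, h1, s.controls_splitLast le_rfl, ← results_splitLast le_rfl x 0]
  simp [results]

theorem linearControl_splitLast (s : Strategy Q ℂ) (K : ℕ) (mu : ℝ) (n : ℕ) (x : History ℂ (n + 1)) :
    linearControl s K mu n ((splitLast x).1, (splitLast x).2.1)
      = -p.lamAt K (n + 1) * estimateAt s mu (n + 1) x := by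
  rw [linearControl, estimateAt]
  congr 1
  refine p.estimate_congr (fun j hj => s.controls_splitLast (by omega) x) fun j hj => ?_
  exact results_splitLast (by omega) x 0

theorem measurable_estimateAt (s : Strategy Q ℂ) (mu : ℝ) (n : ℕ) : Measurable (estimateAt s mu n) :=
  p.measurable_estimate (s.measurable_controls n)
    (fun j => (measurable_results n j).comp (measurable_id.prodMk measurable_const)) n

namespace Evolution

variable {s : Strategy Q ℂ} (R : Evolution s) {K : ℕ} {mu : ℝ}

/-- The measurement of the pair `(η, u)` is the image of one of `η` under the graph of the
prescribed control. The recursion with the operator `1` then gives probability zero to the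
complement of the graph. -/
theorem ae_control_eq (hs : s.IsLinearGaussian K mu) {n : ℕ} (hn : n < K) :
    ∀ᵐ h ∂(R.P n), s.controls h n = -p.lamAt K n * estimateAt s mu n h := by
  rcases n with _ | n
  · exact .of_forall fun h => hs.1 hn
  have hm := measurable_linearControl s K mu n
  let B : Set (History ℂ n × (ℂ × ℂ)) := {y | y.2.2 ≠ linearControl s K mu n (y.1, y.2.1)}
  have hB : MeasurableSet B :=
    (measurableSet_eq_fun (by fun_prop) (hm.comp (by fun_prop))).compl
  have h1 := R.integral_step n (Q.one_mem_futureAlgebra (n + 1)) (F := B.indicator 1)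
    (measurable_one.indicator hB) (C := 1) (norm_indicator_one_le B)
  have h2 : ∀ h, (s.meas n h).cint (R.post n h).vec
      (fun i => (1 : H →L[ℂ] H) ((R.post n h).vec i)) (fun z => B.indicator 1 (h, z)) = 0 := fun h => by
    obtain ⟨E, -, hE⟩ := hs.2 n hn h
    have hg : Measurable fun η => (η, linearControl s K mu n (h, η)) :=
      measurable_id.prodMk (hm.comp (by fun_prop))
    rw [POVM.cint_map hg (E := E) hE _ _ (F := fun z => B.indicator 1 (h, z))
      ((measurable_one.indicator hB).comp (by fun_prop))]
    have : (fun η => B.indicator (1 : History ℂ n × (ℂ × ℂ) → ℂ) (h, (η, linearControl s K mu n (h, η)))) = fun _ => 0 := by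
      funext η
      simp [B]
    rw [this, POVM.cint_zero]
  rw [integral_congr_ae (.of_forall h2), integral_zero] at h1
  have h3 : ∀ x : History ℂ (n + 1), B.indicator (1 : History ℂ n × (ℂ × ℂ) → ℂ) (splitLast x) * (R.post (n + 1) x).ev 1
      = (splitLast ⁻¹' B).indicator 1 x := fun x => by
    rw [NormalState.ev_one, mul_one]
    rfl
  have hB' := measurable_splitLast (Y := ℂ) (n := n) hB
  rw [integral_congr_ae (.of_forall h3), integral_indicator hB'] at h1
  have h4 : (R.P (n + 1)) (splitLast ⁻¹' B) = 0 := by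
    have : (R.P (n + 1)).real (splitLast ⁻¹' B) = 0 := by simpa [Measure.real] using h1
    exact (measureReal_eq_zero_iff).1 this
  filter_upwards [measure_eq_zero_iff_ae_notMem.1 h4] with x hx
  rw [← linearControl_splitLast]
  have : (splitLast x).2.2 = linearControl s K mu n ((splitLast x).1, (splitLast x).2.1) := by
    by_contra h
    exact hx h
  rw [← this]
  simp only [Strategy.controls, dif_pos (Nat.lt_succ_self n)]
  rfl

/-- Under the linear strategy the a posteriori states are Gaussian, with the Kalman estimates as
means. -/
theorem ae_gaussian (hSig : 0 ≤ p.Sig) (hsig : 0 ≤ p.sig)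
    (hnu : 0 ≤ p.nu) (hups : ‖p.ups‖ ^ 2 ≤ p.sig * p.nu) (hQ : Q.IsGaussian) (hmu : 0 ≤ mu)
    (hs : s.IsLinearGaussian K mu) {n : ℕ} (hn : n = 0 ∨ n < K) :
    ∀ᵐ h ∂(R.P n), ∀ ζ, (R.post n h).ev (Q.xWeyl 0 n ζ)
      = gaussianChar p.hbar (p.SigAt mu n) (estimateAt s mu n h - shift p (s.controls h) n) ζ := by
  induction n with
  | zero =>
    refine .of_forall fun h ζ => ?_
    have := hQ 0 ζ 0
    rw [R.post_zero]
    simpa [gaussianChar, OpenOscillator.xWeyl, estimateAt, Params.estimate, Params.SigAt, shift]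
      using this
  | succ n ih =>
    -- The linear strategy prescribes the measurement of `y_{n+1}` only for `n + 1 < K`; nothing is
    -- claimed about the states at the final instant `K`.
    have hn' : n + 1 < K := hn.resolve_left (by omega)
    have ih := ih (.inr (by omega))
    have hSn := p.SigAt_nonneg hSig hsig hnu hmu hups n
    have hm := measurable_estimateAt s mu n
    have hsh := measurable_shift (p := p) (s.measurable_controls n) n
    have hc := s.measurable_controls n n
    -- The part of the amplitude caused by the controls is subtracted, because the fixed operators
    -- of the future algebra are those for vanishing controls.
    let A : History ℂ n → ℂ := fun h => estimateAt s mu n h - shift p (s.controls h) n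
    let M : History ℂ n × (ℂ × ℂ) → ℂ := fun y => p.phi * A y.1 + p.gainOf mu (p.SigAt mu n)
      * (y.2.1 - (p.gamma * (A y.1 + shift p (s.controls y.1) n) + p.delta * s.controls y.1 n))
    have hM : Measurable M := by
      have hf : Measurable (Prod.fst : History ℂ n × (ℂ × ℂ) → History ℂ n) := measurable_fst
      have a1 := (hm.sub hsh).comp hf
      have a2 := hsh.comp hf
      have a3 := hc.comp hf
      exact (a1.const_mul _).add ((measurable_snd.fst.sub (((a1.add a2).const_mul _).add
        (a3.const_mul _))).const_mul _)
    have hMx : ∀ x : History ℂ (n + 1), M (splitLast x)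
        = estimateAt s mu (n + 1) x - shift p (s.controls x) (n + 1) := fun x => by
      rw [estimateAt_succ, ← shift_congr fun j (hj : j < n + 1) =>
        s.controls_splitLast (Nat.lt_succ_iff.1 hj) x, shift]
      simp only [M, A]
      ring
    suffices h : ∀ ζ, ∀ᵐ x ∂(R.P (n + 1)), (R.post (n + 1) x).ev (Q.xWeyl 0 (n + 1) ζ)
        - gaussianChar p.hbar (p.SigAt mu (n + 1)) (M (splitLast x)) ζ ∈ ({0} : Set ℂ) by
      have h' := ae_forall_of_continuous isClosed_singleton (fun x => ?_) h
      · filter_upwards [h'] with x hx ζ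
        rw [← hMx]
        exact sub_eq_zero.1 (hx ζ)
      · refine (NormalState.continuous_ev _ (Q.isWeyl_xWeyl_zero (n + 1)).cont
          (Q.isWeyl_xWeyl_zero (n + 1)).norm_le).sub ?_
        unfold gaussianChar
        fun_prop
    intro ζ
    have hw : Measurable fun y => gaussianChar p.hbar (p.SigAt mu (n + 1)) (M y) ζ := by fun_prop
    have hev := R.integrable_ev (n + 1) (Q.xWeyl 0 (n + 1) ζ)
    have hwi : Integrable (fun x => gaussianChar p.hbar (p.SigAt mu (n + 1)) (M (splitLast x)) ζ)
        (R.P (n + 1)) := .of_bound (hw.comp measurable_splitLast).aestronglyMeasurable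
          (C := _) (.of_forall fun x => (norm_gaussianChar _ _ _ _).le)
    refine R.ae_eq_zero_of_rect n (hev.sub hwi) ((R.measurable_ev _ _).measurable.sub
      (hw.comp measurable_splitLast)) fun B S hB hS => ?_
    have hBS := hB.prod hS
    have hi : Measurable ((B ×ˢ S).indicator (1 : History ℂ n × (ℂ × ℂ) → ℂ)) := measurable_one.indicator hBS
    have i1 : Integrable (fun x : History ℂ (n + 1) => (B ×ˢ S).indicator 1 (splitLast x)
        * (R.post (n + 1) x).ev (Q.xWeyl 0 (n + 1) ζ)) (R.P (n + 1)) :=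
      hev.bdd_mul (hi.comp measurable_splitLast).aestronglyMeasurable (c := 1)
        (.of_forall fun x => norm_indicator_one_le _ _)
    have i2 : Integrable (fun x : History ℂ (n + 1) => (B ×ˢ S).indicator 1 (splitLast x)
        * gaussianChar p.hbar (p.SigAt mu (n + 1)) (M (splitLast x)) ζ) (R.P (n + 1)) :=
      hwi.bdd_mul (hi.comp measurable_splitLast).aestronglyMeasurable (c := 1)
        (.of_forall fun x => norm_indicator_one_le _ _)
    simp only [mul_sub]
    rw [integral_sub i1 i2, sub_eq_zero]
    rw [R.integral_step n (Q.xWeyl_mem_futureAlgebra 0 (n + 1) ζ) hi (norm_indicator_one_le _)]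
    -- The recursion is used a second time, with the operator `1` and the asserted characteristic
    -- function as test function; `cint_eq` identifies the two right-hand sides.
    have h2 := R.integral_step n (Q.one_mem_futureAlgebra (n + 1))
      (F := fun y => (B ×ˢ S).indicator 1 y * gaussianChar p.hbar (p.SigAt mu (n + 1)) (M y) ζ)
      (hi.mul hw) (C := 1 * Real.exp (-(p.hbar * (p.SigAt mu (n + 1) + 1 / 2) * ‖ζ‖ ^ 2))) fun y => by
        rw [norm_mul, norm_gaussianChar]
        exact mul_le_mul_of_nonneg_right (norm_indicator_one_le _ _) (Real.exp_pos _).le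
    simp only [NormalState.ev_one, mul_one, one_apply_eq_self] at h2
    rw [h2]
    refine integral_congr_ae ?_
    filter_upwards [ih, R.ae_noiseIndependent hQ n] with h hG hN
    obtain ⟨E, hI, hE⟩ := hs.2 n hn' h
    have hg : Measurable fun η => (η, linearControl s K mu n (h, η)) :=
      measurable_id.prodMk ((measurable_linearControl s K mu n).comp (by fun_prop))
    rw [POVM.cint_map hg (E := E) hE _ _ (F := fun z => (B ×ˢ S).indicator 1 (h, z))
        (hi.comp (by fun_prop)),
      POVM.cint_map hg (E := E) hE _ _ (F := fun z => (B ×ˢ S).indicator 1 (h, z)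
        * gaussianChar p.hbar (p.SigAt mu (n + 1)) (M (h, z)) ζ) ((hi.mul hw).comp (by fun_prop))]
    exact hN.cint_eq hG hSn hnu hmu hups hI ζ (F := fun η => (B ×ˢ S).indicator 1
      (h, (η, linearControl s K mu n (h, η)))) (hi.comp (by fun_prop)) fun η => norm_indicator_one_le _ _

theorem ae_energy_mean (hh : 0 < p.hbar) (hSig : 0 ≤ p.Sig) (hsig : 0 ≤ p.sig)
    (hnu : 0 ≤ p.nu) (hups : ‖p.ups‖ ^ 2 ≤ p.sig * p.nu) (hQ : Q.IsGaussian) (hmu : 0 ≤ mu)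
    (hs : s.IsLinearGaussian K mu) {n : ℕ} (hn : n < K) :
    ∀ᵐ h ∂(R.P n), (R.post n h).energy (Q.xWeyl (s.controls h) n)
        = ENNReal.ofReal (‖estimateAt s mu n h‖ ^ 2 + p.hbar * p.SigAt mu n) ∧
      (R.post n h).mean (Q.xWeyl (s.controls h) n) = estimateAt s mu n h := by
  filter_upwards [R.ae_gaussian hSig hsig hnu hups hQ hmu hs (.inr hn)] with h hG
  refine energy_mean_of_gaussian (Q.isWeyl_xWeyl _ n) hh.le
    (p.SigAt_nonneg hSig hsig hnu hmu hups n) fun ζ => ?_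
  rw [Q.xWeyl_eq, NormalState.ev_smul, hG, ← gaussianChar_add, sub_add_cancel]

/-- Energies and controls are bounded alternately: the square of `λ_n z_n` is dominated by `|λ_n|²`
times the conditional energy, and `energy_succ` passes to the next instant. At the instant `K` this
needs no Gaussian state. -/
theorem finiteEnergy (hh : 0 < p.hbar) (hSig : 0 ≤ p.Sig) (hsig : 0 ≤ p.sig)
    (hnu : 0 ≤ p.nu) (hups : ‖p.ups‖ ^ 2 ≤ p.sig * p.nu) (hQ : Q.IsGaussian) (hmu : 0 ≤ mu)
    (hs : s.IsLinearGaussian K mu) : R.FiniteEnergy K := by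
  have hctrl : ∀ n < K, ∫⁻ h, (R.post n h).energy (Q.xWeyl (s.controls h) n) ∂(R.P n) ≠ ⊤ →
      R.FiniteAt n := fun n hn hE => by
    refine ⟨ne_top_of_le_ne_top (ENNReal.mul_ne_top (ENNReal.ofReal_ne_top (r := ‖p.lamAt K n‖ ^ 2)) hE)
      ?_, hE⟩
    rw [← lintegral_const_mul _ (R.measurable_energy hh n n)]
    refine lintegral_mono_ae ?_
    filter_upwards [R.ae_control_eq hs hn, R.ae_energy_mean hh hSig hsig hnu hups hQ hmu hs hn]
      with h h1 h2
    rw [h1, h2.1, ← ENNReal.ofReal_mul (sq_nonneg _), norm_mul, norm_neg, mul_pow]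
    refine ENNReal.ofReal_le_ofReal (mul_le_mul_of_nonneg_left ?_ (sq_nonneg _))
    have := mul_nonneg hh.le (p.SigAt_nonneg hSig hsig hnu hmu hups n)
    linarith
  have hE : ∀ n ≤ K, ∫⁻ h, (R.post n h).energy (Q.xWeyl (s.controls h) n) ∂(R.P n) ≠ ⊤ := by
    intro n
    induction n with
    | zero =>
      intro _
      simp only [(energy_zero hh hSig hQ _).1, lintegral_const, measure_univ, mul_one]
      exact ENNReal.ofReal_ne_top
    | succ n ih => exact fun hn => ((hctrl n hn (ih (by omega))).energy_succ hh hsig hQ).1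
  exact ⟨fun n hn => (hctrl n hn (hE n hn.le)).control, hE⟩

/-- For `u = -λ z` the error `u + λ x` is `λ (x - z)`, with `z` the conditional mean; its
conditional second moment is `|λ|² ħ Σ`, so the bound `le_error` is attained. -/
theorem cost_linear (hh : 0 < p.hbar) (hSig : 0 ≤ p.Sig) (hsig : 0 ≤ p.sig)
    (hnu : 0 ≤ p.nu) (hups : ‖p.ups‖ ^ 2 ≤ p.sig * p.nu) (hQ : Q.IsGaussian)
    (hUps : ∀ k < K, 0 < p.UpsAt K k) (hs : s.IsLinearGaussian K p.muMin) :
    R.cost K = p.minLoss K := by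
  have hmu := p.muMin_nonneg
  have hF := R.finiteEnergy hh hSig hsig hnu hups hQ hmu hs
  rw [p.minLoss_eq hUps, cost_eq hh hsig hQ hUps hF, meanEnergy_zero hh hSig hQ]
  congr 1
  refine Finset.sum_congr rfl fun n hn => ?_
  have hn := Finset.mem_range.1 hn
  congr 2
  have h1 := (hF.finiteAt hn).integral_quadratic hh (‖p.lamAt K n‖ ^ 2) 1 (p.lamAt K n)
  rw [one_mul] at h1
  rw [← h1.2]
  have h2 : ∀ᵐ h ∂(R.P n), ‖p.lamAt K n‖ ^ 2 * ((R.post n h).energy (Q.xWeyl (s.controls h) n)).toReal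
        + 2 * (p.lamAt K n * (conj (s.controls h n)
          * (R.post n h).mean (Q.xWeyl (s.controls h) n))).re
        + 1 * ‖s.controls h n‖ ^ 2 = ‖p.lamAt K n‖ ^ 2 * (p.hbar * p.SigAt p.muMin n) := by
    filter_upwards [R.ae_control_eq hs hn, R.ae_energy_mean hh hSig hsig hnu hups hQ hmu hs hn]
      with h h1 h2
    have h0 : 0 ≤ p.hbar * p.SigAt p.muMin n :=
      mul_nonneg hh.le (p.SigAt_nonneg hSig hsig hnu hmu hups n)
    rw [h1, h2.1, h2.2, ENNReal.toReal_ofReal (by positivity), norm_mul, norm_neg, mul_pow]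
    have : (p.lamAt K n * (conj (-p.lamAt K n * estimateAt s p.muMin n h)
        * estimateAt s p.muMin n h)).re
        = -(‖p.lamAt K n‖ ^ 2 * ‖estimateAt s p.muMin n h‖ ^ 2) := by
      rw [← Complex.ofReal_re (-(‖p.lamAt K n‖ ^ 2 * ‖estimateAt s p.muMin n h‖ ^ 2))]
      congr 1
      push_cast
      rw [← Complex.mul_conj', ← Complex.mul_conj', map_mul, map_neg]
      ring
    rw [this]
    ring
  rw [integral_congr_ae h2]
  simp

end Evolution

end Conditional


/-! ### Gaussian integrals of Weyl operators -/

theorem symp_eq_inner (c : ℝ) (w q : ℂ) : symp c w q = ⟪(c : ℂ) * (Complex.I * q), w⟫_ℝ := by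
  rw [Complex.inner, symp]
  simp only [map_mul, Complex.conj_ofReal, Complex.conj_I, Complex.mul_re, Complex.mul_im,
    Complex.ofReal_re, Complex.ofReal_im, Complex.neg_re, Complex.neg_im, Complex.I_re, Complex.I_im,
    Complex.conj_re, Complex.conj_im]
  ring

theorem integral_gauss {b : ℝ} (hb : 0 < b) (c w : ℂ) :
    ∫ v : ℂ, Complex.exp (-(b * ‖v‖ ^ 2 : ℝ) + c * (⟪w, v⟫_ℝ : ℝ))
      = (Real.pi / b : ℝ) * Complex.exp (c ^ 2 * ‖w‖ ^ 2 / (4 * b)) := by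
  have h := GaussianFourier.integral_cexp_neg_mul_sq_norm_add (V := ℂ) (b := (b : ℂ)) (by simpa) c w
  rw [Complex.finrank_real_complex] at h
  have h2 : ((Real.pi : ℂ) / b) ^ (((2 : ℕ) : ℂ) / 2) = (Real.pi / b : ℝ) := by
    rw [Nat.cast_ofNat, div_self two_ne_zero, Complex.cpow_one]
    push_cast
    rfl
  rw [h2] at h
  rw [← h]
  congr 1
  funext v
  push_cast
  ring_nf

theorem integrable_gauss {b : ℝ} (hb : 0 < b) :
    Integrable (fun v : ℂ => Real.exp (-(b * ‖v‖ ^ 2))) := by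
  have h := GaussianFourier.integrable_cexp_neg_mul_sq_norm_add (V := ℂ) (b := (b : ℂ)) (by simpa) 0 0
  refine h.norm.congr (.of_forall fun v => ?_)
  simp only [zero_mul, add_zero]
  rw [Complex.norm_exp]
  congr 1
  simp [← Complex.ofReal_pow]

/-! ### Vectors filtered by Gaussian averages of Weyl operators. -/

section Smoothing

variable {H : Type*} [NormedAddCommGroup H] [InnerProductSpace ℂ H] [CompleteSpace H]
  {c : ℝ} {W : ℂ → H →L[ℂ] H}

/-- The Gaussian average of a family of operators, applied to a vector. -/
def gaussVec (W : ℂ → H →L[ℂ] H) (a : ℝ) (η : ℂ) (f : H) : H :=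
  ∫ θ, ((Real.exp (-(a * ‖θ‖ ^ 2)) : ℂ) * phase (-θ) η) • W θ f

theorem norm_gauss_phase (a : ℝ) (η θ : ℂ) :
    ‖(Real.exp (-(a * ‖θ‖ ^ 2)) : ℂ) * phase (-θ) η‖ = Real.exp (-(a * ‖θ‖ ^ 2)) := by
  rw [norm_mul, norm_phase, mul_one, Complex.norm_real, Real.norm_eq_abs, abs_of_pos (Real.exp_pos _)]

theorem integrable_gaussVec (hW : IsWeyl (symp c) W) {a : ℝ} (ha : 0 < a) (η : ℂ) (f : H) :
    Integrable fun θ => ((Real.exp (-(a * ‖θ‖ ^ 2)) : ℂ) * phase (-θ) η) • W θ f := by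
  have hc := hW.cont f
  refine ((integrable_gauss ha).mul_const ‖f‖).mono' ?_ (.of_forall fun θ => ?_)
  · exact Continuous.aestronglyMeasurable (by fun_prop)
  · rw [norm_smul, norm_gauss_phase, hW.norm_apply]

/-- The arguments are symmetric about `w` so that, after the three Weyl operators are combined, `w`
enters through a character only and can be integrated out. -/
theorem weyl_sandwich (hW : IsWeyl (symp c) W) {D : H →L[ℂ] H} (hD : ∀ θ, Commute (W θ) D)
    (f : H) (ζ w u : ℂ) : ⟪W (w - u / 2) f, W ζ (D (W (w + u / 2) f))⟫_ℂ
      = Complex.exp (-Complex.I * (⟪(c : ℂ) * (Complex.I * (2 * ζ + u)), w⟫_ℝ : ℝ))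
        * ⟪f, W (ζ + u) (D f)⟫_ℂ := by
  have h1 : W (-(w - u / 2)) * W ζ * (D * W (w + u / 2))
      = Complex.exp (-Complex.I * (⟪(c : ℂ) * (Complex.I * (2 * ζ + u)), w⟫_ℝ : ℝ))
        • (W (ζ + u) * D) := by
    rw [← (hD _).eq, ← mul_assoc, hW.mul, smul_mul_assoc, hW.mul, smul_smul, ← Complex.exp_add,
      smul_mul_assoc]
    have e : -(w - u / 2) + ζ + (w + u / 2) = ζ + u := by ring
    rw [e, ← symp_eq_inner]
    congr 2
    rw [← mul_add, ← Complex.ofReal_add, neg_mul, ← mul_neg, ← Complex.ofReal_neg]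
    congr 2
    simp only [symp, Complex.mul_im, Complex.add_re, Complex.add_im, Complex.sub_re, Complex.sub_im,
      Complex.neg_re, Complex.neg_im, Complex.conj_re, Complex.conj_im, map_add, map_mul]
    simp
    ring
  rw [hW.inner_left]
  have h2 := congrArg (fun T : H →L[ℂ] H => ⟪f, T f⟫_ℂ) h1
  simp only [mul_apply_eq_comp, smul_apply, inner_smul_right] at h2
  exact h2

/-- The expectation of a Weyl operator in a vector filtered by a Gaussian average of Weyl
operators. -/
theorem inner_gaussVec (hW : IsWeyl (symp c) W) {a : ℝ} (ha : 0 < a) {D : H →L[ℂ] H}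
    (hD : ∀ θ, Commute (W θ) D) (η : ℂ) (f : H) (ζ : ℂ) :
    ⟪gaussVec W a η f, W ζ (D (gaussVec W a η f))⟫_ℂ
      = (Real.pi / (2 * a) : ℝ) * ∫ u, (Real.exp (-(a / 2 * ‖u‖ ^ 2
          + c ^ 2 / (8 * a) * ‖2 * ζ + u‖ ^ 2)) : ℂ) * phase (-u) η * ⟪f, W (ζ + u) (D f)⟫_ℂ := by
  let φ : ℂ → ℂ := fun θ => (Real.exp (-(a * ‖θ‖ ^ 2)) : ℂ) * phase (-θ) η
  have hφ : Continuous φ := by fun_prop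
  let K : ℂ → ℂ → ℂ := fun θ θ' => conj (φ θ) * φ θ' * ⟪W θ f, W ζ (D (W θ' f))⟫_ℂ
  have hi := integrable_gaussVec hW ha η f
  have hF := hW.cont f
  have h1 : ⟪gaussVec W a η f, W ζ (D (gaussVec W a η f))⟫_ℂ = ∫ θ, ∫ θ', K θ θ' := by
    have e1 : W ζ (D (gaussVec W a η f)) = ∫ θ', φ θ' • W ζ (D (W θ' f)) := by
      refine ((W ζ ∘L D).integral_comp_comm hi).symm.trans ?_
      refine integral_congr_ae (.of_forall fun θ => ?_)
      simp [φ]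
    have hi2 : Integrable fun θ' => φ θ' • W ζ (D (W θ' f)) := by
      have := (W ζ ∘L D).integrable_comp hi
      simpa [φ] using this
    have e2 : ∀ y, ⟪gaussVec W a η f, y⟫_ℂ = ∫ θ, ⟪φ θ • W θ f, y⟫_ℂ := fun y => by
      rw [← inner_conj_symm, gaussVec, ← integral_inner hi, ← integral_conj]
      simp only [inner_conj_symm, φ]
    rw [e2, e1]
    refine integral_congr_ae (.of_forall fun θ => ?_)
    simp only
    rw [← integral_inner hi2]
    refine integral_congr_ae (.of_forall fun θ' => ?_)
    simp only [K, inner_smul_left, inner_smul_right, φ]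
    ring
  have hKi : Integrable (fun z : ℂ × ℂ => K z.1 z.2) (volume.prod volume) := by
    refine (((integrable_gauss ha).mul_prod (integrable_gauss ha)).mul_const (‖f‖ * (‖D‖ * ‖f‖))).mono'
      ?_ (.of_forall fun z => ?_)
    · refine Continuous.aestronglyMeasurable ?_
      have k1 : Continuous fun z : ℂ × ℂ => W z.1 f := hF.comp continuous_fst
      have k2 : Continuous fun z : ℂ × ℂ => W ζ (D (W z.2 f)) :=
        (W ζ).continuous.comp (D.continuous.comp (hF.comp continuous_snd))
      have k3 : Continuous fun z : ℂ × ℂ => conj (φ z.1) * φ z.2 :=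
        (Complex.continuous_conj.comp (hφ.comp continuous_fst)).mul (hφ.comp continuous_snd)
      exact k3.mul (k1.inner k2)
    · rw [norm_mul, norm_mul, RCLike.norm_conj, norm_gauss_phase, norm_gauss_phase]
      refine mul_le_mul_of_nonneg_left ((norm_inner_le_norm _ _).trans ?_) (by positivity)
      rw [hW.norm_apply, hW.norm_apply]
      refine mul_le_mul_of_nonneg_left ((D.le_opNorm _).trans_eq ?_) (norm_nonneg _)
      rw [hW.norm_apply]
  have hKs : Integrable (fun z : ℂ × ℂ => K z.1 (z.1 + z.2)) (volume.prod volume) :=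
    (measurePreserving_prod_add (volume : Measure ℂ) (volume : Measure ℂ)).integrable_comp_of_integrable
      hKi
  -- The variables are changed to the midpoint `w` and the difference `u` of `θ` and `θ'`; by the
  -- parallelogram law the Gaussian weight separates.
  have hK : ∀ u w, K (w + -(u / 2)) (w + -(u / 2) + u) = (Real.exp (-(a / 2 * ‖u‖ ^ 2)) : ℂ)
      * phase (-u) η * ⟪f, W (ζ + u) (D f)⟫_ℂ * Complex.exp (-(2 * a * ‖w‖ ^ 2 : ℝ)
        + -Complex.I * (⟪(c : ℂ) * (Complex.I * (2 * ζ + u)), w⟫_ℝ : ℝ)) := fun u w => by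
    have e1 : w + -(u / 2) = w - u / 2 := by ring
    have e2 : w - u / 2 + u = w + u / 2 := by ring
    have e3 : conj (φ (w - u / 2)) * φ (w + u / 2) = (Real.exp (-(a / 2 * ‖u‖ ^ 2)) : ℂ)
        * phase (-u) η * Complex.exp (-(2 * a * ‖w‖ ^ 2 : ℝ)) := by
      simp only [φ, map_mul, Complex.conj_ofReal, conj_phase, neg_neg]
      have e4 : phase (w - u / 2) η * phase (-(w + u / 2)) η = phase (-u) η := by
        rw [← phase_add_left]
        congr 1
        ring
      have e5 : (Real.exp (-(a * ‖w - u / 2‖ ^ 2)) : ℂ) * (Real.exp (-(a * ‖w + u / 2‖ ^ 2)) : ℂ)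
          = (Real.exp (-(a / 2 * ‖u‖ ^ 2)) : ℂ) * Complex.exp (-(2 * a * ‖w‖ ^ 2 : ℝ)) := by
        rw [← Complex.ofReal_neg, ← Complex.ofReal_exp, ← Complex.ofReal_mul, ← Complex.ofReal_mul,
          ← Real.exp_add, ← Real.exp_add]
        have := parallelogram_law_with_norm ℝ w (u / 2)
        rw [norm_div, Complex.norm_ofNat] at this
        congr 2
        linear_combination (-a) * this
      linear_combination (phase (w - u / 2) η * phase (-(w + u / 2)) η) * e5
        + (Real.exp (-(a / 2 * ‖u‖ ^ 2)) : ℂ) * Complex.exp (-(2 * a * ‖w‖ ^ 2 : ℝ)) * e4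
    rw [e1, e2]
    simp only [K]
    rw [e3, weyl_sandwich hW hD, Complex.exp_add]
    ring
  calc ⟪gaussVec W a η f, W ζ (D (gaussVec W a η f))⟫_ℂ = ∫ θ, ∫ θ', K θ θ' := h1
    _ = ∫ θ, ∫ u, K θ (θ + u) := by
      refine integral_congr_ae (.of_forall fun θ => ?_)
      exact (integral_add_left_eq_self (fun θ' => K θ θ') θ).symm
    _ = ∫ u, ∫ θ, K θ (θ + u) := integral_integral_swap hKs
    _ = ∫ u, ∫ w, K (w + -(u / 2)) (w + -(u / 2) + u) := by
      refine integral_congr_ae (.of_forall fun u => ?_)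
      exact (integral_add_right_eq_self (fun θ => K θ (θ + u)) (-(u / 2))).symm
    _ = _ := by
      rw [← integral_const_mul]
      refine integral_congr_ae (.of_forall fun u => ?_)
      simp only [hK]
      rw [integral_const_mul, integral_gauss (by positivity)]
      have e : Complex.exp ((-Complex.I) ^ 2 * ‖(c : ℂ) * (Complex.I * (2 * ζ + u))‖ ^ 2
          / (4 * ((2 * a : ℝ) : ℂ))) = (Real.exp (-(c ^ 2 / (8 * a) * ‖2 * ζ + u‖ ^ 2)) : ℂ) := by
        rw [Complex.ofReal_exp]
        congr 1
        rw [norm_mul, norm_mul, Complex.norm_I, Complex.norm_real, one_mul, Real.norm_eq_abs]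
        push_cast
        rw [mul_pow, ← Complex.ofReal_pow |c|, sq_abs, neg_sq, Complex.I_sq]
        push_cast
        have : (a : ℂ) ≠ 0 := by exact_mod_cast ha.ne'
        field_simp
        ring
      rw [e, neg_add, Real.exp_add]
      push_cast
      ring

/-- As `a` varies, `a / 2 + c² / (8 a)` takes all values from its minimum `|c| / 2` upwards (for `c
= 0`, all positive ones); the witness is the larger root of the quadratic equation. -/
theorem exists_gauss_parameter (c : ℝ) {s : ℝ} (hs : 0 < s) (h : |c| / 2 ≤ s) :
    ∃ a, 0 < a ∧ a / 2 + c ^ 2 / (8 * a) = s := by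
  have h1 : 0 ≤ s ^ 2 - c ^ 2 / 4 := by
    have := pow_le_pow_left₀ (by positivity) h 2
    rw [div_pow, sq_abs] at this
    linarith
  have h2 := Real.sqrt_nonneg (s ^ 2 - c ^ 2 / 4)
  refine ⟨s + Real.sqrt (s ^ 2 - c ^ 2 / 4), by positivity, ?_⟩
  have h3 := Real.sq_sqrt h1
  set r := Real.sqrt (s ^ 2 - c ^ 2 / 4)
  have : s + r ≠ 0 := by positivity
  field_simp
  linear_combination 8 * h3

end Smoothing

/-! ### Measures with prescribed characteristic functions -/

section Levy

open Filter

/-- Lévy's continuity theorem for finite measures: continuity of the limit gives tightness, and a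
cluster point along an ultrafilter is enough. -/
theorem exists_measure_of_tendsto_char {m : ℕ → Measure ℂ} [∀ n, IsFiniteMeasure (m n)] {g : ℂ → ℂ}
    (hg : Continuous g) (h : ∀ θ, Tendsto (fun n => ∫ η, phase θ η ∂(m n)) atTop (nhds (g θ))) :
    ∃ μ : Measure ℂ, IsFiniteMeasure μ ∧ ∀ θ, ∫ η, phase θ η ∂μ = g θ := by
  have hm : Tendsto (fun n => (((m n).real Set.univ : ℝ) : ℂ)) atTop (nhds (g 0)) := by
    simpa using h 0
  have hre : Tendsto (fun n => (m n).real Set.univ) atTop (nhds (g 0).re) :=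
    (Complex.continuous_re.tendsto _).comp hm
  have hg0 : g 0 = ((g 0).re : ℂ) :=
    tendsto_nhds_unique hm ((Complex.continuous_ofReal.tendsto _).comp hre)
  have hnn : 0 ≤ (g 0).re := ge_of_tendsto' hre fun n => measureReal_nonneg
  -- If the masses tend to zero, the limit is the zero measure; otherwise they are eventually
  -- positive, and the measures can be normalized.
  rcases hnn.eq_or_lt with h0 | h0
  · refine ⟨0, inferInstance, fun θ => ?_⟩
    rw [integral_zero_measure]
    refine (tendsto_nhds_unique (h θ) (squeeze_zero_norm (fun n => ?_) (h0 ▸ hre))).symm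
    refine (norm_integral_le_integral_norm _).trans ?_
    simp
  obtain ⟨N, hN⟩ := eventually_atTop.1 (hre.eventually (lt_mem_nhds h0))
  have hne : ∀ n, NeZero (m (n + N)) := fun n => ⟨fun h1 => by
    have := hN (n + N) (by omega)
    simp [h1] at this⟩
  let μ : ℕ → ProbabilityMeasure ℂ := fun n =>
    ⟨((m (n + N)) Set.univ)⁻¹ • m (n + N), inferInstance⟩
  have hμ : ∀ n θ, ∫ η, phase θ η ∂(μ n : Measure ℂ)
      = (((m (n + N)).real Set.univ : ℝ) : ℂ)⁻¹ * ∫ η, phase θ η ∂(m (n + N)) := fun n θ => by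
    change ∫ η, phase θ η ∂(((m (n + N)) Set.univ)⁻¹ • m (n + N)) = _
    rw [integral_smul_measure, ENNReal.toReal_inv, ← Complex.coe_smul, smul_eq_mul]
    push_cast
    rfl
  have hg0' : g 0 ≠ 0 := by rw [hg0]; exact_mod_cast h0.ne'
  have hlim : ∀ θ, Tendsto (fun n => ∫ η, phase θ η ∂(μ n : Measure ℂ)) atTop
      (nhds ((g 0)⁻¹ * g θ)) := fun θ => by
    simp only [hμ]
    exact (((tendsto_add_atTop_iff_nat N).2 hm).inv₀ hg0').mul ((tendsto_add_atTop_iff_nat N).2 (h θ))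
  have htight : IsTightMeasureSet (Set.range fun n => (μ n : Measure ℂ)) := by
    refine isTightMeasureSet_of_tendsto_charFun
      (f := fun t => (g 0)⁻¹ * g (-Complex.I * t / 2)) ?_ fun t => ?_
    · exact (continuous_const.mul (hg.comp (by fun_prop))).continuousAt
    · simp only [charFun_eq_integral_phase]
      exact hlim _
  have hcomp : IsCompact (closure (Set.range μ)) := by
    refine isCompact_closure_of_isTightMeasureSet ?_
    convert htight using 1
    ext ν
    simp
  obtain ⟨ν, -, hν⟩ := hcomp.ultrafilter_le_nhds ((hyperfilter ℕ).map μ)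
    (.trans (by simp) (monotone_principal subset_closure))
  have hν' : Tendsto μ (hyperfilter ℕ : Filter ℕ) (nhds ν) := hν
  rw [ProbabilityMeasure.tendsto_iff_forall_integral_rclike_tendsto ℂ] at hν'
  refine ⟨(g 0).re.toNNReal • (ν : Measure ℂ), inferInstance, fun θ => ?_⟩
  have h1 := hν' (BoundedContinuousFunction.ofNormedAddCommGroup (phase θ) (by fun_prop) 1
    fun η => (norm_phase θ η).le)
  have h2 := tendsto_nhds_unique h1 ((hlim θ).mono_left Nat.hyperfilter_le_atTop)
  rw [integral_smul_nnreal_measure]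
  have h3 : ∫ η, phase θ η ∂(ν : Measure ℂ) = (g 0)⁻¹ * g θ := h2
  rw [h3, NNReal.smul_def, Real.coe_toNNReal _ hnn, ← Complex.coe_smul, smul_eq_mul, ← hg0,
    mul_inv_cancel_left₀ hg0']

end Levy


/-! ### Covariant measurements of Weyl systems -/

section Covariant

open Filter

variable {H : Type*} [NormedAddCommGroup H] [InnerProductSpace ℂ H] [CompleteSpace H]
  {c : ℝ} {W : ℂ → H →L[ℂ] H}

theorem phase_eq_inner (q η : ℂ) :
    phase q η = Complex.exp (Complex.I * (⟪2 * (Complex.I * q), η⟫_ℝ : ℝ)) := by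
  rw [phase, Complex.inner]
  congr 1
  have : 2 * (conj q * η).im = (conj (2 * (Complex.I * q)) * η).re := by
    simp only [map_mul, Complex.conj_I, Complex.mul_re, Complex.mul_im, Complex.neg_re,
      Complex.neg_im, Complex.I_re, Complex.I_im, Complex.conj_re, Complex.conj_im, map_ofNat]
    simp
    ring
  have h2 : ((2 * (conj q * η).im : ℝ) : ℂ) = ((conj (2 * (Complex.I * q)) * η).re : ℝ) := by rw [this]
  rw [mul_comm η, ← h2]
  push_cast
  ring

theorem integral_gauss_phase {b : ℝ} (hb : 0 < b) (q : ℂ) :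
    ∫ η, (Real.exp (-(b * ‖η‖ ^ 2)) : ℂ) * phase q η
      = (Real.pi / b : ℝ) * Real.exp (-(‖q‖ ^ 2 / b)) := by
  have h := integral_gauss hb Complex.I (2 * (Complex.I * q))
  have e : ∀ η, Complex.exp (-(b * ‖η‖ ^ 2 : ℝ) + Complex.I * (⟪2 * (Complex.I * q), η⟫_ℝ : ℝ))
      = (Real.exp (-(b * ‖η‖ ^ 2)) : ℂ) * phase q η := fun η => by
    rw [Complex.exp_add, phase_eq_inner]
    push_cast
    rfl
  simp only [e] at h
  rw [h, Complex.ofReal_exp]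
  congr 2
  rw [norm_mul, norm_mul, Complex.norm_I, Complex.norm_ofNat, Complex.I_sq]
  push_cast
  have : (b : ℂ) ≠ 0 := by exact_mod_cast hb.ne'
  field_simp
  ring

/-- The Fourier transform `P` of the damped function is nonnegative, being a multiple of the squared
norm of a Gaussian average. Its integrability is not needed: the additional weight `exp (-r² |η|²)`
makes it a finite density and averages the characteristic function over a Gaussian of width `r`. -/
theorem exists_smoothed_measure (hW : IsWeyl (symp c) W) (f : H) {s r : ℝ} (hs : 0 < s)
    (hcs : |c| / 2 ≤ s) (hr : 0 < r) : ∃ μ : Measure ℂ, IsFiniteMeasure μ ∧ ∀ θ,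
      ∫ η, phase θ η ∂μ = (1 / Real.pi : ℝ) * ∫ w, (Real.exp (-(1 * ‖w‖ ^ 2)) : ℂ)
        * ((Real.exp (-(s * ‖θ + r * w‖ ^ 2)) : ℂ) * ⟪f, W (θ + r * w) f⟫_ℂ) := by
  obtain ⟨a, ha, has⟩ := exists_gauss_parameter c hs hcs
  have hF := hW.cont f
  let g : ℂ → ℂ := fun u => (Real.exp (-(s * ‖u‖ ^ 2)) : ℂ) * ⟪f, W u f⟫_ℂ
  have hg : Continuous g := by fun_prop
  have hgi : Integrable g := by
    refine ((integrable_gauss hs).mul_const (‖f‖ * ‖f‖)).mono' hg.aestronglyMeasurable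
      (.of_forall fun u => ?_)
    rw [norm_mul, Complex.norm_real, Real.norm_eq_abs, abs_of_pos (Real.exp_pos _)]
    refine mul_le_mul_of_nonneg_left ((norm_inner_le_norm _ _).trans_eq ?_) (Real.exp_pos _).le
    rw [hW.norm_apply]
  let P : ℂ → ℂ := fun η => ∫ u, phase (-u) η * g u
  -- The parameter `a` was chosen so that the two exponents of `inner_gaussVec` at `ζ = 0` add up to
  -- the damping `s`.
  have hP : ∀ η, P η = ((2 * a / Real.pi * ‖gaussVec W a η f‖ ^ 2 : ℝ) : ℂ) := fun η => by
    have h := inner_gaussVec hW ha (D := 1) (fun θ => Commute.one_right _) η f 0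
    simp only [hW.zero, one_apply_eq_self, mul_zero, zero_add] at h
    rw [inner_self_eq_norm_sq_to_K] at h
    have e : (∫ u, (Real.exp (-(a / 2 * ‖u‖ ^ 2 + c ^ 2 / (8 * a) * ‖u‖ ^ 2)) : ℂ)
        * phase (-u) η * ⟪f, W u f⟫_ℂ) = P η := by
      refine integral_congr_ae (.of_forall fun u => ?_)
      simp only [g, ← add_mul, has]
      ring
    rw [e] at h
    have hpi : (Real.pi : ℂ) ≠ 0 := by exact_mod_cast Real.pi_ne_zero
    have ha' : (a : ℂ) ≠ 0 := by exact_mod_cast ha.ne'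
    push_cast
    change ((‖gaussVec W a η f‖ : ℝ) : ℂ) ^ 2 = _ at h
    rw [h]
    push_cast
    field_simp
  have hPm : StronglyMeasurable P := by
    refine StronglyMeasurable.integral_prod_right (f := fun η u => phase (-u) η * g u) ?_
    exact Continuous.stronglyMeasurable (by fun_prop)
  have hPn : ∀ η, ‖P η‖ ≤ ∫ u, ‖g u‖ := fun η => by
    refine (norm_integral_le_integral_norm _).trans_eq ?_
    simp
  let d : ℂ → ℝ := fun η => 1 / Real.pi ^ 2 * (Real.exp (-(r ^ 2 * ‖η‖ ^ 2)) * (P η).re)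
  have hr2 : 0 < r ^ 2 := by positivity
  have hd0 : ∀ η, 0 ≤ d η := fun η => by
    simp only [d, hP, Complex.ofReal_re]
    positivity
  have hdm : Measurable d := by
    have := Complex.measurable_re.comp hPm.measurable
    simp only [d]
    fun_prop
  have hdi : Integrable d := by
    refine (((integrable_gauss hr2).mul_const (∫ u, ‖g u‖)).const_mul (1 / Real.pi ^ 2)).mono'
      hdm.aestronglyMeasurable (.of_forall fun η => ?_)
    rw [Real.norm_eq_abs, abs_mul, abs_mul, abs_of_pos (Real.exp_pos _),
      abs_of_nonneg (by positivity : 0 ≤ 1 / Real.pi ^ 2)]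
    gcongr
    exact (Complex.abs_re_le_norm _).trans (hPn η)
  refine ⟨volume.withDensity fun η => ENNReal.ofReal (d η), isFiniteMeasure_withDensity_ofReal hdi.2,
    fun θ => ?_⟩
  have h1 : ∫ η, phase θ η ∂(volume.withDensity fun η => ENNReal.ofReal (d η))
      = ∫ η, (d η).toNNReal • phase θ η :=
    integral_withDensity_eq_integral_smul hdm.real_toNNReal _
  have h2 : ∀ η, (d η).toNNReal • phase θ η = (1 / Real.pi ^ 2 : ℝ) * ∫ u,
      (Real.exp (-(r ^ 2 * ‖η‖ ^ 2)) : ℂ) * phase (θ - u) η * g u := fun η => by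
    rw [NNReal.smul_def, Real.coe_toNNReal _ (hd0 η), ← Complex.coe_smul, smul_eq_mul]
    have : ((P η).re : ℂ) = P η := by rw [hP, Complex.ofReal_re]
    have e : ∫ u, (Real.exp (-(r ^ 2 * ‖η‖ ^ 2)) : ℂ) * phase (θ - u) η * g u
        = (Real.exp (-(r ^ 2 * ‖η‖ ^ 2)) : ℂ) * phase θ η * P η := by
      rw [← integral_const_mul]
      refine integral_congr_ae (.of_forall fun u => ?_)
      simp only [sub_eq_add_neg, phase_add_left]
      ring
    rw [e, ← this]
    simp only [d]
    push_cast
    ring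
  have h3 : Integrable (fun z : ℂ × ℂ => (Real.exp (-(r ^ 2 * ‖z.1‖ ^ 2)) : ℂ)
      * phase (θ - z.2) z.1 * g z.2) (volume.prod volume) := by
    refine ((integrable_gauss hr2).mul_prod hgi.norm).mono'
      (Continuous.aestronglyMeasurable (by fun_prop)) (.of_forall fun z => ?_)
    rw [norm_mul, norm_mul, norm_phase, mul_one, Complex.norm_real, Real.norm_eq_abs,
      abs_of_pos (Real.exp_pos _)]
  have h4 : ∀ u, ∫ η, (Real.exp (-(r ^ 2 * ‖η‖ ^ 2)) : ℂ) * phase (θ - u) η * g u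
      = (Real.pi / r ^ 2 : ℝ) * ((Real.exp (-(‖θ - u‖ ^ 2 / r ^ 2)) : ℂ) * g u) := fun u => by
    rw [integral_mul_const, integral_gauss_phase hr2]
    ring
  have h5 : ∫ u, (Real.exp (-(‖θ - u‖ ^ 2 / r ^ 2)) : ℂ) * g u
      = (r ^ 2 : ℝ) * ∫ w, (Real.exp (-(1 * ‖w‖ ^ 2)) : ℂ) * g (θ + r * w) := by
    rw [← integral_add_left_eq_self _ θ]
    have := Measure.integral_comp_smul (volume : Measure ℂ)
      (fun u => (Real.exp (-(‖θ - (θ + u)‖ ^ 2 / r ^ 2)) : ℂ) * g (θ + u)) r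
    rw [Complex.finrank_real_complex, abs_of_pos (by positivity), ← Complex.coe_smul, smul_eq_mul]
      at this
    have e : ∀ w : ℂ, (Real.exp (-(‖θ - (θ + r • w)‖ ^ 2 / r ^ 2)) : ℂ) * g (θ + r • w)
        = (Real.exp (-(1 * ‖w‖ ^ 2)) : ℂ) * g (θ + r * w) := fun w => by
      rw [sub_add_cancel_left, norm_neg, norm_smul, Real.norm_eq_abs, abs_of_pos hr, mul_pow,
        mul_div_cancel_left₀ _ hr2.ne', one_mul, Complex.real_smul]
    simp only [e] at this
    rw [this, ← mul_assoc, ← Complex.ofReal_mul, mul_inv_cancel₀ hr2.ne', Complex.ofReal_one, one_mul]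
  rw [h1, integral_congr_ae (.of_forall h2), integral_const_mul, integral_integral_swap h3,
    integral_congr_ae (.of_forall h4), integral_const_mul, h5, ← mul_assoc, ← mul_assoc]
  congr 1
  have hpi : (Real.pi : ℂ) ≠ 0 := by exact_mod_cast Real.pi_ne_zero
  have hr' : (r : ℂ) ≠ 0 := by exact_mod_cast hr.ne'
  push_cast
  field_simp

/-- The threshold `|c| / 2` is reached as the limit of slightly stronger dampings, while the width
of the averaging tends to zero. -/
theorem exists_weyl_measure (hW : IsWeyl (symp c) W) (f : H) :
    ∃ μ : Measure ℂ, IsFiniteMeasure μ ∧ ∀ θ, ∫ η, phase θ η ∂μ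
      = (Real.exp (-(|c| / 2 * ‖θ‖ ^ 2)) : ℂ) * ⟪f, W θ f⟫_ℂ := by
  let e : ℕ → ℝ := fun n => 1 / ((n : ℝ) + 1)
  have he : ∀ n, 0 < e n := fun n => by positivity
  have hlim : Tendsto e atTop (nhds 0) := tendsto_one_div_add_atTop_nhds_zero_nat
  have hc := abs_nonneg c
  have hF := hW.cont f
  choose m hm hchar using fun n => exists_smoothed_measure hW f (s := |c| / 2 + e n) (r := e n)
    (by have := he n; positivity) (by have := he n; linarith) (he n)
  refine exists_measure_of_tendsto_char (m := m) (by fun_prop) fun θ => ?_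
  simp only [hchar]
  have hg : ∫ w : ℂ, (Real.exp (-(1 * ‖w‖ ^ 2)) : ℂ) * ((Real.exp (-(|c| / 2 * ‖θ‖ ^ 2)) : ℂ)
      * ⟪f, W θ f⟫_ℂ) = Real.pi * ((Real.exp (-(|c| / 2 * ‖θ‖ ^ 2)) : ℂ) * ⟪f, W θ f⟫_ℂ) := by
    have := integral_gauss_phase one_pos 0
    simp only [phase_zero_left, mul_one] at this
    rw [integral_mul_const, this]
    simp
  have hpi : (Real.pi : ℂ) ≠ 0 := by exact_mod_cast Real.pi_ne_zero
  have hgoal : (Real.exp (-(|c| / 2 * ‖θ‖ ^ 2)) : ℂ) * ⟪f, W θ f⟫_ℂ = (1 / Real.pi : ℝ)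
      * ∫ w : ℂ, (Real.exp (-(1 * ‖w‖ ^ 2)) : ℂ) * ((Real.exp (-(|c| / 2 * ‖θ‖ ^ 2)) : ℂ)
        * ⟪f, W θ f⟫_ℂ) := by
    rw [hg]
    push_cast
    field_simp
  rw [hgoal]
  refine Tendsto.const_mul _ (tendsto_integral_of_dominated_convergence
    (fun w => Real.exp (-(1 * ‖w‖ ^ 2)) * (1 * (‖f‖ * ‖f‖))) (fun n => ?_)
    ((integrable_gauss one_pos).mul_const _) (fun n => .of_forall fun w => ?_) (.of_forall fun w => ?_))
  · exact Continuous.aestronglyMeasurable (by fun_prop)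
  · rw [norm_mul, norm_mul, Complex.norm_real, Real.norm_eq_abs, abs_of_pos (Real.exp_pos _),
      Complex.norm_real, Real.norm_eq_abs, abs_of_pos (Real.exp_pos _)]
    have h0 := (he n).le
    gcongr
    · exact Real.exp_le_one_iff.2 (neg_nonpos.2 (by positivity))
    · exact (norm_inner_le_norm _ _).trans_eq (by rw [hW.norm_apply])
  · have hcont : Continuous fun t : ℝ => (Real.exp (-(1 * ‖w‖ ^ 2)) : ℂ)
        * ((Real.exp (-((|c| / 2 + t) * ‖θ + t * w‖ ^ 2)) : ℂ) * ⟪f, W (θ + t * w) f⟫_ℂ) := by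
      fun_prop
    simpa [Function.comp_def] using (hcont.tendsto 0).comp hlim

/-- The sesquilinear form with prescribed values on the diagonal is that of an operator. -/
theorem exists_operator {T : ℂ → H →L[ℂ] H} (hT : T 0 = 1) {μ : H → Measure ℂ}
    (hμ : ∀ f, IsFiniteMeasure (μ f)) (hchar : ∀ f θ, ∫ η, phase θ η ∂(μ f) = ⟪f, T θ f⟫_ℂ)
    {S : Set ℂ} (hS : MeasurableSet S) :
    ∃ A : H →L[ℂ] H, (∀ f, ⟪f, A f⟫_ℂ = ((μ f).real S : ℂ)) ∧
      ∀ D, (∀ θ, Commute D (T θ)) → Commute D A := by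
  -- Every linear relation between the values `⟨f, T θ f⟩` that holds for all `θ` passes to the
  -- masses of `S`. Sesquilinearity of the polarized form, its diagonal values and its commutation
  -- with `D` are all instances.
  have key : ∀ {J : Type} [Fintype J] (b : J → ℂ) (F : J → H),
      (∀ θ, ∑ j, b j * ⟪F j, T θ (F j)⟫_ℂ = 0) → ∑ j, b j * ((μ (F j)).real S : ℂ) = 0 := by
    intro J _ b F h
    have := sum_integral_eq_zero_of_char (m := fun j => μ (F j)) (a := b) (f := S.indicator 1)
      (fun θ => by simpa only [hchar] using h θ)
      fun j => (integrable_const (1 : ℂ)).indicator hS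
    refine Eq.trans (Finset.sum_congr rfl fun j _ => ?_) this
    rw [integral_indicator hS]
    simp
  let B : H → H → ℂ := fun f g => (1 / 4) * ∑ k : Fin 4, Complex.I ^ (k : ℕ)
    * ((μ (f + ((-Complex.I) ^ (k : ℕ)) • g)).real S : ℂ)
  have key2 : ∀ {J : Type} [Fintype J] (b : J → ℂ) (F G : J → H),
      (∀ θ, ∑ j, b j * ⟪F j, T θ (G j)⟫_ℂ = 0) → ∑ j, b j * B (F j) (G j) = 0 := by
    intro J _ b F G h
    have := key (J := J × Fin 4) (fun j => b j.1 * Complex.I ^ (j.2 : ℕ))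
      (fun j => F j.1 + ((-Complex.I) ^ (j.2 : ℕ)) • G j.1) fun θ => by
        rw [Fintype.sum_prod_type]
        simp only [mul_assoc, ← Finset.mul_sum, POVM.polarization]
        rw [← mul_zero 4, ← h θ, Finset.mul_sum]
        exact Finset.sum_congr rfl fun j _ => by ring
    rw [Fintype.sum_prod_type] at this
    simp only [mul_assoc, ← Finset.mul_sum] at this
    rw [← mul_zero (1 / 4), ← this, Finset.mul_sum]
    exact Finset.sum_congr rfl fun j _ => by simp only [B]; ring
  have hB : ∀ f, B f f = ((μ f).real S : ℂ) := fun f => by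
    have := key (J := Option (Fin 4)) (fun j => j.elim (-1) fun k => 1 / 4 * Complex.I ^ (k : ℕ))
      (fun j => j.elim f fun k => f + ((-Complex.I) ^ (k : ℕ)) • f) fun θ => by
        simp only [Fintype.sum_option, Option.elim, mul_assoc, ← Finset.mul_sum, POVM.polarization]
        ring
    simp only [Fintype.sum_option, Option.elim, mul_assoc, ← Finset.mul_sum] at this
    linear_combination this
  let L : H →ₗ⋆[ℂ] H →ₗ[ℂ] ℂ := LinearMap.mk₂'ₛₗ (starRingEnd ℂ) (RingHom.id ℂ) B
    (fun f f' g => by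
      have := key2 ![1, -1, -1] ![f + f', f, f'] ![g, g, g] fun θ => by
        simp [Fin.sum_univ_three]
      simp [Fin.sum_univ_three] at this
      linear_combination this)
    (fun a f g => by
      have := key2 ![1, -conj a] ![a • f, f] ![g, g] fun θ => by
        simp [Fin.sum_univ_two]
        ring
      simp [Fin.sum_univ_two] at this
      rw [smul_eq_mul]
      linear_combination this)
    (fun f g g' => by
      have := key2 ![1, -1, -1] ![f, f, f] ![g + g', g, g'] fun θ => by
        simp [Fin.sum_univ_three]
      simp [Fin.sum_univ_three] at this
      linear_combination this)
    (fun a f g => by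
      have := key2 ![1, -a] ![f, f] ![a • g, g] fun θ => by
        simp [Fin.sum_univ_two]
      simp [Fin.sum_univ_two] at this
      rw [smul_eq_mul, RingHom.id_apply]
      linear_combination this)
  have hL : ∀ f g, L f g = B f g := fun f g => rfl
  have hmass : ∀ f, (μ f).real S ≤ ‖f‖ ^ 2 := fun f => by
    refine (measureReal_mono (Set.subset_univ S)).trans_eq ?_
    have := hchar f 0
    simp only [phase_zero_left, hT, one_apply_eq_self, inner_self_eq_norm_sq_to_K] at this
    rw [integral_const, ← Complex.coe_smul, smul_eq_mul, mul_one] at this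
    exact Complex.ofReal_injective (this.trans (by push_cast; rfl))
  -- Each of the four polarized masses is at most `‖f + i g‖² ≤ 4`, with `i` standing for a unit;
  -- the general bound follows by homogeneity.
  have hb1 : ∀ f g, ‖f‖ = 1 → ‖g‖ = 1 → ‖L f g‖ ≤ 4 := fun f g hf hg => by
    have h1 : ∀ k : Fin 4, ‖Complex.I ^ (k : ℕ) * ((μ (f + ((-Complex.I) ^ (k : ℕ)) • g)).real S : ℂ)‖
        ≤ 4 := fun k => by
      rw [norm_mul, norm_pow, Complex.norm_I, one_pow, one_mul, Complex.norm_real, Real.norm_eq_abs,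
        abs_of_nonneg measureReal_nonneg]
      refine (hmass _).trans ?_
      have h2 : ‖f + ((-Complex.I) ^ (k : ℕ)) • g‖ ≤ 2 := by
        refine (norm_add_le _ _).trans ?_
        rw [norm_smul, norm_pow, norm_neg, Complex.norm_I, one_pow, one_mul, hf, hg]
        norm_num
      nlinarith [norm_nonneg (f + ((-Complex.I) ^ (k : ℕ)) • g)]
    rw [hL, norm_mul]
    refine (mul_le_mul_of_nonneg_left ((norm_sum_le _ _).trans (Finset.sum_le_sum fun k _ => h1 k))
      (norm_nonneg _)).trans ?_
    simp
  have hbound : ∀ f g, ‖L f g‖ ≤ 4 * ‖f‖ * ‖g‖ := fun f g => by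
    by_cases hf : f = 0
    · simp [hf]
    by_cases hg : g = 0
    · simp [hg]
    have hf' := norm_ne_zero_iff.2 hf
    have hg' := norm_ne_zero_iff.2 hg
    have h1 := hb1 (((‖f‖ : ℂ)⁻¹) • f) (((‖g‖ : ℂ)⁻¹) • g)
      (by rw [norm_smul, norm_inv, Complex.norm_real, norm_norm, inv_mul_cancel₀ hf'])
      (by rw [norm_smul, norm_inv, Complex.norm_real, norm_norm, inv_mul_cancel₀ hg'])
    rw [map_smul, LinearMap.map_smulₛₗ, LinearMap.smul_apply, norm_smul, norm_smul, RCLike.norm_conj,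
      norm_inv, norm_inv, Complex.norm_real, Complex.norm_real, norm_norm, norm_norm, ← mul_assoc,
      ← mul_inv, inv_mul_le_iff₀ (by positivity)] at h1
    linarith
  let A := ContinuousLinearMap.adjoint (InnerProductSpace.continuousLinearMapOfBilin
    (LinearMap.mkContinuous₂ L 4 hbound))
  have hA : ∀ f g, ⟪f, A g⟫_ℂ = B f g := fun f g => by
    rw [ContinuousLinearMap.adjoint_inner_right, InnerProductSpace.continuousLinearMapOfBilin_apply,
      LinearMap.mkContinuous₂_apply, hL]
  refine ⟨A, fun f => by rw [hA, hB], fun D hD => ?_⟩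
  refine ContinuousLinearMap.ext fun g => ext_inner_left ℂ fun f => ?_
  rw [mul_apply_eq_comp, mul_apply_eq_comp, ← ContinuousLinearMap.adjoint_inner_left, hA, hA]
  have := key2 ![1, -1] ![ContinuousLinearMap.adjoint D f, f] ![g, D g] fun θ => by
    have h1 := congrArg (fun X : H →L[ℂ] H => ⟪f, X g⟫_ℂ) (hD θ).eq
    simp only [mul_apply_eq_comp] at h1
    simp [Fin.sum_univ_two, ContinuousLinearMap.adjoint_inner_left, h1]
  simp [Fin.sum_univ_two] at this
  linear_combination this

theorem exists_povm {T : ℂ → H →L[ℂ] H} (hT : T 0 = 1)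
    (h : ∀ f, ∃ μ : Measure ℂ, IsFiniteMeasure μ ∧ ∀ θ, ∫ η, phase θ η ∂μ = ⟪f, T θ f⟫_ℂ) :
    ∃ E : POVM ℂ H, (∀ θ f, ∫ η, phase θ η ∂(E.measureAt f) = ⟪f, T θ f⟫_ℂ) ∧
      ∀ S, MeasurableSet S → E.eff S ∈ bicommutant (Set.range T) := by
  classical
  choose μ hμ hchar using h
  choose A hA hAc using fun (S : Set ℂ) (hS : MeasurableSet S) => exists_operator hT hμ hchar hS
  let eff : Set ℂ → H →L[ℂ] H := fun S => if hS : MeasurableSet S then A S hS else 0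
  have heff : ∀ S, MeasurableSet S → ∀ f, ⟪f, eff S f⟫_ℂ = ((μ f).real S : ℂ) := fun S hS f => by
    simp only [eff, dif_pos hS, hA]
  let E : POVM ℂ H :=
    { eff := eff
      pos := fun S hS => by
        rw [ContinuousLinearMap.isPositive_iff_complex]
        intro f
        have h1 : ⟪eff S f, f⟫_ℂ = ((μ f).real S : ℂ) := by
          rw [← inner_conj_symm, heff S hS, Complex.conj_ofReal]
        rw [h1]
        exact ⟨by simp, by simp [measureReal_nonneg]⟩
      total := by
        have h1 : ∀ f, ⟪f, eff Set.univ f⟫_ℂ = ⟪f, (1 : H →L[ℂ] H) f⟫_ℂ := fun f => by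
          have := hchar f 0
          simp only [phase_zero_left, hT] at this
          rw [heff _ MeasurableSet.univ, ← this, integral_const, ← Complex.coe_smul, smul_eq_mul,
            mul_one]
        have h2 : (eff Set.univ : H →ₗ[ℂ] H) = ((1 : H →L[ℂ] H) : H →ₗ[ℂ] H) := by
          refine (ext_inner_map _ _).1 fun f => ?_
          have := congrArg conj (h1 f)
          simp only [inner_conj_symm] at this
          exact this
        exact ContinuousLinearMap.coe_injective h2
      additive := fun S hS hd f => by
        rw [heff _ (MeasurableSet.iUnion hS)]
        simp only [fun n => heff (S n) (hS n) f]
        rw [Complex.hasSum_ofReal]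
        have := hμ f
        have h1 := measure_iUnion (μ := μ f) hd hS
        have h2 := ENNReal.hasSum_toReal (h1 ▸ measure_ne_top (μ f) _)
        rw [← ENNReal.tsum_toReal_eq fun n => measure_ne_top (μ f) (S n), ← h1] at h2
        exact h2 }
  have hmeas : ∀ f, E.measureAt f = μ f := fun f => by
    have := hμ f
    ext S hS
    rw [POVM.measureAt_apply _ _ hS, heff S hS, Complex.ofReal_re, ofReal_measureReal]
  refine ⟨E, fun θ f => by rw [hmeas, hchar], fun S hS => ?_⟩
  refine Set.mem_centralizer_iff.2 fun D hD => ?_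
  have : E.eff S = A S hS := dif_pos hS
  rw [this]
  exact (hAc S hS D fun θ => ((Set.mem_centralizer_iff.1 hD _ ⟨θ, rfl⟩).symm : _)).eq

end Covariant


/-! ### Existence of the coherent measurement, and filtered Gaussian states -/

section Filtered

variable {H : Type*} [NormedAddCommGroup H] [InnerProductSpace ℂ H] [CompleteSpace H]

theorem bicommutant_range_smul (T : ℂ → H →L[ℂ] H) {a : ℂ → ℂ} :
    bicommutant (Set.range fun θ => a θ • T θ) ⊆ bicommutant (Set.range T) := by
  refine Set.centralizer_subset fun D hD => Set.mem_centralizer_iff.2 ?_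
  rintro _ ⟨θ, rfl⟩
  have := Set.mem_centralizer_iff.1 hD _ ⟨θ, rfl⟩
  simp only [smul_mul_assoc, mul_smul_comm, this]

/-- The identity `max 0 ε - ε / 2 = |ε| / 2` shows that the minimal noise parameter gives exactly
the damping of `exists_weyl_measure`. -/
theorem OpenOscillator.exists_coherent_measurement {p : Params} (Q : OpenOscillator p H)
    (hh : 0 < p.hbar) (k : ℕ) : ∃ E : POVM ℂ H, Q.IsIndirectMeasurement p.muMin 0 k E ∧
      ∀ S, MeasurableSet S → E.eff S ∈ Q.outputAlgebra k := by
  have hW := Q.isWeyl_yWeyl_zero k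
  have hexp : ∀ θ : ℂ, (Real.exp (-(|p.hbar * p.eps| / 2 * ‖θ‖ ^ 2)) : ℂ)
      = Complex.exp (-(p.hbar * p.muMin * ‖θ‖ ^ 2 : ℝ))
        * Complex.exp ((p.hbar * p.eps * ‖θ‖ ^ 2 / 2 : ℝ)) := fun θ => by
    rw [← Complex.exp_add, Complex.ofReal_exp, ← Complex.ofReal_neg, ← Complex.ofReal_add]
    congr 2
    rw [abs_mul, abs_of_pos hh, Params.muMin]
    rcases le_total 0 p.eps with h | h
    · rw [abs_of_nonneg h, max_eq_right h]; ring
    · rw [abs_of_nonpos h, max_eq_left h]; ring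
  obtain ⟨E, hE, hS⟩ := exists_povm
    (T := fun θ => (Real.exp (-(|p.hbar * p.eps| / 2 * ‖θ‖ ^ 2)) : ℂ) • Q.yWeyl 0 k θ)
    (by simp [hW.zero]) (fun f => by
      obtain ⟨μ, hμ, h⟩ := exists_weyl_measure hW f
      exact ⟨μ, hμ, fun θ => by rw [h, smul_apply, inner_smul_right]⟩)
  refine ⟨E, fun θ f => ?_, fun S h => bicommutant_range_smul _ (hS S h)⟩
  rw [hE, smul_apply, inner_smul_right, hexp, mul_assoc]

/-- The state displaced by a Weyl operator. -/
def NormalState.displace (ρ : NormalState H) {V : Type*} [AddCommGroup V] [TopologicalSpace V]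
    {B : V → V → ℝ} {W : V → H →L[ℂ] H} (hW : IsWeyl B W) (a : V) : NormalState H where
  vec i := W a (ρ.vec i)
  normalized := by simpa only [hW.norm_apply] using ρ.normalized

theorem NormalState.ev_displace (ρ : NormalState H) {c : ℝ} {W : ℂ → H →L[ℂ] H}
    (hW : IsWeyl (symp c) W) (a ζ : ℂ) {D : H →L[ℂ] H} (hD : ∀ θ, Commute (W θ) D) :
    (ρ.displace hW a).ev (W ζ * D) = phase ζ (-(c * a)) * ρ.ev (W ζ * D) := by
  have h1 : W (-a) * (W ζ * D * W a) = phase ζ (-(c * a)) • (W ζ * D) := by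
    rw [mul_assoc (W ζ), ← (hD a).eq, ← mul_assoc, ← mul_assoc, hW.mul, smul_mul_assoc, hW.mul,
      smul_smul, smul_mul_assoc, ← Complex.exp_add, phase]
    congr 1
    · congr 1
      simp only [symp]
      rw [← mul_add, ← Complex.ofReal_add, mul_comm 2 Complex.I, mul_assoc Complex.I]
      congr 1
      have : c * (-a * conj ζ).im + c * ((-a + ζ) * conj a).im = 2 * (conj ζ * -(c * a)).im := by
        simp
        ring
      rw [this]
      push_cast
      rfl
    · rw [neg_add_cancel_comm]
  calc (ρ.displace hW a).ev (W ζ * D) = ∑' i, ⟪ρ.vec i, (W (-a) * (W ζ * D * W a)) (ρ.vec i)⟫_ℂ := by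
        refine tsum_congr fun i => ?_
        simp only [NormalState.displace, hW.inner_left, mul_apply_eq_comp]
    _ = _ := by
        rw [h1]
        exact ρ.ev_smul _ _

/-- The states with a prescribed decrease of the variance, obtained by a Gaussian average of the
Weyl operators. -/
theorem NormalState.exists_filtered (ρ : NormalState H) {c : ℝ} {W : ℂ → H →L[ℂ] H}
    (hW : IsWeyl (symp c) W) (hc : 0 < c) {m m' : ℝ} (hm' : c / 2 ≤ m') (hm : m' < m)
    (h1 : ∀ ζ, ρ.ev (W ζ) = Real.exp (-(m * ‖ζ‖ ^ 2))) :
    ∃ ρ' : NormalState H, ∀ (D : H →L[ℂ] H) (w : ℂ), (∀ θ, Commute (W θ) D) →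
      (∀ ζ, ρ.ev (W ζ * D) = Real.exp (-(m * ‖ζ‖ ^ 2)) * w) →
        ∀ ζ, ρ'.ev (W ζ * D) = Real.exp (-(m' * ‖ζ‖ ^ 2)) * w := by
  have hd : 0 < m - m' := sub_pos.2 hm
  have hm0 : 0 < m' := by linarith
  -- The damping `s` for which the filtered exponent becomes `m'`. The condition `c / 2 ≤ s` amounts
  -- to `0 ≤ (m + c / 2) (m' - c / 2)`.
  obtain ⟨s, hs⟩ : ∃ s, s = (m * m' - c ^ 2 / 4) / (m - m') := ⟨_, rfl⟩
  have hsm : s * (m - m') = m * m' - c ^ 2 / 4 := by rw [hs, div_mul_cancel₀ _ hd.ne']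
  have hsc : c / 2 ≤ s := by
    rw [hs, le_div_iff₀ hd]
    nlinarith
  have hs0 : 0 < s := by linarith
  obtain ⟨a, ha, has⟩ := exists_gauss_parameter c hs0 (by rwa [abs_of_pos hc])
  have hb : 0 < s + m := by linarith
  let G : ℂ → ℂ → ℝ := fun ζ u => Real.exp (-(a / 2 * ‖u‖ ^ 2 + c ^ 2 / (8 * a) * ‖2 * ζ + u‖ ^ 2))
  have hGle : ∀ ζ u, G ζ u ≤ Real.exp (-(a / 2 * ‖u‖ ^ 2)) := fun ζ u => by
    refine Real.exp_le_exp.2 (neg_le_neg ?_)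
    have : 0 ≤ c ^ 2 / (8 * a) * ‖2 * ζ + u‖ ^ 2 := by positivity
    linarith
  have ha2 : 0 < a / 2 := by positivity
  have hGi : ∀ ζ, ∫ u, G ζ u * Real.exp (-(m * ‖ζ + u‖ ^ 2))
      = Real.exp (-(m' * ‖ζ‖ ^ 2)) * (Real.pi / (s + m)) := fun ζ => by
    -- The quadratic exponent in `u` has its centre at `-t ζ`; after a translation only the exponent
    -- `m'` in `ζ` remains.
    let t : ℝ := (c ^ 2 / (4 * a) + m) / (s + m)
    have ht : t * (s + m) = c ^ 2 / (4 * a) + m := div_mul_cancel₀ _ hb.ne'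
    have hq : c ^ 2 / (8 * a) = s - a / 2 := by linarith
    have hq' : c ^ 2 / (4 * a) = 2 * s - a := by
      have : c ^ 2 / (4 * a) = 2 * (c ^ 2 / (8 * a)) := by field_simp; ring
      rw [this, hq]; ring
    have hca : c ^ 2 = 4 * a * (2 * s - a) := by
      rw [← hq']; field_simp
    have e : ∀ u, G ζ u * Real.exp (-(m * ‖ζ + u‖ ^ 2))
        = Real.exp (-(m' * ‖ζ‖ ^ 2)) * Real.exp (-((s + m) * ‖u + t * ζ‖ ^ 2)) := fun u => by
      simp only [G]
      rw [← Real.exp_add, ← Real.exp_add]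
      congr 1
      rw [hq]
      rw [hq'] at ht
      have ht2 : t ^ 2 * (s + m) = 4 * (s - a / 2) + m - m' := by
        have hb' := hb.ne'
        apply mul_right_cancel₀ hb'
        have : t ^ 2 * (s + m) * (s + m) = (t * (s + m)) ^ 2 := by ring
        rw [this, ht]
        rw [hca] at hsm
        nlinarith
      simp only [Complex.sq_norm, Complex.normSq_apply, Complex.add_re, Complex.add_im,
        Complex.mul_re, Complex.mul_im, Complex.ofReal_re, Complex.ofReal_im, Complex.re_ofNat,
        Complex.im_ofNat]
      linear_combination (2 * (u.re * ζ.re + u.im * ζ.im)) * ht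
        + (ζ.re ^ 2 + ζ.im ^ 2) * ht2
    rw [integral_congr_ae (.of_forall e), integral_const_mul,
      integral_add_right_eq_self (fun u : ℂ => Real.exp (-((s + m) * ‖u‖ ^ 2))) (t * ζ)]
    congr 1
    have := integral_gauss hb 0 0
    simp only [zero_mul, add_zero, ne_eq, OfNat.ofNat_ne_zero, not_false_eq_true, zero_pow,
      zero_div, Complex.exp_zero, mul_one] at this
    have h2 : ∀ v : ℂ, Complex.exp (-((s + m) * ‖v‖ ^ 2 : ℝ))
        = ((Real.exp (-((s + m) * ‖v‖ ^ 2)) : ℝ) : ℂ) := fun v => by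
      push_cast
      rfl
    simp only [h2] at this
    rw [integral_complex_ofReal] at this
    exact Complex.ofReal_injective this
  let N0 : ℝ := Real.pi / (2 * a) * (Real.pi / (s + m))
  have hN0 : 0 < N0 := by have := Real.pi_pos; positivity
  -- An operator `D` that commutes with the Weyl operators is carried along with its expectation
  -- `w`; for products of later noises this preserves their independence.
  have key : ∀ (D : H →L[ℂ] H) (w : ℂ), (∀ θ, Commute (W θ) D) →
      (∀ ζ, ρ.ev (W ζ * D) = Real.exp (-(m * ‖ζ‖ ^ 2)) * w) → ∀ ζ,
        HasSum (fun i => ⟪gaussVec W a 0 (ρ.vec i), (W ζ * D) (gaussVec W a 0 (ρ.vec i))⟫_ℂ)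
          (N0 * (Real.exp (-(m' * ‖ζ‖ ^ 2)) * w)) := by
    intro D w hD hw ζ
    let F : ℕ → ℂ → ℂ := fun i u => (G ζ u : ℂ) * ⟪ρ.vec i, W (ζ + u) (D (ρ.vec i))⟫_ℂ
    have hFc : ∀ i, Continuous (F i) := fun i => by
      have := hW.cont (D (ρ.vec i))
      simp only [F, G]
      fun_prop
    have hFle : ∀ i u, ‖F i u‖ ≤ Real.exp (-(a / 2 * ‖u‖ ^ 2)) * (‖D‖ * ‖ρ.vec i‖ ^ 2) := fun i u => by
      rw [norm_mul, Complex.norm_real, Real.norm_eq_abs, abs_of_pos (Real.exp_pos _)]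
      refine mul_le_mul (hGle ζ u) ?_ (norm_nonneg _) (Real.exp_pos _).le
      refine (norm_inner_le_norm _ _).trans ?_
      rw [hW.norm_apply, sq, mul_comm ‖D‖, mul_assoc]
      refine mul_le_mul_of_nonneg_left ?_ (norm_nonneg _)
      rw [mul_comm]
      exact D.le_opNorm _
    have hFi : ∀ i, Integrable (F i) := fun i =>
      ((integrable_gauss ha2).mul_const (‖D‖ * ‖ρ.vec i‖ ^ 2)).mono' (hFc i).aestronglyMeasurable
        (.of_forall (hFle i))
    have hsum : Summable fun i => ∫ u, ‖F i u‖ := by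
      refine Summable.of_nonneg_of_le (fun i => integral_nonneg fun u => norm_nonneg _) (fun i => ?_)
        ((ρ.summable_sq.mul_left ‖D‖).mul_left (∫ u : ℂ, Real.exp (-(a / 2 * ‖u‖ ^ 2))))
      rw [← integral_mul_const]
      exact integral_mono (hFi i).norm ((integrable_gauss ha2).mul_const _) (hFle i)
    have h2 := (hasSum_integral_of_summable_integral_norm hFi hsum).mul_left
      ((Real.pi / (2 * a) : ℝ) : ℂ)
    have h3 : ∀ u, ∑' i, F i u = ((G ζ u * Real.exp (-(m * ‖ζ + u‖ ^ 2)) : ℝ) : ℂ) * w := fun u => by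
      rw [tsum_mul_left]
      have := hw (ζ + u)
      simp only [NormalState.ev, mul_apply_eq_comp] at this
      rw [this]
      push_cast
      ring
    have h4 : ∫ u, ∑' i, F i u = (Real.exp (-(m' * ‖ζ‖ ^ 2)) * (Real.pi / (s + m)) : ℝ) * w := by
      rw [integral_congr_ae (.of_forall h3), integral_mul_const, integral_complex_ofReal, hGi]
    rw [h4] at h2
    have h5 : ∀ i, ⟪gaussVec W a 0 (ρ.vec i), (W ζ * D) (gaussVec W a 0 (ρ.vec i))⟫_ℂ
        = (Real.pi / (2 * a) : ℝ) * ∫ u, F i u := fun i => by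
      rw [mul_apply_eq_comp, inner_gaussVec hW ha hD]
      simp only [phase_zero_right, mul_one, F, G]
    have h6 : (N0 : ℂ) * (Real.exp (-(m' * ‖ζ‖ ^ 2)) * w) = (Real.pi / (2 * a) : ℝ)
        * ((Real.exp (-(m' * ‖ζ‖ ^ 2)) * (Real.pi / (s + m)) : ℝ) * w) := by
      simp only [N0]
      push_cast
      ring
    simp only [h5]
    rw [h6]
    exact h2
  have hnorm := key 1 1 (fun θ => Commute.one_right _) (fun ζ => by rw [mul_one, mul_one, h1]) 0
  simp only [hW.zero, mul_one, norm_zero, ne_eq, OfNat.ofNat_ne_zero, not_false_eq_true, zero_pow,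
    mul_zero, neg_zero, Real.exp_zero, Complex.ofReal_one, one_apply_eq_self] at hnorm
  have hsq : ((Real.sqrt N0)⁻¹) ^ 2 = N0⁻¹ := by rw [inv_pow, Real.sq_sqrt hN0.le]
  let ρ' : NormalState H :=
    { vec := fun i => ((Real.sqrt N0)⁻¹ : ℂ) • gaussVec W a 0 (ρ.vec i)
      normalized := by
        have h2 := (Complex.hasSum_re hnorm).mul_left N0⁻¹
        rw [Complex.ofReal_re, inv_mul_cancel₀ hN0.ne'] at h2
        have h3 : ∀ i, ‖((Real.sqrt N0)⁻¹ : ℂ) • gaussVec W a 0 (ρ.vec i)‖ ^ 2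
            = N0⁻¹ * (⟪gaussVec W a 0 (ρ.vec i), gaussVec W a 0 (ρ.vec i)⟫_ℂ).re := fun i => by
          rw [norm_smul, mul_pow, ← Complex.ofReal_inv, Complex.norm_real, Real.norm_eq_abs, sq_abs, hsq]
          congr 1
          exact (inner_self_eq_norm_sq (𝕜 := ℂ) _).symm
        simp only [h3]
        exact h2 }
  refine ⟨ρ', fun D w hD hw ζ => ?_⟩
  have h2 := (key D w hD hw ζ).mul_left ((N0⁻¹ : ℝ) : ℂ)
  rw [← mul_assoc, ← Complex.ofReal_mul, inv_mul_cancel₀ hN0.ne', Complex.ofReal_one, one_mul] at h2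
  rw [← h2.tsum_eq]
  refine tsum_congr fun i => ?_
  simp only [ρ', map_smul, inner_smul_left, inner_smul_right, ← mul_assoc]
  congr 1
  rw [← Complex.ofReal_inv, Complex.conj_ofReal, ← Complex.ofReal_mul, ← sq, hsq]

end Filtered

/-! ### Reference states with the conditional variances of the Kalman filter. -/

section Reference

variable {p : Params} {H : Type*} [NormedAddCommGroup H] [InnerProductSpace ℂ H]
  [CompleteSpace H] {Q : OpenOscillator p H}

namespace OpenOscillator

theorem xWeyl_commute_noise {m n : ℕ} (hmn : m ≤ n) (θ : ℂ) (M : ℕ) (a : ℕ → ℂ × ℂ) :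
    Commute (Q.xWeyl 0 m θ) (Q.noise n M a) := by
  induction M with
  | zero => exact Commute.one_right _
  | succ M ih =>
    rw [noise_succ']
    exact ih.mul_right (Q.xWeyl_commute_N 0 (by omega) θ _)

theorem NoiseIndependent.succ {n : ℕ} {ρ : NormalState H} (h : Q.NoiseIndependent n ρ) :
    Q.NoiseIndependent (n + 1) ρ := fun ζ M a => by
  rw [xWeyl_zero_succ, h.ev_jointWeyl_mul_noise, h.ev_jointWeyl]

theorem NoiseIndependent.gaussian_succ {n : ℕ} {ρ : NormalState H} (h : Q.NoiseIndependent n ρ)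
    {S : ℝ} {a : ℂ} (hG : ∀ ζ, ρ.ev (Q.xWeyl 0 n ζ) = gaussianChar p.hbar S a ζ) (ζ : ℂ) :
    ρ.ev (Q.xWeyl 0 (n + 1) ζ)
      = gaussianChar p.hbar (‖p.phi‖ ^ 2 * S + p.sig) (p.phi * a) ζ := by
  rw [xWeyl_zero_succ, h.ev_jointWeyl, hG, gaussianChar, gaussianChar, phase_mul_right, mul_assoc,
    Params.noiseWeight, ← Complex.exp_add]
  congr 1
  · simp [Params.pull]
  · congr 1
    rw [← Complex.ofReal_neg, ← Complex.ofReal_neg, ← Complex.ofReal_neg, ← Complex.ofReal_add]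
    congr 1
    simp [Params.pull, Params.covForm, Params.commForm, Complex.mul_conj, mul_pow,
      Complex.normSq_eq_norm_sq, -Complex.ofReal_sub]
    have hre : ((‖ζ‖ : ℂ) ^ 2).re = ‖ζ‖ ^ 2 := by rw [← Complex.ofReal_pow, Complex.ofReal_re]
    rw [hre]
    ring

theorem NoiseIndependent.displace {n : ℕ} {ρ : NormalState H} (h : Q.NoiseIndependent n ρ) (a : ℂ) :
    Q.NoiseIndependent n (ρ.displace (Q.isWeyl_xWeyl_zero n) a) := fun ζ M b => by
  have h1 := ρ.ev_displace (Q.isWeyl_xWeyl_zero n) a ζ (D := 1) fun θ => Commute.one_right _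
  rw [mul_one] at h1
  rw [ρ.ev_displace (Q.isWeyl_xWeyl_zero n) a ζ fun θ => xWeyl_commute_noise le_rfl θ M b, h1, h]
  ring

theorem ev_displace_gaussian (hh : 0 < p.hbar) {n : ℕ} {ρ : NormalState H} {S : ℝ} {b : ℂ}
    (hG : ∀ ζ, ρ.ev (Q.xWeyl 0 n ζ) = gaussianChar p.hbar S b ζ) (d ζ : ℂ) :
    (ρ.displace (Q.isWeyl_xWeyl_zero n) (-(d / p.hbar))).ev (Q.xWeyl 0 n ζ)
      = gaussianChar p.hbar S (b + d) ζ := by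
  have h1 := ρ.ev_displace (Q.isWeyl_xWeyl_zero n) (-(d / p.hbar)) ζ (D := 1)
    fun θ => Commute.one_right _
  have hh' : (p.hbar : ℂ) ≠ 0 := by exact_mod_cast hh.ne'
  rw [mul_one, mul_neg, neg_neg, mul_div_cancel₀ _ hh'] at h1
  rw [h1, hG, gaussianChar_add]

/-- Without measurement the variance obeys the recursion of the filter with the subtracted gain term
left out, so it dominates `Σ_n`; this leaves room for a filtering. -/
theorem IsGaussian.exists_unconditional (hQ : Q.IsGaussian) {mu : ℝ}
    (hS : ∀ n, 0 ≤ p.SigAt mu n) (hmu : 0 ≤ p.nu + mu) (n : ℕ) : Q.NoiseIndependent n Q.state ∧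
      ∃ S a, p.SigAt mu n ≤ S ∧ ∀ ζ, Q.state.ev (Q.xWeyl 0 n ζ) = gaussianChar p.hbar S a ζ := by
  induction n with
  | zero =>
    refine ⟨hQ.noiseIndependent, p.Sig, p.z, le_rfl, fun ζ => ?_⟩
    have h2 := hQ 0 ζ 0
    simpa [gaussianChar, xWeyl] using h2
  | succ n ih =>
    obtain ⟨h, S, a, hle, hG⟩ := ih
    refine ⟨h.succ, _, _, ?_, h.gaussian_succ hG⟩
    have h1 : 0 ≤ ‖p.gainOf mu (p.SigAt mu n)‖ ^ 2 * p.psiOf mu (p.SigAt mu n) :=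
      mul_nonneg (sq_nonneg _) (Params.psiOf_nonneg _ (hS n) hmu)
    have h2 := mul_le_mul_of_nonneg_left hle (sq_nonneg ‖p.phi‖)
    simp only [Params.SigAt]
    linarith

/-- There are states in which the amplitude has the conditional variance of the Kalman filter. -/
theorem IsGaussian.exists_reference (hQ : Q.IsGaussian) (hh : 0 < p.hbar) {mu : ℝ}
    (hS : ∀ n, 0 ≤ p.SigAt mu n) (hmu : 0 ≤ p.nu + mu) (n : ℕ) : ∃ ρ, Q.NoiseIndependent n ρ ∧
      ∀ ζ, ρ.ev (Q.xWeyl 0 n ζ) = gaussianChar p.hbar (p.SigAt mu n) 0 ζ := by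
  obtain ⟨h, S, b, hle, hG⟩ := hQ.exists_unconditional hS hmu n
  have hW := Q.isWeyl_xWeyl_zero n
  obtain ⟨ρ, hρ⟩ : ∃ ρ, ρ = Q.state.displace hW (-(-b / p.hbar)) := ⟨_, rfl⟩
  have hNρ : Q.NoiseIndependent n ρ := hρ ▸ h.displace _
  have hGρ : ∀ ζ, ρ.ev (Q.xWeyl 0 n ζ) = gaussianChar p.hbar S 0 ζ := fun ζ => by
    rw [hρ, ev_displace_gaussian hh hG, add_neg_cancel]
  -- The filtering requires a strict decrease of the variance; in the case of equality the centred
  -- state already serves.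
  rcases hle.eq_or_lt with heq | hlt
  · exact ⟨ρ, hNρ, by rwa [heq]⟩
  have hchar : ∀ T ζ, gaussianChar p.hbar T 0 ζ = Real.exp (-(p.hbar * (T + 1 / 2) * ‖ζ‖ ^ 2)) :=
    fun T ζ => by simp [gaussianChar]
  simp only [hchar] at hGρ ⊢
  obtain ⟨ρ', h'⟩ := ρ.exists_filtered hW hh (m := p.hbar * (S + 1 / 2))
    (m' := p.hbar * (p.SigAt mu n + 1 / 2)) (by have := mul_nonneg hh.le (hS n); linarith)
    (by gcongr) hGρ
  have hG' : ∀ ζ, ρ'.ev (Q.xWeyl 0 n ζ)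
      = Real.exp (-(p.hbar * (p.SigAt mu n + 1 / 2) * ‖ζ‖ ^ 2)) := fun ζ => by
    have := h' 1 1 (fun θ => Commute.one_right _) (fun ζ => by rw [mul_one, mul_one, hGρ]) ζ
    rwa [mul_one, mul_one] at this
  refine ⟨ρ', fun ζ M a => ?_, hG'⟩
  rw [hG']
  exact h' _ _ (fun θ => xWeyl_commute_noise le_rfl θ M a) (fun ζ => by rw [hNρ, hGρ]) ζ

end OpenOscillator

end Reference


/-! ### Images of measurements, and mixtures of states -/

section Mixture

variable {H : Type*} [NormedAddCommGroup H] [InnerProductSpace ℂ H] [CompleteSpace H]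
  {Z Z' : Type*} [MeasurableSpace Z] [MeasurableSpace Z']

namespace POVM

/-- The image of a measurement under a measurable function of the result. -/
def map (E : POVM Z H) {g : Z → Z'} (hg : Measurable g) : POVM Z' H where
  eff S := E.eff (g ⁻¹' S)
  pos _ hS := E.pos _ (hg hS)
  total := E.total
  additive S hS hd f := by
    rw [Set.preimage_iUnion]
    exact E.additive (fun n => g ⁻¹' S n) (fun n => hg (hS n))
      (fun i j hij => (hd hij).preimage g) f

theorem measureAt_map (E : POVM Z H) {g : Z → Z'} (hg : Measurable g) (f : H) :
    (E.map hg).measureAt f = (E.measureAt f).map g := by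
  ext S hS
  rw [measureAt_apply _ _ hS, Measure.map_apply hg hS, measureAt_apply _ _ (hg hS)]
  rfl

variable (E : POVM Z H)

theorem measureAt_smul (a : ℂ) (f : H) :
    E.measureAt (a • f) = ENNReal.ofReal (‖a‖ ^ 2) • E.measureAt f := by
  ext S hS
  rw [Measure.smul_apply, measureAt_apply _ _ hS, measureAt_apply _ _ hS, smul_eq_mul,
    ← ENNReal.ofReal_mul (sq_nonneg _)]
  congr 1
  rw [map_smul, inner_smul_left, inner_smul_right, ← mul_assoc, ← Complex.normSq_eq_conj_mul_self,
    Complex.normSq_eq_norm_sq, Complex.re_ofReal_mul]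

theorem seqMeasure_smul (a : ℂ) (f : ℕ → H) :
    E.seqMeasure (fun i => a • f i) = ENNReal.ofReal (‖a‖ ^ 2) • E.seqMeasure f := by
  ext S hS
  rw [seqMeasure, seqMeasure, Measure.smul_apply, Measure.sum_apply _ hS, Measure.sum_apply _ hS,
    smul_eq_mul, ← ENNReal.tsum_mul_left]
  simp only [measureAt_smul, Measure.smul_apply, smul_eq_mul]

theorem cint_self (f : ℕ → H) (F : Z → ℂ) : E.cint f f F = ∫ z, F z ∂(E.seqMeasure f) := by
  have h : ∀ k : Fin 4, (fun i => f i + ((-Complex.I) ^ (k : ℕ)) • f i)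
      = fun i => (1 + (-Complex.I) ^ (k : ℕ)) • f i := fun k => by
    funext i
    rw [add_smul, one_smul]
  simp only [cint, h, seqMeasure_smul, integral_smul_measure, Fin.sum_univ_four]
  have h1 : ‖1 + -Complex.I‖ ^ 2 = 2 := by
    rw [Complex.sq_norm, Complex.normSq_apply]; norm_num
  have h3 : ‖1 + (-Complex.I) ^ 3‖ ^ 2 = 2 := by
    rw [Complex.sq_norm, Complex.normSq_apply]; norm_num [pow_succ]
  have h2 : ‖1 + (-Complex.I) ^ 2‖ ^ 2 = 0 := by
    rw [Complex.sq_norm, Complex.normSq_apply]; norm_num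
  have h0 : ‖(1 : ℂ) + 1‖ ^ 2 = 4 := by norm_num
  simp only [Fin.val_zero, Fin.val_one, Fin.val_two, pow_zero, pow_one,
    show ((3 : Fin 4) : ℕ) = 3 from rfl, h0, h1, h2, h3]
  rw [ENNReal.toReal_ofReal (by norm_num), ENNReal.toReal_ofReal (by norm_num),
    ENNReal.toReal_ofReal (by norm_num)]
  simp only [← Complex.coe_smul, smul_eq_mul]
  have : Complex.I ^ 3 = -Complex.I := by rw [pow_succ, Complex.I_sq, neg_one_mul]
  rw [this]
  push_cast
  ring

theorem seqMeasure_univ (ρ : NormalState H) : E.seqMeasure ρ.vec Set.univ = 1 := by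
  rw [seqMeasure, Measure.sum_apply _ MeasurableSet.univ]
  simp only [measureAt_univ]
  rw [← ENNReal.ofReal_tsum_of_nonneg (fun i => by positivity) ρ.summable_sq, ρ.normalized.tsum_eq,
    ENNReal.ofReal_one]

end POVM

/-- The vanishing of a normal functional on a set of operators extends to the von Neumann algebra
that the set generates. -/
theorem IsProductClosed.integral_tsum_inner_eq_zero {A : Set (H →L[ℂ] H)} (hA : IsProductClosed A)
    {κ : Measure Z} [IsFiniteMeasure κ] {F G : ℕ → Z → H} (hF : ∀ i, StronglyMeasurable (F i))
    (hG : ∀ i, StronglyMeasurable (G i)) {C : ℝ} (hFs : ∀ z, Summable fun i => ‖F i z‖ ^ 2)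
    (hGs : ∀ z, Summable fun i => ‖G i z‖ ^ 2) (hFC : ∀ z, ∑' i, ‖F i z‖ ^ 2 ≤ C)
    (hGC : ∀ z, ∑' i, ‖G i z‖ ^ 2 ≤ C)
    (h : ∀ a ∈ A, ∫ z, ∑' i, ⟪G i z, a (F i z)⟫_ℂ ∂κ = 0) {c : H →L[ℂ] H}
    (hc : c ∈ bicommutant A) : ∫ z, ∑' i, ⟪G i z, c (F i z)⟫_ℂ ∂κ = 0 := by
  have hmem : ∀ {F : ℕ → Z → H}, (∀ i, StronglyMeasurable (F i)) →
      (∀ z, Summable fun i => ‖F i z‖ ^ 2) → (∀ z, ∑' i, ‖F i z‖ ^ 2 ≤ C) →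
      MemLp (Function.uncurry F) 2 ((Measure.count : Measure ℕ).prod κ) := by
    intro F hF hs hC
    have hm : StronglyMeasurable (Function.uncurry F) :=
      stronglyMeasurable_uncurry_of_continuous_of_stronglyMeasurable
        (fun z => continuous_of_discreteTopology) hF
    rw [memLp_two_iff_integrable_sq_norm hm.aestronglyMeasurable]
    refine ⟨(hm.norm.pow 2).aestronglyMeasurable, ?_⟩
    rw [hasFiniteIntegral_iff_ofReal (.of_forall fun _ => by positivity),
      lintegral_prod_symm (fun x => ENNReal.ofReal (‖Function.uncurry F x‖ ^ 2))
        (hm.norm.pow 2).measurable.ennreal_ofReal.aemeasurable]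
    refine (lintegral_mono fun z => ?_).trans_lt
      ((lintegral_const (ENNReal.ofReal C)).trans_lt
        (ENNReal.mul_lt_top ENNReal.ofReal_lt_top (measure_lt_top κ _)))
    rw [lintegral_count]
    simp only [Function.uncurry_apply_pair]
    rw [← ENNReal.ofReal_tsum_of_nonneg (fun i => by positivity) (hs z)]
    exact ENNReal.ofReal_le_ofReal (hC z)
  have hFm := hmem hF hFs hFC
  have hGm := hmem hG hGs hGC
  have key : ∀ a : H →L[ℂ] H, ∫ x, ⟪Function.uncurry G x, a (Function.uncurry F x)⟫_ℂ
      ∂((Measure.count : Measure ℕ).prod κ) = ∫ z, ∑' i, ⟪G i z, a (F i z)⟫_ℂ ∂κ := fun a => by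
    have hi : Integrable (fun x => ⟪Function.uncurry G x, a (Function.uncurry F x)⟫_ℂ)
        ((Measure.count : Measure ℕ).prod κ) := by
      have h2 := L2.integrable_inner (𝕜 := ℂ) (hGm.toLp _) ((a.comp_memLp' hFm).toLp _)
      refine h2.congr ?_
      filter_upwards [hGm.coeFn_toLp, (a.comp_memLp' hFm).coeFn_toLp] with x hx1 hx2
      rw [hx1, hx2]
      rfl
    rw [integral_prod_symm _ hi]
    refine integral_congr_ae (.of_forall fun z => ?_)
    exact integral_inner_count (summable_sq_apply (hFs z) a) (hGs z)
  rw [← key]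
  exact hA.integral_inner_eq_zero hFm hGm (fun a ha => by rw [key, h a ha]) hc

/-- Both sides are normal functionals of `c`, so agreement on the generating products extends to the
bicommutant. -/
theorem IsProductClosed.setIntegral_ev_eq {A : Set (H →L[ℂ] H)} (hA : IsProductClosed A)
    {κ : Measure Z} [IsProbabilityMeasure κ] {ρ : NormalState H} {ρ' : Z → NormalState H}
    (hρ' : ∀ i, StronglyMeasurable fun z => (ρ' z).vec i) {e : H →L[ℂ] H} (he : e.IsPositive)
    {S : Set Z} (hS : MeasurableSet S)
    (h : ∀ a ∈ A, ∫ z in S, (ρ' z).ev a ∂κ = ρ.ev (e * a)) {c : H →L[ℂ] H}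
    (hc : c ∈ bicommutant A) : ∫ z in S, (ρ' z).ev c ∂κ = ρ.ev (e * c) := by
  classical
  -- The difference of the two sides becomes one functional on `Bool × Z`: the copy `true` carries
  -- the states restricted to `S`, the copy `false` the state `ρ` with the factor `-e`.
  let G : ℕ → Bool × Z → H := fun i z =>
    if z.1 = true then S.indicator (fun z => (ρ' z).vec i) z.2 else -(e (ρ.vec i))
  let F : ℕ → Bool × Z → H := fun i z => if z.1 = true then (ρ' z.2).vec i else ρ.vec i
  have hFt : ∀ i z, F i (true, z) = (ρ' z).vec i := fun _ _ => if_pos rfl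
  have hFf : ∀ i z, F i (false, z) = ρ.vec i := fun _ _ => if_neg Bool.false_ne_true
  have hGt : ∀ i z, G i (true, z) = S.indicator (fun z => (ρ' z).vec i) z := fun _ _ => if_pos rfl
  have hGf : ∀ i z, G i (false, z) = -(e (ρ.vec i)) := fun _ _ => if_neg Bool.false_ne_true
  have hm : MeasurableSet {z : Bool × Z | z.1 = true} :=
    measurable_fst (MeasurableSet.of_discrete (s := {true}))
  have hF : ∀ i, StronglyMeasurable (F i) := fun i =>
    StronglyMeasurable.ite hm ((hρ' i).comp_measurable measurable_snd) stronglyMeasurable_const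
  have hG : ∀ i, StronglyMeasurable (G i) := fun i =>
    StronglyMeasurable.ite hm (((hρ' i).indicator hS).comp_measurable measurable_snd)
      stronglyMeasurable_const
  have hGle : ∀ z i, ‖S.indicator (fun z => (ρ' z).vec i) z‖ ^ 2 ≤ ‖(ρ' z).vec i‖ ^ 2 :=
    fun z i => by
      gcongr
      exact norm_indicator_le_norm_self (fun z => (ρ' z).vec i) z
  have hes := summable_sq_apply ρ.summable_sq e
  have key : ∀ a : H →L[ℂ] H,
      ∫ z, ∑' i, ⟪G i z, a (F i z)⟫_ℂ ∂((Measure.count : Measure Bool).prod κ)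
        = ∫ z in S, (ρ' z).ev a ∂κ - ρ.ev (e * a) := fun a => by
    have e1 : ∀ z, ∑' i, ⟪G i z, a (F i z)⟫_ℂ = if z.1 = true then
        S.indicator (fun z => (ρ' z).ev a) z.2 else -ρ.ev (e * a) := by
      rintro ⟨_ | _, z⟩
      · simp only [hFf, hGf, inner_neg_left, tsum_neg, NormalState.ev, mul_apply_eq_comp,
          Bool.false_eq_true, if_false]
        congr 1
        exact tsum_congr fun i => he.isSymmetric _ _
      · simp only [hFt, hGt, if_true]
        by_cases hzS : z ∈ S
        · simp only [Set.indicator_of_mem hzS]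
          rfl
        · simp [Set.indicator_of_notMem hzS]
    simp only [e1]
    have hm1 : StronglyMeasurable fun z => S.indicator (fun z => (ρ' z).ev a) z :=
      (measurable_ev hρ' a).indicator hS
    rw [integral_prod]
    · rw [integral_countable (by simp), tsum_bool]
      simp [integral_indicator hS]
      ring
    · refine Integrable.of_bound (StronglyMeasurable.ite hm (hm1.comp_measurable measurable_snd)
        (stronglyMeasurable_const (b := -ρ.ev (e * a)))).aestronglyMeasurable (C := ‖a‖ + ‖ρ.ev (e * a)‖)
        (.of_forall fun z => ?_)
      have h0 := norm_nonneg a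
      have h00 := norm_nonneg (ρ.ev (e * a))
      split_ifs
      · refine (norm_indicator_le_norm_self (fun z => (ρ' z).ev a) z.2).trans ?_
        exact ((ρ' z.2).norm_ev_le a).trans (by linarith)
      · rw [norm_neg]; linarith
  refine sub_eq_zero.1 ((key c).symm.trans ?_)
  refine hA.integral_tsum_inner_eq_zero (C := 1 + ∑' i, ‖e (ρ.vec i)‖ ^ 2) hF hG (fun z => ?_)
    (fun z => ?_) (fun z => ?_) (fun z => ?_) (fun a ha => by rw [key, h a ha, sub_self]) hc
  · rcases z with ⟨_ | _, z⟩
    · simpa only [hFf] using ρ.summable_sq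
    · simpa only [hFt] using (ρ' z).summable_sq
  · rcases z with ⟨_ | _, z⟩
    · simpa only [hGf, norm_neg] using hes
    · simpa only [hGt] using
        Summable.of_nonneg_of_le (fun i => by positivity) (hGle z) (ρ' z).summable_sq
  · have h0 : 0 ≤ ∑' i, ‖e (ρ.vec i)‖ ^ 2 := tsum_nonneg fun i => by positivity
    rcases z with ⟨_ | _, z⟩
    · simp only [hFf]
      rw [ρ.normalized.tsum_eq]
      linarith
    · simp only [hFt]
      rw [(ρ' z).normalized.tsum_eq]
      linarith
  · have h0 : 0 ≤ ∑' i, ‖e (ρ.vec i)‖ ^ 2 := tsum_nonneg fun i => by positivity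
    rcases z with ⟨_ | _, z⟩
    · simp only [hGf, norm_neg]
      linarith
    · simp only [hGt]
      have := (Summable.of_nonneg_of_le (fun i => by positivity) (hGle z)
        (ρ' z).summable_sq).tsum_le_tsum (hGle z) (ρ' z).summable_sq
      rw [(ρ' z).normalized.tsum_eq] at this
      linarith

end Mixture

/-! ### Products of Weyl operators of the future -/

section Future

namespace OpenOscillator

variable {p : Params} {H : Type*} [NormedAddCommGroup H] [InnerProductSpace ℂ H]
  [CompleteSpace H] {Q : OpenOscillator p H}

theorem N_commute_noise {k n M : ℕ} (h : n + M ≤ k) (b : ℂ × ℂ) (a : ℕ → ℂ × ℂ) :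
    Commute (Q.N k b) (Q.noise n M a) := by
  induction M with
  | zero => exact Commute.one_right _
  | succ M ih =>
    rw [noise_succ']
    exact (ih (by omega)).mul_right (Q.N_N_commute _ _ (by omega) _ _)

theorem noise_mul (n M : ℕ) (a b : ℕ → ℂ × ℂ) :
    ∃ z : ℂ, Q.noise n M a * Q.noise n M b = z • Q.noise n M (a + b) := by
  induction M with
  | zero => exact ⟨1, by simp [noise_zero]⟩
  | succ M ih =>
    obtain ⟨z, hz⟩ := ih
    refine ⟨z * Complex.exp (Complex.I * (p.hbar * (p.commForm (a M) (b M)).im : ℝ)), ?_⟩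
    rw [noise_succ', noise_succ', noise_succ', mul_assoc, ← mul_assoc (Q.N _ _),
      (N_commute_noise le_rfl (a M) b).eq, mul_assoc, Q.N_weyl, ← mul_assoc, hz, mul_smul_comm,
      smul_mul_assoc, smul_smul, mul_comm z]
    rfl

theorem star_noise (n M : ℕ) (a : ℕ → ℂ × ℂ) : star (Q.noise n M a) = Q.noise n M (-a) := by
  induction M with
  | zero => simp [noise_zero]
  | succ M ih =>
    rw [noise_succ', noise_succ', star_mul, ih, (Q.isWeyl_N _).star_eq]
    exact (N_commute_noise le_rfl (-a M) (-a)).eq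

theorem noise_const_zero (n M : ℕ) : Q.noise n M 0 = 1 := by
  induction M with
  | zero => rfl
  | succ M ih => rw [noise_succ', ih, Pi.zero_apply, (Q.isWeyl_N _).zero, mul_one]

theorem noise_congr {n M : ℕ} {a b : ℕ → ℂ × ℂ} (h : ∀ j < M, a j = b j) :
    Q.noise n M a = Q.noise n M b := by
  induction M with
  | zero => rfl
  | succ M ih => rw [noise_succ', noise_succ', ih fun j hj => h j (by omega), h M (by omega)]

/-- Padding with zero arguments brings two products of noise operators to a common length, as
multiplication requires. -/
theorem noise_truncate {n M M' : ℕ} (hM : M ≤ M') (a : ℕ → ℂ × ℂ) :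
    Q.noise n M a = Q.noise n M' fun j => if j < M then a j else 0 := by
  induction M', hM using Nat.le_induction with
  | base => exact noise_congr fun j hj => by simp [hj]
  | succ M' hM ih =>
    rw [noise_succ', ← ih]
    simp [(Q.isWeyl_N _).zero, Nat.not_lt.2 hM]

variable (Q) in
/-- The products of Weyl operators of the amplitude and of the future noises. -/
def futureProducts (n : ℕ) : Set (H →L[ℂ] H) :=
  {c | ∃ ζ M a, c = Q.xWeyl 0 n ζ * Q.noise n M a}

theorem isProductClosed_futureProducts (n : ℕ) : IsProductClosed (Q.futureProducts n) where
  one := ⟨0, 0, 0, by rw [(Q.isWeyl_xWeyl_zero n).zero, noise_zero, mul_one]⟩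
  mul := by
    rintro _ ⟨ζ, M, a, rfl⟩ _ ⟨ζ', M', a', rfl⟩
    rw [noise_truncate (le_max_left M M') a, noise_truncate (le_max_right M M') a']
    obtain ⟨z, hz⟩ := noise_mul (Q := Q) n (max M M') (fun j => if j < M then a j else 0)
      fun j => if j < M' then a' j else 0
    refine ⟨Complex.exp (Complex.I * (symp p.hbar ζ ζ' : ℝ)) * z, _, ⟨ζ + ζ', max M M',
      (fun j => if j < M then a j else 0) + fun j => if j < M' then a' j else 0, rfl⟩, ?_⟩
    rw [mul_assoc, ← mul_assoc (Q.noise _ _ _), ← (xWeyl_commute_noise le_rfl ζ' _ _).eq, mul_assoc,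
      hz, ← mul_assoc, (Q.isWeyl_xWeyl_zero n).mul, smul_mul_smul_comm]
  adj := by
    rintro _ ⟨ζ, M, a, rfl⟩
    refine ⟨1, _, ⟨-ζ, M, -a, rfl⟩, ?_⟩
    rw [star_mul, star_noise, (Q.isWeyl_xWeyl_zero n).star_eq, one_smul]
    exact (xWeyl_commute_noise le_rfl (-ζ) M (-a)).eq.symm

theorem futureAlgebra_subset (n : ℕ) : Q.futureAlgebra n ⊆ bicommutant (Q.futureProducts n) := by
  refine bicommutant_mono ?_
  rintro _ (⟨ζ, rfl⟩ | ⟨k, a, hk, rfl⟩)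
  · exact ⟨ζ, 0, 0, by rw [noise_zero, mul_one]⟩
  · obtain ⟨j, rfl⟩ := Nat.exists_eq_add_of_le hk
    refine ⟨0, j + 1, fun i => if i = j then a else 0, ?_⟩
    have h0 : Q.noise n j (fun i => if i = j then a else 0) = Q.noise n j 0 :=
      noise_congr fun i hi => if_neg (Nat.ne_of_lt hi)
    rw [(Q.isWeyl_xWeyl_zero n).zero, one_mul, noise_succ', if_pos rfl, h0, noise_const_zero, one_mul]

end OpenOscillator

end Future


/-! ### Existence of the linear strategy and of its a posteriori states -/

section Existence

open ProbabilityTheory OpenOscillator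

variable {p : Params} {H : Type*} [NormedAddCommGroup H] [InnerProductSpace ℂ H]
  [CompleteSpace H] {Q : OpenOscillator p H}

/-- The controls add a scalar to the output, so one measurement for vanishing controls, translated
by that scalar, serves all histories. -/
theorem OpenOscillator.IsIndirectMeasurement.translate {mu : ℝ} {k : ℕ} {E : POVM ℂ H}
    (hE : Q.IsIndirectMeasurement mu 0 k E) (u : ℕ → ℂ) :
    Q.IsIndirectMeasurement mu u k
      (E.map (measurable_add_const (p.gamma * shift p u k + p.delta * u k))) := fun θ f => by
  rw [POVM.measureAt_map, integral_map (by fun_prop) (by fun_prop)]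
  simp only [phase_add_right θ _ (p.gamma * shift p u k + p.delta * u k)]
  rw [integral_mul_const, hE, Q.yWeyl_eq u, smul_apply, inner_smul_right]
  ring

theorem POVM.measurable_inner_map {X : Type*} [MeasurableSpace X] {Z Z' : Type*} [MeasurableSpace Z]
    [MeasurableSpace Z'] (E : POVM Z H) {g : X × Z → Z'} (hg : Measurable g) {S : Set Z'}
    (hS : MeasurableSet S) (f k : H) :
    Measurable fun x => ⟪f, E.eff {z | g (x, z) ∈ S} k⟫_ℂ := by
  have h1 : ∀ f : H, Measurable fun x => ⟪f, E.eff {z | g (x, z) ∈ S} f⟫_ℂ := fun f => by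
    have h2 : ∀ x, ⟪f, E.eff {z | g (x, z) ∈ S} f⟫_ℂ
        = ((E.measureAt f (Prod.mk x ⁻¹' (g ⁻¹' S))).toReal : ℂ) := fun x =>
      (E.measureAt_real f (measurable_prodMk_left (hg hS))).symm
    simp only [h2]
    exact Complex.measurable_ofReal.comp (measurable_measure_prodMk_left (hg hS)).ennreal_toReal
  have h2 : ∀ x, ⟪f, E.eff {z | g (x, z) ∈ S} k⟫_ℂ = 1 / 4 * ∑ j : Fin 4, Complex.I ^ (j : ℕ)
      * ⟪f + ((-Complex.I) ^ (j : ℕ)) • k, E.eff {z | g (x, z) ∈ S} (f + ((-Complex.I) ^ (j : ℕ)) • k)⟫_ℂ :=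
    fun x => by rw [POVM.polarization]; ring
  simp only [h2]
  exact (Finset.measurable_sum _ fun j _ => (h1 _).const_mul _).const_mul _

theorem Strategy.controls_eq {Y : Type*} [MeasurableSpace Y] {s s' : Strategy Q Y} (h : s.u0 = s'.u0)
    {n : ℕ} (x : History Y n) : s.controls x = s'.controls x := by
  funext j
  cases j with
  | zero => exact h
  | succ j => rfl

/-- A strategy with the coherent measurement, the Kalman estimates and the linear control at all
the stages. -/
theorem Strategy.exists_linearGaussian (Q : OpenOscillator p H) (hh : 0 < p.hbar) (K : ℕ) :
    ∃ s : Strategy Q ℂ, s.u0 = -p.lamAt K 0 * p.z ∧ ∀ n (h : History ℂ n), ∃ E : POVM ℂ H,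
      Q.IsIndirectMeasurement p.muMin (s.controls h) n E ∧ ∀ S, MeasurableSet S →
        (s.meas n h).eff S
          = E.eff {η | (η, linearControl s K p.muMin n (h, η)) ∈ S} := by
  choose E hE hEm using Q.exists_coherent_measurement hh
  have hg0 : Measurable fun η : ℂ => (η, (0 : ℂ)) := by fun_prop
  -- The prescribed control refers to the controls of the strategy that is being defined. They
  -- depend on `u0` and on the history alone, so an auxiliary strategy with the same `u0` removes
  -- the circularity.
  let s0 : Strategy Q ℂ :=
    { u0 := -p.lamAt K 0 * p.z
      meas := fun n _ => (E n).map hg0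
      mem_output := fun n _ S hS => hEm n _ (hg0 hS)
      measurable := fun n S hS f g => measurable_const }
  let b : (n : ℕ) → History ℂ n → ℂ := fun n h =>
    p.gamma * shift p (s0.controls h) n + p.delta * s0.controls h n
  have hb : ∀ n, Measurable (b n) := fun n => by
    have h1 := measurable_shift (p := p) (s0.measurable_controls n) n
    simp only [b]
    fun_prop
  let g : (n : ℕ) → History ℂ n × ℂ → ℂ × ℂ := fun n y =>
    (y.2 + b n y.1, linearControl s0 K p.muMin n (y.1, y.2 + b n y.1))
  have hg : ∀ n, Measurable (g n) := fun n => by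
    have h1 : Measurable fun y : History ℂ n × ℂ => y.2 + b n y.1 :=
      measurable_snd.add ((hb n).comp measurable_fst)
    exact h1.prodMk ((measurable_linearControl s0 K p.muMin n).comp (measurable_fst.prodMk h1))
  let s : Strategy Q ℂ :=
    { u0 := -p.lamAt K 0 * p.z
      meas := fun n h => (E n).map ((hg n).comp (measurable_prodMk_left (x := h)))
      mem_output := fun n h S hS => hEm n _ (((hg n).comp (measurable_prodMk_left (x := h))) hS)
      measurable := fun n S hS f k => (E n).measurable_inner_map (hg n) hS f k }
  have hss : ∀ {n : ℕ} (h : History ℂ n), s0.controls h = s.controls h := fun h =>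
    Strategy.controls_eq rfl h
  refine ⟨s, rfl, fun n h => ⟨_, (hE n).translate (s.controls h), fun S _ => ?_⟩⟩
  rw [← hss h]
  change (E n).eff _ = (E n).eff _
  congr 1

variable {s : Strategy Q ℂ} {K : ℕ} {mu : ℝ}

/-- The a posteriori expectations on the product of Weyl operators of the future after a Gaussian
measurement. -/
theorem setIntegral_ev_posterior (hSig : ∀ n, 0 ≤ p.SigAt mu n) (hnu : 0 ≤ p.nu) (hmu : 0 ≤ mu)
    (hups : ‖p.ups‖ ^ 2 ≤ p.sig * p.nu) {n : ℕ} {h : History ℂ n} {E : POVM ℂ H}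
    (hE : Q.IsIndirectMeasurement mu (s.controls h) n E)
    (hs : ∀ S, MeasurableSet S → (s.meas n h).eff S
      = E.eff {η | (η, linearControl s K mu n (h, η)) ∈ S})
    {ρ : NormalState H} (hρ : Q.NoiseIndependent n ρ)
    (hG : ∀ ζ, ρ.ev (Q.xWeyl 0 n ζ) = gaussianChar p.hbar (p.SigAt mu n)
      (estimateAt s mu n h - shift p (s.controls h) n) ζ)
    {ρ' : ℂ × ℂ → NormalState H} (hρm : ∀ i, StronglyMeasurable fun z => (ρ' z).vec i)
    (hρ' : ∀ z, Q.NoiseIndependent (n + 1) (ρ' z))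
    (hG' : ∀ z ζ, (ρ' z).ev (Q.xWeyl 0 (n + 1) ζ) = gaussianChar p.hbar (p.SigAt mu (n + 1))
      (estimateAt s mu (n + 1) (joinLast (h, z))
        - shift p (s.controls (joinLast (h, z))) (n + 1)) ζ)
    {S : Set (ℂ × ℂ)} (hS : MeasurableSet S) {c : H →L[ℂ] H} (hc : c ∈ Q.futureAlgebra (n + 1)) :
    ∫ z in S, (ρ' z).ev c ∂((s.meas n h).seqMeasure ρ.vec) = ρ.ev ((s.meas n h).eff S * c) := by
  have : IsProbabilityMeasure ((s.meas n h).seqMeasure ρ.vec) := ⟨POVM.seqMeasure_univ _ ρ⟩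
  refine (isProductClosed_futureProducts (n + 1)).setIntegral_ev_eq hρm ((s.meas n h).pos S hS) hS ?_
    (futureAlgebra_subset _ hc)
  rintro _ ⟨ζ, M, a, rfl⟩
  -- On both sides the noises after the next amplitude contribute the same scalar factor, so only
  -- the Weyl operators of `x_{n+1}` remain to be compared.
  have h1 := hρ.ev_output_mul (s.mem_output n h S hS) ζ M a
  rw [mul_sub, NormalState.ev_sub, sub_eq_zero, mul_smul_comm, NormalState.ev_smul] at h1
  rw [h1, mul_comm]
  simp only [hρ' _ ζ M a, hG']
  rw [integral_mul_const]
  congr 1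
  have hlast : ∀ z : ℂ × ℂ, estimateAt s mu (n + 1) (joinLast (h, z))
      - shift p (s.controls (joinLast (h, z))) (n + 1)
      = p.phi * (estimateAt s mu n h - shift p (s.controls h) n)
        + p.gainOf mu (p.SigAt mu n) * (z.1 - (p.gamma * (estimateAt s mu n h
          - shift p (s.controls h) n + shift p (s.controls h) n) + p.delta * s.controls h n)) := fun z => by
    have h2 : shift p (s.controls (joinLast (h, z))) n = shift p (s.controls h) n :=
      shift_congr fun j hj => by
        rw [← s.controls_splitLast hj.le, splitLast_joinLast]
    have h3 : s.controls (joinLast (h, z)) n = s.controls h n := by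
      rw [← s.controls_splitLast le_rfl, splitLast_joinLast]
    rw [estimateAt_succ, splitLast_joinLast, shift, h2, h3]
    ring
  simp only [hlast]
  have hg : Measurable fun η => (η, linearControl s K mu n (h, η)) :=
    measurable_id.prodMk ((measurable_linearControl s K mu n).comp measurable_prodMk_left)
  have hind : Measurable (S.indicator (1 : ℂ × ℂ → ℂ)) := measurable_one.indicator hS
  have hgc : Measurable fun z : ℂ × ℂ => gaussianChar p.hbar (p.SigAt mu (n + 1))
      (p.phi * (estimateAt s mu n h - shift p (s.controls h) n)
        + p.gainOf mu (p.SigAt mu n) * (z.1 - (p.gamma * (estimateAt s mu n h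
          - shift p (s.controls h) n + shift p (s.controls h) n) + p.delta * s.controls h n))) ζ := by
    fun_prop
  have h4 : ρ.ev ((s.meas n h).eff S * Q.xWeyl 0 (n + 1) ζ) = (s.meas n h).cint ρ.vec
      (fun i => Q.xWeyl 0 (n + 1) ζ (ρ.vec i)) (S.indicator (1 : ℂ × ℂ → ℂ)) := by
    rw [POVM.cint_indicator _ hS ρ.summable_sq (summable_sq_apply ρ.summable_sq _)]
    rfl
  rw [h4, POVM.cint_map (E := E) (F := S.indicator (1 : ℂ × ℂ → ℂ)) hg hs _ _ hind,
    hρ.cint_eq hG (hSig n) hnu hmu hups hE ζ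
      (F := fun η => S.indicator (1 : ℂ × ℂ → ℂ) (η, linearControl s K mu n (h, η))) (hind.comp hg) (C := 1)
      fun η => norm_indicator_one_le S _, ← integral_indicator hS, ← POVM.cint_self,
    POVM.cint_map (E := E) hg hs _ _ (hgc.indicator hS)]
  refine congrArg (E.cint ρ.vec ρ.vec) (funext fun η => ?_)
  by_cases hη : (η, linearControl s K mu n (h, η)) ∈ S
  · rw [Set.indicator_of_mem hη, Set.indicator_of_mem hη, Pi.one_apply, one_mul]
    rfl
  · rw [Set.indicator_of_notMem hη, Set.indicator_of_notMem hη, zero_mul]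

instance isMarkovKernel_seqKernel {X Z : Type*} [MeasurableSpace X] [MeasurableSpace Z]
    {E : X → POVM Z H} (hE : WeaklyMeasurable E) {ρ : X → NormalState H}
    (hf : ∀ i, StronglyMeasurable fun x => (ρ x).vec i) :
    IsMarkovKernel (seqKernel hE (f := fun x => (ρ x).vec) hf) :=
  ⟨fun x => ⟨by rw [seqKernel_apply, POVM.seqMeasure_univ]⟩⟩

variable {Y : Type*} [MeasurableSpace Y]

/-- The distributions of the histories that given a posteriori states generate. -/
def historyMeasure (s : Strategy Q Y) (ρ : (n : ℕ) → History Y n → NormalState H)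
    (hρ : ∀ n i, StronglyMeasurable fun h => (ρ n h).vec i) : (n : ℕ) → Measure (History Y n)
  | 0 => Measure.dirac fun i => i.elim0
  | n + 1 => ((historyMeasure s ρ hρ n).compProd
      (seqKernel (s.weaklyMeasurable n) (f := fun h => (ρ n h).vec) (hρ n))).map joinLast

theorem isProbabilityMeasure_historyMeasure (s : Strategy Q Y)
    (ρ : (n : ℕ) → History Y n → NormalState H)
    (hρ : ∀ n i, StronglyMeasurable fun h => (ρ n h).vec i) (n : ℕ) :
    IsProbabilityMeasure (historyMeasure s ρ hρ n) := by
  induction n with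
  | zero => exact Measure.dirac.isProbabilityMeasure
  | succ n ih => exact Measure.isProbabilityMeasure_map measurable_joinLast.aemeasurable

/-- A posteriori states that satisfy the recursion after every history generate the statistics of
a strategy. -/
theorem Evolution.nonempty_of_posterior (s : Strategy Q Y)
    (ρ : (n : ℕ) → History Y n → NormalState H)
    (hρ : ∀ n i, StronglyMeasurable fun h => (ρ n h).vec i) (h0 : ∀ h, ρ 0 h = Q.state)
    (hstep : ∀ n (h : History Y n) (S : Set (Y × ℂ)), MeasurableSet S → ∀ c ∈ Q.futureAlgebra (n + 1),
      ∫ z in S, (ρ (n + 1) (joinLast (h, z))).ev c ∂((s.meas n h).seqMeasure (ρ n h).vec)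
        = (ρ n h).ev ((s.meas n h).eff S * c)) : Nonempty (Evolution s) := by
  refine ⟨⟨historyMeasure s ρ hρ, isProbabilityMeasure_historyMeasure s ρ hρ, ρ, hρ, h0,
    fun n A S hA hS c hc => ?_⟩⟩
  have hp := isProbabilityMeasure_historyMeasure s ρ hρ n
  have hm := QuantumLQG.measurable_ev (hρ (n + 1)) c
  have hset : {h : History Y (n + 1) | (fun i : Fin n => h i.castSucc) ∈ A ∧ h (Fin.last n) ∈ S}
      = splitLast ⁻¹' (A ×ˢ S) := rfl
  have hpre : joinLast ⁻¹' (splitLast ⁻¹' (A ×ˢ S)) = A ×ˢ S := by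
    ext y
    simp
  rw [hset, historyMeasure, setIntegral_map (measurable_splitLast (hA.prod hS))
    hm.aestronglyMeasurable measurable_joinLast.aemeasurable, hpre,
    Measure.setIntegral_compProd hA hS]
  · refine setIntegral_congr_fun hA fun h _ => ?_
    simp only [seqKernel_apply]
    exact hstep n h S hS c hc
  · refine Integrable.integrableOn (Integrable.of_bound
      (hm.comp_measurable measurable_joinLast).aestronglyMeasurable (C := ‖c‖) (.of_forall fun y => ?_))
    exact (ρ (n + 1) (joinLast y)).norm_ev_le c

/-- The states with the Kalman estimates as mean values, obtained by displacements of given centred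
states. -/
def posterior (s : Strategy Q ℂ) (mu : ℝ) (r : ℕ → NormalState H) :
    (n : ℕ) → History ℂ n → NormalState H
  | 0, _ => Q.state
  | n + 1, h => (r (n + 1)).displace (Q.isWeyl_xWeyl_zero (n + 1))
      (-((estimateAt s mu (n + 1) h - shift p (s.controls h) (n + 1)) / p.hbar))

/-- The a posteriori states enter only through the future algebra, where they are determined by
Gaussian characteristic functions and independent noise. The displaced reference states have these
expectations and depend measurably on the history, since only the displacement does. -/
theorem Evolution.nonempty_linearGaussian (hh : 0 < p.hbar) (hSig : ∀ n, 0 ≤ p.SigAt mu n)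
    (hnu : 0 ≤ p.nu) (hmu : 0 ≤ mu) (hups : ‖p.ups‖ ^ 2 ≤ p.sig * p.nu) (hQ : Q.IsGaussian)
    {s : Strategy Q ℂ} (hs : ∀ n (h : History ℂ n), ∃ E : POVM ℂ H,
      Q.IsIndirectMeasurement mu (s.controls h) n E ∧ ∀ S, MeasurableSet S →
        (s.meas n h).eff S = E.eff {η | (η, linearControl s K mu n (h, η)) ∈ S}) :
    Nonempty (Evolution s) := by
  choose r hr hrG using hQ.exists_reference hh hSig (add_nonneg hnu hmu)
  let ρ := posterior s mu r
  have hN : ∀ n h, Q.NoiseIndependent n (ρ n h) := fun n h => by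
    cases n with
    | zero => exact hQ.noiseIndependent
    | succ n => exact (hr (n + 1)).displace _
  have hG : ∀ n h ζ, (ρ n h).ev (Q.xWeyl 0 n ζ) = gaussianChar p.hbar (p.SigAt mu n)
      (estimateAt s mu n h - shift p (s.controls h) n) ζ := fun n h ζ => by
    cases n with
    | zero =>
      have h2 := hQ 0 ζ 0
      simpa [gaussianChar, OpenOscillator.xWeyl, estimateAt, Params.estimate, shift, Params.SigAt, ρ, posterior] using h2
    | succ n => exact (ev_displace_gaussian hh (hrG (n + 1)) _ ζ).trans (by rw [zero_add])
  have hm : ∀ n i, StronglyMeasurable fun h => (ρ n h).vec i := fun n i => by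
    cases n with
    | zero => exact stronglyMeasurable_const (b := Q.state.vec i)
    | succ n =>
      have h1 := measurable_shift (p := p) (s.measurable_controls (n + 1)) (n + 1)
      have h2 := measurable_estimateAt s mu (n + 1)
      have h3 : Measurable fun h : History ℂ (n + 1) =>
          -((estimateAt s mu (n + 1) h - shift p (s.controls h) (n + 1)) / p.hbar) := by fun_prop
      exact ((Q.isWeyl_xWeyl_zero (n + 1)).cont ((r (n + 1)).vec i)).comp_stronglyMeasurable
        h3.stronglyMeasurable
  refine nonempty_of_posterior s ρ hm (fun _ => rfl) fun n h S hS c hc => ?_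
  obtain ⟨E, hE, hES⟩ := hs n h
  exact setIntegral_ev_posterior hSig hnu hmu hups hE hES (hN n h) (hG n h)
    (fun i => (hm (n + 1) i).comp_measurable (measurable_joinLast.comp measurable_prodMk_left))
    (fun z => hN (n + 1) _) (fun z => hG (n + 1) _) hS hc

end Existence

end QuantumLQG

end

theorem theorem5 {H : Type*} [NormedAddCommGroup H] [InnerProductSpace ℂ H] [CompleteSpace H]
    (p : QuantumLQG.Params) (hhbar : 0 < p.hbar)
    (hSig : 0 ≤ p.Sig) (hsig : 0 ≤ p.sig) (hnu : 0 ≤ p.nu) (hups : ‖p.ups‖ ^ 2 ≤ p.sig * p.nu)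
    (hOm : 0 ≤ p.Om) (hom : 0 ≤ p.om) (hvth1 : 0 < p.vth1)
    (K : ℕ) (hUps : ∀ k < K, 0 < p.UpsAt K k)
    (Q : QuantumLQG.OpenOscillator p H) (hQ : Q.IsGaussian) :
    (∃ s : QuantumLQG.Strategy Q ℂ,
      s.IsLinearGaussian K p.muMin ∧ Nonempty (QuantumLQG.Evolution s)) ∧
    ∀ s : QuantumLQG.Strategy Q ℂ, s.IsLinearGaussian K p.muMin →
      ∀ R : QuantumLQG.Evolution s,
        R.FiniteEnergy K ∧ R.cost K = p.minLoss K ∧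
        ∀ (Y : Type*) [MeasurableSpace Y] (s' : QuantumLQG.Strategy Q Y)
          (R' : QuantumLQG.Evolution s'), R'.FiniteEnergy K → R.cost K ≤ R'.cost K := by
  open QuantumLQG in
  have hSigAt := p.SigAt_nonneg hSig hsig hnu p.muMin_nonneg hups
  obtain ⟨s, hs0, hs⟩ := Strategy.exists_linearGaussian Q hhbar K
  -- The constructed strategy measures coherently at every stage, beyond the horizon as well,
  -- because an evolution comprises all instants; linearity up to `K` is part of this.
  refine ⟨⟨s, ⟨fun _ => hs0, fun n _ h => hs n h⟩,
    Evolution.nonempty_linearGaussian hhbar hSigAt hnu p.muMin_nonneg hups hQ hs⟩, fun s hs R => ?_⟩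
  refine ⟨R.finiteEnergy hhbar hSig hsig hnu hups hQ p.muMin_nonneg hs,
    R.cost_linear hhbar hSig hsig hnu hups hQ hUps hs, fun Y _ s' R' hF => ?_⟩
  rw [R.cost_linear hhbar hSig hsig hnu hups hQ hUps hs]
  exact Evolution.minLoss_le_cost hhbar hSig hsig hnu hups hQ hUps hF
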